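/- Let $N\ge 2$, $\ell>0$ and $k\in\{-1,0,1\}$. Consider functions $m,S,\alpha_1,\dots,\alpha_N,\omega_1,\dots,\omega_{N-1}$ of $r$ with $\sum_j\alpha_j=0$, and put $\alpha_0=\alpha_{N+1}=\omega_0=\omega_N=0$, $\mathcal E_j=\alpha_j-\alpha_{j+1}$, $\mu=k-\frac{2m}{r}+\frac{r^2}{\ell^2}$. The static dyonic $\mathfrak{su}(N)$ Einstein–Yang–Mills equations are $$m'=\frac{r^2\eta}{4S^2}+\frac{\zeta}{4\mu S^2}+\mu G+P,\qquad \frac{S'}{S}=\frac{\zeta}{2\mu^2S^2r}+\frac{2G}{r},$$ $$\alpha_j''=\Big(\frac{S'}{S}-\frac2r\Big)\alpha_j'+\frac{1}{\mu r^2}\big(\omega_j^2(\alpha_j-\alpha_{j+1})-\omega_{j-1}^2(\alpha_{j-1}-\alpha_j)\big),\qquad \omega_j''=-\Big(\frac{S'}{S}+\frac{\mu'}{\mu}\Big)\omega_j'-\frac{\omega_j\mathcal E_j^2}{4\mu^2S^2}-\frac{W_j\omega_j}{\mu r^2},$$ where $\eta=\sum_{j=1}^N\alpha_j'^2$, $\zeta=\sum_{j=1}^{N-1}\omega_j^2\mathcal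 E_j^2$, $G=\sum_{j=1}^{N-1}\omega_j'^2$, $P=\frac1{4r^2}\sum_{j=1}^N(\omega_j^2-\omega_{j-1}^2-k(N+1-2j))^2$ and $W_j=k-\omega_j^2+\frac12(\omega_{j+1}^2+\omega_{j-1}^2)$. A *global solution* on $[r_0,\infty)$ is one that is smooth on $[r_0,\infty)$ (one-sided at $r_0$), with $S>0$ there, with $\mu>0$ and the equations satisfied for $r>r_0$, and with, as $r\to\infty$, for some constants (with $S_\infty>0$), $m=M+m_1r^{-1}+O(r^{-2})$, $S=S_\infty+S_4r^{-4}+O(r^{-5})$, $\alpha_j=\alpha_{j,\infty}+d_jr^{-1}+O(r^{-2})$, $\omega_j=\omega_{j,\infty}+c_jr^{-1}+O(r^{-2})$. It is *normalised* if $S_\infty=1$; the time rescaling $(S,\alpha_j)\mapsto(S/S_\infty,\alpha_j/S_\infty)$ normalises any global solution. * A *black hole* with horizon radius $r_h>0$ is a global solution on $[r_h,\infty)$ with $\mu(r_h)=0$, $\mu'(r_h)>0$ and $\alpha_j(r_h)=0$ for all $j$. Its data are $\omega_{jh}=\omega_j(r_h)$, $\mathcal E'_{jh}=\mathcal E_j'(r_h)$,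 $1\le j\le N-1$. * A *soliton* is a global solution on $[0,\infty)$ with $k=1$, $m=O(r^3)$ as $r\to0$, $\omega_j(0)=\sqrt{j(N-j)}$ and $\mathcal E_j(0)=0$. Its data $\breve\beta_k,\breve\theta_k$, $1\le k\le N-1$ (here $k$ is an index), are the limits as $r\to0$ of $\bar\beta_k,\bar\theta_k$ in $$\omega_j=\sqrt{j(N-j)}\Big(1+\sum_{k=1}^{N-1}\bar\beta_k(r)v^j_kr^{k+1}\Big)+O(r^{N+1}),\qquad \mathcal E_j=\sum_{k=1}^{N-1}\bar\theta_k(r)v^j_kr^k+O(r^N),$$ where $v_k^j=\frac{N-1}{N-j}\,{}_3F_2(-k,k+1,1-j;2,1-N;1)$. The *nodes* of $\omega_j$ are its zeros in $(r_0,\infty)$. **Proposition.** (Black holes.) Fix $k,\ell,r_h$ and a normalised black hole with data $\{\omega_{jh},\mathcal E'_{jh}\}$. Then there is $\delta>0$ such that for all data $\{\check\omega_{jh},\check{\mathcal E}'_{jh}\}$ with $|\check\omega_{jh}-\omega_{jh}|<\delta$ and $|\check{\mathcal E}'_{jh}-\mathcal E'_{jh}|<\delta$ for all $j$, there is a black hole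 (same $k,\ell,r_h$) with these data and with the same value $S(r_h)$, having some limit $S_\infty>0$, so that its time rescaling by $1/S_\infty$ is a normalised black hole. For every $j$ such that the original $\omega_j$ does not tend to $0$ as $r\to\infty$, the function $\omega_j$ of the new solution has the same number of nodes as the original one. (Solitons.) The same holds for a normalised soliton (fixed $\ell$, $k=1$) with data $\{\breve\beta_k,\breve\theta_k\}$: all data sufficiently close to these are the data of a soliton with the same value $S(0)$ and some limit $S_\infty>0$, whose time rescaling by $1/S_\infty$ is a normalised soliton, and the number of nodes is the same for every $j$ such that the original $\omega_j$ does not tend to $0$ as $r\to\infty$. -/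

import Mathlib

open Filter Set Asymptotics
open scoped Topology

namespace EYM

/-- The field variables of a static `su(N)` Einstein-Yang-Mills configuration: the mass function `m`
and the lapse `S` of the metric `-μ S² dt² + μ⁻¹ dr² + r² dΩ_k²`, the electric gauge functions
`α j` (`1 ≤ j ≤ N`) and the magnetic gauge functions `ω j` (`1 ≤ j ≤ N - 1`), as functions of the
areal radius `r`. Indices are `1`-based. -/
structure Fields where
  m : ℝ → ℝ
  S : ℝ → ℝ
  α : ℕ → ℝ → ℝ
  ω : ℕ → ℝ → ℝ

namespace Fields

/-- `μ = k - 2 m / r + r² / ℓ²`. -/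
noncomputable def mu (k ℓ : ℝ) (F : Fields) (r : ℝ) : ℝ :=
  k - 2 * F.m r / r + r ^ 2 / ℓ ^ 2

/-- `𝓔_j = α_j - α_{j+1}`. -/
def elec (F : Fields) (j : ℕ) (r : ℝ) : ℝ := F.α j r - F.α (j + 1) r

/-- `η = ∑ α_j'²`. -/
noncomputable def eta (N : ℕ) (F : Fields) (r : ℝ) : ℝ :=
  ∑ j ∈ Finset.Icc 1 N, deriv (F.α j) r ^ 2

/-- `ζ = ∑ ω_j² (α_j - α_{j+1})²`. -/
def zeta (N : ℕ) (F : Fields) (r : ℝ) : ℝ :=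
  ∑ j ∈ Finset.Icc 1 (N - 1), F.ω j r ^ 2 * (F.α j r - F.α (j + 1) r) ^ 2

/-- `G = ∑ ω_j'²`. -/
noncomputable def G (N : ℕ) (F : Fields) (r : ℝ) : ℝ :=
  ∑ j ∈ Finset.Icc 1 (N - 1), deriv (F.ω j) r ^ 2

/-- `P = (1 / 4r²) ∑ (ω_j² - ω_{j-1}² - k (N + 1 - 2j))²`. -/
noncomputable def P (N : ℕ) (k : ℝ) (F : Fields) (r : ℝ) : ℝ :=
  1 / (4 * r ^ 2) * ∑ j ∈ Finset.Icc 1 N,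
    (F.ω j r ^ 2 - F.ω (j - 1) r ^ 2 - k * ((N : ℝ) + 1 - 2 * (j : ℝ))) ^ 2

/-- `W_j = k - ω_j² + (ω_{j+1}² + ω_{j-1}²) / 2`. -/
noncomputable def W (k : ℝ) (F : Fields) (j : ℕ) (r : ℝ) : ℝ :=
  k - F.ω j r ^ 2 + (F.ω (j + 1) r ^ 2 + F.ω (j - 1) r ^ 2) / 2

/-- The change of fields induced by a constant rescaling of the time coordinate. -/
def timeRescale (c : ℝ) (F : Fields) : Fields where
  m := F.m
  S := fun r => c * F.S r
  α := fun j r => c * F.α j r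
  ω := F.ω

end Fields

open Fields

/-- The Einstein and Yang-Mills equations at radius `r`. -/
structure FieldEquationsAt (N : ℕ) (k ℓ : ℝ) (F : Fields) (r : ℝ) : Prop where
  einstein_m : deriv F.m r =
    r ^ 2 * F.eta N r / (4 * F.S r ^ 2) + F.zeta N r / (4 * F.mu k ℓ r * F.S r ^ 2)
      + F.mu k ℓ r * F.G N r + F.P N k r
  einstein_S : deriv F.S r / F.S r =
    F.zeta N r / (2 * F.mu k ℓ r ^ 2 * F.S r ^ 2 * r) + 2 * F.G N r / r
  yangMills_α : ∀ j ∈ Finset.Icc 1 N, deriv (deriv (F.α j)) r =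
    (deriv F.S r / F.S r - 2 / r) * deriv (F.α j) r
      + 1 / (F.mu k ℓ r * r ^ 2) *
        (F.ω j r ^ 2 * (F.α j r - F.α (j + 1) r)
          - F.ω (j - 1) r ^ 2 * (F.α (j - 1) r - F.α j r))
  yangMills_ω : ∀ j ∈ Finset.Icc 1 (N - 1), deriv (deriv (F.ω j)) r =
    -(deriv F.S r / F.S r + deriv (F.mu k ℓ) r / F.mu k ℓ r) * deriv (F.ω j) r
      - 1 / (4 * F.mu k ℓ r ^ 2 * F.S r ^ 2) * F.ω j r * (F.α j r - F.α (j + 1) r) ^ 2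
      - F.W k j r * F.ω j r / (F.mu k ℓ r * r ^ 2)

/-- Asymptotic expansions as `r → ∞`, with `S → Sinf`. For `Sinf = 1` the configuration is
asymptotically (topological) anti-de Sitter with the standard normalisation of time. -/
structure AsymptoticExpansion (N : ℕ) (Sinf : ℝ) (F : Fields) : Prop where
  exp_m : ∃ M m₁ : ℝ, (fun r => F.m r - (M + m₁ / r)) =O[atTop] fun r => 1 / r ^ 2
  exp_S : ∃ S₄ : ℝ, (fun r => F.S r - (Sinf + S₄ / r ^ 4)) =O[atTop] fun r => 1 / r ^ 5
  exp_α : ∀ j ∈ Finset.Icc 1 N, ∃ a d : ℝ,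
    (fun r => F.α j r - (a + d / r)) =O[atTop] fun r => 1 / r ^ 2
  exp_ω : ∀ j ∈ Finset.Icc 1 (N - 1), ∃ w c : ℝ,
    (fun r => F.ω j r - (w + c / r)) =O[atTop] fun r => 1 / r ^ 2

/-- A solution on `[r₀, ∞)` that is smooth up to and including `r = r₀`, solves the field equations
for `r > r₀`, has `μ > 0` there, and has the required behaviour at infinity, with `S → Sinf > 0`. -/
structure IsGlobalSolution (N : ℕ) (k ℓ r₀ Sinf : ℝ) (F : Fields) : Prop where
  smooth_m : ContDiffOn ℝ (⊤ : ℕ∞) F.m (Ici r₀)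
  smooth_S : ContDiffOn ℝ (⊤ : ℕ∞) F.S (Ici r₀)
  smooth_α : ∀ j ∈ Finset.Icc 1 N, ContDiffOn ℝ (⊤ : ℕ∞) (F.α j) (Ici r₀)
  smooth_ω : ∀ j ∈ Finset.Icc 1 (N - 1), ContDiffOn ℝ (⊤ : ℕ∞) (F.ω j) (Ici r₀)
  α_zero : ∀ r, F.α 0 r = 0
  α_last : ∀ r, F.α (N + 1) r = 0
  ω_zero : ∀ r, F.ω 0 r = 0
  ω_last : ∀ r, F.ω N r = 0
  traceless : ∀ r ∈ Ici r₀, ∑ j ∈ Finset.Icc 1 N, F.α j r = 0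
  S_pos : ∀ r ∈ Ici r₀, 0 < F.S r
  mu_pos : ∀ r ∈ Ioi r₀, 0 < F.mu k ℓ r
  equations : ∀ r ∈ Ioi r₀, FieldEquationsAt N k ℓ F r
  Sinf_pos : 0 < Sinf
  infinity : AsymptoticExpansion N Sinf F

/-- A global black hole solution with a regular, non-degenerate event horizon at `r = rh`. -/
structure IsBlackHole (N : ℕ) (k ℓ rh Sinf : ℝ) (F : Fields) : Prop
    extends IsGlobalSolution N k ℓ rh Sinf F where
  mu_horizon : F.mu k ℓ rh = 0
  mu'_horizon : 0 < derivWithin (F.mu k ℓ) (Ici rh) rh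
  α_horizon : ∀ j ∈ Finset.Icc 1 N, F.α j rh = 0

/-- Horizon data: `ω_j(rh) = w j` and `𝓔_j'(rh) = e j` (one-sided derivative) for
`1 ≤ j ≤ N - 1`. -/
structure HasHorizonData (N : ℕ) (rh : ℝ) (F : Fields) (w e : ℕ → ℝ) : Prop where
  ω_horizon : ∀ j ∈ Finset.Icc 1 (N - 1), F.ω j rh = w j
  elec'_horizon : ∀ j ∈ Finset.Icc 1 (N - 1), derivWithin (F.elec j) (Ici rh) rh = e j

/-- A global spherically symmetric (`k = 1`) soliton, regular at the origin. -/
structure IsSoliton (N : ℕ) (ℓ Sinf : ℝ) (F : Fields) : Prop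
    extends IsGlobalSolution N 1 ℓ 0 Sinf F where
  m_origin : F.m =O[𝓝[>] 0] fun r => r ^ 3
  ω_origin : ∀ j ∈ Finset.Icc 1 (N - 1), F.ω j 0 = √((j : ℝ) * ((N : ℝ) - j))
  elec_origin : ∀ j ∈ Finset.Icc 1 (N - 1), F.elec j 0 = 0

/-- The Hahn polynomial `Q_k(x) = ₃F₂(-k, k + 1, -x; 2, 1 - N; 1)`. -/
noncomputable def hahn (N k : ℕ) (x : ℝ) : ℝ :=
  ∑ i ∈ Finset.range (k + 1),
    (ascPochhammer ℝ i).eval (-(k : ℝ)) * (ascPochhammer ℝ i).eval ((k : ℝ) + 1)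
        * (ascPochhammer ℝ i).eval (-x)
      / ((ascPochhammer ℝ i).eval 2 * (ascPochhammer ℝ i).eval (1 - (N : ℝ)) * (i.factorial : ℝ))

/-- `v_k^j = (N - 1) / (N - j) Q_k(j - 1)`: for `1 ≤ k ≤ N - 1`, the vector `(v_k^j)_{1 ≤ j ≤ N - 1}`
spans the eigenspace with eigenvalue `k (k + 1)` of the matrix
`A^i_j = (2 δ^i_j - δ^{i-1}_j - δ^{i+1}_j) j (N - j)`. -/
noncomputable def eigvec (N k j : ℕ) : ℝ :=
  ((N : ℝ) - 1) / ((N : ℝ) - j) * hahn N k ((j : ℝ) - 1)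

/-- Origin data `β k, θ k` (`1 ≤ k ≤ N - 1`): the expansions
`ω_j = √(j (N - j)) (1 + ∑ β̄_k(r) v_k^j r^(k+1)) + O(r^(N+1))` and
`𝓔_j = ∑ θ̄_k(r) v_k^j r^k + O(r^N)` hold near `r = 0`, with `β̄_k → β k` and `θ̄_k → θ k`. -/
def HasOriginData (N : ℕ) (F : Fields) (β θ : ℕ → ℝ) : Prop :=
  ∃ βbar θbar : ℕ → ℝ → ℝ,
    (∀ k ∈ Finset.Icc 1 (N - 1), Tendsto (βbar k) (𝓝[>] 0) (𝓝 (β k))) ∧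
    (∀ k ∈ Finset.Icc 1 (N - 1), Tendsto (θbar k) (𝓝[>] 0) (𝓝 (θ k))) ∧
    ∀ j ∈ Finset.Icc 1 (N - 1),
      ((fun r => F.ω j r - √((j : ℝ) * ((N : ℝ) - j)) *
          (1 + ∑ k ∈ Finset.Icc 1 (N - 1), βbar k r * eigvec N k j * r ^ (k + 1)))
        =O[𝓝[>] 0] fun r => r ^ (N + 1)) ∧
      ((fun r => F.elec j r -
          ∑ k ∈ Finset.Icc 1 (N - 1), θbar k r * eigvec N k j * r ^ k)
        =O[𝓝[>] 0] fun r => r ^ N)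

/-- The number of nodes (zeros) of `f` on `(r₀, ∞)`. -/
noncomputable def nodes (r₀ : ℝ) (f : ℝ → ℝ) : ℕ∞ := {r : ℝ | r₀ < r ∧ f r = 0}.encard

end EYM

/-! In the variable `x = r / (1 + r)` and with `ν = (1 - x)² μ`, the field equations are regular at
`x = 1`, where `ν = 1 / ℓ² > 0`. The prescribed behaviour at infinity then follows from smoothness
up to `x = 1`: the expansions are Taylor expansions there, and the explicit factor `(1 - x)³` in `S'
/ S` removes the terms of orders `r⁻¹, r⁻², r⁻³` from `S`. Conversely, the variables of a given
global solution and their first derivatives have limits at `x = 1` (`IsGlobalSolution.hasLimits`).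
Global existence for nearby data is thereby reduced to continuous dependence on a compact interval
whose only singular point is the inner end.

At the inner end, variables are chosen in which the equations read `p' = f(t, p, q)` and `t q' =
h(t, p) - λ q + t g(t, p, q)`, with smooth `f, g, h` and positive integers `λ`. The value `p(0)`
consists of the free data together with `S`, while `q(0) = h(0, p(0)) / λ` is forced. Subtracting `h
/ λ` from `q` leaves `y' = f - (λ / t) y`. For functions continuous at `0` this is the Volterra
equation `y(t) = c + t ∫₀¹ s^λ f(st, y(st)) ds`, with `c = 0` where `λ ≠ 0`. Since `s^λ ≤ 1`, Picard
iteration, Gronwall's inequality and bootstrapping work as for a regular equation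
(`exists_singular_solution_near`, `exists_regular_singular_solution_near`).

At a horizon, with `t = x - x₀`, write `ν = t n`, `𝓔_j = t ε_j`, `m = m_h + t a`, `ω_j' = κ_j / n`.
Then `p = (ω, 𝓔', S)`, `q = (κ, ε, a)` and every `λ` is `1`. As `n` equals `μ'(r_h)` at the horizon,
non-degeneracy says that `n > 0`, an open condition.

At the origin, the linearised equations couple the components through a matrix with eigenvalues `k
(k + 1)` and eigenvectors `v_k` built from Hahn polynomials. Here `p` holds `S` and the coefficients
`b_k`, `θ_k` of `x^(k+1) v_k` and `x^k v_k`, and `q` holds their derivatives and `a = m / x³`; the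
exponents are `2 (k + 1)` and `3`. A nonlinear term projected to a high mode is divided by a high
power of `x`. This does no harm, because `v_k^j` is a polynomial in `j` of degree less than `k`, so
that `v_a v_b` contains only modes up to `a + b - 1` (`modeStruct_eq_zero`).

Finally, `ω_j` and `S ν ω_j'` satisfy a linear homogeneous system. Hence `ω_j` vanishes identically
beyond a double zero, and also if it vanishes at the horizon (`IsCompactSolution.w_eq_zero`). If its
limit is not zero, its zeros are simple and stay away from both ends of `[x₀, 1]`, and their number
is stable under `C¹`-small perturbations (`encard_zeros_eq_of_near`). -/

namespace EYM

/-! ### Calculus up to an endpoint, and weighted averages. -/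

/-- A function continuous on `[a, b]` whose derivative on `(a, b)` extends continuously to `[a, b]`
has this extension as one-sided derivative. -/
theorem hasDerivWithinAt_Icc_of_Ioo {a b : ℝ} (hab : a < b) {g g' : ℝ → ℝ}
    (hg : ContinuousOn g (Icc a b)) (hg' : ContinuousOn g' (Icc a b))
    (hd : ∀ x ∈ Ioo a b, HasDerivAt g (g' x) x) :
    ∀ x ∈ Icc a b, HasDerivWithinAt g (g' x) (Icc a b) x := by
  intro x hx
  have hcl : closure (Ioo a b) = Icc a b := closure_Ioo hab.ne
  rw [← hcl]
  refine hasFDerivWithinAt_closure_of_tendsto_fderiv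
    (fun y hy => (hd y hy).differentiableAt.differentiableWithinAt) (convex_Ioo a b) isOpen_Ioo
    (fun y hy => (hg y (hcl ▸ hy)).mono Ioo_subset_Icc_self) ?_
  have h1 : Tendsto g' (𝓝[Ioo a b] x) (𝓝 (g' x)) := (hg' x hx).mono Ioo_subset_Icc_self
  have h2 : Tendsto (fun y => ContinuousLinearMap.toSpanSingleton ℝ (g' y)) (𝓝[Ioo a b] x)
      (𝓝 (ContinuousLinearMap.toSpanSingleton ℝ (g' x))) :=
    ((ContinuousLinearMap.toSpanSingletonCLE (𝕜 := ℝ) (E := ℝ)).continuous.tendsto _).comp h1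
  refine h2.congr' ?_
  filter_upwards [self_mem_nhdsWithin] with y hy
  exact ((hd y hy).hasFDerivAt.fderiv).symm

theorem contDiffOn_Icc_succ_of_Ioo {a b : ℝ} (hab : a < b) {g g' : ℝ → ℝ} {n : ℕ}
    (hg : ContinuousOn g (Icc a b)) (hg' : ContDiffOn ℝ n g' (Icc a b))
    (hd : ∀ x ∈ Ioo a b, HasDerivAt g (g' x) x) : ContDiffOn ℝ (n + 1 : ℕ) g (Icc a b) := by
  have h := hasDerivWithinAt_Icc_of_Ioo hab hg hg'.continuousOn hd
  push_cast
  rw [contDiffOn_succ_iff_derivWithin (uniqueDiffOn_Icc hab)]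
  refine ⟨fun x hx => (h x hx).differentiableWithinAt, by simp, hg'.congr fun x hx => ?_⟩
  exact (h x hx).derivWithin (uniqueDiffOn_Icc hab x hx)

/-- The weighted average `∫₀¹ sⁿ φ(s x) ds`. -/
noncomputable def avgPow (n : ℕ) (φ : ℝ → ℝ) (x : ℝ) : ℝ := ∫ s in (0 : ℝ)..1, s ^ n * φ (s * x)

theorem avgPow_congr {n : ℕ} {φ ψ : ℝ → ℝ} {T : ℝ} (h : EqOn φ ψ (Icc 0 T)) :
    EqOn (avgPow n φ) (avgPow n ψ) (Icc 0 T) := by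
  intro x hx
  refine intervalIntegral.integral_congr fun s hs => ?_
  rw [uIcc_of_le zero_le_one] at hs
  have : s * x ∈ Icc 0 T := ⟨mul_nonneg hs.1 hx.1,
    (mul_le_of_le_one_left hx.1 hs.2).trans hx.2⟩
  simp only [h this]

theorem continuous_avgPow {n : ℕ} {φ : ℝ → ℝ} (h : Continuous φ) : Continuous (avgPow n φ) :=
  intervalIntegral.continuous_parametric_intervalIntegral_of_continuous' (by fun_prop) _ _

theorem continuousOn_avgPow {n : ℕ} {φ : ℝ → ℝ} {T : ℝ} (hT : 0 ≤ T)
    (h : ContinuousOn φ (Icc 0 T)) : ContinuousOn (avgPow n φ) (Icc 0 T) := by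
  have h1 : Continuous (IccExtend hT ((Icc 0 T).domRestrict φ)) :=
    (continuousOn_iff_continuous_domRestrict.1 h).Icc_extend'
  refine (continuous_avgPow (n := n) h1).continuousOn.congr (avgPow_congr fun x hx => ?_)
  rw [IccExtend_of_mem _ _ hx]; rfl

theorem pow_succ_mul_avgPow (n : ℕ) (φ : ℝ → ℝ) (x : ℝ) :
    x ^ (n + 1) * avgPow n φ x = ∫ s in (0 : ℝ)..x, s ^ n * φ s := by
  have := intervalIntegral.mul_integral_comp_mul_right (a := 0) (b := 1)
    (f := fun s => s ^ n * φ s) (c := x)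
  simp only [zero_mul, one_mul] at this
  rw [← this, pow_succ', mul_assoc, avgPow, ← intervalIntegral.integral_const_mul]
  congr 1
  refine intervalIntegral.integral_congr fun s _ => ?_
  simp only [mul_pow]; ring

theorem hasDerivAt_avgPow {n : ℕ} {φ : ℝ → ℝ} {T : ℝ} (h : ContinuousOn φ (Icc 0 T))
    {x : ℝ} (hx : x ∈ Ioo 0 T) :
    HasDerivAt (avgPow n φ) ((φ x - (n + 1) * avgPow n φ x) / x) x := by
  have hx0 : x ≠ 0 := hx.1.ne'
  have hc : ContinuousOn (fun s => s ^ n * φ s) (Icc 0 T) := by fun_prop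
  have h1 : HasDerivAt (fun x => ∫ s in (0 : ℝ)..x, s ^ n * φ s) (x ^ n * φ x) x := by
    refine intervalIntegral.integral_hasDerivAt_right ?_ ?_ ?_
    · refine ContinuousOn.intervalIntegrable (hc.mono ?_)
      rw [uIcc_of_le hx.1.le]; exact Icc_subset_Icc_right hx.2.le
    · exact (hc.mono Ioo_subset_Icc_self).stronglyMeasurableAtFilter isOpen_Ioo x hx
    · exact hc.continuousAt (Icc_mem_nhds hx.1 hx.2)
  have h2 := h1.div (hasDerivAt_pow (n + 1) x) (pow_ne_zero _ hx0)
  have h3 := h2.congr_of_eventuallyEq (f₁ := avgPow n φ) (by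
    filter_upwards [Ioi_mem_nhds hx.1] with y hy
    have hy0 : y ≠ 0 := (mem_Ioi.1 hy).ne'
    simp only [Pi.div_apply]
    rw [← pow_succ_mul_avgPow, mul_div_cancel_left₀ _ (pow_ne_zero _ hy0)])
  refine h3.congr_deriv ?_
  rw [← pow_succ_mul_avgPow]
  simp only [Nat.add_sub_cancel]
  push_cast
  field_simp
  ring

/-- Integration by parts. It removes the division by `x` from the derivative of an average:
differentiation raises the weight by one and passes to `φ'`, so smoothness survives at `x = 0`. -/
theorem avgPow_succ_deriv {n : ℕ} {φ φ' : ℝ → ℝ} {T : ℝ} (h : ContinuousOn φ (Icc 0 T))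
    (h' : ContinuousOn φ' (Icc 0 T)) (hd : ∀ x ∈ Ioo 0 T, HasDerivAt φ (φ' x) x)
    {x : ℝ} (hx : x ∈ Ioo 0 T) :
    (φ x - (n + 1) * avgPow n φ x) / x = avgPow (n + 1) φ' x := by
  have hx0 : x ≠ 0 := hx.1.ne'
  have hsub : Icc 0 x ⊆ Icc 0 T := Icc_subset_Icc_right hx.2.le
  have hu : uIcc 0 x = Icc 0 x := uIcc_of_le hx.1.le
  have hcφ := h.mono hsub
  have hcφ' := h'.mono hsub
  have i1 : IntervalIntegrable (fun s => s ^ (n + 1) * φ' s) MeasureTheory.volume 0 x :=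
    ContinuousOn.intervalIntegrable (by rw [hu]; fun_prop)
  have i2 : IntervalIntegrable (fun s => s ^ n * φ s) MeasureTheory.volume 0 x :=
    ContinuousOn.intervalIntegrable (by rw [hu]; fun_prop)
  have key := intervalIntegral.integral_eq_sub_of_hasDerivAt_of_le hx.1.le
    (f := fun s => s ^ (n + 1) * φ s)
    (f' := fun s => (n + 1) * (s ^ n * φ s) + s ^ (n + 1) * φ' s) (by fun_prop)
    (fun s hs => by
      refine ((hasDerivAt_pow (n + 1) s).mul (hd s ⟨hs.1, hs.2.trans hx.2⟩)).congr_deriv ?_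
      rw [Nat.add_sub_cancel]; push_cast; ring)
    ((i2.const_mul _).add i1)
  rw [intervalIntegral.integral_add (i2.const_mul _) i1, intervalIntegral.integral_const_mul,
    ← pow_succ_mul_avgPow, ← pow_succ_mul_avgPow] at key
  simp only [ne_eq, Nat.add_eq_zero_iff, one_ne_zero, and_false, not_false_eq_true, zero_pow,
    zero_mul, sub_zero] at key
  have : x ^ (n + 1) ≠ 0 := pow_ne_zero _ hx0
  field_simp
  refine mul_left_cancel₀ this ?_
  linear_combination -key

/-- The weight `n` must vary in the induction on `k`, because the derivative of the average of
weight `n` is the average of `φ'` of weight `n + 1`. -/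
theorem contDiffOn_avgPow_nat {T : ℝ} (hT : 0 < T) (k : ℕ) : ∀ {n : ℕ} {φ : ℝ → ℝ},
    ContDiffOn ℝ k φ (Icc 0 T) → ContDiffOn ℝ k (avgPow n φ) (Icc 0 T) := by
  induction k with
  | zero =>
    intro n φ h
    simp only [Nat.cast_zero, contDiffOn_zero] at h ⊢
    exact continuousOn_avgPow hT.le h
  | succ k ih =>
    intro n φ h
    have h1 : ContDiffOn ℝ k (derivWithin φ (Icc 0 T)) (Icc 0 T) := by
      push_cast at h
      exact ((contDiffOn_succ_iff_derivWithin (uniqueDiffOn_Icc hT)).1 h).2.2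
    have hd : ∀ x ∈ Ioo 0 T, HasDerivAt φ (derivWithin φ (Icc 0 T) x) x := fun x hx =>
      ((h.differentiableOn (by simp) x ⟨hx.1.le, hx.2.le⟩).hasDerivWithinAt).hasDerivAt
        (Icc_mem_nhds hx.1 hx.2)
    refine contDiffOn_Icc_succ_of_Ioo hT (continuousOn_avgPow hT.le h.continuousOn)
      (ih (n := n + 1) h1) fun x hx => ?_
    rw [← avgPow_succ_deriv h.continuousOn h1.continuousOn hd hx]
    exact hasDerivAt_avgPow h.continuousOn hx

theorem contDiffOn_avgPow {T : ℝ} (hT : 0 < T) {n : ℕ} {φ : ℝ → ℝ}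
    (h : ContDiffOn ℝ (⊤ : ℕ∞) φ (Icc 0 T)) : ContDiffOn ℝ (⊤ : ℕ∞) (avgPow n φ) (Icc 0 T) :=
  contDiffOn_infty.2 fun k => contDiffOn_avgPow_nat hT k (h.of_le (by exact_mod_cast le_top))

/-- The weight `sⁿ` is at most `1` on `[0, 1]`, so the singular coefficient only helps: the estimate
is the one for the plain integral. -/
theorem abs_mul_avgPow_sub_le {n : ℕ} {φ ψ χ : ℝ → ℝ} {T t : ℝ} (hφ : ContinuousOn φ (Icc 0 T))
    (hψ : ContinuousOn ψ (Icc 0 T)) (hχ : ContinuousOn χ (Icc 0 T))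
    (h : ∀ s ∈ Icc 0 T, |φ s - ψ s| ≤ χ s) (ht : t ∈ Icc 0 T) :
    |t * avgPow n φ t - t * avgPow n ψ t| ≤ ∫ s in (0 : ℝ)..t, χ s := by
  have hmem : ∀ s ∈ Icc (0 : ℝ) 1, s * t ∈ Icc 0 T := fun s hs =>
    ⟨mul_nonneg hs.1 ht.1, (mul_le_of_le_one_left ht.1 hs.2).trans ht.2⟩
  have hu : uIcc (0 : ℝ) 1 = Icc 0 1 := uIcc_of_le zero_le_one
  have hcomp : ∀ {g : ℝ → ℝ}, ContinuousOn g (Icc 0 T) →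
      ContinuousOn (fun s => g (s * t)) (Icc 0 1) := fun hg =>
    hg.comp (by fun_prop) hmem
  have i1 := hcomp hφ
  have i2 := hcomp hψ
  have i3 := hcomp hχ
  have e : (∫ s in (0 : ℝ)..t, χ s) = t * ∫ s in (0 : ℝ)..1, χ (s * t) := by
    rw [intervalIntegral.mul_integral_comp_mul_right (f := χ)]; simp
  rw [e, ← mul_sub, abs_mul, abs_of_nonneg ht.1]
  refine mul_le_mul_of_nonneg_left ?_ ht.1
  rw [avgPow, avgPow, ← intervalIntegral.integral_sub
    (ContinuousOn.intervalIntegrable (by rw [hu]; exact (continuousOn_pow n).mul i1))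
    (ContinuousOn.intervalIntegrable (by rw [hu]; exact (continuousOn_pow n).mul i2)), ← Real.norm_eq_abs]
  refine intervalIntegral.norm_integral_le_of_norm_le zero_le_one ?_
    (ContinuousOn.intervalIntegrable (by rw [hu]; exact i3))
  refine Eventually.of_forall fun s hs => ?_
  have hs' : s ∈ Icc (0 : ℝ) 1 := ⟨hs.1.le, hs.2⟩
  rw [← mul_sub, Real.norm_eq_abs, abs_mul, abs_of_nonneg (pow_nonneg hs'.1 n)]
  calc _ ≤ 1 * |φ (s * t) - ψ (s * t)| :=
        mul_le_mul_of_nonneg_right (pow_le_one₀ hs'.1 hs'.2) (abs_nonneg _)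
    _ ≤ _ := by rw [one_mul]; exact h _ (hmem s hs')

/-! ### Gronwall's inequality and Volterra equations for systems with a singular coefficient. -/

/-- Integral form of Gronwall's inequality. -/
theorem le_of_le_add_integral {ψ : ℝ → ℝ} {T L δ : ℝ} (hL : 0 ≤ L)
    (hψ : ContinuousOn ψ (Icc 0 T)) (h0 : ∀ t ∈ Icc 0 T, 0 ≤ ψ t)
    (h : ∀ t ∈ Icc 0 T, ψ t ≤ δ + ∫ s in (0 : ℝ)..t, L * ψ s) :
    ∀ t ∈ Icc 0 T, ψ t ≤ 2 * δ * Real.exp ((2 * L + 1) * T) := by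
  intro t ht
  -- With `2 L ≤ K`, the integral at a maximum point of `ψ(t) exp(-K t)` is at most half of `ψ`
  -- there and can be absorbed. This is the source of the factor `2` and of the exponent in the
  -- bound.
  set K := 2 * L + 1 with hK
  have hKpos : 0 < K := by positivity
  obtain ⟨t₁, ht₁, hmax⟩ := isCompact_Icc.exists_isMaxOn ⟨t, ht⟩
    (f := fun t => ψ t * Real.exp (-(K * t))) (by fun_prop)
  set M := ψ t₁ * Real.exp (-(K * t₁)) with hM
  have hM0 : 0 ≤ M := mul_nonneg (h0 _ ht₁) (Real.exp_pos _).le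
  have hle : ∀ s ∈ Icc 0 T, ψ s ≤ M * Real.exp (K * s) := by
    intro s hs
    have : ψ s * Real.exp (-(K * s)) ≤ M := hmax hs
    rw [Real.exp_neg, ← div_eq_mul_inv, div_le_iff₀ (Real.exp_pos _)] at this
    exact this
  have hint : ∫ s in (0 : ℝ)..t₁, L * (M * Real.exp (K * s))
      = L * M * ((Real.exp (K * t₁) - 1) / K) := by
    have hd : ∀ s ∈ uIcc 0 t₁, HasDerivAt (fun s => L * M * (Real.exp (K * s) / K))
        (L * (M * Real.exp (K * s))) s := by
      intro s _
      refine ((((hasDerivAt_id s).const_mul K).exp.div_const K).const_mul (L * M)).congr_deriv ?_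
      simp only [id]; field_simp
    rw [intervalIntegral.integral_eq_sub_of_hasDerivAt hd
      (Continuous.intervalIntegrable (by fun_prop) _ _)]
    simp; ring
  have h1 : ∫ s in (0 : ℝ)..t₁, L * ψ s ≤ ∫ s in (0 : ℝ)..t₁, L * (M * Real.exp (K * s)) := by
    refine intervalIntegral.integral_mono_on ht₁.1 (ContinuousOn.intervalIntegrable ?_)
      (Continuous.intervalIntegrable (by fun_prop) _ _) fun s hs =>
        mul_le_mul_of_nonneg_left (hle s ⟨hs.1, hs.2.trans ht₁.2⟩) hL
    rw [uIcc_of_le ht₁.1]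
    exact (continuousOn_const.mul hψ).mono (Icc_subset_Icc_right ht₁.2)
  have h2 := (h t₁ ht₁).trans (add_le_add_right h1 δ)
  rw [hint] at h2
  have e1 : M * Real.exp (K * t₁) = ψ t₁ := by
    rw [hM, mul_assoc, ← Real.exp_add]; simp
  have h3 : L * M * ((Real.exp (K * t₁) - 1) / K) ≤ ψ t₁ / 2 := by
    have : L * M * ((Real.exp (K * t₁) - 1) / K) = (L * ψ t₁ - L * M) / K := by
      rw [← e1]; ring
    rw [this, div_le_div_iff₀ hKpos two_pos]
    nlinarith [h0 _ ht₁, mul_nonneg hL hM0]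
  have hδ : 0 ≤ δ := by linarith [h0 _ ht₁]
  have h4 : M ≤ 2 * δ := by
    have h5 : Real.exp (-(K * t₁)) ≤ 1 := by
      rw [Real.exp_le_one_iff]; nlinarith [ht₁.1]
    calc M ≤ ψ t₁ * 1 := mul_le_mul_of_nonneg_left h5 (h0 _ ht₁)
      _ ≤ 2 * δ := by linarith
  calc ψ t ≤ M * Real.exp (K * t) := hle t ht
    _ ≤ 2 * δ * Real.exp (K * T) := by
      refine mul_le_mul h4 ?_ (Real.exp_pos _).le (by positivity)
      exact Real.exp_le_exp.2 (mul_le_mul_of_nonneg_left ht.2 hKpos.le)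

/-- Picard iteration. The weights being at most `1`, the iterates satisfy the usual factorial bound,
so no restriction on `T` is needed. -/
theorem exists_volterra_solution {ι : Type*} [Fintype ι] {T : ℝ} (hT : 0 ≤ T) (lam : ι → ℕ) {F : ℝ × (ι → ℝ) → ι → ℝ}
    (hF : Continuous F) {L : ℝ} (hL : 0 ≤ L)
    (hLip : ∀ t u v, ‖F (t, u) - F (t, v)‖ ≤ L * ‖u - v‖) (c : ι → ℝ) :
    ∃ z : ℝ → ι → ℝ, Continuous z ∧ ∀ t ∈ Icc 0 T, ∀ i,
      z t i = c i + t * avgPow (lam i) (fun s => F (s, z s) i) t := by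
  have hcont : ∀ z : C(Icc 0 T, ι → ℝ), Continuous fun s => F (s, IccExtend hT z s) := fun z =>
    hF.comp (continuous_id.prodMk z.continuous.Icc_extend')
  let Op : C(Icc 0 T, ι → ℝ) → C(Icc 0 T, ι → ℝ) := fun z =>
    ⟨fun t i => c i + t * avgPow (lam i) (fun s => F (s, IccExtend hT z s) i) t, by
      refine continuous_pi fun i => continuous_const.add (continuous_subtype_val.mul ?_)
      exact (continuous_avgPow ((continuous_apply i).comp (hcont z))).comp continuous_subtype_val⟩
  have hOp : ∀ z t i, Op z t i =
    c i + t * avgPow (lam i) (fun s => F (s, IccExtend hT z s) i) t := fun _ _ _ => rfl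
  have hstep : ∀ n : ℕ, ∀ z w : C(Icc 0 T, ι → ℝ), ∀ t : Icc 0 T,
      ‖(Op^[n] z) t - (Op^[n] w) t‖ ≤ (L * t) ^ n / n.factorial * dist z w := by
    intro n z w
    induction n with
    | zero =>
      intro t
      simpa [dist_eq_norm] using (z - w).norm_coe_le_norm t
    | succ n ih =>
      intro t
      have hnn : (0 : ℝ) ≤ t := t.2.1
      rw [pi_norm_le_iff_of_nonneg (by positivity)]
      intro i
      rw [Function.iterate_succ_apply', Function.iterate_succ_apply', Pi.sub_apply, hOp, hOp,
        add_sub_add_left_eq_sub, Real.norm_eq_abs]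
      refine (abs_mul_avgPow_sub_le (T := T)
        (χ := fun s => L * ((L * s) ^ n / n.factorial * dist z w))
        ((continuous_apply i).comp (hcont _)).continuousOn
        ((continuous_apply i).comp (hcont _)).continuousOn
        (by fun_prop) (fun s hs => ?_) t.2).trans (le_of_eq ?_)
      · have h1 := norm_le_pi_norm (F (s, IccExtend hT (Op^[n] z) s)
          - F (s, IccExtend hT (Op^[n] w) s)) i
        rw [Pi.sub_apply, Real.norm_eq_abs] at h1
        refine h1.trans ((hLip _ _ _).trans (mul_le_mul_of_nonneg_left ?_ hL))
        rw [IccExtend_of_mem _ _ hs, IccExtend_of_mem _ _ hs]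
        exact ih ⟨s, hs⟩
      · have hd : ∀ s ∈ uIcc 0 (t : ℝ), HasDerivAt
            (fun s => (L * s) ^ (n + 1) / (n + 1).factorial * dist z w)
            (L * ((L * s) ^ n / n.factorial * dist z w)) s := by
          intro s _
          refine (((((hasDerivAt_id s).const_mul L).pow (n + 1)).div_const
            ((n + 1).factorial : ℝ)).mul_const (dist z w)).congr_deriv ?_
          rw [Nat.factorial_succ]
          push_cast
          simp only [id]
          field_simp
        rw [intervalIntegral.integral_eq_sub_of_hasDerivAt hd
          (Continuous.intervalIntegrable (by fun_prop) _ _)]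
        simp
  -- The map itself need not contract, but some iterate does, and the fixed point of an iterate is
  -- fixed by the map.
  obtain ⟨n, hn⟩ : ∃ n : ℕ, (L * T) ^ n / n.factorial < 1 :=
    ((FloorSemiring.tendsto_pow_div_factorial_atTop (L * T)).eventually
      (gt_mem_nhds zero_lt_one)).exists
  have hK0 : 0 ≤ (L * T) ^ n / n.factorial := by positivity
  have hcon : ContractingWith ((L * T) ^ n / n.factorial).toNNReal Op^[n] := by
    refine ⟨Real.toNNReal_lt_one.2 hn, LipschitzWith.of_dist_le_mul fun z w => ?_⟩
    rw [Real.coe_toNNReal _ hK0, ContinuousMap.dist_le (mul_nonneg hK0 dist_nonneg)]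
    intro t
    rw [dist_eq_norm]
    refine (hstep n z w t).trans (mul_le_mul_of_nonneg_right ?_ dist_nonneg)
    have hnn : (0 : ℝ) ≤ t := t.2.1
    have : (t : ℝ) ≤ T := t.2.2
    gcongr
  have hfix := hcon.isFixedPt_fixedPoint_iterate
  set z := ContractingWith.fixedPoint _ hcon
  refine ⟨IccExtend hT z, z.continuous.Icc_extend', fun t ht i => ?_⟩
  have h1 : z ⟨t, ht⟩ i = Op z ⟨t, ht⟩ i := by rw [hfix.eq]
  rw [IccExtend_of_mem _ _ ht, h1, hOp]

/-- Bootstrapping: the derivative of `z` is `f - λ · avgPow λ f` along `z`, and averages of `C^k`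
functions are `C^k` up to `0`. Each order of smoothness of `z` thus yields the next. Having `c i =
0` for `lam i ≠ 0` turns the average into `z / t`. -/
theorem contDiffOn_of_volterra {ι : Type*} [Fintype ι] {T : ℝ} (hT : 0 < T) {lam : ι → ℕ} {U : Set (ℝ × (ι → ℝ))}
    {f : ℝ × (ι → ℝ) → ι → ℝ} (hf : ContDiffOn ℝ (⊤ : ℕ∞) f U) {z : ℝ → ι → ℝ} {c : ι → ℝ}
    (hc : ∀ i, lam i ≠ 0 → c i = 0) (hz : ContinuousOn z (Icc 0 T))
    (hmem : ∀ t ∈ Icc 0 T, (t, z t) ∈ U)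
    (h : ∀ t ∈ Icc 0 T, ∀ i, z t i = c i + t * avgPow (lam i) (fun s => f (s, z s) i) t) :
    ContDiffOn ℝ (⊤ : ℕ∞) z (Icc 0 T) ∧ ∀ t ∈ Ioo 0 T, ∀ i,
      HasDerivAt (fun s => z s i) (f (t, z t) i - lam i / t * z t i) t := by
  have hφ : ∀ k : ℕ, ContDiffOn ℝ k z (Icc 0 T) → ∀ i,
      ContDiffOn ℝ k (fun s => f (s, z s) i) (Icc 0 T) := by
    intro k hk i
    have h1 : ContDiffOn ℝ k (fun s => f (s, z s)) (Icc 0 T) :=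
      (hf.of_le (by exact_mod_cast le_top)).comp (contDiffOn_id.prodMk hk) hmem
    exact contDiffOn_pi.1 h1 i
  have hz0 : ContDiffOn ℝ (0 : ℕ) z (Icc 0 T) := by simpa [contDiffOn_zero] using hz
  have hd : ∀ t ∈ Ioo 0 T, ∀ i, HasDerivAt (fun s => z s i)
      (f (t, z t) i - lam i * avgPow (lam i) (fun s => f (s, z s) i) t) t := by
    intro t ht i
    have h1 := ((hasDerivAt_id t).mul
      (hasDerivAt_avgPow (n := lam i) (hφ 0 hz0 i).continuousOn ht)).const_add (c i)
    refine (h1.congr_of_eventuallyEq ?_).congr_deriv ?_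
    · filter_upwards [Icc_mem_nhds ht.1 ht.2] with s hs
      exact h s hs i
    · have := ht.1.ne'
      simp only [id]
      field_simp
      ring
  constructor
  · refine contDiffOn_infty.2 fun k => ?_
    induction k with
    | zero => exact hz0
    | succ k ih =>
      refine contDiffOn_pi.2 fun i => ?_
      refine contDiffOn_Icc_succ_of_Ioo hT ((continuous_apply i).comp_continuousOn hz)
        ((hφ k ih i).sub (contDiffOn_const.mul (contDiffOn_avgPow_nat hT k (hφ k ih i))))
        fun t ht => hd t ht i
  · intro t ht i
    refine (hd t ht i).congr_deriv ?_
    have h1 := h t ⟨ht.1.le, ht.2.le⟩ i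
    have := ht.1.ne'
    by_cases hl : lam i = 0
    · simp [hl]
    · rw [h1, hc i hl]; field_simp; ring

/-- The integrating factor `t^λ` turns the equation into `(t^λ y)' = t^λ φ`. Continuity of `y` at
`0` excludes the homogeneous solution `t^(-λ)` and forces `y(0) = 0` when `λ ≠ 0`. -/
theorem volterra_of_hasDerivAt {ι : Type*} {T : ℝ} {lam : ι → ℕ} {φ y : ℝ → ι → ℝ} (hT : 0 < T)
    (hφ : ContinuousOn φ (Icc 0 T)) (hy : ContinuousOn y (Icc 0 T))
    (hd : ∀ t ∈ Ioo 0 T, ∀ i, HasDerivAt (fun s => y s i) (φ t i - lam i / t * y t i) t) (i : ι) :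
    (lam i ≠ 0 → y 0 i = 0) ∧
    ∀ t ∈ Icc 0 T, y t i = y 0 i + t * avgPow (lam i) (fun s => φ s i) t := by
  have hyi : ContinuousOn (fun s => y s i) (Icc 0 T) := (continuous_apply i).comp_continuousOn hy
  have hφi : ContinuousOn (fun s => φ s i) (Icc 0 T) := (continuous_apply i).comp_continuousOn hφ
  have key : ∀ t ∈ Icc 0 T, t ^ (lam i) * y t i =
      0 ^ (lam i) * y 0 i + t ^ (lam i + 1) * avgPow (lam i) (fun s => φ s i) t := by
    intro t ht
    have hsub : Icc 0 t ⊆ Icc 0 T := Icc_subset_Icc_right ht.2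
    have h2 := hyi.mono hsub
    have h3 := hφi.mono hsub
    rw [pow_succ_mul_avgPow]
    have := intervalIntegral.integral_eq_sub_of_hasDerivAt_of_le ht.1
      (f := fun s => s ^ (lam i) * y s i) (f' := fun s => s ^ (lam i) * φ s i) (by fun_prop)
      (fun s hs => by
        refine ((hasDerivAt_pow (lam i) s).mul (hd s ⟨hs.1, hs.2.trans_le ht.2⟩ i)).congr_deriv ?_
        have hs0 := hs.1.ne'
        rcases Nat.eq_zero_or_pos (lam i) with hl | hl
        · simp [hl]
        · obtain ⟨m, hm⟩ := Nat.exists_eq_succ_of_ne_zero hl.ne'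
          rw [hm, Nat.succ_eq_add_one, Nat.add_sub_cancel, pow_succ]
          push_cast
          field_simp
          ring)
      (ContinuousOn.intervalIntegrable (by rw [uIcc_of_le ht.1]; fun_prop))
    linear_combination -this
  have h0 : lam i ≠ 0 → y 0 i = 0 := by
    intro hl
    have hav := continuousOn_avgPow (n := lam i) hT.le hφi
    have h1 : Tendsto (fun t => y t i) (𝓝[Ioc 0 T] 0) (𝓝 (y 0 i)) :=
      (hyi 0 ⟨le_rfl, hT.le⟩).mono Ioc_subset_Icc_self
    have h2 : Tendsto (fun t => t * avgPow (lam i) (fun s => φ s i) t) (𝓝[Ioc 0 T] 0)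
        (𝓝 (0 * avgPow (lam i) (fun s => φ s i) 0)) :=
      ((continuousOn_id.mul hav) 0 ⟨le_rfl, hT.le⟩).mono Ioc_subset_Icc_self
    have h3 : (𝓝[Ioc 0 T] (0 : ℝ)).NeBot := by
      rw [nhdsWithin_Ioc_eq_nhdsGT hT]; infer_instance
    have h4 := tendsto_nhds_unique h1 (h2.congr' ?_)
    · rw [h4, zero_mul]
    · filter_upwards [self_mem_nhdsWithin] with t ht
      have := key t ⟨ht.1.le, ht.2⟩
      rw [zero_pow hl, zero_mul, zero_add, pow_succ, mul_assoc] at this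
      exact (mul_left_cancel₀ (pow_ne_zero _ ht.1.ne') this).symm
  refine ⟨h0, fun t ht => ?_⟩
  rcases eq_or_ne (lam i) 0 with hl | hl
  · have := key t ht
    rw [hl] at this ⊢
    simpa using this
  · rw [h0 hl, zero_add]
    rcases ht.1.eq_or_lt with h | h
    · rw [← h, h0 hl, zero_mul]
    · have := key t ht
      rw [zero_pow hl, zero_mul, zero_add, pow_succ, mul_assoc] at this
      exact mul_left_cancel₀ (pow_ne_zero _ h.ne') this

/-! ### Continuous dependence on the initial data for singular systems. -/

/-- Truncation of a vector to the cube of radius `ρ`. -/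
noncomputable def clip {ι : Type*} (ρ : ℝ) (u : ι → ℝ) : ι → ℝ := fun i => max (-ρ) (min ρ (u i))

theorem continuous_clip {ι : Type*} (ρ : ℝ) : Continuous (clip ρ : (ι → ℝ) → ι → ℝ) :=
  continuous_pi fun i => by unfold clip; fun_prop

theorem norm_clip_le {ι : Type*} [Fintype ι] {ρ : ℝ} (hρ : 0 ≤ ρ) (u : ι → ℝ) : ‖clip ρ u‖ ≤ ρ := by
  rw [pi_norm_le_iff_of_nonneg hρ]
  intro i
  rw [Real.norm_eq_abs, abs_le]
  exact ⟨le_max_left _ _, max_le (by linarith) (min_le_left _ _)⟩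

theorem norm_clip_sub_le {ι : Type*} [Fintype ι] (ρ : ℝ) (u v : ι → ℝ) : ‖clip ρ u - clip ρ v‖ ≤ ‖u - v‖ := by
  rw [pi_norm_le_iff_of_nonneg (norm_nonneg _)]
  intro i
  refine le_trans ?_ (norm_le_pi_norm (u - v) i)
  simp only [Pi.sub_apply, clip, Real.norm_eq_abs]
  rw [max_comm (-ρ), max_comm (-ρ), min_comm ρ, min_comm ρ]
  exact (abs_max_sub_max_le_abs _ _ _).trans (abs_min_sub_min_le_max _ _ _ _ |>.trans (by simp))

theorem clip_eq_self {ι : Type*} [Fintype ι] {ρ : ℝ} {u : ι → ℝ} (h : ‖u‖ ≤ ρ) : clip ρ u = u := by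
  ext i
  have h1 := (norm_le_pi_norm u i).trans h
  rw [Real.norm_eq_abs, abs_le] at h1
  simp [clip, h1.1, h1.2]

/-- Continuous dependence for a system `y' = f (t, y) - (lam / t) y` on `[0, T]`, singular at
`t = 0`, around a given solution. -/
theorem exists_singular_solution_near {ι : Type*} [Fintype ι] {T : ℝ} (hT : 0 < T) (lam : ι → ℕ)
    {U : Set (ℝ × (ι → ℝ))} (hU : IsOpen U) {f : ℝ × (ι → ℝ) → ι → ℝ}
    (hf : ContDiffOn ℝ (⊤ : ℕ∞) f U) {y : ℝ → ι → ℝ} {yT : ι → ℝ}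
    (hyc : ContinuousOn y (Ico 0 T)) (hyT : Tendsto y (𝓝[<] T) (𝓝 yT))
    (hymem : ∀ t ∈ Ico 0 T, (t, y t) ∈ U) (hmemT : (T, yT) ∈ U)
    (hy : ∀ t ∈ Ioo 0 T, ∀ i, HasDerivAt (fun s => y s i) (f (t, y t) i - lam i / t * y t i) t)
    {ε : ℝ} (hε : 0 < ε) :
    ∃ δ > 0, ∀ c : ι → ℝ, (∀ i, lam i ≠ 0 → c i = 0) → (∀ i, lam i = 0 → |c i - y 0 i| < δ) →
      ∃ z : ℝ → ι → ℝ, ContDiffOn ℝ (⊤ : ℕ∞) z (Icc 0 T) ∧ z 0 = c ∧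
        (∀ t ∈ Icc 0 T, (t, z t) ∈ U) ∧
        (∀ t ∈ Ioo 0 T, ∀ i,
          HasDerivAt (fun s => z s i) (f (t, z t) i - lam i / t * z t i) t) ∧
        ∀ t ∈ Ico 0 T, ∀ i, |z t i - y t i| < ε := by
  classical
  -- The reference solution is only known on `[0, T)`; inserting its limit at `T` gives a graph over
  -- a compact interval, which has a uniform tube inside `U`.
  set Y : ℝ → ι → ℝ := Function.update y T yT with hYdef
  have hYeq : ∀ t, t ≠ T → Y t = y t := fun t ht => Function.update_of_ne ht _ _
  have hYc : ContinuousOn Y (Icc 0 T) := by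
    intro t ht
    rcases ht.2.eq_or_lt with h | h
    · subst h
      rw [continuousWithinAt_update_same]
      refine hyT.mono_left (nhdsWithin_mono _ fun s hs => ?_)
      exact lt_of_le_of_ne hs.1.2 hs.2
    · refine (continuousWithinAt_update_of_ne h.ne).2 ?_
      refine (hyc t ⟨ht.1, h⟩).mono_of_mem_nhdsWithin ?_
      exact mem_nhdsWithin.2 ⟨Iio T, isOpen_Iio, h, fun s hs => ⟨hs.2.1, hs.1⟩⟩
  have hYmem : ∀ t ∈ Icc 0 T, (t, Y t) ∈ U := by
    intro t ht
    rcases ht.2.eq_or_lt with h | h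
    · rw [h, hYdef, Function.update_self]; exact hmemT
    · rw [hYeq t h.ne]; exact hymem t ⟨ht.1, h⟩
  have hYd : ∀ t ∈ Ioo 0 T, ∀ i,
      HasDerivAt (fun s => Y s i) (f (t, Y t) i - lam i / t * Y t i) t := by
    intro t ht i
    rw [hYeq t ht.2.ne]
    refine (hy t ht i).congr_of_eventuallyEq ?_
    filter_upwards [Iio_mem_nhds ht.2] with s hs
    rw [hYeq s (ne_of_lt hs)]
  -- the tube around the reference solution
  have hgraph : IsCompact ((fun t => (t, Y t)) '' Icc 0 T) :=
    isCompact_Icc.image_of_continuousOn (continuousOn_id.prodMk hYc)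
  obtain ⟨ρ₀, hρ₀, hthick⟩ := hgraph.exists_cthickening_subset_open hU
    (by rintro _ ⟨t, ht, rfl⟩; exact hYmem t ht)
  set ρ := min ρ₀ (ε / 2) with hρdef
  have hρ : 0 < ρ := lt_min hρ₀ (by linarith)
  have htube : ∀ t ∈ Icc 0 T, ∀ w : ι → ℝ, ‖w‖ ≤ ρ → (t, Y t + w) ∈ U := by
    intro t ht w hw
    refine hthick (Metric.mem_cthickening_of_dist_le _ (t, Y t) _ _ ⟨t, ht, rfl⟩ ?_)
    rw [Prod.dist_eq, dist_self, dist_eq_norm, add_sub_cancel_left]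
    exact max_le hρ₀.le (hw.trans (min_le_left _ _))
  have hTb : IsCompact ((fun q : ℝ × (ι → ℝ) => (q.1, Y q.1 + q.2)) ''
      (Icc 0 T ×ˢ Metric.closedBall 0 ρ)) := by
    refine (isCompact_Icc.prod (isCompact_closedBall _ _)).image_of_continuousOn ?_
    refine continuousOn_fst.prodMk ((hYc.comp continuousOn_fst fun q hq => hq.1).add
      continuousOn_snd)
  have hfd : ContinuousOn (fun q => ‖fderiv ℝ f q‖) U :=
    (hf.continuousOn_fderiv_of_isOpen hU (by simp)).norm
  obtain ⟨L₀, hL₀⟩ := hTb.bddAbove_image (hfd.mono (by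
    rintro _ ⟨q, hq, rfl⟩
    exact htube q.1 hq.1 q.2 (by simpa using hq.2)))
  set L := max L₀ 0 with hLdef
  have hL : 0 ≤ L := le_max_right _ _
  have hLip0 : ∀ t ∈ Icc 0 T, ∀ u v : ι → ℝ, ‖u‖ ≤ ρ → ‖v‖ ≤ ρ →
      ‖f (t, Y t + u) - f (t, Y t + v)‖ ≤ L * ‖u - v‖ := by
    intro t ht u v hu hv
    have hder : ∀ w ∈ Metric.closedBall (0 : ι → ℝ) ρ, HasFDerivWithinAt
        (fun w => f (t, Y t + w)) ((fderiv ℝ f (t, Y t + w)).comp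
          (ContinuousLinearMap.inr ℝ ℝ (ι → ℝ))) (Metric.closedBall 0 ρ) w := by
      intro w hw
      have h1 : (t, Y t + w) ∈ U := htube t ht w (by simpa using hw)
      have h2 : HasFDerivAt f (fderiv ℝ f (t, Y t + w)) (t, Y t + w) :=
        ((hf.contDiffAt (hU.mem_nhds h1)).differentiableAt (by simp)).hasFDerivAt
      have h3 : HasFDerivAt (fun w : ι → ℝ => (t, Y t + w))
          (ContinuousLinearMap.inr ℝ ℝ (ι → ℝ)) w :=
        (hasFDerivAt_const t w).prodMk ((hasFDerivAt_id w).const_add (Y t))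
      exact (h2.comp w h3).hasFDerivWithinAt
    refine (convex_closedBall (0 : ι → ℝ) ρ).norm_image_sub_le_of_norm_hasFDerivWithin_le hder
      (fun w hw => ?_) (by simpa using hv) (by simpa using hu)
    refine (ContinuousLinearMap.opNorm_comp_le _ _).trans ?_
    have h1 : ‖fderiv ℝ f (t, Y t + w)‖ ≤ L :=
      (hL₀ ⟨_, ⟨(t, w), ⟨ht, hw⟩, rfl⟩, rfl⟩).trans (le_max_left _ _)
    calc _ ≤ L * 1 := mul_le_mul h1 (ContinuousLinearMap.norm_inr_le_one ℝ ℝ (ι → ℝ))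
            (norm_nonneg _) hL
      _ = L := mul_one L
  -- the truncated right-hand side
  let pr : ℝ → ℝ := fun t => (projIcc 0 T hT.le t : ℝ)
  have hpr : ∀ t, pr t ∈ Icc 0 T := fun t => (projIcc 0 T hT.le t).2
  have hprc : Continuous pr := continuous_subtype_val.comp continuous_projIcc
  have hpreq : ∀ t ∈ Icc 0 T, pr t = t := fun t ht => by
    simp only [pr, projIcc_of_mem hT.le ht]
  have hYp : Continuous fun t => Y (pr t) := hYc.comp_continuous hprc hpr
  set F : ℝ × (ι → ℝ) → ι → ℝ := fun q =>
    f (pr q.1, Y (pr q.1) + clip ρ (q.2 - Y (pr q.1))) with hFdef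
  have hFc : Continuous F := by
    refine hf.continuousOn.comp_continuous ?_ fun q =>
      htube _ (hpr _) _ (norm_clip_le hρ.le _)
    refine (hprc.comp continuous_fst).prodMk ((hYp.comp continuous_fst).add
      ((continuous_clip ρ).comp (continuous_snd.sub (hYp.comp continuous_fst))))
  have hFLip : ∀ t u v, ‖F (t, u) - F (t, v)‖ ≤ L * ‖u - v‖ := by
    intro t u v
    refine (hLip0 _ (hpr t) _ _ (norm_clip_le hρ.le _) (norm_clip_le hρ.le _)).trans
      (mul_le_mul_of_nonneg_left ((norm_clip_sub_le _ _ _).trans ?_) hL)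
    simp
  have hFeq : ∀ t ∈ Icc 0 T, ∀ u, ‖u - Y t‖ ≤ ρ → F (t, u) = f (t, u) := by
    intro t ht u hu
    simp only [hFdef, hpreq t ht]
    rw [clip_eq_self hu, add_sub_cancel]
  have hYv : ∀ i, (lam i ≠ 0 → Y 0 i = 0) ∧ ∀ t ∈ Icc 0 T, Y t i = Y 0 i +
      t * avgPow (lam i) (fun s => F (s, Y s) i) t := by
    refine volterra_of_hasDerivAt hT (φ := fun s => F (s, Y s)) ?_ hYc ?_
    · exact hFc.comp_continuousOn (continuousOn_id.prodMk hYc)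
    · intro t ht i
      have := hFeq t ⟨ht.1.le, ht.2.le⟩ (Y t) (by simpa using hρ.le)
      simp only [this]
      exact hYd t ht i
  set E := Real.exp ((2 * L + 1) * T) with hE
  have hEpos : 0 < E := Real.exp_pos _
  -- The constant `2 E` is the amplification factor in `le_of_le_add_integral`, so that data this
  -- close keep the solution within distance `ρ`.
  refine ⟨ρ / (2 * E), by positivity, fun c hc hcδ => ?_⟩
  obtain ⟨z, hzc, hz⟩ := exists_volterra_solution hT.le lam hFc hL hFLip c
  have hY0 : Y 0 = y 0 := hYeq 0 hT.ne
  have hcY : ‖c - Y 0‖ ≤ ρ / (2 * E) := by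
    rw [pi_norm_le_iff_of_nonneg (by positivity)]
    intro i
    rw [Pi.sub_apply, Real.norm_eq_abs]
    by_cases hl : lam i = 0
    · rw [hY0]; exact (hcδ i hl).le
    · rw [hc i hl, (hYv i).1 hl]; simp; positivity
  have hzY : ContinuousOn (fun t => ‖z t - Y t‖) (Icc 0 T) := (hzc.continuousOn.sub hYc).norm
  -- Both functions solve the Volterra equation of the truncated right-hand side. Once they are
  -- within `ρ`, the truncation is inactive and `z` solves the original equation.
  have hclose : ∀ t ∈ Icc 0 T, ‖z t - Y t‖ ≤ ρ := by
    intro t ht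
    refine (le_of_le_add_integral hL hzY (fun _ _ => norm_nonneg _) (δ := ‖c - Y 0‖)
      (fun t ht => ?_) t ht).trans ?_
    · rw [pi_norm_le_iff_of_nonneg]
      · intro i
        rw [Pi.sub_apply, hz t ht i, (hYv i).2 t ht, add_sub_add_comm]
        refine (norm_add_le _ _).trans <|
          add_le_add (norm_le_pi_norm (c - Y 0) i) ?_
        refine abs_mul_avgPow_sub_le (T := T)
          (((continuous_apply i).comp hFc).comp_continuousOn
            (continuousOn_id.prodMk hzc.continuousOn))
          (((continuous_apply i).comp hFc).comp_continuousOn (continuousOn_id.prodMk hYc))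
          (continuousOn_const.mul hzY) (fun s _ => ?_) ht
        exact (norm_le_pi_norm (F (s, z s) - F (s, Y s)) i).trans (hFLip _ _ _)
      · refine add_nonneg (norm_nonneg _) (intervalIntegral.integral_nonneg ht.1 fun s _ => ?_)
        positivity
    · calc 2 * ‖c - Y 0‖ * E ≤ 2 * (ρ / (2 * E)) * E := by gcongr
        _ = ρ := by field_simp
  have hzmem : ∀ t ∈ Icc 0 T, (t, z t) ∈ U := by
    intro t ht
    have := htube t ht (z t - Y t) (hclose t ht)
    rwa [add_sub_cancel] at this
  have hzv : ∀ t ∈ Icc 0 T, ∀ i,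
      z t i = c i + t * avgPow (lam i) (fun s => f (s, z s) i) t := by
    intro t ht i
    rw [hz t ht i, avgPow_congr (T := T) (fun s hs => ?_) ht]
    rw [hFeq s hs _ (hclose s hs)]
  obtain ⟨h1, h2⟩ := contDiffOn_of_volterra hT hf hc hzc.continuousOn hzmem hzv
  refine ⟨z, h1, ?_, hzmem, h2, fun t ht i => ?_⟩
  · ext i
    rw [hz 0 ⟨le_rfl, hT.le⟩ i]; simp
  · rw [← hYeq t ht.2.ne]
    have h3 := (norm_le_pi_norm (z t - Y t) i).trans (hclose t ⟨ht.1, ht.2.le⟩)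
    rw [Pi.sub_apply, Real.norm_eq_abs] at h3
    have : ρ ≤ ε / 2 := min_le_right _ _
    linarith

theorem exists_continuous_eqOn_Ico {E : Type*} [TopologicalSpace E] {a T : ℝ} (hT : a < T)
    {y : ℝ → E} {yT : E} (hyc : ContinuousOn y (Ico a T)) (hyT : Tendsto y (𝓝[<] T) (𝓝 yT)) :
    ∃ Y : ℝ → E, Continuous Y ∧ EqOn Y y (Ico a T) ∧ Y T = yT := by
  classical
  set Y : ℝ → E := Function.update y T yT with hYdef
  have hYc : ContinuousOn Y (Icc a T) := by
    intro t ht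
    rcases ht.2.eq_or_lt with h | h
    · subst h
      rw [continuousWithinAt_update_same]
      refine hyT.mono_left (nhdsWithin_mono _ fun s hs => ?_)
      exact lt_of_le_of_ne hs.1.2 hs.2
    · refine (continuousWithinAt_update_of_ne h.ne).2 ?_
      refine (hyc t ⟨ht.1, h⟩).mono_of_mem_nhdsWithin ?_
      exact mem_nhdsWithin.2 ⟨Iio T, isOpen_Iio, h, fun s hs => ⟨hs.2.1, hs.1⟩⟩
  refine ⟨IccExtend hT.le ((Icc a T).domRestrict Y),
    (continuousOn_iff_continuous_domRestrict.1 hYc).Icc_extend', fun t ht => ?_, ?_⟩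
  · rw [IccExtend_of_mem _ _ ⟨ht.1, ht.2.le⟩]
    exact Function.update_of_ne ht.2.ne _ _
  · rw [IccExtend_of_mem _ _ ⟨hT.le, le_rfl⟩]
    exact Function.update_self _ _ _

/-- Continuous dependence for a system `p' = f (t, p, q)`,
`t q' = h (t, p) - lam q + t g (t, p, q)` on `[0, T]` around a given solution. -/
theorem exists_regular_singular_solution_near {ι κ : Type*} [Fintype ι] [Fintype κ] {T : ℝ}
    (hT : 0 < T) {lam : κ → ℕ} (hlam : ∀ i, lam i ≠ 0)
    {U : Set (ℝ × (ι → ℝ) × (κ → ℝ))} (hU : IsOpen U) {V : Set (ℝ × (ι → ℝ))} (hV : IsOpen V)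
    (hUV : ∀ z ∈ U, (z.1, z.2.1) ∈ V)
    {f : ℝ × (ι → ℝ) × (κ → ℝ) → ι → ℝ} (hf : ContDiffOn ℝ (⊤ : ℕ∞) f U)
    {g : ℝ × (ι → ℝ) × (κ → ℝ) → κ → ℝ} (hg : ContDiffOn ℝ (⊤ : ℕ∞) g U)
    {h : ℝ × (ι → ℝ) → κ → ℝ} (hh : ContDiffOn ℝ (⊤ : ℕ∞) h V)
    {p : ℝ → ι → ℝ} {q : ℝ → κ → ℝ} {pT : ι → ℝ} {qT : κ → ℝ}
    (hpc : ContinuousOn p (Ico 0 T)) (hpT : Tendsto p (𝓝[<] T) (𝓝 pT))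
    (hqc : ContinuousOn q (Ico 0 T)) (hqT : Tendsto q (𝓝[<] T) (𝓝 qT))
    (hmem : ∀ t ∈ Ico 0 T, (t, p t, q t) ∈ U) (hmemT : (T, pT, qT) ∈ U)
    (hp : ∀ t ∈ Ioo 0 T, ∀ i, HasDerivAt (fun s => p s i) (f (t, p t, q t) i) t)
    (hq : ∀ t ∈ Ioo 0 T, ∀ i, HasDerivAt (fun s => q s i)
      ((h (t, p t) i - lam i * q t i) / t + g (t, p t, q t) i) t)
    {ε : ℝ} (hε : 0 < ε) :
    ∃ δ > 0, ∀ c : ι → ℝ, (∀ i, |c i - p 0 i| < δ) →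
      ∃ (P : ℝ → ι → ℝ) (Q : ℝ → κ → ℝ), ContDiffOn ℝ (⊤ : ℕ∞) P (Icc 0 T) ∧
        ContDiffOn ℝ (⊤ : ℕ∞) Q (Icc 0 T) ∧ P 0 = c ∧
        (∀ t ∈ Icc 0 T, (t, P t, Q t) ∈ U) ∧
        (∀ t ∈ Ioo 0 T, ∀ i, HasDerivAt (fun s => P s i) (f (t, P t, Q t) i) t) ∧
        (∀ t ∈ Ioo 0 T, ∀ i, HasDerivAt (fun s => Q s i)
          ((h (t, P t) i - lam i * Q t i) / t + g (t, P t, Q t) i) t) ∧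
        ∀ t ∈ Ico 0 T, (∀ i, |P t i - p t i| < ε) ∧ ∀ i, |Q t i - q t i| < ε := by
  obtain ⟨Pe, hPec, hPeq, hPeT⟩ := exists_continuous_eqOn_Ico hT hpc hpT
  obtain ⟨Qe, hQec, hQeq, hQeT⟩ := exists_continuous_eqOn_Ico hT hqc hqT
  -- Closeness to the reference solution is made part of the domain of the equations. It is then
  -- inherited by every solution which stays in that domain.
  set A : Set (ℝ × (ι → ℝ) × (κ → ℝ)) := {z | (∀ i, |z.2.1 i - Pe z.1 i| < ε) ∧
    ∀ i, |z.2.2 i - Qe z.1 i| < ε} with hA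
  have hAo : IsOpen A := by
    have e : A = (⋂ i, {z | |z.2.1 i - Pe z.1 i| < ε}) ∩ ⋂ i, {z | |z.2.2 i - Qe z.1 i| < ε} := by
      ext z; simp [hA]
    rw [e]
    refine (isOpen_iInter_of_finite fun i => ?_).inter (isOpen_iInter_of_finite fun i => ?_)
    · exact isOpen_lt (by fun_prop) continuous_const
    · exact isOpen_lt (by fun_prop) continuous_const
  -- Change of variables `q = y + h(t, p) / λ`, which absorbs the forcing `h / t`. Its derivative
  -- needs only `p' = f`, because `h` does not involve `q`.
  set Φ : ℝ × (ι ⊕ κ → ℝ) → ℝ × (ι → ℝ) × (κ → ℝ) := fun z =>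
    (z.1, fun i => z.2 (Sum.inl i),
      fun i => z.2 (Sum.inr i) + h (z.1, fun i => z.2 (Sum.inl i)) i / lam i) with hΦ
  set V' : Set (ℝ × (ι ⊕ κ → ℝ)) := {z | (z.1, fun i => z.2 (Sum.inl i)) ∈ V} with hV'
  have hπ : ContDiff ℝ (⊤ : ℕ∞)
      (fun z : ℝ × (ι ⊕ κ → ℝ) => (z.1, fun i => z.2 (Sum.inl i))) :=
    contDiff_fst.prodMk (contDiff_pi.2 fun i =>
      (contDiff_apply ℝ ℝ (Sum.inl i : ι ⊕ κ)).comp contDiff_snd)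
  have hV'o : IsOpen V' := hV.preimage hπ.continuous
  have hΦs : ContDiffOn ℝ (⊤ : ℕ∞) Φ V' := by
    refine contDiffOn_fst.prodMk (ContDiffOn.prodMk ?_ ?_)
    · exact (contDiff_pi.2 fun i =>
        (contDiff_apply ℝ ℝ (Sum.inl i : ι ⊕ κ)).comp contDiff_snd).contDiffOn
    · refine contDiffOn_pi.2 fun i => ContDiffOn.add ?_ (ContDiffOn.div_const ?_ _)
      · exact ((contDiff_apply ℝ ℝ (Sum.inr i : ι ⊕ κ)).comp contDiff_snd).contDiffOn
      · exact contDiffOn_pi.1 (hh.comp hπ.contDiffOn fun z hz => hz) i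
  set U' : Set (ℝ × (ι ⊕ κ → ℝ)) := V' ∩ Φ ⁻¹' (U ∩ A) with hU'
  have hU'o : IsOpen U' := hΦs.continuousOn.isOpen_inter_preimage hV'o (hU.inter hAo)
  have hΦU : MapsTo Φ U' U := fun z hz => hz.2.1
  -- The subtracted term is the total derivative of `h(t, p(t)) / λ`, with `p'` replaced by `f`.
  set F : ℝ × (ι ⊕ κ → ℝ) → ι ⊕ κ → ℝ := fun z => Sum.elim (f (Φ z)) fun i =>
    g (Φ z) i - (fderiv ℝ h (z.1, fun i => z.2 (Sum.inl i)) (1, f (Φ z))) i / lam i with hF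
  have hfΦ : ContDiffOn ℝ (⊤ : ℕ∞) (fun z => f (Φ z)) U' :=
    hf.comp (hΦs.mono inter_subset_left) hΦU
  have hgΦ : ContDiffOn ℝ (⊤ : ℕ∞) (fun z => g (Φ z)) U' :=
    hg.comp (hΦs.mono inter_subset_left) hΦU
  have hFs : ContDiffOn ℝ (⊤ : ℕ∞) F U' := by
    refine contDiffOn_pi.2 fun i => ?_
    rcases i with i | i
    · exact contDiffOn_pi.1 hfΦ i
    · refine (contDiffOn_pi.1 hgΦ i).sub (ContDiffOn.div_const ?_ _)
      have h1 : ContDiffOn ℝ (⊤ : ℕ∞) (fderiv ℝ h) V :=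
        hh.fderiv_of_isOpen hV (by simp)
      have h2 := (h1.comp hπ.contDiffOn (fun z (hz : z ∈ U') => hz.1)).clm_apply
        ((contDiffOn_const (c := (1 : ℝ))).prodMk hfΦ)
      exact contDiffOn_pi.1 h2 i
  have hl0 : ∀ i, (lam i : ℝ) ≠ 0 := fun i => Nat.cast_ne_zero.2 (hlam i)
  set lam' : ι ⊕ κ → ℕ := Sum.elim (fun _ => 0) lam with hlam'
  set y : ℝ → ι ⊕ κ → ℝ := fun t => Sum.elim (p t) fun i => q t i - h (t, p t) i / lam i with hy
  have hpV : ∀ t ∈ Ico 0 T, (t, p t) ∈ V := fun t ht => hUV _ (hmem t ht)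
  have hΦy : ∀ t, Φ (t, y t) = (t, p t, q t) := fun t => by simp [hΦ, hy]
  have hc1 : ContinuousOn (fun t => h (t, p t)) (Ico 0 T) :=
    hh.continuousOn.comp (continuousOn_id.prodMk hpc) hpV
  have hVT : (T, pT) ∈ V := hUV _ hmemT
  have hyc : ContinuousOn y (Ico 0 T) := by
    refine continuousOn_pi.2 fun i => ?_
    rcases i with i | i
    · exact (continuous_apply i).comp_continuousOn hpc
    · exact ((continuous_apply i).comp_continuousOn hqc).sub
        (((continuous_apply i).comp_continuousOn hc1).div_const _)
  have hyT : Tendsto y (𝓝[<] T) (𝓝 (Sum.elim pT fun i => qT i - h (T, pT) i / lam i)) := by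
    rw [tendsto_pi_nhds] at hpT hqT ⊢
    have h1 : Tendsto (fun t => h (t, p t)) (𝓝[<] T) (𝓝 (h (T, pT))) := by
      refine ((hh.continuousOn.continuousAt (hV.mem_nhds hVT)).tendsto).comp ?_
      exact (tendsto_id.mono_left nhdsWithin_le_nhds).prodMk_nhds (tendsto_pi_nhds.2 hpT)
    rw [tendsto_pi_nhds] at h1
    rintro (i | i)
    · exact hpT i
    · exact (hqT i).sub ((h1 i).div_const _)
  have key : ∀ {P : ℝ → ι → ℝ} {t : ℝ}, (t, P t) ∈ V → ∀ {P' : ι → ℝ},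
      (∀ i, HasDerivAt (fun s => P s i) (P' i) t) → ∀ i,
      HasDerivAt (fun s => h (s, P s) i) ((fderiv ℝ h (t, P t) (1, P')) i) t := by
    intro P t ht P' hP i
    have h1 : HasFDerivAt h (fderiv ℝ h (t, P t)) (t, P t) :=
      ((hh.contDiffAt (hV.mem_nhds ht)).differentiableAt (by simp)).hasFDerivAt
    have h2 : HasDerivAt (fun s => (s, P s)) (1, P') t :=
      (hasDerivAt_id t).prodMk (hasDerivAt_pi.2 hP)
    exact hasDerivAt_pi.1 (h1.comp_hasDerivAt t h2) i
  have hmem' : ∀ t ∈ Ico 0 T, (t, y t) ∈ U' := by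
    intro t ht
    refine ⟨hpV t ht, ?_⟩
    rw [mem_preimage, hΦy]
    refine ⟨hmem t ht, ?_⟩
    simp [hA, hPeq ht, hQeq ht, hε]
  have hmemT' : (T, (Sum.elim pT fun i => qT i - h (T, pT) i / lam i)) ∈ U' := by
    refine ⟨hVT, ?_⟩
    have : Φ (T, (Sum.elim pT fun i => qT i - h (T, pT) i / lam i)) = (T, pT, qT) := by
      simp [hΦ]
    rw [mem_preimage, this]
    refine ⟨hmemT, ?_⟩
    simp [hA, hPeT, hQeT, hε]
  obtain ⟨δ, hδ, hsol⟩ := exists_singular_solution_near hT lam' hU'o hFs hyc hyT hmem' hmemT'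
    (fun t ht i => by
      rcases i with i | i
      · refine (hp t ht i).congr_deriv ?_
        simp [hF, hlam', hΦy]
      · refine ((hq t ht i).sub ((key (hpV t ⟨ht.1.le, ht.2⟩) (hp t ht) i).div_const
          (lam i : ℝ))).congr_deriv ?_
        simp only [hF, hlam', Sum.elim_inr]
        rw [hΦy]
        simp only [hy, Sum.elim_inr, Sum.elim_inl]
        have := ht.1.ne'
        have := hl0 i
        field_simp
        ring) hε
  refine ⟨δ, hδ, fun c hc => ?_⟩
  -- The closeness of the new variables is not needed: membership in `U'`, hence in `A` after `Φ`,
  -- already bounds `p` and `q`.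
  obtain ⟨z, hz, hz0, hzU, hzd, -⟩ := hsol (Sum.elim c fun _ => 0)
    (by rintro (i | i) hi <;> simp_all) (by
      rintro (i | i) hi
      · simpa [hy] using hc i
      · exact absurd hi (hlam i))
  have hzp : ∀ t ∈ Ioo 0 T, ∀ i, HasDerivAt (fun s => z s (Sum.inl i)) (f (Φ (t, z t)) i) t := by
    intro t ht i
    refine (hzd t ht (Sum.inl i)).congr_deriv ?_
    simp [hF, hlam']
  have hzΦ : ContDiffOn ℝ (⊤ : ℕ∞) (fun t => Φ (t, z t)) (Icc 0 T) :=
    (hΦs.mono inter_subset_left).comp (contDiffOn_id.prodMk hz) hzU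
  refine ⟨fun t => (Φ (t, z t)).2.1, fun t => (Φ (t, z t)).2.2, hzΦ.snd.fst, hzΦ.snd.snd, ?_, ?_,
    hzp, fun t ht i => ?_, fun t ht => ?_⟩
  · simp [hΦ, hz0]
  · exact fun t ht => (hzU t ht).2.1
  · have htI : t ∈ Icc 0 T := ⟨ht.1.le, ht.2.le⟩
    refine ((hzd t ht (Sum.inr i)).add ((key (P := fun s i => z s (Sum.inl i)) (hzU t htI).1
      (hzp t ht) i).div_const (lam i : ℝ))).congr_deriv ?_
    have := ht.1.ne'
    have := hl0 i
    simp only [hF, hlam', Sum.elim_inr, hΦ]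
    field_simp
    ring
  · have := (hzU t ⟨ht.1, ht.2.le⟩).2.2
    simp only [hA, mem_ofPred_eq, hΦ] at this
    rw [hPeq ht, hQeq ht] at this
    exact this

/-! ### Division by powers of the variable, and uniqueness at a singular point. -/

theorem contDiffOn_avgPow_Ico {T : ℝ} {n : ℕ} {φ : ℝ → ℝ}
    (h : ContDiffOn ℝ (⊤ : ℕ∞) φ (Ico 0 T)) : ContDiffOn ℝ (⊤ : ℕ∞) (avgPow n φ) (Ico 0 T) := by
  intro x hx
  have hx' : x < (x + T) / 2 := by linarith [hx.2]
  have hT' : (x + T) / 2 < T := by linarith [hx.2]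
  have h1 := contDiffOn_avgPow (n := n) (hx.1.trans_lt hx')
    (h.mono (Icc_subset_Ico_right hT')) x ⟨hx.1, hx'.le⟩
  refine h1.mono_of_mem_nhdsWithin ?_
  exact mem_nhdsWithin.2 ⟨Iio ((x + T) / 2), isOpen_Iio, hx', fun s hs => ⟨hs.2.1, hs.1.le⟩⟩

/-- The quotient is the average `∫₀¹ φ'(s x) ds`, which is smooth up to `0`. -/
theorem exists_eq_mul_of_apply_zero {T : ℝ} {φ : ℝ → ℝ} (hφ : ContDiffOn ℝ (⊤ : ℕ∞) φ (Ico 0 T))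
    (h0 : φ 0 = 0) :
    ∃ ψ : ℝ → ℝ, ContDiffOn ℝ (⊤ : ℕ∞) ψ (Ico 0 T) ∧ ∀ x ∈ Ico 0 T, φ x = x * ψ x := by
  have hud : UniqueDiffOn ℝ (Ico 0 T) := uniqueDiffOn_Ico 0 T
  have h1 : ContDiffOn ℝ (⊤ : ℕ∞) (derivWithin φ (Ico 0 T)) (Ico 0 T) :=
    ((contDiffOn_infty_iff_derivWithin hud).1 hφ).2
  refine ⟨_, contDiffOn_avgPow_Ico (n := 0) h1, fun x hx => ?_⟩
  have := pow_succ_mul_avgPow 0 (derivWithin φ (Ico 0 T)) x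
  have hsub : Icc 0 x ⊆ Ico 0 T := Icc_subset_Ico_right hx.2
  rw [zero_add, pow_one] at this
  rw [this]
  simp only [pow_zero, one_mul]
  rw [intervalIntegral.integral_eq_sub_of_hasDerivAt_of_le hx.1 (hφ.continuousOn.mono hsub)
    (fun s hs => ((hφ.differentiableOn (by simp) s
      ⟨hs.1.le, hs.2.trans hx.2⟩).hasDerivWithinAt).hasDerivAt
        (Ico_mem_nhds hs.1 (hs.2.trans hx.2))), h0, sub_zero]
  refine ContinuousOn.intervalIntegrable ?_
  rw [uIcc_of_le hx.1]
  exact h1.continuousOn.mono hsub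

/-- Hadamard's lemma at an endpoint. -/
theorem exists_eq_pow_mul_of_isBigO {T : ℝ} (hT : 0 < T) (m : ℕ) : ∀ {φ : ℝ → ℝ},
    ContDiffOn ℝ (⊤ : ℕ∞) φ (Ico 0 T) → φ =O[𝓝[>] 0] (fun x => x ^ m) →
    ∃ ψ : ℝ → ℝ, ContDiffOn ℝ (⊤ : ℕ∞) ψ (Ico 0 T) ∧ ∀ x ∈ Ico 0 T, φ x = x ^ m * ψ x := by
  induction m with
  | zero => exact fun {φ} h _ => ⟨φ, h, by simp⟩
  | succ m ih =>
    intro φ h hO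
    have h0 : φ 0 = 0 := by
      have t1 : Tendsto φ (𝓝[>] 0) (𝓝 (φ 0)) := by
        have := h.continuousOn 0 ⟨le_rfl, hT⟩
        rw [← nhdsWithin_Ioo_eq_nhdsGT hT]
        exact this.mono Ioo_subset_Ico_self
      have t2 : Tendsto (fun x : ℝ => x ^ (m + 1)) (𝓝[>] 0) (𝓝 0) := by
        have : Tendsto (fun x : ℝ => x ^ (m + 1)) (𝓝 0) (𝓝 (0 ^ (m + 1))) :=
          (continuous_pow (m + 1)).tendsto 0
        rw [zero_pow (Nat.succ_ne_zero m)] at this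
        exact this.mono_left nhdsWithin_le_nhds
      exact tendsto_nhds_unique t1 (hO.trans_tendsto t2)
    obtain ⟨χ, hχ, hφ⟩ := exists_eq_mul_of_apply_zero h h0
    obtain ⟨ψ, hψ, hψ'⟩ := ih hχ (by
      obtain ⟨C, hC⟩ := hO.bound
      refine IsBigO.of_bound C ?_
      filter_upwards [hC, Ioo_mem_nhdsGT hT] with x hx hxT
      rw [hφ x ⟨hxT.1.le, hxT.2⟩, pow_succ', norm_mul, norm_mul] at hx
      have hpos : 0 < ‖x‖ := norm_pos_iff.2 hxT.1.ne'
      rw [← mul_le_mul_iff_right₀ hpos]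
      linarith)
    refine ⟨ψ, hψ, fun x hx => ?_⟩
    rw [hφ x hx, hψ' x hx, pow_succ']
    ring

/-- A linear homogeneous system in first-order form, with a regular singular point at the initial
radius, has only the trivial solution with trivial initial data. -/
theorem eq_zero_of_singular_linear {a b C : ℝ} {φ ψ φ' ψ' : ℝ → ℝ}
    (hφc : ContinuousOn φ (Icc a b)) (hψc : ContinuousOn ψ (Icc a b))
    (hφ : ∀ t ∈ Ioo a b, HasDerivAt φ (φ' t) t) (hψ : ∀ t ∈ Ioo a b, HasDerivAt ψ (ψ' t) t)
    (h1 : ∀ t ∈ Ioo a b, |φ' t| * (t - a) ≤ C * |ψ t|) (h2 : ∀ t ∈ Ioo a b, |ψ' t| ≤ C * |φ t|)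
    (hC : 0 ≤ C) (hφa : φ a = 0) (hψa : ψ a = 0) : ∀ t ∈ Icc a b, φ t = 0 := by
  intro t ht
  -- Any `K > C²` would do: the two bounds combine to `|φ'| ≤ C² M exp(K t)`, where `M` is the
  -- maximum of `|φ| exp(-K t)`. This contradicts a positive `M`.
  set K := C ^ 2 + 1 with hK
  obtain ⟨t₁, ht₁, hmax⟩ := isCompact_Icc.exists_isMaxOn ⟨t, ht⟩
    (f := fun t => |φ t| * Real.exp (-(K * t))) (by fun_prop)
  set M := |φ t₁| * Real.exp (-(K * t₁)) with hM
  have hM0 : 0 ≤ M := by positivity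
  have hle : ∀ s ∈ Icc a b, |φ s| ≤ M * Real.exp (K * s) := by
    intro s hs
    have : |φ s| * Real.exp (-(K * s)) ≤ M := hmax hs
    rwa [Real.exp_neg, ← div_eq_mul_inv, div_le_iff₀ (Real.exp_pos _)] at this
  -- Since `ψ` vanishes at `a`, the mean value theorem gives a factor `s - a`, which cancels the
  -- singular weight in the bound for `φ'`.
  have hψle : ∀ s ∈ Ioo a b, |ψ s| ≤ (s - a) * (C * (M * Real.exp (K * s))) := by
    intro s hs
    obtain ⟨ξ, hξ, e⟩ := exists_hasDerivAt_eq_slope ψ ψ' hs.1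
      (hψc.mono (Icc_subset_Icc_right hs.2.le)) (fun x hx => hψ x ⟨hx.1, hx.2.trans hs.2⟩)
    have hsa : 0 < s - a := sub_pos.2 hs.1
    rw [hψa, sub_zero, eq_div_iff hsa.ne'] at e
    rw [← e, abs_mul, abs_of_pos hsa, mul_comm]
    refine mul_le_mul_of_nonneg_left ((h2 ξ ⟨hξ.1, hξ.2.trans hs.2⟩).trans ?_) hsa.le
    refine mul_le_mul_of_nonneg_left ((hle ξ ⟨hξ.1.le, (hξ.2.trans hs.2).le⟩).trans ?_) hC
    refine mul_le_mul_of_nonneg_left (Real.exp_le_exp.2 ?_) hM0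
    exact mul_le_mul_of_nonneg_left hξ.2.le (by positivity)
  have hzero : φ t₁ = 0 := by
    rcases ht₁.1.eq_or_lt with h | h
    · rw [← h, hφa]
    -- Cauchy's mean value theorem against `exp(K t)` compares `φ` with the weight at the maximum
    -- point directly.
    obtain ⟨ξ, hξ, e⟩ := exists_ratio_hasDerivAt_eq_ratio_slope φ φ' h
      (hφc.mono (Icc_subset_Icc_right ht₁.2)) (fun x hx => hφ x ⟨hx.1, hx.2.trans_le ht₁.2⟩)
      (fun s => Real.exp (K * s)) (fun s => K * Real.exp (K * s)) (by fun_prop) (fun x _ => by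
        refine ((hasDerivAt_id x).const_mul K).exp.congr_deriv ?_
        simp only [id]; ring)
    have hξb : ξ ∈ Ioo a b := ⟨hξ.1, hξ.2.trans_le ht₁.2⟩
    have hξa : 0 < ξ - a := sub_pos.2 hξ.1
    have h3 : |φ' ξ| ≤ C ^ 2 * (M * Real.exp (K * ξ)) := by
      rw [← mul_le_mul_iff_left₀ hξa]
      calc _ ≤ C * |ψ ξ| := h1 ξ hξb
        _ ≤ C * ((ξ - a) * (C * (M * Real.exp (K * ξ)))) :=
          mul_le_mul_of_nonneg_left (hψle ξ hξb) hC
        _ = _ := by ring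
    rw [hφa, sub_zero] at e
    have hexp : 0 ≤ Real.exp (K * t₁) - Real.exp (K * a) := by
      rw [sub_nonneg, Real.exp_le_exp]
      exact mul_le_mul_of_nonneg_left h.le (by positivity)
    have h4 : |φ t₁| * (K * Real.exp (K * ξ)) =
        (Real.exp (K * t₁) - Real.exp (K * a)) * |φ' ξ| := by
      rw [← abs_of_nonneg hexp, ← abs_mul, e, abs_mul, abs_of_nonneg (by positivity :
        0 ≤ K * Real.exp (K * ξ))]
    have h5 : |φ t₁| * K ≤ Real.exp (K * t₁) * (C ^ 2 * M) := by
      rw [← mul_le_mul_iff_left₀ (Real.exp_pos (K * ξ))]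
      calc _ = (Real.exp (K * t₁) - Real.exp (K * a)) * |φ' ξ| := by rw [← h4]; ring
        _ ≤ Real.exp (K * t₁) * (C ^ 2 * (M * Real.exp (K * ξ))) := by
          refine mul_le_mul ?_ h3 (abs_nonneg _) (Real.exp_pos _).le
          linarith [Real.exp_pos (K * a)]
        _ = _ := by ring
    have e1 : Real.exp (K * t₁) * M = |φ t₁| := by
      rw [hM, mul_comm, mul_assoc, ← Real.exp_add]; simp
    have h6 : |φ t₁| * K ≤ C ^ 2 * |φ t₁| := by rw [← e1] at h5 ⊢; linarith
    have : |φ t₁| ≤ 0 := by rw [hK] at h6; linarith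
    exact abs_nonpos_iff.1 this
  have : |φ t| ≤ M * Real.exp (K * t) := hle t ht
  rw [hM, hzero, abs_zero, zero_mul, zero_mul] at this
  exact abs_nonpos_iff.1 this

/-! ### One-sided limits and stability of simple zeros. -/

theorem exists_tendsto_of_deriv_isBigO_one {b : ℝ} {f f' : ℝ → ℝ}
    (hd : ∀ᶠ x in 𝓝[<] b, HasDerivAt f (f' x) x) (hO : f' =O[𝓝[<] b] (fun _ => (1 : ℝ))) :
    ∃ l, Tendsto f (𝓝[<] b) (𝓝 l) := by
  obtain ⟨C, hC⟩ := hO.bound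
  obtain ⟨a, ha, hsub⟩ := (mem_nhdsLT_iff_exists_Ioo_subset).1 (hd.and hC)
  have hL : LipschitzOnWith C.toNNReal f (Ioo a b) := by
    refine (convex_Ioo a b).lipschitzOnWith_of_nnnorm_hasDerivWithin_le
      (fun x hx => (hsub hx).1.hasDerivWithinAt) fun x hx => ?_
    have := (hsub hx).2
    rw [norm_one, mul_one] at this
    rw [← NNReal.coe_le_coe, coe_nnnorm]
    exact this.trans (Real.le_coe_toNNReal C)
  -- A Lipschitz extension to the whole line reduces the existence of the limit to continuity at
  -- `b`.
  obtain ⟨g, hg, hfg⟩ := hL.extend_real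
  refine ⟨g b, Tendsto.congr' ?_ (hg.continuous.continuousAt.tendsto.mono_left nhdsWithin_le_nhds)⟩
  filter_upwards [Ioo_mem_nhdsLT (mem_Iio.1 ha)] with x hx using (hfg hx).symm

/-- A slope of at least `c` over a distance `r` on either side moves the value by at least `r c`,
more than `|h z|`. This forces a sign change, and monotonicity makes the zero unique. -/
theorem existsUnique_zero_near {h h' : ℝ → ℝ} {z r c : ℝ} (hr : 0 < r) (hc : 0 < c)
    (hd : ∀ x ∈ Icc (z - r) (z + r), HasDerivAt h (h' x) x)
    (hsign : (∀ x ∈ Icc (z - r) (z + r), c ≤ h' x) ∨ ∀ x ∈ Icc (z - r) (z + r), h' x ≤ -c)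
    (hz : |h z| < r * c) : ∃! w, w ∈ Icc (z - r) (z + r) ∧ h w = 0 := by
  have main : ∀ {h h' : ℝ → ℝ}, (∀ x ∈ Icc (z - r) (z + r), HasDerivAt h (h' x) x) →
      (∀ x ∈ Icc (z - r) (z + r), c ≤ h' x) → |h z| < r * c →
      ∃! w, w ∈ Icc (z - r) (z + r) ∧ h w = 0 := by
    intro h h' hd hp hz
    have hcont : ContinuousOn h (Icc (z - r) (z + r)) :=
      fun x hx => (hd x hx).continuousAt.continuousWithinAt
    have hi : interior (Icc (z - r) (z + r)) ⊆ Icc (z - r) (z + r) := interior_subset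
    have hmv := (convex_Icc (z - r) (z + r)).mul_sub_le_image_sub_of_le_deriv hcont
      (fun x hx => (hd x (hi hx)).differentiableAt.differentiableWithinAt) (C := c)
      (fun x hx => by rw [(hd x (hi hx)).deriv]; exact hp x (hi hx))
    have hmono : StrictMonoOn h (Icc (z - r) (z + r)) := by
      refine strictMonoOn_of_deriv_pos (convex_Icc _ _) hcont fun x hx => ?_
      rw [(hd x (hi hx)).deriv]
      exact hc.trans_le (hp x (hi hx))
    have m1 : z - r ∈ Icc (z - r) (z + r) := ⟨le_rfl, by linarith⟩
    have m2 : z ∈ Icc (z - r) (z + r) := ⟨by linarith, by linarith⟩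
    have m3 : z + r ∈ Icc (z - r) (z + r) := ⟨by linarith, le_rfl⟩
    have e1 := hmv _ m1 _ m2 (by linarith)
    have e2 := hmv _ m2 _ m3 (by linarith)
    rw [abs_lt] at hz
    obtain ⟨w, hw, hw0⟩ := intermediate_value_Icc (by linarith : z - r ≤ z + r) hcont
      (show (0 : ℝ) ∈ Icc (h (z - r)) (h (z + r)) from ⟨by linarith, by linarith⟩)
    exact ⟨w, ⟨hw, hw0⟩, fun w' hw' => hmono.injOn hw'.1 hw (hw'.2.trans hw0.symm)⟩
  rcases hsign with hs | hs
  · exact main hd hs hz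
  · obtain ⟨w, hw, hu⟩ := main (h := fun x => -h x) (h' := fun x => -h' x)
      (fun x hx => (hd x hx).neg) (fun x hx => by linarith [hs x hx]) (by simpa using hz)
    exact ⟨w, ⟨hw.1, by simpa using hw.2⟩, fun w' hw' => hu w' ⟨hw'.1, by simpa using hw'.2⟩⟩

/-- The number of simple zeros is stable under `C¹`-small perturbations. -/
theorem encard_zeros_eq_of_near {a b : ℝ} (hab : a < b) {f f' : ℝ → ℝ} {l l' : ℝ}
    (hf : ContinuousOn f (Ico a b)) (hf' : ContinuousOn f' (Ico a b))
    (hl : Tendsto f (𝓝[<] b) (𝓝 l)) (hl' : Tendsto f' (𝓝[<] b) (𝓝 l')) (hl0 : l ≠ 0)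
    (ha : f a ≠ 0) (hd : ∀ x ∈ Ioo a b, HasDerivAt f (f' x) x)
    (hs : ∀ x ∈ Ioo a b, f x = 0 → f' x ≠ 0) :
    ∃ ε > 0, ∀ g g' : ℝ → ℝ, (∀ x ∈ Ioo a b, HasDerivAt g (g' x) x) →
      (∀ x ∈ Ico a b, |g x - f x| < ε) → (∀ x ∈ Ico a b, |g' x - f' x| < ε) →
      {x | x ∈ Ioo a b ∧ g x = 0}.encard = {x | x ∈ Ioo a b ∧ f x = 0}.encard := by
  obtain ⟨F, hFc, hF, hFb⟩ := exists_continuous_eqOn_Ico hab hf hl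
  obtain ⟨F', hFc', hF', -⟩ := exists_continuous_eqOn_Ico hab hf' hl'
  have hFa : F a ≠ 0 := by rw [hF ⟨le_rfl, hab⟩]; exact ha
  obtain ⟨t, ht, hmin⟩ := isCompact_Icc.exists_isMinOn (nonempty_Icc.2 hab.le)
    (f := fun x => |F x| + |F' x|) (by fun_prop)
  have hpos : 0 < |F t| + |F' t| := by
    by_contra hcon
    have h1 : F t = 0 := abs_nonpos_iff.1 (by linarith [abs_nonneg (F t), abs_nonneg (F' t)])
    have h2 : F' t = 0 := abs_nonpos_iff.1 (by linarith [abs_nonneg (F t), abs_nonneg (F' t)])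
    rcases ht.1.eq_or_lt with e | e
    · exact hFa (e ▸ h1)
    rcases ht.2.eq_or_lt with e' | e'
    · rw [e', hFb] at h1; exact hl0 h1
    · rw [hF ⟨e.le, e'⟩] at h1
      rw [hF' ⟨e.le, e'⟩] at h2
      exact hs t ⟨e, e'⟩ h1 h2
  -- One constant with two uses: `|F| ≥ c` at both ends, and `|F'| ≥ c` wherever `|F| < c`. It is
  -- positive because `F` and `F'` have no common zero on the closed interval.
  set c := min (min |F a| |l|) ((|F t| + |F' t|) / 2) with hc
  have hc0 : 0 < c := lt_min (lt_min (abs_pos.2 hFa) (abs_pos.2 hl0)) (by linarith)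
  have hcF : ∀ x ∈ Icc a b, |F x| < c → c ≤ |F' x| := by
    intro x hx h1
    have h2 : |F t| + |F' t| ≤ |F x| + |F' x| := hmin hx
    have h3 : c ≤ (|F t| + |F' t|) / 2 := min_le_right _ _
    linarith
  obtain ⟨η₁, hη₁, hu₁⟩ := Metric.uniformContinuousOn_iff.1
    (isCompact_Icc.uniformContinuousOn_of_continuous (hFc.continuousOn (s := Icc a b)))
    (c / 4) (by linarith)
  obtain ⟨η₂, hη₂, hu₂⟩ := Metric.uniformContinuousOn_iff.1
    (isCompact_Icc.uniformContinuousOn_of_continuous (hFc'.continuousOn (s := Icc a b)))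
    (c / 4) (by linarith)
  -- Within distance `r`, both `F` and `F'` vary by less than `c / 4`. A point with `|F| < c / 4` is
  -- therefore more than `r` away from either end.
  set r := min η₁ η₂ / 2 with hr
  have hr0 : 0 < r := half_pos (lt_min hη₁ hη₂)
  have hr1 : r < η₁ := by linarith [min_le_left η₁ η₂]
  have hr2 : r < η₂ := by linarith [min_le_right η₁ η₂]
  -- Bounding the derivative error by `c / 4` leaves a slope of at least `c / 2` near a zero; `r *
  -- (c / 2)` is the corresponding admissible value at the centre.
  refine ⟨min (c / 4) (r * (c / 2)), lt_min (by linarith) (by positivity), ?_⟩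
  intro g g' hg hgf hgf'
  have near : ∀ z ∈ Ioo a b, |F z| < c / 4 → ∀ h h' : ℝ → ℝ,
      (∀ x ∈ Ioo a b, HasDerivAt h (h' x) x) → (∀ x ∈ Ioo a b, |h' x - f' x| < c / 4) →
      |h z| < r * (c / 2) → ∃! w, w ∈ Icc (z - r) (z + r) ∧ (w ∈ Ioo a b ∧ h w = 0) := by
    intro z hz hFz h h' hh hh' hhz
    have hzI : z ∈ Icc a b := ⟨hz.1.le, hz.2.le⟩
    have hca : c ≤ |F a| := (min_le_left _ _).trans (min_le_left _ _)
    have hcb : c ≤ |F b| := by rw [hFb]; exact (min_le_left _ _).trans (min_le_right _ _)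
    have hza : a < z - r := by
      by_contra hcon
      have h1 := hu₁ z hzI a ⟨le_rfl, hab.le⟩ (by
        rw [Real.dist_eq, abs_lt]; constructor <;> linarith [hz.1])
      rw [Real.dist_eq, abs_sub_comm] at h1
      linarith [abs_sub_abs_le_abs_sub (F a) (F z)]
    have hzb : z + r < b := by
      by_contra hcon
      have h1 := hu₁ z hzI b ⟨hab.le, le_rfl⟩ (by
        rw [Real.dist_eq, abs_lt]; constructor <;> linarith [hz.2])
      rw [Real.dist_eq, abs_sub_comm] at h1
      linarith [abs_sub_abs_le_abs_sub (F b) (F z)]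
    have hsub : Icc (z - r) (z + r) ⊆ Ioo a b := fun x hx =>
      ⟨hza.trans_le hx.1, hx.2.trans_lt hzb⟩
    have hvar : ∀ x ∈ Icc (z - r) (z + r), |h' x - F' z| < c / 2 := by
      intro x hx
      have hx' := hsub hx
      have h1 := hu₂ x ⟨hx'.1.le, hx'.2.le⟩ z hzI (by
        rw [Real.dist_eq, abs_lt]; constructor <;> linarith [hx.1, hx.2])
      rw [Real.dist_eq, hF' ⟨hx'.1.le, hx'.2⟩] at h1
      have h2 := hh' x hx'
      have := abs_sub_le (h' x) (f' x) (F' z)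
      linarith
    have hF'z := hcF z hzI (by linarith)
    obtain ⟨w, hw, hwu⟩ := existsUnique_zero_near (h := h) (h' := h') hr0 (half_pos hc0)
      (fun x hx => hh x (hsub hx)) (by
        rcases le_abs.1 hF'z with h1 | h1
        · left; intro x hx; linarith [(abs_lt.1 (hvar x hx)).1]
        · right; intro x hx; linarith [(abs_lt.1 (hvar x hx)).2]) hhz
    exact ⟨w, ⟨hw.1, hsub hw.1, hw.2⟩, fun w' hw' => hwu w' ⟨hw'.1, hw'.2.2⟩⟩
  have hfz : ∀ z ∈ Ioo a b, f z = 0 → ∃! w, w ∈ Icc (z - r) (z + r) ∧ (w ∈ Ioo a b ∧ g w = 0) := by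
    intro z hz hz0
    refine near z hz ?_ g g' hg (fun x hx => ?_) ?_
    · rw [hF ⟨hz.1.le, hz.2⟩, hz0, abs_zero]; linarith
    · exact (hgf' x ⟨hx.1.le, hx.2⟩).trans_le (min_le_left _ _)
    · have := (hgf z ⟨hz.1.le, hz.2⟩).trans_le (min_le_right _ _)
      rwa [hz0, sub_zero] at this
  have hgz : ∀ z ∈ Ioo a b, g z = 0 → ∃! w, w ∈ Icc (z - r) (z + r) ∧ (w ∈ Ioo a b ∧ f w = 0) := by
    intro z hz hz0
    have h1 := hgf z ⟨hz.1.le, hz.2⟩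
    rw [hz0, zero_sub, abs_neg] at h1
    refine near z hz ?_ f f' hd (fun x hx => ?_) (h1.trans_le (min_le_right _ _))
    · rw [hF ⟨hz.1.le, hz.2⟩]; exact h1.trans_le (min_le_left _ _)
    · rw [sub_self, abs_zero]; linarith
  symm
  -- The statement `near` is symmetric in `f` and `g`. Zeros of `f` determine zeros of `g` within
  -- distance `r` and conversely, and uniqueness on both sides makes this a bijection.
  choose! φ hφ hφu using hfz
  have hbij : BijOn φ {x | x ∈ Ioo a b ∧ f x = 0} {x | x ∈ Ioo a b ∧ g x = 0} := by
    refine ⟨fun z hz => (hφ z hz.1 hz.2).2, fun z hz z' hz' e => ?_, fun w hw => ?_⟩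
    · have h1 := (hφ z hz.1 hz.2)
      have h2 := (hφ z' hz'.1 hz'.2)
      rw [← e] at h2
      refine (hgz _ h1.2.1 h1.2.2).unique ⟨⟨?_, ?_⟩, hz⟩ ⟨⟨?_, ?_⟩, hz'⟩
      · linarith [h1.1.2]
      · linarith [h1.1.1]
      · linarith [h2.1.2]
      · linarith [h2.1.1]
    · obtain ⟨z, hz, -⟩ := hgz w hw.1 hw.2
      refine ⟨z, hz.2, ((hφu z hz.2.1 hz.2.2) w ⟨⟨?_, ?_⟩, hw⟩).symm⟩
      · linarith [hz.1.2]
      · linarith [hz.1.1]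
  rw [← hbij.image_eq, hbij.injOn.encard_image]

/-! ### Algebraic expressions in the field variables -/

/-- `∑ v_j²`. -/
def sumSq (N : ℕ) (v : ℕ → ℝ) : ℝ := ∑ j ∈ Finset.Icc 1 (N - 1), v j ^ 2

/-- `∑ w_j² E_j²`. -/
def zetaSum (N : ℕ) (w E : ℕ → ℝ) : ℝ := ∑ j ∈ Finset.Icc 1 (N - 1), w j ^ 2 * E j ^ 2

/-- The trace-free sequence `α_1, …, α_N` with differences `α_j - α_{j+1} = E_j`. -/
noncomputable def alphaOf (N : ℕ) (E : ℕ → ℝ) (j : ℕ) : ℝ :=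
  if j ∈ Finset.Icc 1 N then
    -- The fraction `i / N` is the mean over `j` of the indicator of `j ≤ i`, so that the trace
    -- vanishes. The value zero outside `1, …, N` provides `α_0 = α_{N+1} = 0`.
    ∑ i ∈ Finset.Icc 1 (N - 1), ((if j ≤ i then 1 else 0) - (i : ℝ) / N) * E i
  else 0

/-- `∑ α_j'²` in terms of `D_j = α_j' - α_{j+1}'`. -/
noncomputable def etaSum (N : ℕ) (D : ℕ → ℝ) : ℝ := ∑ j ∈ Finset.Icc 1 N, alphaOf N D j ^ 2

/-- The magnetic pressure `P` at radius `x`. -/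
noncomputable def pressure (N : ℕ) (k x : ℝ) (w : ℕ → ℝ) : ℝ :=
  1 / (4 * x ^ 2) * ∑ j ∈ Finset.Icc 1 N,
    (w j ^ 2 - w (j - 1) ^ 2 - k * ((N : ℝ) + 1 - 2 * (j : ℝ))) ^ 2

/-- The coefficient `W_j`. -/
noncomputable def wCoef (k : ℝ) (w : ℕ → ℝ) (j : ℕ) : ℝ :=
  k - w j ^ 2 + (w (j + 1) ^ 2 + w (j - 1) ^ 2) / 2

/-- The source of the equation for `E_j`. -/
def elecForce (w E : ℕ → ℝ) (j : ℕ) : ℝ :=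
  2 * (w j ^ 2 * E j) - w (j - 1) ^ 2 * E (j - 1) - w (j + 1) ^ 2 * E (j + 1)

theorem alphaOf_sub_alphaOf_succ {N : ℕ} {E : ℕ → ℝ} {j : ℕ} (hj : j ∈ Finset.Icc 1 (N - 1)) :
    alphaOf N E j - alphaOf N E (j + 1) = E j := by
  have hj' := Finset.mem_Icc.1 hj
  have h1 : j ∈ Finset.Icc 1 N := Finset.mem_Icc.2 ⟨by omega, by omega⟩
  have h2 : j + 1 ∈ Finset.Icc 1 N := Finset.mem_Icc.2 ⟨by omega, by omega⟩
  rw [alphaOf, alphaOf, if_pos h1, if_pos h2, ← Finset.sum_sub_distrib,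
    Finset.sum_eq_single_of_mem j hj]
  · simp
    ring
  · intro i _ hij
    have : (j ≤ i) ↔ (j + 1 ≤ i) := by omega
    simp [this]

theorem sum_alphaOf {N : ℕ} (hN : 1 ≤ N) (E : ℕ → ℝ) :
    ∑ j ∈ Finset.Icc 1 N, alphaOf N E j = 0 := by
  have hN0 : (N : ℝ) ≠ 0 := by positivity
  rw [Finset.sum_congr rfl (fun j hj => by rw [alphaOf, if_pos hj]), Finset.sum_comm]
  refine Finset.sum_eq_zero fun i hi => ?_
  have hi' := Finset.mem_Icc.1 hi
  rw [← Finset.sum_mul, Finset.sum_sub_distrib, Finset.sum_const, ← Finset.sum_filter]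
  have : (Finset.Icc 1 N).filter (fun j => j ≤ i) = Finset.Icc 1 i := by
    ext j; simp only [Finset.mem_filter, Finset.mem_Icc]; omega
  rw [this]
  simp
  left
  field_simp
  ring

/-- Two sequences with the same consecutive differences differ by a constant, which the vanishing
traces force to be zero. -/
theorem alphaOf_sub {N : ℕ} (hN : 1 ≤ N) {a : ℕ → ℝ} (ha : ∑ j ∈ Finset.Icc 1 N, a j = 0)
    {j : ℕ} (hj : j ∈ Finset.Icc 1 N) : alphaOf N (fun i => a i - a (i + 1)) j = a j := by
  set b := alphaOf N (fun i => a i - a (i + 1)) with hb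
  have hstep : ∀ i ∈ Finset.Icc 1 (N - 1), b (i + 1) - a (i + 1) = b i - a i := by
    intro i hi
    have : b i - b (i + 1) = a i - a (i + 1) :=
      alphaOf_sub_alphaOf_succ (E := fun i => a i - a (i + 1)) hi
    linarith
  have hconst : ∀ n : ℕ, n + 1 ≤ N → b (n + 1) - a (n + 1) = b 1 - a 1 := by
    intro n
    induction n with
    | zero => intro _; rfl
    | succ n ih =>
      intro hn
      rw [hstep (n + 1) (Finset.mem_Icc.2 ⟨by omega, by omega⟩), ih (by omega)]
  have hc : ∀ i ∈ Finset.Icc 1 N, b i - a i = b 1 - a 1 := by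
    intro i hi
    have hi' := Finset.mem_Icc.1 hi
    have := hconst (i - 1) (by omega)
    rwa [Nat.sub_add_cancel hi'.1] at this
  have hsum : ∑ i ∈ Finset.Icc 1 N, (b i - a i) = 0 := by
    rw [Finset.sum_sub_distrib, ha, hb, sum_alphaOf hN, sub_zero]
  rw [Finset.sum_congr rfl hc, Finset.sum_const, Nat.card_Icc, Nat.add_sub_cancel,
    nsmul_eq_mul] at hsum
  have h0 : b 1 - a 1 = 0 := by
    rcases mul_eq_zero.1 hsum with h | h
    · exact absurd h (Nat.cast_ne_zero.2 (by omega))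
    · exact h
  have := hc j hj
  linarith

theorem alphaOf_congr {N : ℕ} {E E' : ℕ → ℝ} (h : ∀ i ∈ Finset.Icc 1 (N - 1), E i = E' i) (j : ℕ) :
    alphaOf N E j = alphaOf N E' j := by
  rw [alphaOf, alphaOf, Finset.sum_congr rfl fun i hi => by rw [h i hi]]

theorem alphaOf_add_mul (N : ℕ) (a b : ℝ) (E E' : ℕ → ℝ) (j : ℕ) :
    alphaOf N (fun i => a * E i + b * E' i) j = a * alphaOf N E j + b * alphaOf N E' j := by
  by_cases hj : j ∈ Finset.Icc 1 N
  · rw [alphaOf, alphaOf, alphaOf, if_pos hj, if_pos hj, if_pos hj, Finset.mul_sum, Finset.mul_sum,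
      ← Finset.sum_add_distrib]
    exact Finset.sum_congr rfl fun i _ => by ring
  · simp [alphaOf, hj]

theorem alphaOf_mul (N : ℕ) (a : ℝ) (E : ℕ → ℝ) (j : ℕ) :
    alphaOf N (fun i => a * E i) j = a * alphaOf N E j := by
  simpa using alphaOf_add_mul N a 0 E E j

theorem hasDerivAt_alphaOf {N : ℕ} {E : ℕ → ℝ → ℝ} {E' : ℕ → ℝ} {x : ℝ}
    (h : ∀ i ∈ Finset.Icc 1 (N - 1), HasDerivAt (E i) (E' i) x) (j : ℕ) :
    HasDerivAt (fun y => alphaOf N (fun i => E i y) j) (alphaOf N E' j) x := by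
  by_cases hj : j ∈ Finset.Icc 1 N
  · simp only [alphaOf, if_pos hj]
    exact HasDerivAt.fun_sum fun i hi => (h i hi).const_mul _
  · simp only [alphaOf, if_neg hj]
    exact hasDerivAt_const _ _

theorem contDiffOn_alphaOf {N : ℕ} {E : ℕ → ℝ → ℝ} {s : Set ℝ}
    (h : ∀ i ∈ Finset.Icc 1 (N - 1), ContDiffOn ℝ (⊤ : ℕ∞) (E i) s) (j : ℕ) :
    ContDiffOn ℝ (⊤ : ℕ∞) (fun y => alphaOf N (fun i => E i y) j) s := by
  by_cases hj : j ∈ Finset.Icc 1 N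
  · simp only [alphaOf, if_pos hj]
    exact ContDiffOn.sum fun i hi => contDiffOn_const.mul (h i hi)
  · simp only [alphaOf, if_neg hj]
    exact contDiffOn_const

theorem etaSum_congr {N : ℕ} {E E' : ℕ → ℝ} (h : ∀ i ∈ Finset.Icc 1 (N - 1), E i = E' i) :
    etaSum N E = etaSum N E' :=
  Finset.sum_congr rfl fun j _ => by rw [alphaOf_congr h]

theorem etaSum_mul (N : ℕ) (a : ℝ) (E : ℕ → ℝ) :
    etaSum N (fun i => a * E i) = a ^ 2 * etaSum N E := by
  simp only [etaSum, alphaOf_mul, Finset.mul_sum, mul_pow]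

theorem sumSq_congr {N : ℕ} {v v' : ℕ → ℝ} (h : ∀ i ∈ Finset.Icc 1 (N - 1), v i = v' i) :
    sumSq N v = sumSq N v' :=
  Finset.sum_congr rfl fun j hj => by rw [h j hj]

theorem sumSq_mul (N : ℕ) (a : ℝ) (v : ℕ → ℝ) :
    sumSq N (fun i => a * v i) = a ^ 2 * sumSq N v := by
  simp only [sumSq, Finset.mul_sum, mul_pow]

theorem zetaSum_mul (N : ℕ) (a : ℝ) (w E : ℕ → ℝ) :
    zetaSum N w (fun i => a * E i) = a ^ 2 * zetaSum N w E := by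
  simp only [zetaSum, Finset.mul_sum]
  exact Finset.sum_congr rfl fun _ _ => by ring

theorem sum_Icc_sub_pred (N : ℕ) (g : ℕ → ℝ) :
    ∑ j ∈ Finset.Icc 1 N, (g j - g (j - 1)) = g N - g 0 := by
  induction N with
  | zero => simp
  | succ n ih => rw [Finset.sum_Icc_succ_top (by omega), ih, Nat.add_sub_cancel]; ring

/-- The source is the consecutive difference of the currents `w_j² E_j - w_{j-1}² E_{j-1}`. These
are trace-free by telescoping, as `w_0 = w_N = 0`, so inverting the difference operator recovers
them. -/
theorem alphaOf_elecForce {N : ℕ} (hN : 1 ≤ N) {w E : ℕ → ℝ} (h0 : w 0 = 0) (hNw : w N = 0) {j : ℕ}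
    (hj : j ∈ Finset.Icc 1 N) :
    alphaOf N (elecForce w E) j = w j ^ 2 * E j - w (j - 1) ^ 2 * E (j - 1) := by
  rw [← alphaOf_sub (a := fun j => w j ^ 2 * E j - w (j - 1) ^ 2 * E (j - 1)) hN ?_ hj]
  · refine alphaOf_congr (fun i hi => ?_) j
    simp only [elecForce, Nat.add_sub_cancel]
    ring
  · rw [sum_Icc_sub_pred N (fun j => w j ^ 2 * E j), h0, hNw]; ring

/-! ### The equations in the compactified radial variable `x = r / (1 + r)` -/

/-- Field variables, and their first derivatives, as functions of `x = r / (1 + r)`. -/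
structure CompactFields where
  m : ℝ → ℝ
  S : ℝ → ℝ
  w : ℕ → ℝ → ℝ
  dw : ℕ → ℝ → ℝ
  E : ℕ → ℝ → ℝ
  dE : ℕ → ℝ → ℝ

/-- `ν = (1 - x)² μ`. -/
noncomputable def nuOf (k ℓ m x : ℝ) : ℝ :=
  k * (1 - x) ^ 2 - 2 * m * (1 - x) ^ 3 / x + x ^ 2 / ℓ ^ 2

/-- The logarithmic derivative of `S` with respect to `x`. -/
noncomputable def sigmaOf (N : ℕ) (x ν S : ℝ) (w dw E : ℕ → ℝ) : ℝ :=
  (1 - x) ^ 3 * (zetaSum N w E / (2 * ν ^ 2 * S ^ 2 * x) + 2 * sumSq N dw / x)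

/-- The derivative of `m` with respect to `x`. -/
noncomputable def massOf (N : ℕ) (k x ν S : ℝ) (w dw E dE : ℕ → ℝ) : ℝ :=
  x ^ 2 * etaSum N dE / (4 * S ^ 2) + zetaSum N w E / (4 * ν * S ^ 2) + ν * sumSq N dw
    + pressure N k x w

namespace CompactFields

variable (N : ℕ) (k ℓ : ℝ) (X : CompactFields) (x : ℝ)

noncomputable def nu : ℝ := nuOf k ℓ (X.m x) x

noncomputable def sigma : ℝ :=
  sigmaOf N x (X.nu k ℓ x) (X.S x) (X.w · x) (X.dw · x) (X.E · x)

end CompactFields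

/-- The static field equations in the compactified variable. -/
structure CompactEquationsAt (N : ℕ) (k ℓ : ℝ) (X : CompactFields) (x : ℝ) : Prop where
  w : ∀ j ∈ Finset.Icc 1 (N - 1), HasDerivAt (X.w j) (X.dw j x) x
  E : ∀ j ∈ Finset.Icc 1 (N - 1), HasDerivAt (X.E j) (X.dE j x) x
  m : HasDerivAt X.m
    (massOf N k x (X.nu k ℓ x) (X.S x) (X.w · x) (X.dw · x) (X.E · x) (X.dE · x)) x
  S : HasDerivAt X.S (X.S x * X.sigma N k ℓ x) x
  dE : ∀ j ∈ Finset.Icc 1 (N - 1), HasDerivAt (X.dE j)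
    ((X.sigma N k ℓ x - 2 / x) * X.dE j x
      + elecForce (X.w · x) (X.E · x) j / (X.nu k ℓ x * x ^ 2)) x
  -- Stated for `ν ω_j'` rather than `ω_j'`: no derivative of `ν` occurs, and the product vanishes
  -- at a horizon.
  flux : ∀ j ∈ Finset.Icc 1 (N - 1), HasDerivAt (fun y => X.nu k ℓ y * X.dw j y)
    (-X.sigma N k ℓ x * (X.nu k ℓ x * X.dw j x)
      - X.w j x * X.E j x ^ 2 / (4 * X.nu k ℓ x * X.S x ^ 2)
      - wCoef k (X.w · x) j * X.w j x / x ^ 2) x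

/-- Solutions of the compactified equations on `[x₀, 1)`, smooth up to `x₀`. -/
structure IsCompactSolution (N : ℕ) (k ℓ x₀ : ℝ) (X : CompactFields) : Prop where
  smooth_m : ContDiffOn ℝ (⊤ : ℕ∞) X.m (Ico x₀ 1)
  smooth_S : ContDiffOn ℝ (⊤ : ℕ∞) X.S (Ico x₀ 1)
  smooth_w : ∀ j ∈ Finset.Icc 1 (N - 1), ContDiffOn ℝ (⊤ : ℕ∞) (X.w j) (Ico x₀ 1)
  smooth_dw : ∀ j ∈ Finset.Icc 1 (N - 1), ContDiffOn ℝ (⊤ : ℕ∞) (X.dw j) (Ico x₀ 1)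
  smooth_E : ∀ j ∈ Finset.Icc 1 (N - 1), ContDiffOn ℝ (⊤ : ℕ∞) (X.E j) (Ico x₀ 1)
  smooth_dE : ∀ j ∈ Finset.Icc 1 (N - 1), ContDiffOn ℝ (⊤ : ℕ∞) (X.dE j) (Ico x₀ 1)
  w_zero : ∀ x, X.w 0 x = 0
  w_last : ∀ x, X.w N x = 0
  S_pos : ∀ x ∈ Ico x₀ 1, 0 < X.S x
  nu_pos : ∀ x ∈ Ioo x₀ 1, 0 < X.nu k ℓ x
  equations : ∀ x ∈ Ioo x₀ 1, CompactEquationsAt N k ℓ X x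

/-- The compactified variables of a solution on `[r₀, ∞)`, where `x₀ = r₀ / (1 + r₀)`. -/
noncomputable def Fields.toCompact (x₀ : ℝ) (F : Fields) : CompactFields where
  m x := F.m (x / (1 - x))
  S x := F.S (x / (1 - x))
  w j x := F.ω j (x / (1 - x))
  dw j := derivWithin (fun x => F.ω j (x / (1 - x))) (Ico x₀ 1)
  E j x := F.elec j (x / (1 - x))
  dE j := derivWithin (fun x => F.elec j (x / (1 - x))) (Ico x₀ 1)

theorem hasDerivAt_div_one_sub {x : ℝ} (hx : x < 1) :
    HasDerivAt (fun x : ℝ => x / (1 - x)) (1 / (1 - x) ^ 2) x := by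
  have h : 1 - x ≠ 0 := (sub_pos.2 hx).ne'
  refine ((hasDerivAt_id x).div ((hasDerivAt_id x).const_sub 1) h).congr_deriv ?_
  simp only [id]; field_simp; ring

theorem hasDerivAt_inv_sq_one_sub {x : ℝ} (hx : x < 1) :
    HasDerivAt (fun x : ℝ => 1 / (1 - x) ^ 2) (2 / (1 - x) ^ 3) x := by
  have h : 1 - x ≠ 0 := (sub_pos.2 hx).ne'
  refine ((hasDerivAt_const x (1 : ℝ)).div (((hasDerivAt_id x).const_sub 1).pow 2)
    (pow_ne_zero 2 h)).congr_deriv ?_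
  simp only [id]; field_simp; simp; ring

theorem hasDerivAt_div_one_add {r : ℝ} (hr : 0 ≤ r) :
    HasDerivAt (fun r : ℝ => r / (1 + r)) (1 / (1 + r) ^ 2) r := by
  have h : 1 + r ≠ 0 := by positivity
  refine ((hasDerivAt_id r).div ((hasDerivAt_id r).const_add 1) h).congr_deriv ?_
  simp only [id]; field_simp; ring

theorem mu_eq_nuOf (k ℓ : ℝ) (F : Fields) {x : ℝ} (hx : x < 1) :
    F.mu k ℓ (x / (1 - x)) = nuOf k ℓ (F.m (x / (1 - x))) x / (1 - x) ^ 2 := by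
  have h : 1 - x ≠ 0 := (sub_pos.2 hx).ne'
  rw [Fields.mu, nuOf]
  rcases eq_or_ne x 0 with h0 | h0
  · simp [h0]
  · generalize F.m (x / (1 - x)) = m
    have hl : x ^ 2 / (1 - x) ^ 2 = (x / (1 - x)) ^ 2 := by rw [div_pow]
    field_simp

theorem div_one_sub_mem_Ici {r₀ x : ℝ} (hr₀ : 0 ≤ r₀) (hx : x ∈ Ico (r₀ / (1 + r₀)) 1) :
    x / (1 - x) ∈ Ici r₀ := by
  have h : 0 < 1 - x := sub_pos.2 hx.2
  have h1 := hx.1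
  rw [div_le_iff₀ (by positivity)] at h1
  rw [mem_Ici, le_div_iff₀ h]
  linarith

theorem div_one_sub_mem_Ioi {r₀ x : ℝ} (hr₀ : 0 ≤ r₀) (hx : x ∈ Ioo (r₀ / (1 + r₀)) 1) :
    x / (1 - x) ∈ Ioi r₀ := by
  have h : 0 < 1 - x := sub_pos.2 hx.2
  have h1 := hx.1
  rw [div_lt_iff₀ (by positivity)] at h1
  rw [mem_Ioi, lt_div_iff₀ h]
  linarith

theorem contDiffOn_comp_div_one_sub {r₀ : ℝ} (hr₀ : 0 ≤ r₀) {φ : ℝ → ℝ}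
    (h : ContDiffOn ℝ (⊤ : ℕ∞) φ (Ici r₀)) :
    ContDiffOn ℝ (⊤ : ℕ∞) (fun x => φ (x / (1 - x))) (Ico (r₀ / (1 + r₀)) 1) := by
  refine h.comp ?_ fun x hx => div_one_sub_mem_Ici hr₀ hx
  exact contDiffOn_id.div (contDiffOn_const.sub contDiffOn_id) fun x hx => (sub_pos.2 hx.2).ne'

theorem hasDerivAt_deriv_of_contDiffOn_Ici {r₀ : ℝ} {φ : ℝ → ℝ}
    (h : ContDiffOn ℝ (⊤ : ℕ∞) φ (Ici r₀)) {r : ℝ} (hr : r₀ < r) :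
    HasDerivAt φ (deriv φ r) r ∧ HasDerivAt (deriv φ) (deriv (deriv φ) r) r := by
  have h1 : ContDiffOn ℝ (⊤ : ℕ∞) φ (Ioi r₀) := h.mono Ioi_subset_Ici_self
  have h2 := ((contDiffOn_infty_iff_deriv_of_isOpen isOpen_Ioi).1 h1)
  exact ⟨((h1.differentiableOn (by simp)).differentiableAt (Ioi_mem_nhds hr)).hasDerivAt,
    ((h2.2.differentiableOn (by simp)).differentiableAt (Ioi_mem_nhds hr)).hasDerivAt⟩

/-- A global solution solves the compactified equations. -/
theorem IsGlobalSolution.toCompact {N : ℕ} (hN : 1 ≤ N) {k ℓ r₀ Sinf : ℝ} (hr₀ : 0 ≤ r₀)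
    {F : Fields} (hF : IsGlobalSolution N k ℓ r₀ Sinf F) :
    IsCompactSolution N k ℓ (r₀ / (1 + r₀)) (F.toCompact (r₀ / (1 + r₀))) := by
  set x₀ := r₀ / (1 + r₀) with hx₀
  have hx₀0 : 0 ≤ x₀ := by positivity
  have hud : UniqueDiffOn ℝ (Ico x₀ 1) := uniqueDiffOn_Ico _ _
  have hmemα : ∀ j ∈ Finset.Icc 1 (N - 1), j ∈ Finset.Icc 1 N ∧ j + 1 ∈ Finset.Icc 1 N := by
    intro j hj
    simp only [Finset.mem_Icc] at hj ⊢
    omega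
  have hE : ∀ j ∈ Finset.Icc 1 (N - 1), ContDiffOn ℝ (⊤ : ℕ∞) (F.elec j) (Ici r₀) := fun j hj =>
    (hF.smooth_α j (hmemα j hj).1).sub (hF.smooth_α (j + 1) (hmemα j hj).2)
  have hder : ∀ φ : ℝ → ℝ, ContDiffOn ℝ (⊤ : ℕ∞) φ (Ici r₀) → ∀ x ∈ Ioo x₀ 1,
      derivWithin (fun x => φ (x / (1 - x))) (Ico x₀ 1) x =
        deriv φ (x / (1 - x)) * (1 / (1 - x) ^ 2) ∧
      HasDerivAt (fun x => φ (x / (1 - x))) (deriv φ (x / (1 - x)) * (1 / (1 - x) ^ 2)) x := by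
    intro φ hφ x hx
    have h1 := (hasDerivAt_deriv_of_contDiffOn_Ici hφ (div_one_sub_mem_Ioi hr₀ hx)).1.comp x
      (hasDerivAt_div_one_sub hx.2)
    exact ⟨(h1.hasDerivWithinAt).derivWithin (hud x ⟨hx.1.le, hx.2⟩), h1⟩
  have hnu : ∀ x ∈ Ico x₀ 1, (F.toCompact x₀).nu k ℓ x = (1 - x) ^ 2 * F.mu k ℓ (x / (1 - x)) := by
    intro x hx
    have h : 1 - x ≠ 0 := (sub_pos.2 hx.2).ne'
    rw [mu_eq_nuOf k ℓ F hx.2, mul_div_cancel₀ _ (pow_ne_zero 2 h)]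
    rfl
  refine ⟨contDiffOn_comp_div_one_sub hr₀ hF.smooth_m, contDiffOn_comp_div_one_sub hr₀ hF.smooth_S,
    fun j hj => contDiffOn_comp_div_one_sub hr₀ (hF.smooth_ω j hj),
    fun j hj => ((contDiffOn_infty_iff_derivWithin hud).1
      (contDiffOn_comp_div_one_sub hr₀ (hF.smooth_ω j hj))).2,
    fun j hj => contDiffOn_comp_div_one_sub hr₀ (hE j hj),
    fun j hj => ((contDiffOn_infty_iff_derivWithin hud).1
      (contDiffOn_comp_div_one_sub hr₀ (hE j hj))).2, fun x => hF.ω_zero _, fun x => hF.ω_last _,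
    fun x hx => hF.S_pos _ (div_one_sub_mem_Ici hr₀ hx), fun x hx => ?_, fun x hx => ?_⟩
  · rw [hnu x ⟨hx.1.le, hx.2⟩]
    exact mul_pos (pow_pos (sub_pos.2 hx.2) 2) (hF.mu_pos _ (div_one_sub_mem_Ioi hr₀ hx))
  have hs : 1 - x ≠ 0 := (sub_pos.2 hx.2).ne'
  have hx0 : x ≠ 0 := (hx₀0.trans_lt hx.1).ne'
  have hxI : x ∈ Ico x₀ 1 := ⟨hx.1.le, hx.2⟩
  have hr : x / (1 - x) ∈ Ioi r₀ := div_one_sub_mem_Ioi hr₀ hx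
  have hμ := hF.mu_pos _ hr
  have hSp := hF.S_pos _ (mem_Ici_of_Ioi hr)
  have heq := hF.equations _ hr
  have hnux := hnu x hxI
  set r := x / (1 - x) with hrdef
  set X := F.toCompact x₀ with hX
  set μ := F.mu k ℓ r with hμdef
  have hXS : X.S x = F.S r := rfl
  have hXw : (fun j => X.w j x) = fun j => F.ω j r := rfl
  have hXE : (fun j => X.E j x) = fun j => F.elec j r := rfl
  have hdw : ∀ j ∈ Finset.Icc 1 (N - 1), deriv (F.ω j) r = (1 - x) ^ 2 * X.dw j x := by
    intro j hj
    rw [show X.dw j x = _ from (hder _ (hF.smooth_ω j hj) x hx).1, ← hrdef]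
    field_simp
  have hdE : ∀ j ∈ Finset.Icc 1 (N - 1), deriv (F.elec j) r = (1 - x) ^ 2 * X.dE j x := by
    intro j hj
    rw [show X.dE j x = _ from (hder _ (hE j hj) x hx).1, ← hrdef]
    field_simp
  have hG : F.G N r = ((1 - x) ^ 2) ^ 2 * sumSq N (X.dw · x) := by
    rw [← sumSq_mul]
    exact sumSq_congr hdw
  have hζ : F.zeta N r = zetaSum N (X.w · x) (X.E · x) := rfl
  have hαd : ∀ j ∈ Finset.Icc 1 N, HasDerivAt (F.α j) (deriv (F.α j) r) r := fun j hj =>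
    (hasDerivAt_deriv_of_contDiffOn_Ici (hF.smooth_α j hj) hr).1
  have hEd : ∀ j ∈ Finset.Icc 1 (N - 1),
      deriv (F.elec j) r = deriv (F.α j) r - deriv (F.α (j + 1)) r := fun j hj =>
    ((hαd j (hmemα j hj).1).sub (hαd _ (hmemα j hj).2)).deriv
  -- Differentiating the trace condition shows that the derivatives `α_j'` are trace-free as well.
  -- They, and hence `η`, are then determined by the differences `𝓔_j'`.
  have htr : ∑ j ∈ Finset.Icc 1 N, deriv (F.α j) r = 0 := by
    have h1 : HasDerivAt (fun r => ∑ j ∈ Finset.Icc 1 N, F.α j r)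
        (∑ j ∈ Finset.Icc 1 N, deriv (F.α j) r) r := HasDerivAt.fun_sum hαd
    have h2 : HasDerivAt (fun r => ∑ j ∈ Finset.Icc 1 N, F.α j r) 0 r := by
      refine (hasDerivAt_const r (0 : ℝ)).congr_of_eventuallyEq ?_
      filter_upwards [Ioi_mem_nhds hr] with s hs using hF.traceless s (mem_Ici_of_Ioi hs)
    exact h1.unique h2
  have hη : F.eta N r = ((1 - x) ^ 2) ^ 2 * etaSum N (X.dE · x) := by
    rw [← etaSum_mul, Fields.eta]
    refine Finset.sum_congr rfl fun j hj => ?_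
    rw [← alphaOf_sub hN htr hj]
    congr 1
    exact alphaOf_congr (fun i hi => by rw [← hdE i hi, hEd i hi]) j
  have hσ : deriv F.S r / F.S r = (1 - x) ^ 2 * X.sigma N k ℓ x := by
    rw [heq.einstein_S, hG, hζ, CompactFields.sigma, sigmaOf, hnux, hXS, ← hμdef]
    generalize F.S r = s at hSp ⊢
    rw [hrdef]
    field_simp
  have hσ' : deriv F.S r = F.S r * ((1 - x) ^ 2 * X.sigma N k ℓ x) := by
    rw [← hσ]; field_simp
  have hP : F.P N k r = (1 - x) ^ 2 * pressure N k x (X.w · x) := by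
    simp only [Fields.P, pressure, ← mul_assoc]
    congr 1
    rw [hrdef]; field_simp
  refine ⟨fun j hj => ?_, fun j hj => ?_, ?_, ?_, fun j hj => ?_, fun j hj => ?_⟩
  · rw [show X.dw j x = _ from (hder _ (hF.smooth_ω j hj) x hx).1]
    exact (hder _ (hF.smooth_ω j hj) x hx).2
  · rw [show X.dE j x = _ from (hder _ (hE j hj) x hx).1]
    exact (hder _ (hE j hj) x hx).2
  · refine (hder _ hF.smooth_m x hx).2.congr_deriv ?_
    rw [← hrdef, heq.einstein_m, hη, hG, hζ, hP, massOf, hnux, hXS]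
    rw [show r ^ 2 = x ^ 2 / (1 - x) ^ 2 by rw [hrdef, div_pow]]
    rw [← hμdef]
    field_simp
  · refine (hder _ hF.smooth_S x hx).2.congr_deriv ?_
    rw [← hrdef, hσ', hXS]
    field_simp
  · have h2 := (hasDerivAt_deriv_of_contDiffOn_Ici (hE j hj) hr).2
    have h3 : deriv (deriv (F.elec j)) r = deriv (deriv (F.α j)) r - deriv (deriv (F.α (j + 1))) r := by
      have e1 := (hasDerivAt_deriv_of_contDiffOn_Ici (hF.smooth_α j (hmemα j hj).1) hr).2
      have e2 := (hasDerivAt_deriv_of_contDiffOn_Ici (hF.smooth_α _ (hmemα j hj).2) hr).2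
      refine h2.unique ((e1.sub e2).congr_of_eventuallyEq ?_)
      filter_upwards [Ioi_mem_nhds hr] with s hs
      have a1 := (hasDerivAt_deriv_of_contDiffOn_Ici (hF.smooth_α j (hmemα j hj).1) hs).1
      have a2 := (hasDerivAt_deriv_of_contDiffOn_Ici (hF.smooth_α _ (hmemα j hj).2) hs).1
      exact (a1.sub a2).deriv
    have hj1 : j - 1 + 1 = j := Nat.sub_add_cancel (Finset.mem_Icc.1 hj).1
    have h4 : deriv (deriv (F.elec j)) r = ((1 - x) ^ 2 * X.sigma N k ℓ x - 2 / r) *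
        ((1 - x) ^ 2 * X.dE j x) + 1 / (μ * r ^ 2) * elecForce (X.w · x) (X.E · x) j := by
      rw [h3, heq.yangMills_α j (hmemα j hj).1, heq.yangMills_α _ (hmemα j hj).2, hσ, ← hdE j hj,
        hEd j hj]
      have hXw' : ∀ i, X.w i x = F.ω i r := fun i => rfl
      have hXE' : ∀ i, X.E i x = F.α i r - F.α (i + 1) r := fun i => rfl
      simp only [elecForce, hXw', hXE', hj1, Nat.add_sub_cancel]
      ring
    have h5 : HasDerivAt (X.dE j) (deriv (deriv (F.elec j)) r * (1 / (1 - x) ^ 2) *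
        (1 / (1 - x) ^ 2) + deriv (F.elec j) r * (2 / (1 - x) ^ 3)) x := by
      refine ((h2.comp x (hasDerivAt_div_one_sub hx.2)).mul
        (hasDerivAt_inv_sq_one_sub hx.2)).congr_of_eventuallyEq ?_
      filter_upwards [Ioo_mem_nhds hx.1 hx.2] with y hy
      exact (hder _ (hE j hj) y hy).1
    refine h5.congr_deriv ?_
    rw [h4, hdE j hj, hnux]
    generalize X.sigma N k ℓ x = σ
    generalize elecForce (X.w · x) (X.E · x) j = e
    rw [hrdef]
    field_simp
    ring
  · have hνdw : ∀ y ∈ Ioo x₀ 1, X.nu k ℓ y * X.dw j y =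
        F.mu k ℓ (y / (1 - y)) * deriv (F.ω j) (y / (1 - y)) := by
      intro y hy
      have h : 1 - y ≠ 0 := (sub_pos.2 hy.2).ne'
      rw [hnu y ⟨hy.1.le, hy.2⟩, show X.dw j y = _ from (hder _ (hF.smooth_ω j hj) y hy).1]
      field_simp
    have hr0 : r ≠ 0 := (hr₀.trans_lt hr).ne'
    have h1 : HasDerivAt (F.mu k ℓ) (deriv (F.mu k ℓ) r) r := by
      refine DifferentiableAt.hasDerivAt ?_
      have := (hasDerivAt_deriv_of_contDiffOn_Ici hF.smooth_m hr).1.differentiableAt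
      unfold Fields.mu
      fun_prop (disch := assumption)
    have h2 := (hasDerivAt_deriv_of_contDiffOn_Ici (hF.smooth_ω j hj) hr).2
    have h3 := ((h1.mul h2).comp x (hasDerivAt_div_one_sub hx.2)).congr_of_eventuallyEq
      (f₁ := fun y => X.nu k ℓ y * X.dw j y) (by
        filter_upwards [Ioo_mem_nhds hx.1 hx.2] with y hy
        exact hνdw y hy)
    refine h3.congr_deriv ?_
    have hXw' : X.w j x = F.ω j r := rfl
    have hXE' : X.E j x = F.α j r - F.α (j + 1) r := rfl
    have hW : wCoef k (X.w · x) j = F.W k j r := rfl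
    rw [heq.yangMills_ω j hj, hσ, hdw j hj, hnux, hXw', hXE', hW, hXS, ← hμdef]
    generalize X.sigma N k ℓ x = σ
    generalize F.W k j r = W
    generalize F.S r = s at hSp ⊢
    generalize F.ω j r = w
    generalize F.α j r - F.α (j + 1) r = e
    generalize deriv (F.mu k ℓ) r = μ'
    rw [hrdef]
    field_simp
    ring

/-! ### From the compactified equations back to the field equations -/

/-- The fields in the areal radius determined by compactified fields. -/
noncomputable def CompactFields.toFields (N : ℕ) (X : CompactFields) : Fields where
  m r := X.m (r / (1 + r))
  S r := X.S (r / (1 + r))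
  α j r := alphaOf N (fun i => X.E i (r / (1 + r))) j
  ω j r := X.w j (r / (1 + r))

theorem div_one_add_mem_Ioo {r₀ r : ℝ} (hr₀ : 0 ≤ r₀) (hr : r₀ < r) :
    r / (1 + r) ∈ Ioo (r₀ / (1 + r₀)) 1 := by
  have h : 0 < 1 + r := by linarith
  refine ⟨?_, ?_⟩
  · rw [div_lt_div_iff₀ (by linarith) h]; nlinarith
  · rw [div_lt_one h]; linarith

theorem div_one_add_mem_Ico {r₀ r : ℝ} (hr₀ : 0 ≤ r₀) (hr : r₀ ≤ r) :
    r / (1 + r) ∈ Ico (r₀ / (1 + r₀)) 1 := by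
  rcases hr.eq_or_lt with h | h
  · subst h
    refine ⟨le_rfl, ?_⟩
    rw [div_lt_one (by linarith)]; linarith
  · exact Ioo_subset_Ico_self (div_one_add_mem_Ioo hr₀ h)

theorem toFields_mu {N : ℕ} {k ℓ : ℝ} (X : CompactFields) {r : ℝ} (hr : 0 ≤ r) :
    (X.toFields N).mu k ℓ r = X.nu k ℓ (r / (1 + r)) * (1 + r) ^ 2 := by
  have h : 1 + r ≠ 0 := by positivity
  have h1 : 1 - r / (1 + r) = 1 / (1 + r) := by field_simp; ring
  have h2 : r / (1 + r) / (1 - r / (1 + r)) = r := by rw [h1]; field_simp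
  have h3 : r / (1 + r) < 1 := by rw [div_lt_one (by positivity)]; linarith
  have := mu_eq_nuOf k ℓ (X.toFields N) h3
  rw [h2, h1] at this
  rw [this]
  simp only [CompactFields.toFields, CompactFields.nu]
  field_simp

/-- The compactified system only evolves the differences `𝓔_j`; the equations for `α_j` follow by
applying the linear operator `alphaOf`, which turns `elecForce` back into the currents. The
differences at the indices `0` and `N` are harmless because they are multiplied by `ω_0 = ω_N = 0`.
-/
theorem IsCompactSolution.fieldEquationsAt {N : ℕ} (hN : 1 ≤ N) {k ℓ r₀ : ℝ} (hr₀ : 0 ≤ r₀)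
    {X : CompactFields} (hX : IsCompactSolution N k ℓ (r₀ / (1 + r₀)) X) {r : ℝ} (hr : r₀ < r) :
    FieldEquationsAt N k ℓ (X.toFields N) r := by
  have hmem : ∀ {s}, r₀ < s → s / (1 + s) ∈ Ioo (r₀ / (1 + r₀)) 1 := div_one_add_mem_Ioo hr₀
  have hcomp : ∀ {φ : ℝ → ℝ} {φ' s : ℝ}, r₀ < s → HasDerivAt φ φ' (s / (1 + s)) →
      HasDerivAt (fun r => φ (r / (1 + r))) (φ' * (1 / (1 + s) ^ 2)) s := fun hs h =>
    HasDerivAt.comp (h := fun r => r / (1 + r)) _ h (hasDerivAt_div_one_add (hr₀.trans hs.le))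
  set H := X.toFields N with hH
  have hw : ∀ j ∈ Finset.Icc 1 (N - 1), ∀ s, r₀ < s →
      HasDerivAt (H.ω j) (X.dw j (s / (1 + s)) * (1 / (1 + s) ^ 2)) s := fun j hj s hs =>
    hcomp hs ((hX.equations _ (hmem hs)).w j hj)
  have hα : ∀ j, ∀ s, r₀ < s → HasDerivAt (H.α j)
      (alphaOf N (fun i => X.dE i (s / (1 + s)) * (1 / (1 + s) ^ 2)) j) s := fun j s hs =>
    hasDerivAt_alphaOf (fun i hi => hcomp hs ((hX.equations _ (hmem hs)).E i hi)) j
  have hr0 : 0 < r := hr₀.trans_lt hr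
  have hu : 1 + r ≠ 0 := by positivity
  have heq := hX.equations _ (hmem hr)
  have hν := hX.nu_pos _ (hmem hr)
  have hS := hX.S_pos _ (Ioo_subset_Ico_self (hmem hr))
  have hμ : H.mu k ℓ r = X.nu k ℓ (r / (1 + r)) * (1 + r) ^ 2 := toFields_mu X hr0.le
  set x := r / (1 + r) with hx
  have hx1 : 1 - x = 1 / (1 + r) := by rw [hx]; field_simp; ring
  have hHS : H.S r = X.S x := rfl
  have hHω : ∀ j, H.ω j r = X.w j x := fun j => rfl
  have hαE : ∀ j ∈ Finset.Icc 1 (N - 1), H.α j r - H.α (j + 1) r = X.E j x := fun j hj =>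
    alphaOf_sub_alphaOf_succ (E := fun i => X.E i x) hj
  have hwαE : ∀ j ≤ N, X.w j x ^ 2 * (H.α j r - H.α (j + 1) r) = X.w j x ^ 2 * X.E j x := by
    intro j hj
    by_cases hj' : j ∈ Finset.Icc 1 (N - 1)
    · rw [hαE j hj']
    · have : j = 0 ∨ j = N := by rw [Finset.mem_Icc] at hj'; omega
      rcases this with h | h
      · rw [h, hX.w_zero]; ring
      · rw [h, hX.w_last]; ring
  have hη : H.eta N r = (1 / (1 + r) ^ 2) ^ 2 * etaSum N (X.dE · x) := by
    rw [← etaSum_mul, Fields.eta]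
    refine Finset.sum_congr rfl fun j _ => ?_
    rw [(hα j r hr).deriv]
    simp only [mul_comm]
    rfl
  have hζ : H.zeta N r = zetaSum N (X.w · x) (X.E · x) := by
    refine Finset.sum_congr rfl fun j hj => ?_
    rw [hαE j hj]
    rfl
  have hG : H.G N r = (1 / (1 + r) ^ 2) ^ 2 * sumSq N (X.dw · x) := by
    rw [← sumSq_mul, Fields.G]
    refine Finset.sum_congr rfl fun j hj => ?_
    rw [(hw j hj r hr).deriv, mul_comm]
  have hP : H.P N k r = (1 / (1 + r) ^ 2) * pressure N k x (X.w · x) := by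
    simp only [Fields.P, pressure, ← mul_assoc]
    congr 1
    rw [hx]; field_simp
  have hm : HasDerivAt H.m _ r := hcomp hr heq.m
  have hSd : HasDerivAt H.S _ r := hcomp hr heq.S
  have hσ : deriv H.S r / H.S r = X.sigma N k ℓ x * (1 / (1 + r) ^ 2) := by
    rw [hSd.deriv, hHS]; field_simp
  refine ⟨?_, ?_, fun j hj => ?_, fun j hj => ?_⟩
  · rw [hm.deriv, hη, hζ, hG, hP, hμ, hHS, massOf]
    generalize X.nu k ℓ x = ν at hν ⊢
    generalize X.S x = s at hS ⊢
    generalize pressure N k x (X.w · x) = p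
    generalize zetaSum N (X.w · x) (X.E · x) = z
    rw [show x ^ 2 = r ^ 2 / (1 + r) ^ 2 by rw [hx, div_pow]]
    field_simp
  · rw [hσ, hζ, hG, hμ, hHS, CompactFields.sigma, sigmaOf, hx1]
    generalize X.nu k ℓ x = ν at hν ⊢
    generalize X.S x = s at hS ⊢
    generalize zetaSum N (X.w · x) (X.E · x) = z
    generalize sumSq N (X.dw · x) = g
    rw [hx]
    field_simp
  · have h1 : HasDerivAt (deriv (H.α j)) (alphaOf N (fun i =>
        ((X.sigma N k ℓ x - 2 / x) * (1 / (1 + r) ^ 4) - 2 / (1 + r) ^ 3) * X.dE i x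
          + 1 / (X.nu k ℓ x * x ^ 2 * (1 + r) ^ 4) * elecForce (X.w · x) (X.E · x) i) j) r := by
      refine (hasDerivAt_alphaOf (E := fun i s => X.dE i (s / (1 + s)) * (1 / (1 + s) ^ 2))
        (fun i hi => ?_) j).congr_of_eventuallyEq ?_
      · have h2 : HasDerivAt (fun s : ℝ => 1 / (1 + s) ^ 2) (-2 / (1 + r) ^ 3) r := by
          refine ((hasDerivAt_const r (1 : ℝ)).div (((hasDerivAt_id r).const_add 1).pow 2)
            (pow_ne_zero 2 hu)).congr_deriv ?_
          simp only [id]; field_simp; simp; ring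
        refine ((hcomp hr (heq.dE i hi)).mul h2).congr_deriv ?_
        rw [← hx]
        field_simp
        ring
      · filter_upwards [Ioi_mem_nhds hr] with s hs
        exact (hα j s hs).deriv
    rw [h1.deriv, alphaOf_add_mul, alphaOf_elecForce hN (hX.w_zero x) (hX.w_last x) hj, hσ,
      (hα j r hr).deriv, ← hx, hμ]
    simp only [mul_comm _ (1 / (1 + r) ^ 2)]
    rw [alphaOf_mul]
    have hj' := Finset.mem_Icc.1 hj
    have e1 := hwαE j hj'.2
    have e2 := hwαE (j - 1) (by omega)
    rw [Nat.sub_add_cancel hj'.1] at e2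
    rw [hHω, hHω, e1, e2]
    generalize X.nu k ℓ x = ν at hν ⊢
    generalize X.sigma N k ℓ x = σ
    generalize X.w j x ^ 2 * X.E j x - X.w (j - 1) x ^ 2 * X.E (j - 1) x = f
    rw [hx]
    field_simp
    ring
  · have hμd : HasDerivAt (H.mu k ℓ) (deriv (H.mu k ℓ) r) r := by
      refine DifferentiableAt.hasDerivAt ?_
      have := hm.differentiableAt
      have := hr0.ne'
      unfold Fields.mu
      fun_prop (disch := assumption)
    have hμ0 : H.mu k ℓ r ≠ 0 := by rw [hμ]; positivity
    have h1 := ((hcomp hr (heq.flux j hj)).div hμd hμ0).congr_of_eventuallyEq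
      (f₁ := deriv (H.ω j)) (by
      filter_upwards [Ioi_mem_nhds hr] with s hs
      have hs' : r₀ < s := hs
      have hs0 : 0 < s := hr₀.trans_lt hs'
      rw [(hw j hj s hs).deriv, Pi.div_apply, hH, toFields_mu X hs0.le]
      have := hX.nu_pos _ (hmem hs')
      field_simp)
    rw [h1.deriv, hσ, (hw j hj r hr).deriv, hαE j hj, ← hx, hμ, hHω, hHS]
    have hW : H.W k j r = wCoef k (X.w · x) j := rfl
    rw [hW]
    generalize X.nu k ℓ x = ν at hν ⊢
    generalize X.sigma N k ℓ x = σ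
    generalize wCoef k (X.w · x) j = W
    generalize deriv (H.mu k ℓ) r = μ'
    generalize X.S x = s at hS ⊢
    rw [hx]
    field_simp
    ring

/-! ### Expansions as `r → ∞` from smoothness at `x = 1`. -/

theorem exists_expansion_right {a b : ℝ} (hab : a < b) {φ : ℝ → ℝ}
    (h : ContDiffOn ℝ (⊤ : ℕ∞) φ (Icc a b)) :
    ∃ d C, 0 ≤ C ∧ ∀ x ∈ Icc a b, |φ x - (φ b + d * (b - x))| ≤ C * (b - x) ^ 2 := by
  have h1 : ContDiffOn ℝ (2 : ℕ) (fun z => φ (b - z)) (Icc 0 (b - a)) :=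
    (contDiffOn_infty.1 h 2).comp (contDiffOn_const.sub contDiffOn_id) fun z hz =>
      ⟨by linarith [hz.2], by linarith [hz.1]⟩
  obtain ⟨C, hC⟩ := exists_taylor_mean_remainder_bound (n := 1) (sub_pos.2 hab).le
    (by exact_mod_cast h1)
  refine ⟨derivWithin (fun z => φ (b - z)) (Icc 0 (b - a)) 0, |C|, abs_nonneg _,
    fun x hx => ?_⟩
  have h2 := hC (b - x) ⟨by linarith [hx.2], by linarith [hx.1]⟩
  rw [taylorWithinEval_succ, taylor_within_zero_eval, Real.norm_eq_abs] at h2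
  simp only [sub_sub_cancel, sub_zero, smul_eq_mul] at h2
  norm_num at h2
  rw [mul_comm _ (b - x)]
  exact h2.trans (mul_le_mul_of_nonneg_right (le_abs_self C) (by positivity))

/-- First-order Taylor expansion at `x = 1`, with `1 - x = 1 / (1 + r) = 1 / r + O(1 / r²)`. -/
theorem isBigO_comp_div_one_add {a : ℝ} (ha : a < 1) {φ : ℝ → ℝ}
    (h : ContDiffOn ℝ (⊤ : ℕ∞) φ (Icc a 1)) :
    ∃ d, (fun r => φ (r / (1 + r)) - (φ 1 + d / r)) =O[atTop] fun r : ℝ => 1 / r ^ 2 := by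
  obtain ⟨d, C, hC0, hC⟩ := exists_expansion_right ha h
  refine ⟨d, IsBigO.of_bound (C + |d|) ?_⟩
  have h1 : ∀ᶠ r : ℝ in atTop, a < r / (1 + r) := by
    have : Tendsto (fun r : ℝ => r / (1 + r)) atTop (𝓝 1) := by
      have h2 : Tendsto (fun r : ℝ => 1 - 1 / (1 + r)) atTop (𝓝 (1 - 0)) :=
        tendsto_const_nhds.sub (tendsto_const_nhds.div_atTop
          (tendsto_atTop_add_const_left _ _ tendsto_id))
      rw [sub_zero] at h2
      refine h2.congr' ?_
      filter_upwards [eventually_gt_atTop 0] with r hr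
      field_simp; ring
    exact this.eventually (lt_mem_nhds ha)
  filter_upwards [h1, eventually_gt_atTop 0] with r hra hr
  have h2 := hC (r / (1 + r)) ⟨hra.le, by rw [div_le_one (by positivity)]; linarith⟩
  have e1 : 1 - r / (1 + r) = 1 / (1 + r) := by field_simp; ring
  rw [e1] at h2
  have e2 : (1 / (1 + r)) ^ 2 ≤ 1 / r ^ 2 := by
    rw [div_pow, one_pow]
    exact one_div_le_one_div_of_le (by positivity) (by gcongr; linarith)
  have e3 : φ (r / (1 + r)) - (φ 1 + d / r) =
      (φ (r / (1 + r)) - (φ 1 + d * (1 / (1 + r)))) + -(d * (1 / (r * (1 + r)))) := by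
    field_simp; ring
  have e4 : |1 / (r * (1 + r))| ≤ 1 / r ^ 2 := by
    rw [abs_of_pos (by positivity)]
    exact one_div_le_one_div_of_le (by positivity) (by nlinarith)
  rw [Real.norm_eq_abs, Real.norm_eq_abs, abs_of_pos (by positivity : 0 < 1 / r ^ 2), e3, add_mul]
  refine (abs_add_le _ _).trans (add_le_add (h2.trans ?_) ?_)
  · exact mul_le_mul_of_nonneg_left e2 hC0
  · rw [abs_neg, abs_mul]
    exact mul_le_mul_of_nonneg_left e4 (abs_nonneg _)

/-- Integrating `(1 - x)³ γ(x)` from `x` to `1` gives `φ(1) - φ(x) = γ(1) (1 - x)⁴ / 4 + O((1 -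
x)⁵)`, so the coefficient is `-γ(1) / 4`. Replacing `(1 + r)⁻⁴` by `r⁻⁴` costs only `O(r⁻⁵)`. -/
theorem isBigO_comp_div_one_add_of_deriv {a : ℝ} (ha : a < 1) {φ γ : ℝ → ℝ}
    (hφ : ContinuousOn φ (Icc a 1)) (h : ContDiffOn ℝ (⊤ : ℕ∞) γ (Icc a 1))
    (hd : ∀ x ∈ Ioo a 1, HasDerivAt φ ((1 - x) ^ 3 * γ x) x) :
    ∃ d, (fun r => φ (r / (1 + r)) - (φ 1 + d / r ^ 4)) =O[atTop] fun r : ℝ => 1 / r ^ 5 := by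
  obtain ⟨d, C₀, hC0, hC₀⟩ := exists_expansion_right ha h
  set C := |d| + C₀ * (1 - a) with hCdef
  have hC1 : 0 ≤ C := add_nonneg (abs_nonneg _) (mul_nonneg hC0 (by linarith))
  have hLip : ∀ x ∈ Icc a 1, |γ x - γ 1| ≤ C * (1 - x) := by
    intro x hx
    have h1 := hC₀ x hx
    have h2 : 0 ≤ 1 - x := by linarith [hx.2]
    calc |γ x - γ 1| = |(γ x - (γ 1 + d * (1 - x))) + d * (1 - x)| := by ring_nf
      _ ≤ C₀ * (1 - x) ^ 2 + |d| * (1 - x) := by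
        refine (abs_add_le _ _).trans (add_le_add h1 ?_)
        rw [abs_mul, abs_of_nonneg h2]
      _ ≤ C * (1 - x) := by
        rw [hCdef]
        have : C₀ * (1 - x) ^ 2 ≤ C₀ * ((1 - a) * (1 - x)) := by
          refine mul_le_mul_of_nonneg_left ?_ hC0
          rw [pow_two]
          exact mul_le_mul_of_nonneg_right (by linarith [hx.1]) h2
        linarith
  have key : ∀ x ∈ Ioo a 1, |φ x - (φ 1 + -(γ 1 / 4) * (1 - x) ^ 4)| ≤ C * (1 - x) ^ 5 := by
    intro x hx
    have hx1 : 0 < 1 - x := by linarith [hx.2]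
    obtain ⟨ξ, hξ, e⟩ := exists_hasDerivAt_eq_slope
      (fun y => φ y - (φ 1 + -(γ 1 / 4) * (1 - y) ^ 4)) (fun y => (1 - y) ^ 3 * (γ y - γ 1)) hx.2
      (by
        have := hφ.mono (Icc_subset_Icc_left hx.1.le)
        fun_prop)
      (fun y hy => by
        have h1 := (hd y ⟨hx.1.trans hy.1, hy.2⟩).sub
          ((((((hasDerivAt_id y).const_sub 1).pow 4)).const_mul (-(γ 1 / 4))).const_add (φ 1))
        refine h1.congr_deriv ?_
        simp only [id]
        norm_num
        ring)
    have h2 : φ x - (φ 1 + -(γ 1 / 4) * (1 - x) ^ 4) = -((1 - ξ) ^ 3 * (γ ξ - γ 1)) * (1 - x) := by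
      rw [e]; field_simp; ring
    have hξ1 : 0 ≤ 1 - ξ := by linarith [hξ.2]
    have hξx : 1 - ξ ≤ 1 - x := by linarith [hξ.1]
    rw [h2, abs_mul, abs_neg, abs_mul, abs_of_pos hx1, abs_of_nonneg (by positivity)]
    calc _ ≤ (1 - x) ^ 3 * (C * (1 - x)) * (1 - x) := by
          gcongr
          exact (hLip ξ ⟨(hx.1.trans hξ.1).le, hξ.2.le⟩).trans
            (mul_le_mul_of_nonneg_left hξx hC1)
      _ = _ := by ring
  refine ⟨-(γ 1 / 4), IsBigO.of_bound (C + |γ 1| * 4) ?_⟩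
  have h1 : ∀ᶠ r : ℝ in atTop, a < r / (1 + r) := by
    have : Tendsto (fun r : ℝ => r / (1 + r)) atTop (𝓝 1) := by
      have h2 : Tendsto (fun r : ℝ => 1 - 1 / (1 + r)) atTop (𝓝 (1 - 0)) :=
        tendsto_const_nhds.sub (tendsto_const_nhds.div_atTop
          (tendsto_atTop_add_const_left _ _ tendsto_id))
      rw [sub_zero] at h2
      refine h2.congr' ?_
      filter_upwards [eventually_gt_atTop 0] with r hr
      field_simp; ring
    exact this.eventually (lt_mem_nhds ha)
  filter_upwards [h1, eventually_gt_atTop 1] with r hra hr1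
  have hr : 0 < r := by linarith
  have h2 := key (r / (1 + r)) ⟨hra, by rw [div_lt_one (by positivity)]; linarith⟩
  have e1 : 1 - r / (1 + r) = 1 / (1 + r) := by field_simp; ring
  rw [e1] at h2
  have e2 : (1 / (1 + r)) ^ 5 ≤ 1 / r ^ 5 := by
    rw [div_pow, one_pow]
    exact one_div_le_one_div_of_le (by positivity) (by gcongr; linarith)
  have e3 : φ (r / (1 + r)) - (φ 1 + -(γ 1 / 4) / r ^ 4) =
      (φ (r / (1 + r)) - (φ 1 + -(γ 1 / 4) * (1 / (1 + r)) ^ 4))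
        + γ 1 * ((1 / r ^ 4 - 1 / (1 + r) ^ 4) / 4) := by
    field_simp; ring
  have e4 : |(1 / r ^ 4 - 1 / (1 + r) ^ 4) / 4| ≤ 4 * (1 / r ^ 5) := by
    have e5 : (1 / r ^ 4 - 1 / (1 + r) ^ 4) / 4 =
        (4 * r ^ 3 + 6 * r ^ 2 + 4 * r + 1) / (4 * (r ^ 4 * (1 + r) ^ 4)) := by
      field_simp; ring
    rw [e5, abs_of_pos (by positivity), mul_one_div, div_le_div_iff₀ (by positivity) (by positivity)]
    have e6 : 4 * r ^ 3 + 6 * r ^ 2 + 4 * r + 1 ≤ 16 * r ^ 3 := by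
      nlinarith [mul_pos hr hr, mul_pos (mul_pos hr hr) (sub_pos.2 hr1), mul_pos hr (sub_pos.2 hr1)]
    have e7 : r ^ 4 ≤ (1 + r) ^ 4 := by gcongr; linarith
    calc _ ≤ 16 * r ^ 3 * r ^ 5 := by gcongr
      _ = 16 * (r ^ 4 * r ^ 4) := by ring
      _ ≤ 16 * (r ^ 4 * (1 + r) ^ 4) := by gcongr
      _ = _ := by ring
  rw [Real.norm_eq_abs, Real.norm_eq_abs, abs_of_pos (by positivity : 0 < 1 / r ^ 5), e3, add_mul]
  refine (abs_add_le _ _).trans (add_le_add (h2.trans ?_) ?_)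
  · exact mul_le_mul_of_nonneg_left e2 hC1
  · rw [abs_mul, mul_assoc]
    exact mul_le_mul_of_nonneg_left e4 (abs_nonneg _)

/-! ### Smoothness of the algebraic expressions. -/

section Smoothness

variable {V : Type*} [NormedAddCommGroup V] [NormedSpace ℝ V] {N : ℕ} {w E : V → ℕ → ℝ} {s : Set V}

theorem contDiffOn_zetaSum
    (hw : ∀ j ∈ Finset.Icc 1 (N - 1), ContDiffOn ℝ (⊤ : ℕ∞) (fun z => w z j) s)
    (hE : ∀ j ∈ Finset.Icc 1 (N - 1), ContDiffOn ℝ (⊤ : ℕ∞) (fun z => E z j) s) :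
    ContDiffOn ℝ (⊤ : ℕ∞) (fun x => zetaSum N (w x) (E x)) s :=
  ContDiffOn.sum fun j hj => ((hw j hj).pow 2).mul ((hE j hj).pow 2)

theorem contDiffOn_sumSq
    (hw : ∀ j ∈ Finset.Icc 1 (N - 1), ContDiffOn ℝ (⊤ : ℕ∞) (fun z => w z j) s) :
    ContDiffOn ℝ (⊤ : ℕ∞) (fun x => sumSq N (w x)) s :=
  ContDiffOn.sum fun j hj => (hw j hj).pow 2

theorem contDiffOn_etaSum
    (hE : ∀ j ∈ Finset.Icc 1 (N - 1), ContDiffOn ℝ (⊤ : ℕ∞) (fun z => E z j) s) :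
    ContDiffOn ℝ (⊤ : ℕ∞) (fun x => etaSum N (E x)) s := by
  refine ContDiffOn.sum fun j hj => ContDiffOn.pow ?_ 2
  simp only [alphaOf, if_pos hj]
  exact ContDiffOn.sum fun i hi => contDiffOn_const.mul (hE i hi)

theorem contDiffOn_pressure {k : ℝ} {x : V → ℝ} (hx : ContDiffOn ℝ (⊤ : ℕ∞) x s)
    (hx0 : ∀ z ∈ s, x z ≠ 0) (hw : ∀ j, ContDiffOn ℝ (⊤ : ℕ∞) (fun z => w z j) s) :
    ContDiffOn ℝ (⊤ : ℕ∞) (fun z => pressure N k (x z) (w z)) s := by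
  refine (contDiffOn_const.div (contDiffOn_const.mul (hx.pow 2)) fun z hz => ?_).mul
    (ContDiffOn.sum fun j _ => ((((hw j).pow 2).sub ((hw (j - 1)).pow 2)).sub
      contDiffOn_const).pow 2)
  exact mul_ne_zero four_ne_zero (pow_ne_zero 2 (hx0 z hz))

theorem contDiffOn_wCoef {k : ℝ} (hw : ∀ j, ContDiffOn ℝ (⊤ : ℕ∞) (fun z => w z j) s) (j : ℕ) :
    ContDiffOn ℝ (⊤ : ℕ∞) (fun z => wCoef k (w z) j) s :=
  (contDiffOn_const.sub ((hw j).pow 2)).add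
    ((((hw (j + 1)).pow 2).add ((hw (j - 1)).pow 2)).div_const 2)

theorem contDiffOn_elecForce (hw : ∀ j, ContDiffOn ℝ (⊤ : ℕ∞) (fun z => w z j) s)
    (hE : ∀ j, ContDiffOn ℝ (⊤ : ℕ∞) (fun z => E z j) s) (j : ℕ) :
    ContDiffOn ℝ (⊤ : ℕ∞) (fun z => elecForce (w z) (E z) j) s :=
  ((contDiffOn_const.mul (((hw j).pow 2).mul (hE j))).sub
    (((hw (j - 1)).pow 2).mul (hE (j - 1)))).sub (((hw (j + 1)).pow 2).mul (hE (j + 1)))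

end Smoothness

theorem nuOf_one (k ℓ m : ℝ) : nuOf k ℓ m 1 = 1 / ℓ ^ 2 := by simp [nuOf]

/-- A solution of the compactified equations which is smooth up to `x = 1` is a global solution. -/
theorem IsCompactSolution.isGlobalSolution {N : ℕ} (hN : 1 ≤ N) {k ℓ r₀ : ℝ} (hℓ : 0 < ℓ)
    (hr₀ : 0 ≤ r₀) {X : CompactFields} (hX : IsCompactSolution N k ℓ (r₀ / (1 + r₀)) X)
    (hm : ContDiffOn ℝ (⊤ : ℕ∞) X.m (Icc (r₀ / (1 + r₀)) 1))
    (hS : ContDiffOn ℝ (⊤ : ℕ∞) X.S (Icc (r₀ / (1 + r₀)) 1))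
    (hw : ∀ j ∈ Finset.Icc 1 (N - 1), ContDiffOn ℝ (⊤ : ℕ∞) (X.w j) (Icc (r₀ / (1 + r₀)) 1))
    (hdw : ∀ j ∈ Finset.Icc 1 (N - 1), ContDiffOn ℝ (⊤ : ℕ∞) (X.dw j) (Icc (r₀ / (1 + r₀)) 1))
    (hE : ∀ j ∈ Finset.Icc 1 (N - 1), ContDiffOn ℝ (⊤ : ℕ∞) (X.E j) (Icc (r₀ / (1 + r₀)) 1))
    (hS1 : 0 < X.S 1) : IsGlobalSolution N k ℓ r₀ (X.S 1) (X.toFields N) := by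
  set x₀ := r₀ / (1 + r₀) with hx₀
  have hx₀0 : 0 ≤ x₀ := by positivity
  have hx₀1 : x₀ < 1 := by rw [hx₀, div_lt_one (by linarith)]; linarith
  have hcomp : ∀ {φ : ℝ → ℝ}, ContDiffOn ℝ (⊤ : ℕ∞) φ (Ico x₀ 1) →
      ContDiffOn ℝ (⊤ : ℕ∞) (fun r => φ (r / (1 + r))) (Ici r₀) := fun h =>
    h.comp (contDiffOn_id.div (contDiffOn_const.add contDiffOn_id) fun r (hr : r₀ ≤ r) =>
      (by linarith : (0 : ℝ) < 1 + r).ne') fun r hr => div_one_add_mem_Ico hr₀ hr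
  refine ⟨hcomp hX.smooth_m, hcomp hX.smooth_S, fun j _ => contDiffOn_alphaOf
    (fun i hi => hcomp (hX.smooth_E i hi)) j, fun j hj => hcomp (hX.smooth_w j hj),
    fun r => by simp [CompactFields.toFields, alphaOf],
    fun r => by simp [CompactFields.toFields, alphaOf], fun r => hX.w_zero _, fun r => hX.w_last _,
    fun r _ => sum_alphaOf hN _, fun r hr => hX.S_pos _ (div_one_add_mem_Ico hr₀ hr),
    fun r hr => ?_, fun r hr => hX.fieldEquationsAt hN hr₀ hr, hS1, ⟨?_, ?_, ?_, ?_⟩⟩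
  · have h0 : 0 < r := hr₀.trans_lt hr
    rw [toFields_mu X h0.le]
    exact mul_pos (hX.nu_pos _ (div_one_add_mem_Ioo hr₀ hr)) (by positivity)
  · obtain ⟨d, hd⟩ := isBigO_comp_div_one_add hx₀1 hm
    exact ⟨_, d, hd⟩
  -- Only a neighbourhood of `x = 1` matters. Starting at an interior point avoids the zero of `ν`
  -- at a horizon and the point `x = 0`.
  · set a := (x₀ + 1) / 2 with ha
    have ha0 : x₀ < a := by linarith
    have ha1 : a < 1 := by linarith
    have hsub : Icc a 1 ⊆ Icc x₀ 1 := Icc_subset_Icc_left ha0.le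
    have hne : ∀ x ∈ Icc a 1, x ≠ 0 := fun x hx => by linarith [hx.1]
    have hνc : ContDiffOn ℝ (⊤ : ℕ∞) (fun x => X.nu k ℓ x) (Icc a 1) := by
      have := hm.mono hsub
      unfold CompactFields.nu nuOf
      fun_prop (disch := assumption)
    have hν0 : ∀ x ∈ Icc a 1, X.nu k ℓ x ≠ 0 := by
      intro x hx
      rcases hx.2.eq_or_lt with h | h
      · rw [h, CompactFields.nu, nuOf_one]; positivity
      · exact (hX.nu_pos x ⟨ha0.trans_le hx.1, h⟩).ne'
    have hSne : ∀ x ∈ Icc a 1, X.S x ≠ 0 := by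
      intro x hx
      rcases hx.2.eq_or_lt with h | h
      · rw [h]; exact hS1.ne'
      · exact (hX.S_pos x ⟨ha0.le.trans hx.1, h⟩).ne'
    refine isBigO_comp_div_one_add_of_deriv ha1 (γ := fun x => X.S x *
      (zetaSum N (X.w · x) (X.E · x) / (2 * X.nu k ℓ x ^ 2 * X.S x ^ 2 * x)
        + 2 * sumSq N (X.dw · x) / x)) (hS.continuousOn.mono hsub) ?_ fun x hx => ?_
    · have h1 := contDiffOn_zetaSum (fun j hj => (hw j hj).mono hsub)
        (fun j hj => (hE j hj).mono hsub)
      have h2 := contDiffOn_sumSq (fun j hj => (hdw j hj).mono hsub)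
      have h3 := hS.mono hsub
      refine h3.mul ((h1.div (((contDiffOn_const.mul (hνc.pow 2)).mul (h3.pow 2)).mul
        contDiffOn_id) fun x hx => ?_).add ((contDiffOn_const.mul h2).div contDiffOn_id hne))
      have := hne x hx
      have := hν0 x hx
      have := hSne x hx
      simp only [id]
      positivity
    · refine (hX.equations x ⟨ha0.trans hx.1, hx.2⟩).S.congr_deriv ?_
      rw [CompactFields.sigma, sigmaOf]
      ring
  · intro j _
    obtain ⟨d, hd⟩ := isBigO_comp_div_one_add hx₀1 (contDiffOn_alphaOf hE j)
    exact ⟨_, d, hd⟩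
  · intro j hj
    obtain ⟨d, hd⟩ := isBigO_comp_div_one_add hx₀1 (hw j hj)
    exact ⟨_, d, hd⟩

/-! ### Rescaling of time -/

theorem IsGlobalSolution.timeRescale {N : ℕ} {k ℓ r₀ Sinf : ℝ} {F : Fields}
    (hF : IsGlobalSolution N k ℓ r₀ Sinf F) {c : ℝ} (hc : 0 < c) :
    IsGlobalSolution N k ℓ r₀ (c * Sinf) (F.timeRescale c) := by
  refine ⟨hF.smooth_m, contDiffOn_const.mul hF.smooth_S,
    fun j hj => contDiffOn_const.mul (hF.smooth_α j hj), hF.smooth_ω,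
    fun r => ?_, fun r => ?_, hF.ω_zero, hF.ω_last, fun r hr => ?_,
    fun r hr => mul_pos hc (hF.S_pos r hr), hF.mu_pos, fun r hr => ?_, mul_pos hc hF.Sinf_pos,
    ⟨hF.infinity.exp_m, ?_, fun j hj => ?_, hF.infinity.exp_ω⟩⟩
  · simp [Fields.timeRescale, hF.α_zero]
  · simp [Fields.timeRescale, hF.α_last]
  · simp only [Fields.timeRescale]
    rw [← Finset.mul_sum, hF.traceless r hr, mul_zero]
  · have heq := hF.equations r hr
    have hS := hF.S_pos r (mem_Ici_of_Ioi hr)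
    have hμ := hF.mu_pos r hr
    set H := F.timeRescale c with hH
    have hHμ : H.mu k ℓ = F.mu k ℓ := rfl
    have hHS : H.S r = c * F.S r := rfl
    have hHα : ∀ j, H.α j r = c * F.α j r := fun j => rfl
    have hdα : ∀ j, deriv (H.α j) = fun s => c * deriv (F.α j) s := fun j => by
      ext s; exact deriv_const_mul_field c
    have hη : H.eta N r = c ^ 2 * F.eta N r := by
      simp only [Fields.eta, hdα, mul_pow, Finset.mul_sum]
    have hζ : H.zeta N r = c ^ 2 * F.zeta N r := by
      simp only [Fields.zeta, Finset.mul_sum]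
      refine Finset.sum_congr rfl fun j _ => ?_
      rw [hHα, hHα]
      change F.ω j r ^ 2 * _ = _
      ring
    have hG : H.G N r = F.G N r := rfl
    have hP : H.P N k r = F.P N k r := rfl
    have hdS : deriv H.S r / H.S r = deriv F.S r / F.S r := by
      have : deriv H.S r = c * deriv F.S r := deriv_const_mul_field c
      rw [this, hHS, mul_div_mul_left _ _ hc.ne']
    refine ⟨?_, ?_, fun j hj => ?_, fun j hj => ?_⟩
    · change deriv F.m r = _
      rw [heq.einstein_m, hη, hζ, hG, hP, hHμ, hHS]
      field_simp
    · rw [hdS, heq.einstein_S, hζ, hG, hHμ, hHS]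
      field_simp
    · have : deriv (deriv (H.α j)) r = c * deriv (deriv (F.α j)) r := by
        rw [hdα]; exact deriv_const_mul_field c
      rw [this, heq.yangMills_α j hj, hdS, hdα, hHμ, hHα, hHα, hHα]
      change _ = _ * (c * deriv (F.α j) r) + _ * (F.ω j r ^ 2 * _ - F.ω (j - 1) r ^ 2 * _)
      ring
    · rw [hdS, hHμ, hHS, hHα, hHα]
      change deriv (deriv (F.ω j)) r = _ * deriv (F.ω j) r - _ * F.ω j r * _ -
        F.W k j r * F.ω j r / _
      rw [heq.yangMills_ω j hj]
      field_simp
  · obtain ⟨s, hs⟩ := hF.infinity.exp_S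
    refine ⟨c * s, (hs.const_mul_left c).congr_left fun r => ?_⟩
    simp only [Fields.timeRescale]; ring
  · obtain ⟨a, d, hd⟩ := hF.infinity.exp_α j hj
    refine ⟨c * a, c * d, (hd.const_mul_left c).congr_left fun r => ?_⟩
    simp only [Fields.timeRescale]; ring

theorem IsBlackHole.normalise {N : ℕ} {k ℓ rh c : ℝ} {H : Fields}
    (hH : IsBlackHole N k ℓ rh c H) : IsBlackHole N k ℓ rh 1 (H.timeRescale c⁻¹) := by
  have hc := hH.Sinf_pos
  have h := hH.toIsGlobalSolution.timeRescale (inv_pos.2 hc)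
  rw [inv_mul_cancel₀ hc.ne'] at h
  refine ⟨h, hH.mu_horizon, hH.mu'_horizon, fun j hj => ?_⟩
  simp [Fields.timeRescale, hH.α_horizon j hj]

theorem IsSoliton.normalise {N : ℕ} {ℓ c : ℝ} {H : Fields} (hH : IsSoliton N ℓ c H) :
    IsSoliton N ℓ 1 (H.timeRescale c⁻¹) := by
  have hc := hH.Sinf_pos
  have h := hH.toIsGlobalSolution.timeRescale (inv_pos.2 hc)
  rw [inv_mul_cancel₀ hc.ne'] at h
  refine ⟨h, hH.m_origin, hH.ω_origin, fun j hj => ?_⟩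
  have := hH.elec_origin j hj
  simp only [Fields.elec, Fields.timeRescale] at this ⊢
  rw [← mul_sub, this, mul_zero]

/-! ### Limits at infinity -/

theorem tendsto_of_expansion {f : ℝ → ℝ} {a d : ℝ} {n m : ℕ} (hn : n ≠ 0) (hm : m ≠ 0)
    (h : (fun r => f r - (a + d / r ^ n)) =O[atTop] fun r : ℝ => 1 / r ^ m) :
    Tendsto f atTop (𝓝 a) := by
  have h0 : ∀ p : ℕ, p ≠ 0 → ∀ d : ℝ, Tendsto (fun r : ℝ => d / r ^ p) atTop (𝓝 0) :=
    fun p hp d => tendsto_const_nhds.div_atTop (tendsto_pow_atTop hp)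
  have h1 := h.trans_tendsto (h0 m hm 1)
  have h2 := h1.add ((tendsto_const_nhds (x := a)).add (h0 n hn d))
  simpa using h2

theorem tendsto_div_one_sub : Tendsto (fun x : ℝ => x / (1 - x)) (𝓝[<] 1) atTop := by
  have h1 : Tendsto (fun x : ℝ => (1 - x)⁻¹) (𝓝[<] 1) atTop := by
    refine tendsto_inv_nhdsGT_zero.comp (tendsto_nhdsWithin_iff.2 ⟨?_, ?_⟩)
    · have : Tendsto (fun x : ℝ => 1 - x) (𝓝 1) (𝓝 (1 - 1)) :=
        (continuous_const.sub continuous_id).tendsto 1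
      rw [sub_self] at this
      exact this.mono_left nhdsWithin_le_nhds
    · filter_upwards [self_mem_nhdsWithin] with x hx using sub_pos.2 (mem_Iio.1 hx)
  exact Tendsto.pos_mul_atTop one_pos (tendsto_id.mono_left nhdsWithin_le_nhds) h1

/-- Limits at `x = 1`. -/
structure HasLimits (N : ℕ) (X : CompactFields) (mL SL : ℝ) (wL dwL EL dEL : ℕ → ℝ) : Prop where
  m : Tendsto X.m (𝓝[<] 1) (𝓝 mL)
  S : Tendsto X.S (𝓝[<] 1) (𝓝 SL)
  w : ∀ j ∈ Finset.Icc 1 (N - 1), Tendsto (X.w j) (𝓝[<] 1) (𝓝 (wL j))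
  dw : ∀ j ∈ Finset.Icc 1 (N - 1), Tendsto (X.dw j) (𝓝[<] 1) (𝓝 (dwL j))
  E : ∀ j ∈ Finset.Icc 1 (N - 1), Tendsto (X.E j) (𝓝[<] 1) (𝓝 (EL j))
  dE : ∀ j ∈ Finset.Icc 1 (N - 1), Tendsto (X.dE j) (𝓝[<] 1) (𝓝 (dEL j))

theorem tendsto_nu {k ℓ mL : ℝ} {X : CompactFields} (hm : Tendsto X.m (𝓝[<] 1) (𝓝 mL)) :
    Tendsto (fun x => X.nu k ℓ x) (𝓝[<] 1) (𝓝 (1 / ℓ ^ 2)) := by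
  rw [← nuOf_one k ℓ mL]
  have hid : Tendsto (fun x : ℝ => x) (𝓝[<] 1) (𝓝 1) := tendsto_id.mono_left nhdsWithin_le_nhds
  have h1 : Tendsto (fun x : ℝ => 1 - x) (𝓝[<] 1) (𝓝 (1 - 1)) := tendsto_const_nhds.sub hid
  exact (((tendsto_const_nhds.mul (h1.pow 2)).sub
    (((tendsto_const_nhds.mul hm).mul (h1.pow 3)).div hid one_ne_zero)).add
    ((hid.pow 2).div_const _))

/-- The expansions give the limits of the undifferentiated fields but cannot be differentiated term
by term. The limits of the derivatives come from the equations: `S ν ω_j'` and `x² 𝓔_j' / S` have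
bounded derivatives near `x = 1`, the terms in `σ` cancelling in both. -/
theorem IsGlobalSolution.hasLimits {N : ℕ} (hN : 1 ≤ N) {k ℓ r₀ Sinf : ℝ} (hℓ : 0 < ℓ)
    (hr₀ : 0 ≤ r₀) {F : Fields} (hF : IsGlobalSolution N k ℓ r₀ Sinf F) :
    ∃ mL wL dwL EL dEL,
      HasLimits N (F.toCompact (r₀ / (1 + r₀))) mL Sinf wL dwL EL dEL := by
  have hX := hF.toCompact hN hr₀
  set x₀ := r₀ / (1 + r₀) with hx₀
  have hx₀0 : 0 ≤ x₀ := by positivity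
  have hx₀1 : x₀ < 1 := by rw [hx₀, div_lt_one (by linarith)]; linarith
  set X := F.toCompact x₀ with hXdef
  have hev : ∀ᶠ x in 𝓝[<] (1 : ℝ), x ∈ Ioo x₀ 1 := Ioo_mem_nhdsLT hx₀1
  obtain ⟨M, m₁, hM⟩ := hF.infinity.exp_m
  obtain ⟨s₄, hs⟩ := hF.infinity.exp_S
  have hm : Tendsto X.m (𝓝[<] 1) (𝓝 M) :=
    (tendsto_of_expansion (f := F.m) (a := M) (d := m₁) one_ne_zero two_ne_zero
      (by simpa using hM)).comp tendsto_div_one_sub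
  have hS : Tendsto X.S (𝓝[<] 1) (𝓝 Sinf) :=
    (tendsto_of_expansion four_ne_zero (by norm_num) hs).comp tendsto_div_one_sub
  have hw : ∀ j ∈ Finset.Icc 1 (N - 1), ∃ l, Tendsto (X.w j) (𝓝[<] 1) (𝓝 l) := by
    intro j hj
    obtain ⟨a, d, hd⟩ := hF.infinity.exp_ω j hj
    exact ⟨a, (tendsto_of_expansion (f := F.ω j) (a := a) (d := d) one_ne_zero two_ne_zero
      (by simpa using hd)).comp
      tendsto_div_one_sub⟩
  have hE : ∀ j ∈ Finset.Icc 1 (N - 1), ∃ l, Tendsto (X.E j) (𝓝[<] 1) (𝓝 l) := by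
    intro j hj
    have hj' := Finset.mem_Icc.1 hj
    obtain ⟨a, d, hd⟩ := hF.infinity.exp_α j (Finset.mem_Icc.2 ⟨by omega, by omega⟩)
    obtain ⟨a', d', hd'⟩ := hF.infinity.exp_α (j + 1) (Finset.mem_Icc.2 ⟨by omega, by omega⟩)
    exact ⟨a - a', ((tendsto_of_expansion (f := F.α j) (a := a) (d := d) one_ne_zero
      two_ne_zero (by simpa using hd)).sub
      (tendsto_of_expansion (f := F.α (j + 1)) (a := a') (d := d') one_ne_zero two_ne_zero (by simpa using hd'))).comp
      tendsto_div_one_sub⟩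
  have hw' : ∀ j ≤ N, ∃ l, Tendsto (X.w j) (𝓝[<] 1) (𝓝 l) := by
    intro j hj
    by_cases hj' : j ∈ Finset.Icc 1 (N - 1)
    · exact hw j hj'
    · have : j = 0 ∨ j = N := by rw [Finset.mem_Icc] at hj'; omega
      have h0 : X.w j = fun _ => 0 := by
        ext x
        rcases this with h | h
        · rw [h, hX.w_zero]
        · rw [h, hX.w_last]
      exact ⟨0, by rw [h0]; exact tendsto_const_nhds⟩
  have hwE : ∀ j ≤ N, ∃ l, Tendsto (fun x => X.w j x ^ 2 * X.E j x) (𝓝[<] 1) (𝓝 l) := by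
    intro j hj
    by_cases hj' : j ∈ Finset.Icc 1 (N - 1)
    · obtain ⟨l, hl⟩ := hw j hj'
      obtain ⟨l', hl'⟩ := hE j hj'
      exact ⟨_, (hl.pow 2).mul hl'⟩
    · have : j = 0 ∨ j = N := by rw [Finset.mem_Icc] at hj'; omega
      have h0 : (fun x => X.w j x ^ 2 * X.E j x) = fun _ => 0 := by
        ext x
        rcases this with h | h
        · rw [h, hX.w_zero]; ring
        · rw [h, hX.w_last]; ring
      exact ⟨0, by rw [h0]; exact tendsto_const_nhds⟩
  have hν := tendsto_nu (k := k) (ℓ := ℓ) hm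
  have hν0 : 1 / ℓ ^ 2 ≠ 0 := by positivity
  have hid : Tendsto (fun x : ℝ => x) (𝓝[<] 1) (𝓝 1) := tendsto_id.mono_left nhdsWithin_le_nhds
  have hS0 := hF.Sinf_pos.ne'
  have hdw : ∀ j ∈ Finset.Icc 1 (N - 1), ∃ l, Tendsto (X.dw j) (𝓝[<] 1) (𝓝 l) := by
    intro j hj
    have hj' := Finset.mem_Icc.1 hj
    obtain ⟨w, hw1⟩ := hw j hj
    obtain ⟨w₁, hw2⟩ := hw' (j + 1) (by omega)
    obtain ⟨w₂, hw3⟩ := hw' (j - 1) (by omega)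
    obtain ⟨e, he⟩ := hE j hj
    obtain ⟨l, hl⟩ := exists_tendsto_of_deriv_isBigO_one (b := 1)
      (f := fun x => X.S x * (X.nu k ℓ x * X.dw j x))
      (f' := fun x => -(X.S x * (X.w j x * X.E j x ^ 2 / (4 * X.nu k ℓ x * X.S x ^ 2)
        + (k - X.w j x ^ 2 + (X.w (j + 1) x ^ 2 + X.w (j - 1) x ^ 2) / 2) * X.w j x / x ^ 2)))
      (by
        filter_upwards [hev] with x hx
        have h := hX.equations x hx
        refine (h.S.mul (h.flux j hj)).congr_deriv ?_
        rw [wCoef]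
        ring)
      (by
        refine Tendsto.isBigO_one ℝ (c := _) (Tendsto.neg (hS.mul (Tendsto.add
          ((hw1.mul (he.pow 2)).div ((tendsto_const_nhds.mul hν).mul (hS.pow 2)) ?_)
          ((((tendsto_const_nhds.sub (hw1.pow 2)).add
            (((hw2.pow 2).add (hw3.pow 2)).div_const 2)).mul hw1).div (hid.pow 2) ?_))))
        · positivity
        · norm_num)
    refine ⟨l / (Sinf * (1 / ℓ ^ 2)), (hl.div (hS.mul hν) (mul_ne_zero hS0 hν0)).congr' ?_⟩
    filter_upwards [hev] with x hx
    have h1 := (hX.S_pos x ⟨hx.1.le, hx.2⟩).ne'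
    have h2 := (hX.nu_pos x hx).ne'
    rw [Pi.div_apply]
    field_simp
  have hdE : ∀ j ∈ Finset.Icc 1 (N - 1), ∃ l, Tendsto (X.dE j) (𝓝[<] 1) (𝓝 l) := by
    intro j hj
    have hj' := Finset.mem_Icc.1 hj
    obtain ⟨a, ha⟩ := hwE j (by omega)
    obtain ⟨a₁, ha1⟩ := hwE (j - 1) (by omega)
    obtain ⟨a₂, ha2⟩ := hwE (j + 1) (by omega)
    obtain ⟨l, hl⟩ := exists_tendsto_of_deriv_isBigO_one (b := 1)
      (f := fun x => x ^ 2 * X.dE j x / X.S x)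
      (f' := fun x => (2 * (X.w j x ^ 2 * X.E j x) - X.w (j - 1) x ^ 2 * X.E (j - 1) x
        - X.w (j + 1) x ^ 2 * X.E (j + 1) x) / (X.nu k ℓ x * X.S x))
      (by
        filter_upwards [hev] with x hx
        have h := hX.equations x hx
        have h1 := (hX.S_pos x ⟨hx.1.le, hx.2⟩).ne'
        have h2 := (hX.nu_pos x hx).ne'
        have h3 : x ≠ 0 := (hx₀0.trans_lt hx.1).ne'
        refine (((hasDerivAt_pow 2 x).mul (h.dE j hj)).div h.S h1).congr_deriv ?_
        simp only [Pi.mul_apply, elecForce]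
        field_simp
        push_cast
        ring)
      (by
        exact Tendsto.isBigO_one ℝ (c := _) ((((tendsto_const_nhds.mul ha).sub ha1).sub ha2).div
          (hν.mul hS) (mul_ne_zero hν0 hS0)))
    refine ⟨l * Sinf / 1 ^ 2, ((hl.mul hS).div (hid.pow 2) (by norm_num)).congr' ?_⟩
    filter_upwards [hev] with x hx
    have h1 := (hX.S_pos x ⟨hx.1.le, hx.2⟩).ne'
    have h3 : x ≠ 0 := (hx₀0.trans_lt hx.1).ne'
    rw [Pi.div_apply]
    field_simp
  choose! wL hwL using hw
  choose! dwL hdwL using hdw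
  choose! EL hEL using hE
  choose! dEL hdEL using hdE
  exact ⟨M, wL, dwL, EL, dEL, hm, hS, hwL, hdwL, hEL, hdEL⟩

/-! ### Zeros of the gauge functions. -/

theorem IsCompactSolution.continuousOn_nu {N : ℕ} {k ℓ x₀ : ℝ} {X : CompactFields}
    (hX : IsCompactSolution N k ℓ x₀ X) {s : Set ℝ} (hs : s ⊆ Ico x₀ 1) (h0 : ∀ x ∈ s, x ≠ 0) :
    ContinuousOn (fun x => X.nu k ℓ x) s := by
  have := hX.smooth_m.continuousOn.mono hs
  unfold CompactFields.nu nuOf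
  fun_prop (disch := assumption)

/-- If `w_j` and its flux vanish at one radius, then `w_j` vanishes beyond it. -/
theorem IsCompactSolution.w_eq_zero {N : ℕ} {k ℓ x₀ : ℝ} {X : CompactFields}
    (hX : IsCompactSolution N k ℓ x₀ X) {j : ℕ} (hj : j ∈ Finset.Icc 1 (N - 1)) {x₁ : ℝ}
    (hx₁ : x₁ ∈ Ico x₀ 1) (hx₁0 : 0 < x₁) {c₁ c₂ : ℝ → ℝ} (hc₁ : ContinuousOn c₁ (Ico x₁ 1))
    (hc₂ : ContinuousOn c₂ (Ico x₁ 1))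
    (h₁ : ∀ x ∈ Ioo x₁ 1, (x - x₁) / X.nu k ℓ x = c₁ x)
    (h₂ : ∀ x ∈ Ioo x₁ 1, X.E j x ^ 2 / X.nu k ℓ x = c₂ x)
    (hw : X.w j x₁ = 0) (hdw : X.nu k ℓ x₁ * X.dw j x₁ = 0) : ∀ x ∈ Ico x₁ 1, X.w j x = 0 := by
  intro b hb
  have hsub : Icc x₁ b ⊆ Ico x₀ 1 := fun x hx => ⟨hx₁.1.trans hx.1, hx.2.trans_lt hb.2⟩
  have hsub1 : Icc x₁ b ⊆ Ico x₁ 1 := fun x hx => ⟨hx.1, hx.2.trans_lt hb.2⟩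
  have hne : ∀ x ∈ Icc x₁ b, x ≠ 0 := fun x hx => (hx₁0.trans_le hx.1).ne'
  have hSne : ∀ x ∈ Icc x₁ b, X.S x ≠ 0 := fun x hx => (hX.S_pos x (hsub hx)).ne'
  have hS := hX.smooth_S.continuousOn.mono hsub
  have hν := hX.continuousOn_nu hsub hne
  have hwc : ∀ i ≤ N, ContinuousOn (X.w i) (Icc x₁ b) := by
    intro i hi
    by_cases hi' : i ∈ Finset.Icc 1 (N - 1)
    · exact (hX.smooth_w i hi').continuousOn.mono hsub
    · have : i = 0 ∨ i = N := by rw [Finset.mem_Icc] at hi'; omega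
      have h0 : X.w i = fun _ => 0 := by
        ext x
        rcases this with h | h
        · rw [h, hX.w_zero]
        · rw [h, hX.w_last]
      rw [h0]; exact continuousOn_const
  have hj' := Finset.mem_Icc.1 hj
  have w1 := hwc j (by omega)
  have w2 := hwc (j + 1) (by omega)
  have w3 := hwc (j - 1) (by omega)
  have k1 := hc₁.mono hsub1
  have k2 := hc₂.mono hsub1
  have hdwc := (hX.smooth_dw j hj).continuousOn.mono hsub
  have hA : ContinuousOn (fun x => c₁ x / X.S x) (Icc x₁ b) := k1.div hS hSne
  have hB : ContinuousOn (fun x => c₂ x / (4 * X.S x) + X.S x *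
      (k - X.w j x ^ 2 + (X.w (j + 1) x ^ 2 + X.w (j - 1) x ^ 2) / 2) / x ^ 2) (Icc x₁ b) := by
    refine (k2.div (continuousOn_const.mul hS) fun x hx => ?_).add
      (ContinuousOn.div (by fun_prop) (by fun_prop) fun x hx => pow_ne_zero 2 (hne x hx))
    exact mul_ne_zero four_ne_zero (hSne x hx)
  obtain ⟨C₁, hC₁⟩ := isCompact_Icc.exists_bound_of_continuousOn hA
  obtain ⟨C₂, hC₂⟩ := isCompact_Icc.exists_bound_of_continuousOn hB
  -- The pair is `w_j` and `S ν w_j'`. The factor `S` cancels `σ`, leaving a derivative proportional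
  -- to `w_j`. The continuous functions `c₁`, `c₂` replace quotients by `ν`, so that `x₁` may be a
  -- horizon.
  refine eq_zero_of_singular_linear (a := x₁) (b := b) (C := max (max C₁ C₂) 0) (φ := X.w j)
    (ψ := fun x => X.S x * (X.nu k ℓ x * X.dw j x)) (φ' := X.dw j)
    (ψ' := fun x => -((c₂ x / (4 * X.S x) + X.S x *
      (k - X.w j x ^ 2 + (X.w (j + 1) x ^ 2 + X.w (j - 1) x ^ 2) / 2) / x ^ 2) * X.w j x))
    w1 (hS.mul (hν.mul hdwc)) (fun t ht => ?_) (fun t ht => ?_) (fun t ht => ?_) (fun t ht => ?_)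
    (le_max_right _ _) hw (by simp [hdw]) b ⟨hb.1, le_rfl⟩
  all_goals
    have htI : t ∈ Icc x₁ b := ⟨ht.1.le, ht.2.le⟩
    have ht1 : t ∈ Ioo x₁ 1 := ⟨ht.1, ht.2.trans hb.2⟩
    have ht0 : t ∈ Ioo x₀ 1 := ⟨hx₁.1.trans_lt ht.1, ht.2.trans hb.2⟩
    have e1 := hSne t htI
    have e2 := (hX.nu_pos t ht0).ne'
    have e3 := hne t htI
  · exact (hX.equations t ht0).w j hj
  · have h := hX.equations t ht0
    refine (h.S.mul (h.flux j hj)).congr_deriv ?_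
    rw [wCoef, ← h₂ t ht1]
    field_simp
    ring
  · have h3 := hC₁ t htI
    have h4 : |X.dw j t| * (t - x₁) = ‖c₁ t / X.S t‖ * |X.S t * (X.nu k ℓ t * X.dw j t)| := by
      rw [Real.norm_eq_abs, ← abs_mul, ← h₁ t ht1, ← abs_of_pos (sub_pos.2 ht.1), ← abs_mul,
        abs_of_pos (sub_pos.2 ht.1)]
      congr 1
      field_simp
    rw [h4]
    exact mul_le_mul_of_nonneg_right (h3.trans ((le_max_left _ _).trans (le_max_left _ _)))
      (abs_nonneg _)
  · have h3 := hC₂ t htI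
    rw [abs_neg, abs_mul]
    exact mul_le_mul_of_nonneg_right (h3.trans ((le_max_right _ _).trans (le_max_left _ _)))
      (abs_nonneg _)

theorem nodes_eq_encard {r₀ : ℝ} (hr₀ : 0 ≤ r₀) (f : ℝ → ℝ) :
    nodes r₀ f = {x | x ∈ Ioo (r₀ / (1 + r₀)) 1 ∧ f (x / (1 - x)) = 0}.encard := by
  have hinv : ∀ r, r₀ < r → r / (1 + r) / (1 - r / (1 + r)) = r := by
    intro r hr
    have h : 0 < 1 + r := by linarith
    have h1 : 1 - r / (1 + r) = 1 / (1 + r) := by field_simp; ring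
    rw [h1]; field_simp
  have hinv' : ∀ x : ℝ, x < 1 → x / (1 - x) / (1 + x / (1 - x)) = x := by
    intro x hx
    have h : 0 < 1 - x := by linarith
    have h1 : 1 + x / (1 - x) = 1 / (1 - x) := by field_simp; ring
    rw [h1]; field_simp
  have hbij : BijOn (fun r => r / (1 + r)) {r | r₀ < r ∧ f r = 0}
      {x | x ∈ Ioo (r₀ / (1 + r₀)) 1 ∧ f (x / (1 - x)) = 0} := by
    refine ⟨fun r hr => ⟨div_one_add_mem_Ioo hr₀ hr.1, ?_⟩, fun r hr r' hr' e => ?_,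
      fun x hx => ⟨x / (1 - x), ⟨div_one_sub_mem_Ioi hr₀ hx.1, hx.2⟩, hinv' x hx.1.2⟩⟩
    · simp only [hinv r hr.1]; exact hr.2
    · simp only at e
      rw [← hinv r hr.1, e, hinv r' hr'.1]
  rw [nodes, ← hbij.image_eq, hbij.injOn.encard_image]

/-- The node numbers of the gauge functions which do not tend to zero are stable. -/
theorem IsGlobalSolution.exists_nodes_eq {N : ℕ} (hN : 1 ≤ N) {k ℓ r₀ Sinf : ℝ} (hℓ : 0 < ℓ)
    (hr₀ : 0 ≤ r₀) {F : Fields} (hF : IsGlobalSolution N k ℓ r₀ Sinf F)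
    (hstart : ∀ j ∈ Finset.Icc 1 (N - 1), F.ω j r₀ = 0 → ∀ r ∈ Ici r₀, F.ω j r = 0) :
    ∃ ε > 0, ∀ Y : CompactFields,
      (∀ j ∈ Finset.Icc 1 (N - 1), ∀ x ∈ Ioo (r₀ / (1 + r₀)) 1,
        HasDerivAt (Y.w j) (Y.dw j x) x) →
      (∀ j ∈ Finset.Icc 1 (N - 1), ∀ x ∈ Ico (r₀ / (1 + r₀)) 1,
        |Y.w j x - (F.toCompact (r₀ / (1 + r₀))).w j x| < ε ∧
        |Y.dw j x - (F.toCompact (r₀ / (1 + r₀))).dw j x| < ε) →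
      ∀ j ∈ Finset.Icc 1 (N - 1), ¬ Tendsto (F.ω j) atTop (𝓝 0) →
        nodes r₀ ((Y.toFields N).ω j) = nodes r₀ (F.ω j) := by
  have hX := hF.toCompact hN hr₀
  obtain ⟨mL, wL, dwL, EL, dEL, hL⟩ := hF.hasLimits hN hℓ hr₀
  set x₀ := r₀ / (1 + r₀) with hx₀
  have hx₀0 : 0 ≤ x₀ := by positivity
  have hx₀1 : x₀ < 1 := by rw [hx₀, div_lt_one (by linarith)]; linarith
  set X := F.toCompact x₀ with hXdef
  have hXw : ∀ j r, r₀ ≤ r → F.ω j r = X.w j (r / (1 + r)) := by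
    intro j r hr
    have h : 0 < 1 + r := by linarith
    have h1 : 1 - r / (1 + r) = 1 / (1 + r) := by field_simp; ring
    change _ = F.ω j (r / (1 + r) / (1 - r / (1 + r)))
    rw [h1]; congr 1; field_simp
  have each : ∀ j ∈ Finset.Icc 1 (N - 1), ∀ᶠ ε in 𝓝[>] (0 : ℝ), ∀ Y : CompactFields,
      (∀ x ∈ Ioo x₀ 1, HasDerivAt (Y.w j) (Y.dw j x) x) →
      (∀ x ∈ Ico x₀ 1, |Y.w j x - X.w j x| < ε ∧ |Y.dw j x - X.dw j x| < ε) →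
      ¬ Tendsto (F.ω j) atTop (𝓝 0) → nodes r₀ ((Y.toFields N).ω j) = nodes r₀ (F.ω j) := by
    intro j hj
    by_cases hT : Tendsto (F.ω j) atTop (𝓝 0)
    · exact Eventually.of_forall fun ε Y _ _ h => absurd hT h
    have hξ : Tendsto (fun r : ℝ => r / (1 + r)) atTop (𝓝[<] 1) := by
      refine tendsto_nhdsWithin_iff.2 ⟨?_, ?_⟩
      · have h2 : Tendsto (fun r : ℝ => 1 - 1 / (1 + r)) atTop (𝓝 (1 - 0)) :=
          tendsto_const_nhds.sub (tendsto_const_nhds.div_atTop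
            (tendsto_atTop_add_const_left _ _ tendsto_id))
        rw [sub_zero] at h2
        refine h2.congr' ?_
        filter_upwards [eventually_gt_atTop 0] with r hr
        field_simp; ring
      · filter_upwards [eventually_gt_atTop 0] with r hr
        rw [mem_Iio, div_lt_one (by linarith)]; linarith
    have hlim : Tendsto (F.ω j) atTop (𝓝 (wL j)) := by
      refine ((hL.w j hj).comp hξ).congr' ?_
      filter_upwards [eventually_ge_atTop r₀] with r hr using (hXw j r hr).symm
    have hwL : wL j ≠ 0 := fun h => hT (h ▸ hlim)
    -- A non-zero limit is incompatible with vanishing on a final interval. This rules out both a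
    -- zero at the start and a double zero inside.
    have hnz : ∀ x₁ ∈ Ico x₀ 1, ¬ ∀ x ∈ Ico x₁ 1, X.w j x = 0 := by
      intro x₁ hx₁ h
      refine hwL (tendsto_nhds_unique (hL.w j hj) (tendsto_const_nhds.congr' ?_))
      filter_upwards [Ioo_mem_nhdsLT hx₁.2] with x hx using (h x ⟨hx.1.le, hx.2⟩).symm
    have ha : X.w j x₀ ≠ 0 := by
      intro h
      rw [hx₀, ← hXw j r₀ le_rfl] at h
      exact hnz x₀ ⟨le_rfl, hx₀1⟩ fun x hx =>
        hstart j hj h _ (div_one_sub_mem_Ici hr₀ hx)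
    obtain ⟨ε, hε, hs⟩ := encard_zeros_eq_of_near hx₀1 (hX.smooth_w j hj).continuousOn
      (hX.smooth_dw j hj).continuousOn (hL.w j hj) (hL.dw j hj) hwL ha
      (fun x hx => (hX.equations x hx).w j hj) (fun x₁ hx₁ h0 h0' => by
        have hpos : 0 < x₁ := hx₀0.trans_lt hx₁.1
        have hsub : Ico x₁ 1 ⊆ Ico x₀ 1 := Ico_subset_Ico_left hx₁.1.le
        have hνc := hX.continuousOn_nu hsub fun x hx => (hpos.trans_le hx.1).ne'
        have hν0 : ∀ x ∈ Ico x₁ 1, X.nu k ℓ x ≠ 0 := fun x hx =>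
          (hX.nu_pos x ⟨hx₁.1.trans_le hx.1, hx.2⟩).ne'
        have hEc := (hX.smooth_E j hj).continuousOn.mono hsub
        refine hnz x₁ ⟨hx₁.1.le, hx₁.2⟩ (hX.w_eq_zero hj ⟨hx₁.1.le, hx₁.2⟩ hpos
          (c₁ := fun x => (x - x₁) / X.nu k ℓ x) (c₂ := fun x => X.E j x ^ 2 / X.nu k ℓ x)
          (ContinuousOn.div (by fun_prop) hνc hν0) ((hEc.pow 2).div hνc hν0)
          (fun _ _ => rfl) (fun _ _ => rfl) h0 (by rw [h0', mul_zero])))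
    filter_upwards [Ioo_mem_nhdsGT hε] with ε' hε' Y hY hYX _
    rw [nodes_eq_encard hr₀, nodes_eq_encard hr₀]
    have e : {x | x ∈ Ioo x₀ 1 ∧ (Y.toFields N).ω j (x / (1 - x)) = 0} =
        {x | x ∈ Ioo x₀ 1 ∧ Y.w j x = 0} := by
      ext x
      refine and_congr_right fun hx => ?_
      have h : 0 < 1 - x := by linarith [hx.2]
      have h1 : 1 + x / (1 - x) = 1 / (1 - x) := by field_simp; ring
      have h2 : x / (1 - x) / (1 + x / (1 - x)) = x := by rw [h1]; field_simp
      change Y.w j (x / (1 - x) / (1 + x / (1 - x))) = 0 ↔ _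
      rw [h2]
    rw [e]
    exact hs (Y.w j) (Y.dw j) hY (fun x hx => (hYX x hx).1.trans hε'.2)
      fun x hx => (hYX x hx).2.trans hε'.2
  -- Each index admits all sufficiently small `ε`, and there are finitely many indices, so one `ε`
  -- serves for all.
  obtain ⟨ε, hε, hε0⟩ := (((Finset.eventually_all _).2 each).and self_mem_nhdsWithin).exists
  exact ⟨ε, hε0, fun Y hY hYX j hj => hε j hj Y (hY j hj) (hYX j hj)⟩

/-! ### Continuous dependence measured by functions of the state. -/

/-- `exists_regular_singular_solution_near` with control of a continuous function of the
variables. -/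
theorem exists_regular_singular_solution_near_of_continuousOn {ι κ J : Type*} [Fintype ι]
    [Fintype κ] [Finite J] {T : ℝ}
    (hT : 0 < T) {lam : κ → ℕ} (hlam : ∀ i, lam i ≠ 0)
    {U : Set (ℝ × (ι → ℝ) × (κ → ℝ))} (hU : IsOpen U) {V : Set (ℝ × (ι → ℝ))} (hV : IsOpen V)
    (hUV : ∀ z ∈ U, (z.1, z.2.1) ∈ V)
    {f : ℝ × (ι → ℝ) × (κ → ℝ) → ι → ℝ} (hf : ContDiffOn ℝ (⊤ : ℕ∞) f U)
    {g : ℝ × (ι → ℝ) × (κ → ℝ) → κ → ℝ} (hg : ContDiffOn ℝ (⊤ : ℕ∞) g U)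
    {h : ℝ × (ι → ℝ) → κ → ℝ} (hh : ContDiffOn ℝ (⊤ : ℕ∞) h V)
    {o : ℝ × (ι → ℝ) × (κ → ℝ) → J → ℝ} (ho : ∀ j, ContinuousOn (fun z => o z j) U)
    {p : ℝ → ι → ℝ} {q : ℝ → κ → ℝ} {pT : ι → ℝ} {qT : κ → ℝ}
    (hpc : ContinuousOn p (Ico 0 T)) (hpT : Tendsto p (𝓝[<] T) (𝓝 pT))
    (hqc : ContinuousOn q (Ico 0 T)) (hqT : Tendsto q (𝓝[<] T) (𝓝 qT))
    (hmem : ∀ t ∈ Ico 0 T, (t, p t, q t) ∈ U) (hmemT : (T, pT, qT) ∈ U)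
    (hp : ∀ t ∈ Ioo 0 T, ∀ i, HasDerivAt (fun s => p s i) (f (t, p t, q t) i) t)
    (hq : ∀ t ∈ Ioo 0 T, ∀ i, HasDerivAt (fun s => q s i)
      ((h (t, p t) i - lam i * q t i) / t + g (t, p t, q t) i) t)
    {ε : ℝ} (hε : 0 < ε) :
    ∃ δ > 0, ∀ c : ι → ℝ, (∀ i, |c i - p 0 i| < δ) →
      ∃ (P : ℝ → ι → ℝ) (Q : ℝ → κ → ℝ), ContDiffOn ℝ (⊤ : ℕ∞) P (Icc 0 T) ∧
        ContDiffOn ℝ (⊤ : ℕ∞) Q (Icc 0 T) ∧ P 0 = c ∧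
        (∀ t ∈ Icc 0 T, (t, P t, Q t) ∈ U) ∧
        (∀ t ∈ Ioo 0 T, ∀ i, HasDerivAt (fun s => P s i) (f (t, P t, Q t) i) t) ∧
        (∀ t ∈ Ioo 0 T, ∀ i, HasDerivAt (fun s => Q s i)
          ((h (t, P t) i - lam i * Q t i) / t + g (t, P t, Q t) i) t) ∧
        ∀ t ∈ Ico 0 T, ∀ j, |o (t, P t, Q t) j - o (t, p t, q t) j| < ε := by
  have hzT : Tendsto (fun t => (t, p t, q t)) (𝓝[<] T) (𝓝 (T, pT, qT)) :=
    (tendsto_id.mono_left nhdsWithin_le_nhds).prodMk_nhds (hpT.prodMk_nhds hqT)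
  have hex : ∀ j, ∃ O : ℝ → ℝ, Continuous O ∧
      EqOn O (fun t => o (t, p t, q t) j) (Ico 0 T) ∧ O T = o (T, pT, qT) j := fun j =>
    exists_continuous_eqOn_Ico hT ((ho j).comp (continuousOn_id.prodMk (hpc.prodMk hqc)) hmem)
      (((ho j).continuousAt (hU.mem_nhds hmemT)).tendsto.comp hzT)
  choose O hOc hO hOT using hex
  -- Shrinking the domain to the states whose observables are `ε`-close to the reference values
  -- makes the closeness a consequence of staying in the domain.
  set U' := U ∩ ⋂ j, U ∩ (fun z => o z j - O j z.1) ⁻¹' Ioo (-ε) ε with hU'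
  have hU'o : IsOpen U' := hU.inter (isOpen_iInter_of_finite fun j =>
    ((ho j).sub (by fun_prop)).isOpen_inter_preimage hU isOpen_Ioo)
  have hsub : U' ⊆ U := inter_subset_left
  obtain ⟨δ, hδ, hex⟩ := exists_regular_singular_solution_near hT hlam hU'o hV
    (fun z hz => hUV z (hsub hz)) (hf.mono hsub) (hg.mono hsub) hh hpc hpT hqc hqT
    (fun t ht => ⟨hmem t ht, mem_iInter.2 fun j => ⟨hmem t ht, by simp [hO j ht, hε]⟩⟩)
    ⟨hmemT, mem_iInter.2 fun j => ⟨hmemT, by simp [hOT j, hε]⟩⟩ hp hq hε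
  refine ⟨δ, hδ, fun c hc => ?_⟩
  obtain ⟨P, Q, h1, h2, h3, h4, h5, h6, -⟩ := hex c hc
  refine ⟨P, Q, h1, h2, h3, fun t ht => hsub (h4 t ht), h5, h6, fun t ht j => ?_⟩
  have := (mem_iInter.1 (h4 t ⟨ht.1, ht.2.le⟩).2 j).2
  rw [mem_preimage, hO j ht] at this
  exact abs_lt.2 this

/-! ### Vectors made of two indexed families and a scalar -/

abbrev Idx (N : ℕ) : Type := ↥(Finset.Icc 1 (N - 1))

/-- Both the regular unknowns `p` and the singular unknowns `q`, at the horizon as at the origin,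
consist of two families indexed by `1, …, N - 1` and one scalar. -/
abbrev BlockIdx (N : ℕ) : Type := Idx N ⊕ Idx N ⊕ Unit

/-- The sequence equal to `v` on `1, …, N - 1` and zero elsewhere. -/
def restrictIdx (N : ℕ) (v : ℕ → ℝ) (j : ℕ) : ℝ := if j ∈ Finset.Icc 1 (N - 1) then v j else 0

/-- The first family. -/
def blockA {N : ℕ} (v : BlockIdx N → ℝ) (j : ℕ) : ℝ :=
  if h : j ∈ Finset.Icc 1 (N - 1) then v (Sum.inl ⟨j, h⟩) else 0

/-- The second family. -/
def blockB {N : ℕ} (v : BlockIdx N → ℝ) (j : ℕ) : ℝ :=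
  if h : j ∈ Finset.Icc 1 (N - 1) then v (Sum.inr (Sum.inl ⟨j, h⟩)) else 0

/-- The scalar. -/
def blockC {N : ℕ} (v : BlockIdx N → ℝ) : ℝ := v (Sum.inr (Sum.inr ()))

def blocks (N : ℕ) (A B : ℕ → ℝ) (C : ℝ) : BlockIdx N → ℝ :=
  Sum.elim (fun i => A i) (Sum.elim (fun i => B i) fun _ => C)

section Blocks

variable {N : ℕ}

theorem restrictIdx_of_mem {v : ℕ → ℝ} {j : ℕ} (hj : j ∈ Finset.Icc 1 (N - 1)) :
    restrictIdx N v j = v j := if_pos hj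

theorem restrictIdx_of_le {v : ℕ → ℝ} (h0 : v 0 = 0) (hN : v N = 0) {j : ℕ} (hj : j ≤ N) :
    restrictIdx N v j = v j := by
  by_cases h : j ∈ Finset.Icc 1 (N - 1)
  · exact if_pos h
  · rw [restrictIdx, if_neg h]
    have : j = 0 ∨ j = N := by rw [Finset.mem_Icc] at h; omega
    rcases this with rfl | rfl
    · exact h0.symm
    · exact hN.symm

theorem blockA_blocks (A B : ℕ → ℝ) (C : ℝ) : blockA (blocks N A B C) = restrictIdx N A := by
  ext j; by_cases h : j ∈ Finset.Icc 1 (N - 1) <;> simp [blockA, restrictIdx, h, blocks]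

theorem blockB_blocks (A B : ℕ → ℝ) (C : ℝ) : blockB (blocks N A B C) = restrictIdx N B := by
  ext j; by_cases h : j ∈ Finset.Icc 1 (N - 1) <;> simp [blockB, restrictIdx, h, blocks]

theorem blockC_blocks (A B : ℕ → ℝ) (C : ℝ) : blockC (blocks N A B C) = C := rfl

theorem blockA_of_mem (v : BlockIdx N → ℝ) {j : ℕ} (hj : j ∈ Finset.Icc 1 (N - 1)) :
    blockA v j = v (Sum.inl ⟨j, hj⟩) := dif_pos hj

theorem blockB_of_mem (v : BlockIdx N → ℝ) {j : ℕ} (hj : j ∈ Finset.Icc 1 (N - 1)) :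
    blockB v j = v (Sum.inr (Sum.inl ⟨j, hj⟩)) := dif_pos hj

theorem blockA_of_notMem (v : BlockIdx N → ℝ) {j : ℕ} (hj : j ∉ Finset.Icc 1 (N - 1)) :
    blockA v j = 0 := dif_neg hj

theorem forall_blockIdx {p : BlockIdx N → Prop} :
    (∀ i, p i) ↔ (∀ j (h : j ∈ Finset.Icc 1 (N - 1)), p (Sum.inl ⟨j, h⟩)) ∧
      (∀ j (h : j ∈ Finset.Icc 1 (N - 1)), p (Sum.inr (Sum.inl ⟨j, h⟩))) ∧
      p (Sum.inr (Sum.inr ())) := by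
  constructor
  · intro h; exact ⟨fun _ _ => h _, fun _ _ => h _, h _⟩
  · rintro ⟨h1, h2, h3⟩ (⟨j, hj⟩ | ⟨j, hj⟩ | _)
    exacts [h1 j hj, h2 j hj, h3]

theorem continuousOn_blocks {s : Set ℝ} {A B : ℝ → ℕ → ℝ} {C : ℝ → ℝ}
    (hA : ∀ j ∈ Finset.Icc 1 (N - 1), ContinuousOn (fun t => A t j) s)
    (hB : ∀ j ∈ Finset.Icc 1 (N - 1), ContinuousOn (fun t => B t j) s) (hC : ContinuousOn C s) :
    ContinuousOn (fun t => blocks N (A t) (B t) (C t)) s :=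
  continuousOn_pi.2 (forall_blockIdx.2 ⟨hA, hB, hC⟩)

theorem tendsto_blocks {l : Filter ℝ} {A B : ℝ → ℕ → ℝ} {C : ℝ → ℝ} {a b : ℕ → ℝ} {c : ℝ}
    (hA : ∀ j ∈ Finset.Icc 1 (N - 1), Tendsto (fun t => A t j) l (𝓝 (a j)))
    (hB : ∀ j ∈ Finset.Icc 1 (N - 1), Tendsto (fun t => B t j) l (𝓝 (b j)))
    (hC : Tendsto C l (𝓝 c)) :
    Tendsto (fun t => blocks N (A t) (B t) (C t)) l (𝓝 (blocks N a b c)) :=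
  tendsto_pi_nhds.2 (forall_blockIdx.2 ⟨hA, hB, hC⟩)

theorem contDiffOn_blocks {V : Type*} [NormedAddCommGroup V] [NormedSpace ℝ V] {s : Set V}
    {A B : V → ℕ → ℝ} {C : V → ℝ}
    (hA : ∀ j ∈ Finset.Icc 1 (N - 1), ContDiffOn ℝ (⊤ : ℕ∞) (fun t => A t j) s)
    (hB : ∀ j ∈ Finset.Icc 1 (N - 1), ContDiffOn ℝ (⊤ : ℕ∞) (fun t => B t j) s)
    (hC : ContDiffOn ℝ (⊤ : ℕ∞) C s) :
    ContDiffOn ℝ (⊤ : ℕ∞) (fun t => blocks N (A t) (B t) (C t)) s :=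
  contDiffOn_pi.2 (forall_blockIdx.2 ⟨hA, hB, hC⟩)

section

variable {V : Type*} [NormedAddCommGroup V] [NormedSpace ℝ V] {s : Set V} {v : V → BlockIdx N → ℝ}

theorem contDiffOn_blockA (hv : ContDiffOn ℝ (⊤ : ℕ∞) v s) (j : ℕ) :
    ContDiffOn ℝ (⊤ : ℕ∞) (fun z => blockA (v z) j) s := by
  by_cases h : j ∈ Finset.Icc 1 (N - 1)
  · simp only [blockA_of_mem _ h]; exact contDiffOn_pi.1 hv _
  · simp only [blockA_of_notMem _ h]; exact contDiffOn_const

theorem contDiffOn_blockB (hv : ContDiffOn ℝ (⊤ : ℕ∞) v s) (j : ℕ) :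
    ContDiffOn ℝ (⊤ : ℕ∞) (fun z => blockB (v z) j) s := by
  by_cases h : j ∈ Finset.Icc 1 (N - 1)
  · simp only [blockB_of_mem _ h]; exact contDiffOn_pi.1 hv _
  · simp only [blockB, dif_neg h]; exact contDiffOn_const

theorem contDiffOn_blockC (hv : ContDiffOn ℝ (⊤ : ℕ∞) v s) :
    ContDiffOn ℝ (⊤ : ℕ∞) (fun z => blockC (v z)) s := contDiffOn_pi.1 hv _

end

variable {w E : ℕ → ℝ}

theorem zetaSum_restrictIdx :
    zetaSum N (restrictIdx N w) (restrictIdx N E) = zetaSum N w E :=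
  Finset.sum_congr rfl fun j hj => by rw [restrictIdx_of_mem hj, restrictIdx_of_mem hj]

theorem sumSq_restrictIdx : sumSq N (restrictIdx N w) = sumSq N w :=
  sumSq_congr fun _ hj => restrictIdx_of_mem hj

theorem etaSum_restrictIdx : etaSum N (restrictIdx N w) = etaSum N w :=
  etaSum_congr fun _ hj => restrictIdx_of_mem hj

theorem pressure_restrictIdx (h0 : w 0 = 0) (hN : w N = 0) (k x : ℝ) :
    pressure N k x (restrictIdx N w) = pressure N k x w := by
  rw [pressure, pressure]
  refine congrArg _ (Finset.sum_congr rfl fun j hj => ?_)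
  have := Finset.mem_Icc.1 hj
  rw [restrictIdx_of_le h0 hN (by omega), restrictIdx_of_le h0 hN (by omega)]

theorem wCoef_restrictIdx (h0 : w 0 = 0) (hN : w N = 0) (k : ℝ) {j : ℕ}
    (hj : j ∈ Finset.Icc 1 (N - 1)) : wCoef k (restrictIdx N w) j = wCoef k w j := by
  have := Finset.mem_Icc.1 hj
  rw [wCoef, wCoef, restrictIdx_of_le h0 hN (by omega), restrictIdx_of_le h0 hN (by omega),
    restrictIdx_of_le h0 hN (by omega)]

theorem elecForce_restrictIdx (h0 : w 0 = 0) (hN : w N = 0) {j : ℕ}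
    (hj : j ∈ Finset.Icc 1 (N - 1)) :
    elecForce (restrictIdx N w) (restrictIdx N E) j = elecForce w E j := by
  have hj' := Finset.mem_Icc.1 hj
  have key : ∀ i ≤ N, restrictIdx N w i ^ 2 * restrictIdx N E i = w i ^ 2 * E i := by
    intro i hi
    by_cases h : i ∈ Finset.Icc 1 (N - 1)
    · rw [restrictIdx_of_mem h, restrictIdx_of_mem h]
    · have : i = 0 ∨ i = N := by rw [Finset.mem_Icc] at h; omega
      rw [restrictIdx_of_le h0 hN hi]
      rcases this with rfl | rfl <;> simp [h0, hN]
  rw [elecForce, elecForce, key _ (by omega), key _ (by omega), key _ (by omega)]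

theorem elecForce_mul (a : ℝ) (w E : ℕ → ℝ) (j : ℕ) :
    elecForce w (fun i => a * E i) j = a * elecForce w E j := by
  simp only [elecForce]; ring

end Blocks

/-! ### Horizon variables -/

/-- The mass at a horizon of radius `rh`. -/
noncomputable def horizonMass (k ℓ rh : ℝ) : ℝ := rh / 2 * (k + rh ^ 2 / ℓ ^ 2)

/-- The quotient `ν / (x - x₀)` near a horizon, when `m = horizonMass + (x - x₀) a`. -/
noncomputable def horizonNu (k ℓ rh x a : ℝ) : ℝ :=
  (1 + rh) / x * (k * (1 - x) ^ 2 +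
    (x ^ 2 + x * (rh * (1 - x)) + (rh * (1 - x)) ^ 2) / ℓ ^ 2) - 2 * a * (1 - x) ^ 3 / x

/-- The terms in `k` contain the factor `x - rh (1 - x)`, and those in `1 / ℓ²` contain `x³ - rh³ (1
- x)³`. Factoring this difference of cubes exhibits `x - rh (1 - x)`, which is `(1 + rh)` times the
distance from the horizon. -/
theorem nuOf_horizonMass_add (k ℓ : ℝ) {rh x a : ℝ} (hrh : 0 < rh) (hx : 0 < x) :
    nuOf k ℓ (horizonMass k ℓ rh + (x - rh / (1 + rh)) * a) x =
      (x - rh / (1 + rh)) * horizonNu k ℓ rh x a := by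
  have h1 : 1 + rh ≠ 0 := by positivity
  have h2 : x - rh / (1 + rh) = (x - rh * (1 - x)) / (1 + rh) := by field_simp; ring
  rw [h2, nuOf, horizonMass, horizonNu]
  by_cases hl : ℓ = 0
  · subst hl; simp; field_simp; ring
  · field_simp
    ring

/-- The regularised expression for the logarithmic derivative of `S`. -/
noncomputable def horizonSigma (N : ℕ) (x n S : ℝ) (w κ ε : ℕ → ℝ) : ℝ :=
  (1 - x) ^ 3 * (zetaSum N w ε / (2 * n ^ 2 * S ^ 2 * x) + 2 * sumSq N κ / (n ^ 2 * x))

theorem sumSq_div (N : ℕ) (n : ℝ) (κ : ℕ → ℝ) :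
    sumSq N (fun j => κ j / n) = sumSq N κ / n ^ 2 := by
  simp only [sumSq, Finset.sum_div, div_pow]

/-- The double pole `1 / ν²` is cancelled by the simple zeros of the electric functions, whose
squares contribute `t²`. -/
theorem sigmaOf_horizon (N : ℕ) {t x n S : ℝ} (ht : t ≠ 0) (w κ ε : ℕ → ℝ) :
    sigmaOf N x (t * n) S w (fun j => κ j / n) (fun j => t * ε j) =
      horizonSigma N x n S w κ ε := by
  rw [sigmaOf, horizonSigma, zetaSum_mul, sumSq_div, ← div_div (2 * sumSq N κ), mul_div_assoc]
  congr 2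
  · field_simp
  · ring

/-- The separation into terms with and without a factor `t` decides which go into `horizonG` and
which into `horizonH`; the latter contain only regular unknowns. -/
theorem massOf_horizon (N : ℕ) (k : ℝ) {t x n S : ℝ} (ht : t ≠ 0) (hn : n ≠ 0)
    (w κ ε D : ℕ → ℝ) :
    massOf N k x (t * n) S w (fun j => κ j / n) (fun j => t * ε j) D =
      x ^ 2 * etaSum N D / (4 * S ^ 2) + pressure N k x w +
        t * (zetaSum N w ε / (4 * n * S ^ 2) + sumSq N κ / n) := by
  rw [massOf, zetaSum_mul, sumSq_div]
  field_simp
  ring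

/-- Phase space. -/
abbrev Phase (N : ℕ) : Type := ℝ × (BlockIdx N → ℝ) × (BlockIdx N → ℝ)

noncomputable section HorizonSystem

variable (N : ℕ) (k ℓ rh : ℝ)

def horizonN (z : Phase N) : ℝ := horizonNu k ℓ rh (rh / (1 + rh) + z.1) (blockC z.2.2)

def horizonS (z : Phase N) : ℝ :=
  horizonSigma N (rh / (1 + rh) + z.1) (horizonN N k ℓ rh z) (blockC z.2.1) (blockA z.2.1)
    (blockA z.2.2) (blockB z.2.2)

/-- Right-hand side for `p = (ω, 𝓔', S)`. The singular unknowns are `q = (κ, ε, a)` with `ν ω' = t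
κ`, `𝓔 = t ε` and `m = horizonMass + t a`. -/
def horizonF (z : Phase N) : BlockIdx N → ℝ :=
  blocks N (fun j => blockA z.2.2 j / horizonN N k ℓ rh z)
    (fun j => (horizonS N k ℓ rh z - 2 / (rh / (1 + rh) + z.1)) * blockB z.2.1 j +
      elecForce (blockA z.2.1) (blockB z.2.2) j /
        (horizonN N k ℓ rh z * (rh / (1 + rh) + z.1) ^ 2))
    (blockC z.2.1 * horizonS N k ℓ rh z)

/-- The derivatives of the flux, of `𝓔` and of `m` on the horizon. They determine `κ`, `ε`, `a` at
`t = 0`. Depending on `(t, p)` only is essential for the elimination of the `1 / t` term. -/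
def horizonH (z : ℝ × (BlockIdx N → ℝ)) : BlockIdx N → ℝ :=
  blocks N (fun j => -(wCoef k (blockA z.2) j * blockA z.2 j / (rh / (1 + rh) + z.1) ^ 2))
    (fun j => blockB z.2 j)
    ((rh / (1 + rh) + z.1) ^ 2 * etaSum N (blockB z.2) / (4 * blockC z.2 ^ 2) +
      pressure N k (rh / (1 + rh) + z.1) (blockA z.2))

def horizonG (z : Phase N) : BlockIdx N → ℝ :=
  blocks N (fun j => -horizonS N k ℓ rh z * blockA z.2.2 j -
      blockA z.2.1 j * blockB z.2.2 j ^ 2 / (4 * horizonN N k ℓ rh z * blockC z.2.1 ^ 2))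
    (fun _ => 0)
    (zetaSum N (blockA z.2.1) (blockB z.2.2) / (4 * horizonN N k ℓ rh z * blockC z.2.1 ^ 2) +
      sumSq N (blockA z.2.2) / horizonN N k ℓ rh z)

def horizonDomain : Set (Phase N) :=
  {z | 0 < rh / (1 + rh) + z.1 ∧ 0 < blockC z.2.1} ∩ horizonN N k ℓ rh ⁻¹' Ioi 0

end HorizonSystem

section

variable {N : ℕ} {k ℓ rh : ℝ}

theorem contDiffOn_blocks_coord (s : Set (Phase N)) :
    ContDiffOn ℝ (⊤ : ℕ∞) (fun z : Phase N => z.1) s ∧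
    ContDiffOn ℝ (⊤ : ℕ∞) (fun z : Phase N => z.2.1) s ∧
    ContDiffOn ℝ (⊤ : ℕ∞) (fun z : Phase N => z.2.2) s :=
  ⟨contDiffOn_fst, contDiff_snd.fst.contDiffOn, contDiff_snd.snd.contDiffOn⟩

theorem contDiffOn_horizonN :
    ContDiffOn ℝ (⊤ : ℕ∞) (horizonN N k ℓ rh)
      {z | 0 < rh / (1 + rh) + z.1 ∧ 0 < blockC z.2.1} := by
  obtain ⟨h1, -, h3⟩ := contDiffOn_blocks_coord
    {z : Phase N | 0 < rh / (1 + rh) + z.1 ∧ 0 < blockC z.2.1}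
  have h4 := contDiffOn_blockC h3
  have h0 : ∀ z ∈ {z : Phase N | 0 < rh / (1 + rh) + z.1 ∧ 0 < blockC z.2.1},
    rh / (1 + rh) + z.1 ≠ 0 := fun z hz => hz.1.ne'
  unfold horizonN horizonNu
  generalize (rh / (1 + rh)) = x₀ at *
  fun_prop (disch := assumption)

theorem continuous_blockC : Continuous (blockC : (BlockIdx N → ℝ) → ℝ) := continuous_apply _

theorem isOpen_horizonDomain : IsOpen (horizonDomain N k ℓ rh) := by
  refine contDiffOn_horizonN.continuousOn.isOpen_inter_preimage ?_ isOpen_Ioi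
  have := continuous_blockC (N := N)
  exact (isOpen_lt (by fun_prop) (by fun_prop)).and (isOpen_lt (by fun_prop) (by fun_prop))

theorem contDiffOn_horizon :
    ContDiffOn ℝ (⊤ : ℕ∞) (horizonF N k ℓ rh) (horizonDomain N k ℓ rh) ∧
    ContDiffOn ℝ (⊤ : ℕ∞) (horizonG N k ℓ rh) (horizonDomain N k ℓ rh) := by
  obtain ⟨h1, h2, h3⟩ := contDiffOn_blocks_coord (horizonDomain N k ℓ rh)
  have hx : ContDiffOn ℝ (⊤ : ℕ∞) (fun z : Phase N => rh / (1 + rh) + z.1)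
    (horizonDomain N k ℓ rh) := contDiffOn_const.add h1
  have hn : ContDiffOn ℝ (⊤ : ℕ∞) (horizonN N k ℓ rh) (horizonDomain N k ℓ rh) :=
    contDiffOn_horizonN.mono inter_subset_left
  have hw := contDiffOn_blockA h2
  have hD := contDiffOn_blockB h2
  have hS := contDiffOn_blockC h2
  have hκ := contDiffOn_blockA h3
  have hε := contDiffOn_blockB h3
  have hx0 : ∀ z ∈ horizonDomain N k ℓ rh, rh / (1 + rh) + z.1 ≠ 0 := fun z hz => hz.1.1.ne'
  have hn0 : ∀ z ∈ horizonDomain N k ℓ rh, horizonN N k ℓ rh z ≠ 0 := fun z hz =>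
    (show 0 < horizonN N k ℓ rh z from hz.2).ne'
  have hS0 : ∀ z ∈ horizonDomain N k ℓ rh, blockC z.2.1 ≠ 0 := fun z hz => hz.1.2.ne'
  have hζ := contDiffOn_zetaSum (N := N) (fun j _ => hw j) (fun j _ => hε j)
  have hκ2 := contDiffOn_sumSq (N := N) (fun j _ => hκ j)
  have hσ : ContDiffOn ℝ (⊤ : ℕ∞) (horizonS N k ℓ rh) (horizonDomain N k ℓ rh) := by
    refine ((contDiffOn_const.sub hx).pow 3).mul ((hζ.div (((contDiffOn_const.mul
      (hn.pow 2)).mul (hS.pow 2)).mul hx) fun z hz => ?_).add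
      ((contDiffOn_const.mul hκ2).div ((hn.pow 2).mul hx) fun z hz => ?_))
    · have := hx0 z hz
      have := hn0 z hz
      have := hS0 z hz
      positivity
    · have := hx0 z hz
      have := hn0 z hz
      positivity
  have h4n : ∀ z ∈ horizonDomain N k ℓ rh,
      4 * horizonN N k ℓ rh z * blockC z.2.1 ^ 2 ≠ 0 := fun z hz => by
    have := hn0 z hz
    have := hS0 z hz
    positivity
  refine ⟨contDiffOn_blocks (fun j _ => (hκ j).div hn hn0) (fun j _ => ?_) (hS.mul hσ),
    contDiffOn_blocks (fun j _ => ?_) (fun j _ => contDiffOn_const) ?_⟩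
  · refine ((hσ.sub (contDiffOn_const.div hx hx0)).mul (hD j)).add
      ((contDiffOn_elecForce hw hε j).div (hn.mul (hx.pow 2)) fun z hz => ?_)
    exact mul_ne_zero (hn0 z hz) (pow_ne_zero 2 (hx0 z hz))
  · exact (hσ.neg.mul (hκ j)).sub (((hw j).mul ((hε j).pow 2)).div
      ((contDiffOn_const.mul hn).mul (hS.pow 2)) h4n)
  · exact (hζ.div ((contDiffOn_const.mul hn).mul (hS.pow 2)) h4n).add (hκ2.div hn hn0)

theorem contDiffOn_horizonH :
    ContDiffOn ℝ (⊤ : ℕ∞) (horizonH N k rh)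
      {z | 0 < rh / (1 + rh) + z.1 ∧ 0 < blockC z.2} := by
  set V := {z : ℝ × (BlockIdx N → ℝ) | 0 < rh / (1 + rh) + z.1 ∧ 0 < blockC z.2} with hV
  have h2 : ContDiffOn ℝ (⊤ : ℕ∞) (fun z : ℝ × (BlockIdx N → ℝ) => z.2) V := contDiffOn_snd
  have hx : ContDiffOn ℝ (⊤ : ℕ∞) (fun z : ℝ × (BlockIdx N → ℝ) => rh / (1 + rh) + z.1) V :=
    contDiffOn_const.add contDiffOn_fst
  have hw := contDiffOn_blockA h2
  have hD := contDiffOn_blockB h2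
  have hS := contDiffOn_blockC h2
  have hx0 : ∀ z ∈ V, rh / (1 + rh) + z.1 ≠ 0 := fun z hz => hz.1.ne'
  have hS0 : ∀ z ∈ V, blockC z.2 ≠ 0 := fun z hz => hz.2.ne'
  refine contDiffOn_blocks (fun j _ => (((contDiffOn_wCoef hw j).mul (hw j)).div (hx.pow 2)
    fun z hz => pow_ne_zero 2 (hx0 z hz)).neg) (fun j _ => hD j)
    ((((hx.pow 2).mul (contDiffOn_etaSum fun j _ => hD j)).div (contDiffOn_const.mul (hS.pow 2))
      fun z hz => mul_ne_zero four_ne_zero (pow_ne_zero 2 (hS0 z hz))).add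
      (contDiffOn_pressure hx hx0 hw))

theorem isOpen_horizonBase :
    IsOpen {z : ℝ × (BlockIdx N → ℝ) | 0 < rh / (1 + rh) + z.1 ∧ 0 < blockC z.2} := by
  have := continuous_blockC (N := N)
  exact (isOpen_lt (by fun_prop) (by fun_prop)).and (isOpen_lt (by fun_prop) (by fun_prop))

theorem HasDerivAt.of_id_mul {y : ℝ → ℝ} {v t : ℝ} (ht : t ≠ 0)
    (h : HasDerivAt (fun s => s * y s) v t) : HasDerivAt y ((v - y t) / t) t := by
  have h1 := h.div (hasDerivAt_id t) ht
  refine (h1.congr_of_eventuallyEq ?_).congr_deriv ?_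
  · filter_upwards [eventually_ne_nhds ht] with s hs
    simp [hs]
  · simp only [id]; field_simp

/-- As `μ = (1 + r)² ν` and `dx / dr = (1 + r)⁻²`, the factors cancel at the simple zero: the slope
of `μ` in `r` is the value of `n = ν / (x - x₀)`. Hence non-degeneracy of the horizon is positivity
of `n`. -/
theorem hasDerivWithinAt_mu_horizon (hrh : 0 < rh) {F : Fields} {n : ℝ → ℝ}
    (h : ∀ r ∈ Ici rh, F.mu k ℓ r =
      (r / (1 + r) - rh / (1 + rh)) * n (r / (1 + r)) * (1 + r) ^ 2)
    (hn : DifferentiableWithinAt ℝ n (Ico (rh / (1 + rh)) 1) (rh / (1 + rh))) :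
    HasDerivWithinAt (F.mu k ℓ) (n (rh / (1 + rh))) (Ici rh) rh := by
  have h0 : 1 + rh ≠ 0 := by positivity
  have h1 : HasDerivWithinAt (fun x => (x - rh / (1 + rh)) * n x) (n (rh / (1 + rh)))
      (Ico (rh / (1 + rh)) 1) (rh / (1 + rh)) := by
    refine (((hasDerivWithinAt_id _ _).sub_const _).mul hn.hasDerivWithinAt).congr_deriv ?_
    simp
  have h2 : HasDerivWithinAt (fun r : ℝ => r / (1 + r)) (1 / (1 + rh) ^ 2) (Ici rh) rh :=
    (hasDerivAt_div_one_add hrh.le).hasDerivWithinAt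
  have h3 := HasDerivWithinAt.comp (h := fun r : ℝ => r / (1 + r)) rh h1 h2
    fun r hr => div_one_add_mem_Ico hrh.le hr
  have h4 : HasDerivWithinAt (fun r : ℝ => (1 + r) ^ 2) (2 * (1 + rh)) (Ici rh) rh := by
    refine (((hasDerivWithinAt_id _ _).const_add 1).pow 2).congr_deriv ?_
    simp
  refine ((h3.mul h4).congr (fun r hr => ?_) ?_).congr_deriv ?_
  · exact h r hr
  · exact h rh self_mem_Ici
  · simp [Function.comp]
    field_simp

end

/-- The compactified fields built from a solution of the regularised horizon system. -/
noncomputable def horizonFields (N : ℕ) (k ℓ rh : ℝ) (P Q : ℝ → BlockIdx N → ℝ) :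
    CompactFields where
  m x := horizonMass k ℓ rh + (x - rh / (1 + rh)) * blockC (Q (x - rh / (1 + rh)))
  S x := blockC (P (x - rh / (1 + rh)))
  w j x := blockA (P (x - rh / (1 + rh))) j
  dw j x := blockA (Q (x - rh / (1 + rh))) j /
    horizonN N k ℓ rh (x - rh / (1 + rh), P (x - rh / (1 + rh)), Q (x - rh / (1 + rh)))
  E j x := (x - rh / (1 + rh)) * blockB (Q (x - rh / (1 + rh))) j
  dE j x := blockB (P (x - rh / (1 + rh))) j

section

variable {N : ℕ} {k ℓ rh : ℝ} {P Q : ℝ → BlockIdx N → ℝ}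

theorem horizonFields_nu (hrh : 0 < rh) {x : ℝ} (hx : 0 < x) :
    (horizonFields N k ℓ rh P Q).nu k ℓ x = (x - rh / (1 + rh)) * horizonN N k ℓ rh
      (x - rh / (1 + rh), P (x - rh / (1 + rh)), Q (x - rh / (1 + rh))) := by
  rw [horizonN, add_sub_cancel]
  exact nuOf_horizonMass_add k ℓ hrh hx

/-- Undoes the substitution: multiplying the equations for `κ`, `ε`, `a` by `t` gives those for the
flux, for `𝓔` and for `m`. Smoothness up to `x = 1` comes for free, since the system is solved on
the closed interval. -/
theorem horizonFields_isCompactSolution (hrh : 0 < rh)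
    (hP : ContDiffOn ℝ (⊤ : ℕ∞) P (Icc 0 (1 - rh / (1 + rh))))
    (hQ : ContDiffOn ℝ (⊤ : ℕ∞) Q (Icc 0 (1 - rh / (1 + rh))))
    (hU : ∀ t ∈ Icc 0 (1 - rh / (1 + rh)), (t, P t, Q t) ∈ horizonDomain N k ℓ rh)
    (hp : ∀ t ∈ Ioo 0 (1 - rh / (1 + rh)), ∀ i, HasDerivAt (fun s => P s i)
      (horizonF N k ℓ rh (t, P t, Q t) i) t)
    (hq : ∀ t ∈ Ioo 0 (1 - rh / (1 + rh)), ∀ i, HasDerivAt (fun s => Q s i)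
      ((horizonH N k rh (t, P t) i - ((1 : ℕ) : ℝ) * Q t i) / t +
        horizonG N k ℓ rh (t, P t, Q t) i) t) :
    IsCompactSolution N k ℓ (rh / (1 + rh)) (horizonFields N k ℓ rh P Q) ∧
    ContDiffOn ℝ (⊤ : ℕ∞) (horizonFields N k ℓ rh P Q).m (Icc (rh / (1 + rh)) 1) ∧
    ContDiffOn ℝ (⊤ : ℕ∞) (horizonFields N k ℓ rh P Q).S (Icc (rh / (1 + rh)) 1) ∧
    (∀ j, ContDiffOn ℝ (⊤ : ℕ∞) ((horizonFields N k ℓ rh P Q).w j) (Icc (rh / (1 + rh)) 1)) ∧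
    (∀ j, ContDiffOn ℝ (⊤ : ℕ∞) ((horizonFields N k ℓ rh P Q).dw j) (Icc (rh / (1 + rh)) 1)) ∧
    (∀ j, ContDiffOn ℝ (⊤ : ℕ∞) ((horizonFields N k ℓ rh P Q).E j) (Icc (rh / (1 + rh)) 1)) ∧
    (∀ j, ContDiffOn ℝ (⊤ : ℕ∞) ((horizonFields N k ℓ rh P Q).dE j) (Icc (rh / (1 + rh)) 1)) ∧
    ContDiffOn ℝ (⊤ : ℕ∞) (fun x => horizonN N k ℓ rh
      (x - rh / (1 + rh), P (x - rh / (1 + rh)), Q (x - rh / (1 + rh)))) (Icc (rh / (1 + rh)) 1)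
    := by
  have hx₀ : 0 < rh / (1 + rh) := by positivity
  set Y := horizonFields N k ℓ rh P Q with hY
  have hsh : ContDiffOn ℝ (⊤ : ℕ∞) (fun x : ℝ => x - rh / (1 + rh)) (Icc (rh / (1 + rh)) 1) :=
    contDiffOn_id.sub contDiffOn_const
  have hmaps : MapsTo (fun x : ℝ => x - rh / (1 + rh)) (Icc (rh / (1 + rh)) 1)
    (Icc 0 (1 - rh / (1 + rh))) := fun x hx => ⟨by linarith [hx.1], by linarith [hx.2]⟩
  have hP' := hP.comp hsh hmaps
  have hQ' := hQ.comp hsh hmaps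
  have hz : ContDiffOn ℝ (⊤ : ℕ∞) (fun x => horizonN N k ℓ rh
      (x - rh / (1 + rh), P (x - rh / (1 + rh)), Q (x - rh / (1 + rh)))) (Icc (rh / (1 + rh)) 1) :=
    contDiffOn_horizonN.comp (hsh.prodMk (hP'.prodMk hQ')) fun x hx => (hU _ (hmaps hx)).1
  have hn0 : ∀ x ∈ Icc (rh / (1 + rh)) 1, 0 < horizonN N k ℓ rh
      (x - rh / (1 + rh), P (x - rh / (1 + rh)), Q (x - rh / (1 + rh))) :=
    fun x hx => (hU _ (hmaps hx)).2
  have sm : ContDiffOn ℝ (⊤ : ℕ∞) Y.m (Icc (rh / (1 + rh)) 1) :=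
    contDiffOn_const.add (hsh.mul (contDiffOn_blockC hQ'))
  have sS : ContDiffOn ℝ (⊤ : ℕ∞) Y.S (Icc (rh / (1 + rh)) 1) := contDiffOn_blockC hP'
  have sw : ∀ j, ContDiffOn ℝ (⊤ : ℕ∞) (Y.w j) (Icc (rh / (1 + rh)) 1) := contDiffOn_blockA hP'
  have sdw : ∀ j, ContDiffOn ℝ (⊤ : ℕ∞) (Y.dw j) (Icc (rh / (1 + rh)) 1) := fun j =>
    (contDiffOn_blockA hQ' j).div hz fun x hx => (hn0 x hx).ne'
  have sE : ∀ j, ContDiffOn ℝ (⊤ : ℕ∞) (Y.E j) (Icc (rh / (1 + rh)) 1) := fun j =>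
    hsh.mul (contDiffOn_blockB hQ' j)
  have sdE : ∀ j, ContDiffOn ℝ (⊤ : ℕ∞) (Y.dE j) (Icc (rh / (1 + rh)) 1) := contDiffOn_blockB hP'
  refine ⟨⟨sm.mono Ico_subset_Icc_self, sS.mono Ico_subset_Icc_self,
    fun j _ => (sw j).mono Ico_subset_Icc_self, fun j _ => (sdw j).mono Ico_subset_Icc_self,
    fun j _ => (sE j).mono Ico_subset_Icc_self, fun j _ => (sdE j).mono Ico_subset_Icc_self,
    fun x => blockA_of_notMem _ (by simp), fun x => blockA_of_notMem _ ?_,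
    fun x hx => (hU _ (hmaps (Ico_subset_Icc_self hx))).1.2, fun x hx => ?_, fun x hx => ?_⟩,
    sm, sS, sw, sdw, sE, sdE, hz⟩
  · rw [Finset.mem_Icc]; omega
  · rw [horizonFields_nu hrh (hx₀.trans hx.1)]
    exact mul_pos (sub_pos.2 hx.1) (hn0 x (Ioo_subset_Icc_self hx))
  have hx0 : 0 < x := hx₀.trans hx.1
  have hν := horizonFields_nu (N := N) (k := k) (ℓ := ℓ) (P := P) (Q := Q) hrh hx0
  have hn := hn0 x (Ioo_subset_Icc_self hx)
  have hSp : 0 < Y.S x := (hU _ (hmaps (Ioo_subset_Icc_self hx))).1.2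
  have ht : x - rh / (1 + rh) ∈ Ioo 0 (1 - rh / (1 + rh)) :=
    ⟨by linarith [hx.1], by linarith [hx.2]⟩
  have hadd : rh / (1 + rh) + (x - rh / (1 + rh)) = x := by ring
  have hpx := fun i => (hp _ ht i).comp_sub_const x (rh / (1 + rh))
  have hqx := fun i => ((((hasDerivAt_id x).sub_const (rh / (1 + rh))).mul
    ((hq _ ht i).comp_sub_const x (rh / (1 + rh)))))
  set t := x - rh / (1 + rh) with htdef
  set n := horizonN N k ℓ rh (t, P t, Q t) with hndef
  have ht0 : t ≠ 0 := ht.1.ne'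
  have eσ : Y.sigma N k ℓ x = horizonS N k ℓ rh (t, P t, Q t) := by
    rw [CompactFields.sigma, hν, horizonS, hadd, ← hndef]
    exact sigmaOf_horizon N ht0 _ _ _
  obtain ⟨p1, p2, p3⟩ := forall_blockIdx.1 hpx
  obtain ⟨q1, q2, q3⟩ := forall_blockIdx.1 hqx
  have hwE : ∀ j ∈ Finset.Icc 1 (N - 1), HasDerivAt (Y.w j) (Y.dw j x) x := by
    intro j hj
    have := p1 j hj
    simp only [Y, horizonFields, blockA_of_mem _ hj]
    refine this.congr_deriv ?_
    simp [horizonF, blocks, blockA_of_mem _ hj, ← htdef, ← hndef]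
  refine ⟨hwE, fun j hj => ?_, ?_, ?_, fun j hj => ?_, fun j hj => ?_⟩
  · have := q2 j hj
    simp only [Y, horizonFields, blockB_of_mem _ hj]
    refine this.congr_deriv ?_
    simp [horizonH, horizonG, blocks, ← htdef, blockB_of_mem _ hj]
    field_simp
    ring
  · refine (q3.const_add (horizonMass k ℓ rh)).congr_deriv ?_
    rw [hν]
    refine Eq.trans ?_ (massOf_horizon N k (x := x) (S := blockC (P t)) ht0 hn.ne' (blockA (P t))
      (blockA (Q t)) (blockB (Q t)) (blockB (P t))).symm
    simp only [horizonH, horizonG, blocks, Sum.elim_inr, hadd, ← htdef, id, ← hndef]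
    push_cast
    field_simp
    ring
  · refine p3.congr_deriv ?_
    rw [eσ]; rfl
  · have := p2 j hj
    rw [eσ, hν]
    simp only [Y, horizonFields, blockB_of_mem _ hj, ← htdef]
    refine this.congr_deriv ?_
    simp only [horizonF, blocks, Sum.elim_inl, Sum.elim_inr, hadd, elecForce_mul,
      blockB_of_mem _ hj, ← hndef]
    field_simp
  · have := q1 j hj
    rw [eσ, hν]
    have hfl : (fun y => Y.nu k ℓ y * Y.dw j y) =ᶠ[𝓝 x]
        fun y => (y - rh / (1 + rh)) * blockA (Q (y - rh / (1 + rh))) j := by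
      filter_upwards [Ioo_mem_nhds hx.1 hx.2] with y hy
      have hny := hn0 y (Ioo_subset_Icc_self hy)
      rw [horizonFields_nu hrh (hx₀.trans hy.1)]
      simp only [Y, horizonFields]
      rw [mul_assoc, mul_div_cancel₀ _ hny.ne']
    refine HasDerivAt.congr_of_eventuallyEq ?_ hfl
    simp only [Y, horizonFields, blockA_of_mem _ hj, ← htdef, ← hndef]
    refine this.congr_deriv ?_
    simp only [horizonH, horizonG, blocks, Sum.elim_inl, hadd, ← htdef, id,
      blockA_of_mem _ hj, ← hndef]
    have hS' : blockC (P t) ≠ 0 := hSp.ne'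
    push_cast
    field_simp
    ring

end

/-! ### Black holes: the regularised system along a given solution, and nearby solutions. -/

theorem zetaSum_congr {N : ℕ} {w E E' : ℕ → ℝ} (h : ∀ j ∈ Finset.Icc 1 (N - 1), E j = E' j) :
    zetaSum N w E = zetaSum N w E' :=
  Finset.sum_congr rfl fun j hj => by rw [h j hj]

theorem elecForce_congr {N : ℕ} {w E E' : ℕ → ℝ} (h0 : w 0 = 0) (hN : w N = 0)
    (h : ∀ j ∈ Finset.Icc 1 (N - 1), E j = E' j) {j : ℕ} (hj : j ∈ Finset.Icc 1 (N - 1)) :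
    elecForce w E j = elecForce w E' j := by
  rw [← elecForce_restrictIdx h0 hN hj, ← elecForce_restrictIdx (E := E') h0 hN hj]
  congr 1
  ext i
  by_cases hi : i ∈ Finset.Icc 1 (N - 1) <;> simp [restrictIdx, hi]
  exact h i (by simpa using hi)

/-- A black hole gives a solution of the regularised horizon system. -/
theorem IsBlackHole.exists_horizon_solution {N : ℕ} (hN : 1 ≤ N) {k ℓ rh Sinf : ℝ} (hℓ : 0 < ℓ)
    (hrh : 0 < rh) {F : Fields} (hF : IsBlackHole N k ℓ rh Sinf F) {T : ℝ}
    (hT : T = 1 - rh / (1 + rh)) {X : CompactFields} (hX : X = F.toCompact (rh / (1 + rh))) :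
    ∃ (a n : ℝ → ℝ) (ε κ : ℕ → ℝ → ℝ) (p q : ℝ → BlockIdx N → ℝ) (pT qT : BlockIdx N → ℝ),
      (∀ t, p t = blocks N (X.w · (rh / (1 + rh) + t)) (X.dE · (rh / (1 + rh) + t))
        (X.S (rh / (1 + rh) + t))) ∧
      (∀ t, q t = blocks N (κ · t) (ε · t) (a t)) ∧
      (∀ t, n t = horizonN N k ℓ rh (t, p t, q t)) ∧
      (∀ j t, κ j t = n t * X.dw j (rh / (1 + rh) + t)) ∧
      (∀ j ∈ Finset.Icc 1 (N - 1), ∀ t ∈ Ico 0 T, X.E j (rh / (1 + rh) + t) = t * ε j t) ∧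
      (∀ t ∈ Ico 0 T, X.nu k ℓ (rh / (1 + rh) + t) = t * n t) ∧
      (∀ t ∈ Ico 0 T, X.m (rh / (1 + rh) + t) = horizonMass k ℓ rh + t * a t) ∧
      ContinuousOn p (Ico 0 T) ∧ Tendsto p (𝓝[<] T) (𝓝 pT) ∧
      ContinuousOn q (Ico 0 T) ∧ Tendsto q (𝓝[<] T) (𝓝 qT) ∧
      ContinuousOn n (Ico 0 T) ∧ (∀ j ∈ Finset.Icc 1 (N - 1), ContinuousOn (ε j) (Ico 0 T)) ∧
      (∀ t ∈ Ico 0 T, (t, p t, q t) ∈ horizonDomain N k ℓ rh) ∧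
      (T, pT, qT) ∈ horizonDomain N k ℓ rh := by
  have hG := hF.toIsGlobalSolution
  have hXs : IsCompactSolution N k ℓ (rh / (1 + rh)) X := hX ▸ hG.toCompact hN hrh.le
  obtain ⟨mL, wL, dwL, EL, dEL, hL⟩ := hG.hasLimits hN hℓ hrh.le
  rw [← hX] at hL
  set x₀ := rh / (1 + rh) with hx₀
  have hx₀0 : 0 < x₀ := by positivity
  have hx₀1 : x₀ < 1 := by rw [hx₀, div_lt_one (by linarith)]; linarith
  have hT0 : 0 < T := by linarith
  have hr1 : 1 - x₀ = 1 / (1 + rh) := by rw [hx₀]; field_simp; ring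
  have hx₀r : x₀ / (1 - x₀) = rh := by rw [hr1, hx₀]; field_simp
  have hmaps : MapsTo (fun t => x₀ + t) (Ico 0 T) (Ico x₀ 1) := fun t ht =>
    ⟨by linarith [ht.1], by linarith [ht.2]⟩
  have hsm : ∀ {φ : ℝ → ℝ}, ContDiffOn ℝ (⊤ : ℕ∞) φ (Ico x₀ 1) →
      ContDiffOn ℝ (⊤ : ℕ∞) (fun t => φ (x₀ + t)) (Ico 0 T) := fun h =>
    h.comp (contDiffOn_const.add contDiffOn_id) hmaps
  have hlim : Tendsto (fun t => x₀ + t) (𝓝[<] T) (𝓝[<] 1) := by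
    refine tendsto_nhdsWithin_iff.2 ⟨?_, ?_⟩
    · have : Tendsto (fun t => x₀ + t) (𝓝 T) (𝓝 (x₀ + T)) :=
        (continuous_const.add continuous_id).tendsto T
      rw [show x₀ + T = 1 by linarith] at this
      exact this.mono_left nhdsWithin_le_nhds
    · filter_upwards [self_mem_nhdsWithin] with t ht
      have : t < T := ht
      exact mem_Iio.2 (by linarith)
  have hTlim : Tendsto (fun t : ℝ => t) (𝓝[<] T) (𝓝 T) := tendsto_id.mono_left nhdsWithin_le_nhds
  have hevT : ∀ᶠ t in 𝓝[<] T, t ∈ Ioo 0 T := Ioo_mem_nhdsLT hT0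
  have hmh : X.m x₀ = horizonMass k ℓ rh := by
    have h1 := hF.mu_horizon
    rw [Fields.mu] at h1
    rw [hX]
    change F.m (x₀ / (1 - x₀)) = _
    rw [hx₀r, horizonMass]
    field_simp at h1 ⊢
    linarith
  obtain ⟨a, has, ha⟩ := exists_eq_mul_of_apply_zero (φ := fun t => X.m (x₀ + t) -
    horizonMass k ℓ rh) ((hsm hXs.smooth_m).sub contDiffOn_const) (by simp [hmh])
  have hE0 : ∀ j ∈ Finset.Icc 1 (N - 1), X.E j x₀ = 0 := by
    intro j hj
    have hj' := Finset.mem_Icc.1 hj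
    rw [hX]
    change F.elec j (x₀ / (1 - x₀)) = _
    rw [hx₀r, Fields.elec, hF.α_horizon j (Finset.mem_Icc.2 ⟨by omega, by omega⟩),
      hF.α_horizon (j + 1) (Finset.mem_Icc.2 ⟨by omega, by omega⟩), sub_zero]
  have hεex : ∀ j, ∃ ε : ℝ → ℝ, j ∈ Finset.Icc 1 (N - 1) → ContDiffOn ℝ (⊤ : ℕ∞) ε (Ico 0 T) ∧
      ∀ t ∈ Ico 0 T, X.E j (x₀ + t) = t * ε t := by
    intro j
    by_cases hj : j ∈ Finset.Icc 1 (N - 1)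
    · obtain ⟨ε, h1, h2⟩ := exists_eq_mul_of_apply_zero (hsm (hXs.smooth_E j hj))
        (by simp [hE0 j hj])
      exact ⟨ε, fun _ => ⟨h1, h2⟩⟩
    · exact ⟨0, fun h => absurd h hj⟩
  choose ε hε using hεex
  set n : ℝ → ℝ := fun t => horizonNu k ℓ rh (x₀ + t) (a t) with hn
  set κ : ℕ → ℝ → ℝ := fun j t => n t * X.dw j (x₀ + t) with hκ
  have hnu : ∀ t ∈ Ico 0 T, X.nu k ℓ (x₀ + t) = t * n t := by
    intro t ht
    have h1 := nuOf_horizonMass_add k ℓ (a := a t) hrh (hx₀0.trans_le (hmaps ht).1)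
    rw [← hx₀, add_sub_cancel_left] at h1
    rw [hn, ← h1, CompactFields.nu, ← ha t ht, add_sub_cancel]
  have hns : ContDiffOn ℝ (⊤ : ℕ∞) n (Ico 0 T) := by
    have h0 : ∀ t ∈ Ico 0 T, x₀ + t ≠ 0 := fun t ht => (hx₀0.trans_le (hmaps ht).1).ne'
    rw [hn]
    unfold horizonNu
    fun_prop (disch := assumption)
  -- Positivity at the horizon itself is the condition `μ'(rh) > 0`; away from it, positivity
  -- follows from `ν = t n > 0`.
  have hn0 : 0 < n 0 := by
    have h1 := hasDerivWithinAt_mu_horizon (k := k) (ℓ := ℓ) hrh (F := F)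
      (n := fun x => n (x - x₀)) (fun r hr => ?_) ?_
    · have h2 := h1.derivWithin (uniqueDiffWithinAt_Ici rh)
      rw [← hx₀, sub_self] at h2
      rw [← h2]
      exact hF.mu'_horizon
    · have hξ := div_one_add_mem_Ico hrh.le hr
      rw [← hx₀] at hξ ⊢
      have h2 := hnu (r / (1 + r) - x₀) ⟨by linarith [hξ.1], by linarith [hξ.2]⟩
      rw [add_sub_cancel] at h2
      rw [← h2]
      have hr0 : 0 < 1 + r := by linarith [mem_Ici.1 hr]
      have h3 : 1 - r / (1 + r) = 1 / (1 + r) := by field_simp; ring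
      have h4 : r / (1 + r) / (1 - r / (1 + r)) = r := by rw [h3]; field_simp
      have h5 := mu_eq_nuOf k ℓ F hξ.2
      rw [h4] at h5
      have h6 : X.nu k ℓ (r / (1 + r)) = nuOf k ℓ (F.m r) (r / (1 + r)) := by
        rw [hX]
        change nuOf k ℓ (F.m (r / (1 + r) / (1 - r / (1 + r)))) _ = _
        rw [h4]
      rw [h6, h5, h3]
      field_simp
    · have h2 : ContDiffOn ℝ (⊤ : ℕ∞) (fun x => n (x - x₀)) (Ico x₀ 1) :=
        hns.comp (contDiffOn_id.sub contDiffOn_const) fun x hx =>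
          ⟨by linarith [hx.1], by linarith [hx.2]⟩
      exact (h2.differentiableOn (by simp)) x₀ ⟨le_rfl, hx₀1⟩
  have hnp : ∀ t ∈ Ico 0 T, 0 < n t := by
    intro t ht
    rcases ht.1.eq_or_lt with h | h
    · rw [← h]; exact hn0
    · have h1 := hXs.nu_pos (x₀ + t) ⟨by linarith, (hmaps ht).2⟩
      rw [hnu t ht] at h1
      exact pos_of_mul_pos_right h1 h.le
  have haT : Tendsto a (𝓝[<] T) (𝓝 ((mL - horizonMass k ℓ rh) / T)) := by
    refine (((hL.m.comp hlim).sub_const _).div hTlim hT0.ne').congr' ?_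
    filter_upwards [hevT] with t ht
    have := ha t ⟨ht.1.le, ht.2⟩
    simp only [Function.comp, Pi.div_apply]
    rw [this, mul_div_cancel_left₀ _ ht.1.ne']
  have hεT : ∀ j ∈ Finset.Icc 1 (N - 1), Tendsto (ε j) (𝓝[<] T) (𝓝 (EL j / T)) := by
    intro j hj
    refine (((hL.E j hj).comp hlim).div hTlim hT0.ne').congr' ?_
    filter_upwards [hevT] with t ht
    have := (hε j hj).2 t ⟨ht.1.le, ht.2⟩
    simp only [Function.comp, Pi.div_apply]
    rw [this, mul_div_cancel_left₀ _ ht.1.ne']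
  have hxT : x₀ + T = 1 := by linarith
  set nT := horizonNu k ℓ rh (x₀ + T) ((mL - horizonMass k ℓ rh) / T) with hnT
  -- At `x = 1` every term containing `1 - x` drops out and the value is `(1 + rh) / ℓ²`, whatever
  -- the mass.
  have hnTpos : 0 < nT := by
    rw [hnT, hxT]
    simp [horizonNu]
    positivity
  have hnTl : Tendsto n (𝓝[<] T) (𝓝 nT) := by
    have h1 : ContinuousAt (fun z : ℝ × ℝ => horizonNu k ℓ rh (x₀ + z.1) z.2)
        (T, (mL - horizonMass k ℓ rh) / T) := by
      have : x₀ + T ≠ 0 := by linarith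
      unfold horizonNu
      fun_prop (disch := assumption)
    exact h1.tendsto.comp (hTlim.prodMk_nhds haT)
  refine ⟨a, n, ε, κ, _, _, blocks N wL dEL Sinf,
    blocks N (fun j => nT * dwL j) (fun j => EL j / T) ((mL - horizonMass k ℓ rh) / T),
    fun _ => rfl, fun _ => rfl, fun _ => rfl, fun _ _ => rfl, fun j hj => (hε j hj).2, hnu,
    fun t ht => by linarith [ha t ht],
    continuousOn_blocks (fun j hj => (hsm (hXs.smooth_w j hj)).continuousOn)
      (fun j hj => (hsm (hXs.smooth_dE j hj)).continuousOn) (hsm hXs.smooth_S).continuousOn,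
    tendsto_blocks (fun j hj => (hL.w j hj).comp hlim) (fun j hj => (hL.dE j hj).comp hlim)
      (hL.S.comp hlim),
    continuousOn_blocks (fun j hj => (hns.mul (hsm (hXs.smooth_dw j hj))).continuousOn)
      (fun j hj => (hε j hj).1.continuousOn) has.continuousOn,
    tendsto_blocks (fun j hj => hnTl.mul ((hL.dw j hj).comp hlim)) hεT haT, hns.continuousOn,
    fun j hj => (hε j hj).1.continuousOn,
    fun t ht => ⟨⟨hx₀0.trans_le (hmaps ht).1, hXs.S_pos _ (hmaps ht)⟩, hnp t ht⟩,
    ⟨⟨?_, hG.Sinf_pos⟩, hnTpos⟩⟩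
  change 0 < x₀ + T
  linarith

section

variable {N : ℕ} {k ℓ rh : ℝ}

theorem sigma_eq_horizonS {X : CompactFields} {t x n : ℝ} {κ ε : ℕ → ℝ} {p q : BlockIdx N → ℝ}
    {a : ℝ} (ht : t ≠ 0) (hx : x = rh / (1 + rh) + t) (hn0 : n ≠ 0)
    (hp : p = blocks N (X.w · x) (X.dE · x) (X.S x)) (hq : q = blocks N κ ε a)
    (hn : n = horizonN N k ℓ rh (t, p, q)) (hκ : ∀ j, κ j = n * X.dw j x)
    (hε : ∀ j ∈ Finset.Icc 1 (N - 1), X.E j x = t * ε j) (hν : X.nu k ℓ x = t * n) :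
    X.sigma N k ℓ x = horizonS N k ℓ rh (t, p, q) := by
  rw [CompactFields.sigma, hν, horizonS, ← hn, ← hx]
  have h1 : (fun j => X.dw j x) = fun j => κ j / n := by
    ext j; rw [hκ, mul_div_cancel_left₀ _ hn0]
  have h2 : sigmaOf N x (t * n) (X.S x) (X.w · x) (X.dw · x) (X.E · x) =
      sigmaOf N x (t * n) (X.S x) (X.w · x) (fun j => κ j / n) (fun j => t * ε j) := by
    rw [sigmaOf, sigmaOf, h1, zetaSum_congr hε]
  rw [h2, sigmaOf_horizon N ht, hp, hq, blockA_blocks, blockA_blocks, blockB_blocks,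
    blockC_blocks, horizonSigma, horizonSigma, zetaSum_restrictIdx, sumSq_restrictIdx]

/-- The regularised system holds along a solution of the compactified equations. -/
theorem IsCompactSolution.hasDerivAt_horizon {X : CompactFields}
    (hX : IsCompactSolution N k ℓ (rh / (1 + rh)) X) (hrh : 0 < rh) {T : ℝ}
    (hT : T = 1 - rh / (1 + rh)) {a n : ℝ → ℝ} {ε κ : ℕ → ℝ → ℝ} {p q : ℝ → BlockIdx N → ℝ}
    (hp : ∀ t, p t = blocks N (X.w · (rh / (1 + rh) + t)) (X.dE · (rh / (1 + rh) + t))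
        (X.S (rh / (1 + rh) + t)))
    (hq : ∀ t, q t = blocks N (κ · t) (ε · t) (a t))
    (hn : ∀ t, n t = horizonN N k ℓ rh (t, p t, q t))
    (hκ : ∀ j t, κ j t = n t * X.dw j (rh / (1 + rh) + t))
    (hε : ∀ j ∈ Finset.Icc 1 (N - 1), ∀ t ∈ Ico 0 T, X.E j (rh / (1 + rh) + t) = t * ε j t)
    (hν : ∀ t ∈ Ico 0 T, X.nu k ℓ (rh / (1 + rh) + t) = t * n t)
    (ha : ∀ t ∈ Ico 0 T, X.m (rh / (1 + rh) + t) = horizonMass k ℓ rh + t * a t)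
    {t : ℝ} (ht : t ∈ Ioo 0 T) :
    (∀ i, HasDerivAt (fun s => p s i) (horizonF N k ℓ rh (t, p t, q t) i) t) ∧
    ∀ i, HasDerivAt (fun s => q s i) ((horizonH N k rh (t, p t) i - ((1 : ℕ) : ℝ) * q t i) / t +
      horizonG N k ℓ rh (t, p t, q t) i) t := by
  have ht0 : t ≠ 0 := ht.1.ne'
  have htI : t ∈ Ico 0 T := ⟨ht.1.le, ht.2⟩
  have hev : ∀ᶠ s in 𝓝 t, s ∈ Ico 0 T := by
    filter_upwards [Ioo_mem_nhds ht.1 ht.2] with s hs using ⟨hs.1.le, hs.2⟩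
  obtain ⟨x, hx⟩ : ∃ x, x = rh / (1 + rh) + t := ⟨_, rfl⟩
  have hxI : x ∈ Ioo (rh / (1 + rh)) 1 := ⟨by linarith [ht.1], by linarith [ht.2]⟩
  have hx0 : 0 < x := lt_trans (by positivity) hxI.1
  have heq := hX.equations x hxI
  have hνx := hν t htI
  rw [← hx] at hνx
  have hnpos : 0 < n t := by
    have := hX.nu_pos x hxI
    rw [hνx] at this
    exact pos_of_mul_pos_right this ht.1.le
  have hn0 := hnpos.ne'
  have hS0 : X.S x ≠ 0 := (hX.S_pos x ⟨hxI.1.le, hxI.2⟩).ne'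
  have hpt := hp t
  rw [← hx] at hpt
  have hκt : ∀ j, κ j t = n t * X.dw j x := fun j => by rw [hκ, hx]
  have hεt : ∀ j ∈ Finset.Icc 1 (N - 1), X.E j x = t * ε j t := fun j hj => by
    rw [← hε j hj t htI, hx]
  have eσ := sigma_eq_horizonS ht0 hx hn0 hpt (hq t) (hn t) hκt hεt hνx
  have hA : blockA (p t) = restrictIdx N (X.w · x) := by rw [hpt, blockA_blocks]
  have hB : blockB (p t) = restrictIdx N (X.dE · x) := by rw [hpt, blockB_blocks]
  have hC : blockC (p t) = X.S x := by rw [hpt, blockC_blocks]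
  have hA' : blockA (q t) = restrictIdx N (κ · t) := by rw [hq, blockA_blocks]
  have hB' : blockB (q t) = restrictIdx N (ε · t) := by rw [hq, blockB_blocks]
  have hw0 := hX.w_zero x
  have hwN := hX.w_last x
  have hshift : ∀ {φ : ℝ → ℝ} {v : ℝ}, HasDerivAt φ v x →
      HasDerivAt (fun s => φ (rh / (1 + rh) + s)) v t := by
    intro φ v h
    rw [hx] at h
    exact h.comp_const_add _ _
  constructor
  · rw [forall_blockIdx]
    refine ⟨fun j hj => ?_, fun j hj => ?_, ?_⟩
    · have e1 : (fun s => p s (Sum.inl ⟨j, hj⟩)) = fun s => X.w j (rh / (1 + rh) + s) := by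
        funext s; rw [hp]; rfl
      rw [e1]
      refine (hshift (heq.w j hj)).congr_deriv ?_
      simp only [horizonF, blocks, Sum.elim_inl, ← hn, hA', restrictIdx_of_mem hj, hκt]
      field_simp
    · have e1 : (fun s => p s (Sum.inr (Sum.inl ⟨j, hj⟩))) =
          fun s => X.dE j (rh / (1 + rh) + s) := by
        funext s; rw [hp]; rfl
      rw [e1]
      refine (hshift (heq.dE j hj)).congr_deriv ?_
      rw [hνx, eσ, elecForce_congr hw0 hwN hεt hj, elecForce_mul]
      simp only [horizonF, blocks, Sum.elim_inl, Sum.elim_inr, ← hn, hA, hB', hB,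
        restrictIdx_of_mem hj, ← hx, elecForce_restrictIdx (w := (X.w · x)) hw0 hwN hj]
      field_simp
    · have e1 : (fun s => p s (Sum.inr (Sum.inr ()))) = fun s => X.S (rh / (1 + rh) + s) := by
        funext s; rw [hp]; rfl
      rw [e1]
      refine (hshift heq.S).congr_deriv ?_
      simp only [horizonF, blocks, Sum.elim_inr, eσ, hC]
  -- The products `t κ`, `t ε`, `t a` are the flux, `𝓔` and the mass difference. Their known
  -- derivatives give those of `κ`, `ε`, `a` through the quotient rule `HasDerivAt.of_id_mul`.
  · rw [forall_blockIdx]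
    refine ⟨fun j hj => ?_, fun j hj => ?_, ?_⟩
    · have e1 : ∀ s, q s (Sum.inl ⟨j, hj⟩) = κ j s := fun s => by rw [hq]; rfl
      simp only [e1]
      refine (HasDerivAt.of_id_mul ht0 ((hshift (heq.flux j hj)).congr_of_eventuallyEq
        ?_)).congr_deriv ?_
      · filter_upwards [hev] with s hs
        rw [hν s hs, hκ]; ring
      · rw [eσ, hνx]
        simp only [horizonG, horizonH, blocks, Sum.elim_inl, ← hn, hA, hB', hA', hC,
          restrictIdx_of_mem hj, ← hx, wCoef_restrictIdx (w := (X.w · x)) hw0 hwN k hj, hεt j hj, hκt]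
        push_cast
        field_simp
        ring
    · have e1 : ∀ s, q s (Sum.inr (Sum.inl ⟨j, hj⟩)) = ε j s := fun s => by rw [hq]; rfl
      simp only [e1]
      refine (HasDerivAt.of_id_mul ht0 ((hshift (heq.E j hj)).congr_of_eventuallyEq
        ?_)).congr_deriv ?_
      · filter_upwards [hev] with s hs
        rw [hε j hj s hs]
      · simp only [horizonG, horizonH, blocks, Sum.elim_inl, Sum.elim_inr, hB,
          restrictIdx_of_mem hj]
        push_cast
        ring
    · have e1 : ∀ s, q s (Sum.inr (Sum.inr ())) = a s := fun s => by rw [hq]; rfl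
      simp only [e1]
      refine (HasDerivAt.of_id_mul ht0 (((hshift heq.m).sub_const (horizonMass k ℓ rh)
        ).congr_of_eventuallyEq ?_)).congr_deriv ?_
      · filter_upwards [hev] with s hs
        rw [ha s hs]; ring
      · have h1 : (fun j => X.dw j x) = fun j => κ j t / n t := by
          ext j; rw [hκt, mul_div_cancel_left₀ _ hn0]
        have h2 : massOf N k x (t * n t) (X.S x) (X.w · x) (X.dw · x) (X.E · x) (X.dE · x) =
            massOf N k x (t * n t) (X.S x) (X.w · x) (fun j => κ j t / n t)
              (fun j => t * ε j t) (X.dE · x) := by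
          rw [massOf, massOf, h1, zetaSum_congr hεt]
        rw [hνx, h2, massOf_horizon N k ht0 hn0]
        simp only [horizonG, horizonH, blocks, Sum.elim_inr, ← hn, hA, hB', hB, hA', hC,
          ← hx, pressure_restrictIdx (w := (X.w · x)) hw0 hwN, etaSum_restrictIdx, zetaSum_restrictIdx,
          sumSq_restrictIdx]
        push_cast
        field_simp
        ring

/-- Black holes with data near the data of a given black hole. -/
theorem IsBlackHole.exists_near (hN : 1 ≤ N) (hℓ : 0 < ℓ) (hrh : 0 < rh) {Sinf : ℝ} {F : Fields}
    (hF : IsBlackHole N k ℓ rh Sinf F) {w e : ℕ → ℝ} (hd : HasHorizonData N rh F w e) :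
    ∃ δ : ℝ, 0 < δ ∧ ∀ w' e' : ℕ → ℝ,
      (∀ j ∈ Finset.Icc 1 (N - 1), |w' j - w j| < δ ∧ |e' j - e j| < δ) →
      ∃ (H : Fields) (c : ℝ), IsBlackHole N k ℓ rh c H ∧ H.S rh = F.S rh ∧
        HasHorizonData N rh H w' e' ∧
        ∀ j ∈ Finset.Icc 1 (N - 1), ¬ Tendsto (F.ω j) atTop (𝓝 0) →
          nodes rh (H.ω j) = nodes rh (F.ω j) := by
  have hG := hF.toIsGlobalSolution
  obtain ⟨a, n, ε, κ, p, q, pT, qT, hp, hq, hn, hκ, hε, hν, ha, hpc, hpT, hqc, hqT, hnc, hεc, hU, hUT⟩ :=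
    hF.exists_horizon_solution hN hℓ hrh rfl rfl
  have hXs := hG.toCompact hN hrh.le
  set x₀ := rh / (1 + rh) with hx₀
  set X := F.toCompact x₀ with hX
  have hx₀0 : 0 < x₀ := by positivity
  have hx₀1 : x₀ < 1 := by rw [hx₀, div_lt_one (by linarith)]; linarith
  have hT0 : 0 < 1 - x₀ := by linarith
  have hr1 : 1 - x₀ = 1 / (1 + rh) := by rw [hx₀]; field_simp; ring
  have hx₀r : x₀ / (1 - x₀) = rh := by rw [hr1, hx₀]; field_simp
  have hder := fun t ht => hXs.hasDerivAt_horizon hrh rfl hp hq hn hκ hε hν ha (t := t) ht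
  -- The flux `ν ω_j'` vanishes automatically at the horizon, so a zero of `ω_j` there makes it
  -- identically zero. The required quotients extend continuously as `1 / n` and `t ε² / n`.
  have hnode : ∀ j ∈ Finset.Icc 1 (N - 1), F.ω j rh = 0 → ∀ r ∈ Ici rh, F.ω j r = 0 := by
    intro j hj h0 r hr
    have hmap : ContinuousOn (fun x => x - x₀) (Ico x₀ 1) := by fun_prop
    have hmaps : MapsTo (fun x => x - x₀) (Ico x₀ 1) (Ico 0 (1 - x₀)) := fun x hx =>
      ⟨by linarith [hx.1], by linarith [hx.2]⟩
    have hn' : ∀ t ∈ Ico 0 (1 - x₀), 0 < n t := fun t ht => by rw [hn]; exact (hU t ht).2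
    have key := hXs.w_eq_zero hj (x₁ := x₀) ⟨le_rfl, hx₀1⟩ hx₀0
      (c₁ := fun x => 1 / n (x - x₀)) (c₂ := fun x => (x - x₀) * ε j (x - x₀) ^ 2 / n (x - x₀))
      (continuousOn_const.div (hnc.comp hmap hmaps) fun x hx => (hn' _ (hmaps hx)).ne')
      ((hmap.mul (((hεc j hj).comp hmap hmaps).pow 2)).div (hnc.comp hmap hmaps)
        fun x hx => (hn' _ (hmaps hx)).ne') (fun x hx => ?_) (fun x hx => ?_) ?_ ?_
    · have hξ := div_one_add_mem_Ico hrh.le hr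
      have := key _ hξ
      have hr0 : 0 < 1 + r := by linarith [mem_Ici.1 hr]
      have h3 : 1 - r / (1 + r) = 1 / (1 + r) := by field_simp; ring
      have h4 : r / (1 + r) / (1 - r / (1 + r)) = r := by rw [h3]; field_simp
      change F.ω j (r / (1 + r) / (1 - r / (1 + r))) = 0 at this
      rwa [h4] at this
    · have h1 := hν _ (hmaps (Ioo_subset_Ico_self hx))
      have h2 := (hn' _ (hmaps (Ioo_subset_Ico_self hx))).ne'
      have h3 : x - x₀ ≠ 0 := (sub_pos.2 hx.1).ne'
      rw [add_sub_cancel] at h1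
      rw [h1]
      field_simp
    · have h1 := hν _ (hmaps (Ioo_subset_Ico_self hx))
      have h2 := (hn' _ (hmaps (Ioo_subset_Ico_self hx))).ne'
      have h3 : x - x₀ ≠ 0 := (sub_pos.2 hx.1).ne'
      have h4 := hε j hj _ (hmaps (Ioo_subset_Ico_self hx))
      rw [add_sub_cancel] at h1 h4
      rw [h1, h4]
      field_simp
    · change F.ω j (x₀ / (1 - x₀)) = 0
      rw [hx₀r, h0]
    · have := hν 0 ⟨le_rfl, hT0⟩
      rw [add_zero, zero_mul] at this
      rw [this, zero_mul]
  obtain ⟨ε₀, hε₀, hnodes⟩ := hG.exists_nodes_eq hN hℓ hrh.le hnode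
  rw [← hx₀, ← hX] at hnodes
  -- Node counting needs `C¹` closeness, but `ω_j'` is not a state variable: it is the continuous
  -- function `κ_j / n` of the state.
  have ho : ∀ i : Idx N ⊕ Idx N, ContinuousOn (fun z : Phase N => Sum.elim
      (fun i : Idx N => blockA z.2.1 i) (fun i : Idx N => blockA z.2.2 i / horizonN N k ℓ rh z) i)
      (horizonDomain N k ℓ rh) := by
    obtain ⟨h1, h2, h3⟩ := contDiffOn_blocks_coord (horizonDomain N k ℓ rh)
    have hn : ContDiffOn ℝ (⊤ : ℕ∞) (horizonN N k ℓ rh) (horizonDomain N k ℓ rh) :=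
      contDiffOn_horizonN.mono inter_subset_left
    rintro (i | i)
    · exact (contDiffOn_blockA h2 i).continuousOn
    · exact ((contDiffOn_blockA h3 i).div hn fun z hz =>
        (show 0 < horizonN N k ℓ rh z from hz.2).ne').continuousOn
  obtain ⟨δ, hδ, hex⟩ := exists_regular_singular_solution_near_of_continuousOn hT0
    (lam := fun _ : BlockIdx N => 1) (fun _ => one_ne_zero) isOpen_horizonDomain isOpen_horizonBase
    (fun z hz => hz.1) contDiffOn_horizon.1 contDiffOn_horizon.2 contDiffOn_horizonH ho hpc hpT
    hqc hqT hU hUT (fun t ht => (hder t ht).1) (fun t ht => (hder t ht).2) hε₀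
  have hsq : 0 < (1 + rh) ^ 2 := by positivity
  have hsq1 : 1 ≤ (1 + rh) ^ 2 := by nlinarith
  -- The factor is `dr / dx = (1 - x₀)⁻²` at the horizon.
  have hdE : ∀ j ∈ Finset.Icc 1 (N - 1), X.dE j x₀ = e j * (1 + rh) ^ 2 := by
    intro j hj
    have hj' := Finset.mem_Icc.1 hj
    have h1 : DifferentiableWithinAt ℝ (F.elec j) (Ici rh) rh :=
      (((hG.smooth_α j (Finset.mem_Icc.2 ⟨by omega, by omega⟩)).sub
        (hG.smooth_α (j + 1) (Finset.mem_Icc.2 ⟨by omega, by omega⟩))).differentiableOn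
          (by simp)) rh self_mem_Ici
    have h2 := h1.hasDerivWithinAt
    rw [hd.elec'_horizon j hj, ← hx₀r] at h2
    have h3 := HasDerivWithinAt.comp (h := fun x : ℝ => x / (1 - x)) x₀ h2
      (hasDerivAt_div_one_sub hx₀1).hasDerivWithinAt (s := Ico x₀ 1) fun x hx => by
        rw [hx₀r]; exact div_one_sub_mem_Ici hrh.le hx
    have h4 := h3.derivWithin (uniqueDiffOn_Ico _ _ x₀ ⟨le_rfl, hx₀1⟩)
    change derivWithin (F.elec j ∘ fun x : ℝ => x / (1 - x)) (Ico x₀ 1) x₀ = _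
    rw [h4, hr1]
    field_simp
  -- The data for `𝓔'` in the variable `x` are `(1 + rh)²` times those in `r`, and this factor is at
  -- least `1`, so dividing by it also suffices for `ω`.
  refine ⟨δ / (1 + rh) ^ 2, by positivity, fun w' e' hwe => ?_⟩
  obtain ⟨P, Q, hP, hQ, hP0, hPU, hPd, hQd, hclose⟩ := hex
    (blocks N w' (fun j => e' j * (1 + rh) ^ 2) (F.S rh)) (by
      rw [forall_blockIdx, hp, add_zero]
      refine ⟨fun j hj => ?_, fun j hj => ?_, ?_⟩
      · simp only [blocks, Sum.elim_inl]
        have : X.w j x₀ = w j := by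
          rw [← hd.ω_horizon j hj]
          change F.ω j (x₀ / (1 - x₀)) = _
          rw [hx₀r]
        rw [this]
        exact (hwe j hj).1.trans_le (div_le_self hδ.le hsq1)
      · simp only [blocks, Sum.elim_inl, Sum.elim_inr]
        rw [hdE j hj, ← sub_mul, abs_mul, abs_of_pos hsq, ← lt_div_iff₀ hsq]
        exact (hwe j hj).2
      · have : X.S x₀ = F.S rh := by
          change F.S (x₀ / (1 - x₀)) = _
          rw [hx₀r]
        simp [blocks, this, hδ])
  obtain ⟨hY, sm, sS, sw, sdw, sE, sdE, sn⟩ :=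
    horizonFields_isCompactSolution hrh hP hQ hPU hPd hQd
  set Y := horizonFields N k ℓ rh P Q with hYdef
  have hS1 : 0 < Y.S 1 := (hPU (1 - x₀) ⟨hT0.le, le_rfl⟩).1.2
  have hglob := hY.isGlobalSolution hN hℓ hrh.le sm sS (fun j _ => sw j) (fun j _ => sdw j)
    (fun j _ => sE j) hS1
  have hYnu : ∀ x, 0 < x → Y.nu k ℓ x = (x - x₀) * horizonN N k ℓ rh
      (x - x₀, P (x - x₀), Q (x - x₀)) := fun x hx => horizonFields_nu hrh hx
  have hYE0 : ∀ j, Y.E j x₀ = 0 := fun j => by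
    simp [Y, horizonFields, ← hx₀]
  refine ⟨Y.toFields N, Y.S 1, ⟨hglob, ?_, ?_, fun j hj => ?_⟩, ?_, ⟨fun j hj => ?_,
    fun j hj => ?_⟩, hnodes Y (fun j hj x hx => (hY.equations x hx).w j hj) fun j hj x hx => ?_⟩
  · rw [toFields_mu Y hrh.le, ← hx₀, hYnu x₀ hx₀0]
    simp
  · have h1 := hasDerivWithinAt_mu_horizon (k := k) (ℓ := ℓ) hrh (F := Y.toFields N)
      (n := fun x => horizonN N k ℓ rh (x - x₀, P (x - x₀), Q (x - x₀))) (fun r hr => ?_)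
      ((sn.differentiableOn (by simp) x₀ ⟨le_rfl, hx₀1.le⟩).mono Ico_subset_Icc_self)
    · rw [h1.derivWithin (uniqueDiffWithinAt_Ici rh), ← hx₀, sub_self]
      exact (hPU 0 ⟨le_rfl, hT0.le⟩).2
    · have hr0 : 0 < r := hrh.trans_le hr
      rw [toFields_mu Y hr0.le, hYnu _ (by positivity)]
  · change alphaOf N (fun i => Y.E i (rh / (1 + rh))) j = 0
    simp only [← hx₀, hYE0]
    simp [alphaOf]
  · change blockC (P (x₀ - x₀)) = _
    rw [sub_self, hP0]; rfl
  · change blockA (P (x₀ - x₀)) j = _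
    rw [sub_self, hP0, blockA_blocks, restrictIdx_of_mem hj]
  · have h1 := hasDerivWithinAt_Icc_of_Ioo hx₀1 (sE j).continuousOn (sdE j).continuousOn
      (fun x hx => (hY.equations x hx).E j hj) x₀ ⟨le_rfl, hx₀1.le⟩
    have h2 : Y.dE j x₀ = e' j * (1 + rh) ^ 2 := by
      change blockB (P (x₀ - x₀)) j = _
      rw [sub_self, hP0, blockB_blocks, restrictIdx_of_mem hj]
    have h3 := HasDerivWithinAt.comp (h := fun r : ℝ => r / (1 + r)) rh h1
      (hasDerivAt_div_one_add hrh.le).hasDerivWithinAt (s := Ici rh) fun r hr =>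
        Ico_subset_Icc_self (div_one_add_mem_Ico hrh.le hr)
    have h4 : (Y.toFields N).elec j = Y.E j ∘ fun r : ℝ => r / (1 + r) := by
      funext r
      exact alphaOf_sub_alphaOf_succ (E := fun i => Y.E i (r / (1 + r))) hj
    rw [h4, h3.derivWithin (uniqueDiffWithinAt_Ici rh), h2]
    field_simp
  · have hxt : x - x₀ ∈ Ico 0 (1 - x₀) := ⟨by linarith [hx.1], by linarith [hx.2]⟩
    have h1 := hclose _ hxt (Sum.inl ⟨j, hj⟩)
    have h2 := hclose _ hxt (Sum.inr ⟨j, hj⟩)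
    have ep : blockA (p (x - x₀)) j = X.w j x := by
      rw [hp, blockA_blocks, restrictIdx_of_mem hj, add_sub_cancel]
    have eq : blockA (q (x - x₀)) j = n (x - x₀) * X.dw j x := by
      rw [hq, blockA_blocks, restrictIdx_of_mem hj, hκ, add_sub_cancel]
    simp only [Sum.elim_inl, Sum.elim_inr, ← hn, ep, eq] at h1 h2
    have hn0 : n (x - x₀) ≠ 0 := by
      rw [hn]; exact (show 0 < horizonN N k ℓ rh _ from (hU _ hxt).2).ne'
    rw [mul_div_cancel_left₀ _ hn0] at h2
    exact ⟨h1, h2⟩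

end

/-! ### The eigenvectors built from Hahn polynomials -/

/-- The coefficients of `hahn N k` in the basis of rising factorials of `-x`. -/
noncomputable def hahnCoeff (N k i : ℕ) : ℝ :=
  (ascPochhammer ℝ i).eval (-(k : ℝ)) * (ascPochhammer ℝ i).eval ((k : ℝ) + 1) /
    ((ascPochhammer ℝ i).eval 2 * (ascPochhammer ℝ i).eval (1 - (N : ℝ)) * (i.factorial : ℝ))

theorem hahn_eq (N k : ℕ) (x : ℝ) :
    hahn N k x = ∑ i ∈ Finset.range (k + 1), hahnCoeff N k i * (ascPochhammer ℝ i).eval (-x) :=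
  Finset.sum_congr rfl fun i _ => by rw [hahnCoeff, div_mul_eq_mul_div]

theorem ascPochhammer_succ_eval_left (i : ℕ) (y : ℝ) :
    (ascPochhammer ℝ (i + 1)).eval y = y * (ascPochhammer ℝ i).eval (y + 1) := by
  rw [ascPochhammer_succ_left]; simp

/-- Ratio of consecutive hypergeometric coefficients. The bound on `i` keeps the lower parameter
factor `1 - N + i` away from zero. -/
theorem hahnCoeff_succ {N k i : ℕ} (hi : i + 1 < N) :
    hahnCoeff N k (i + 1) * (((i : ℝ) + 1) * ((i : ℝ) + 2) * (1 - (N : ℝ) + i)) =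
      hahnCoeff N k i * (((i : ℝ) - k) * (i + k + 1)) := by
  have hN : (1 - (N : ℝ) + i) ≠ 0 := by
    have : ((i + 1 : ℕ) : ℝ) < N := by exact_mod_cast hi
    push_cast at this; linarith
  have h2 : (ascPochhammer ℝ i).eval (2 : ℝ) ≠ 0 := (ascPochhammer_pos i 2 two_pos).ne'
  have hf : (i.factorial : ℝ) ≠ 0 := by positivity
  have hi1 : (i : ℝ) + 1 ≠ 0 := by positivity
  have hi2 : (2 : ℝ) + i ≠ 0 := by positivity
  by_cases h3 : (ascPochhammer ℝ i).eval (1 - (N : ℝ)) = 0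
  · simp [hahnCoeff, ascPochhammer_succ_eval, h3]
  · simp only [hahnCoeff, ascPochhammer_succ_eval, Nat.factorial_succ]
    push_cast
    field_simp
    ring

/-- The difference equation of the Hahn polynomials. -/
theorem hahn_difference {N k : ℕ} (hk : k < N) (x : ℝ) :
    ((N : ℝ) - 1 - x) * ((x + 2) * (hahn N k (x + 1) - hahn N k x)
      - x * (hahn N k x - hahn N k (x - 1))) = -((k : ℝ) * (k + 1)) * hahn N k x := by
  set φ : ℕ → ℝ → ℝ := fun i x => (ascPochhammer ℝ i).eval (-x) with hφ
  set g : ℕ → ℝ := fun i => (i : ℝ) * (i + 1) * (hahnCoeff N k i * φ i x) with hg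
  -- On rising factorials, the coefficient recursion splits each term into a telescoping difference
  -- and the eigenvalue times the preceding term. The constant `φ 0` is killed by differences, `g 0
  -- = 0`, and `g k` supplies the missing top term `k (k + 1) c_k φ_k`.
  have hterm : ∀ i ∈ Finset.range k, ((N : ℝ) - 1 - x) * ((x + 2) *
      (hahnCoeff N k (i + 1) * φ (i + 1) (x + 1) - hahnCoeff N k (i + 1) * φ (i + 1) x)
      - x * (hahnCoeff N k (i + 1) * φ (i + 1) x - hahnCoeff N k (i + 1) * φ (i + 1) (x - 1))) =
      -(g (i + 1) - g i) - (k : ℝ) * (k + 1) * (hahnCoeff N k i * φ i x) := by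
    intro i hi
    have hrec := hahnCoeff_succ (N := N) (k := k) (i := i)
      (by have := Finset.mem_range.1 hi; omega)
    have e1 : φ (i + 1) (x + 1) = -(x + 1) * φ i x := by
      simp only [hφ]
      rw [ascPochhammer_succ_eval_left]
      congr 2; ring
    have e2 : φ (i + 1) x = φ i x * (-x + i) := by
      simp only [hφ]; rw [ascPochhammer_succ_eval]
    have e3 : φ (i + 1) x = -x * φ i (x - 1) := by
      simp only [hφ]
      rw [ascPochhammer_succ_eval_left]
      congr 2; ring
    have e4 : φ (i + 1) (x - 1) = φ i (x - 1) * (-(x - 1) + i) := by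
      simp only [hφ]; rw [ascPochhammer_succ_eval]
    have e5 : x * φ (i + 1) (x - 1) = -(φ i x * (-x + i)) * (-(x - 1) + i) := by
      rw [e4, ← e2, e3]; ring
    have e6 : (x + 2) *
      (hahnCoeff N k (i + 1) * φ (i + 1) (x + 1) - hahnCoeff N k (i + 1) * φ (i + 1) x)
      - x * (hahnCoeff N k (i + 1) * φ (i + 1) x - hahnCoeff N k (i + 1) * φ (i + 1) (x - 1)) =
      hahnCoeff N k (i + 1) * ((x + 2) * (φ (i + 1) (x + 1) - φ (i + 1) x) - x * φ (i + 1) x +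
        x * φ (i + 1) (x - 1)) := by ring
    rw [e6, e5, e1]
    simp only [hg, e2]
    push_cast
    linear_combination (φ i x) * hrec
  have h0 : ∀ y, φ 0 y = 1 := fun y => by simp [hφ]
  have hsplit : ∀ y, hahn N k y = ∑ i ∈ Finset.range k, hahnCoeff N k (i + 1) * φ (i + 1) y
      + hahnCoeff N k 0 := by
    intro y
    rw [hahn_eq, Finset.sum_range_succ']
    congr 1
    change hahnCoeff N k 0 * φ 0 y = _
    rw [h0, mul_one]
  have hlast : hahn N k x = ∑ i ∈ Finset.range k, hahnCoeff N k i * φ i x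
      + hahnCoeff N k k * φ k x := by
    rw [hahn_eq, Finset.sum_range_succ]
  have htel := Finset.sum_congr rfl hterm
  rw [Finset.sum_sub_distrib, Finset.sum_neg_distrib, Finset.sum_range_sub, ← Finset.mul_sum,
    ← Finset.mul_sum, Finset.sum_sub_distrib, ← Finset.mul_sum, ← Finset.mul_sum,
    Finset.sum_sub_distrib, Finset.sum_sub_distrib] at htel
  rw [hsplit (x + 1), hsplit (x - 1)]
  nth_rewrite 3 [hlast]
  rw [hsplit x]
  simp only [add_sub_add_right_eq_sub]
  rw [htel]
  simp only [hg]
  push_cast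
  ring

/-- At `x = N - 1` the left side of the difference equation has a vanishing factor, while the
eigenvalue on the right is non-zero. This zero enforces the boundary condition at `j = N` and
permits division by `N - j`. -/
theorem hahn_sub_one {N k : ℕ} (hk : k ∈ Finset.Icc 1 (N - 1)) : hahn N k ((N : ℝ) - 1) = 0 := by
  have hk' := Finset.mem_Icc.1 hk
  have h := hahn_difference (N := N) (k := k) (by omega) ((N : ℝ) - 1)
  rw [sub_self, zero_mul] at h
  have hk0 : (k : ℝ) ≠ 0 := Nat.cast_ne_zero.2 (by omega)
  have : -((k : ℝ) * (k + 1)) ≠ 0 := neg_ne_zero.2 (by positivity)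
  exact (mul_eq_zero.1 h.symm).resolve_left this

theorem hahn_zero (N k : ℕ) : hahn N k 0 = 1 := by
  rw [hahn_eq, Finset.sum_range_succ', Finset.sum_eq_zero]
  · simp [hahnCoeff]
  · intro i _
    rw [ascPochhammer_succ_eval_left]; simp

/-- The weight `j (N - j)`. -/
def weight (N j : ℕ) : ℝ := (j : ℝ) * ((N : ℝ) - j)

theorem weight_zero (N : ℕ) : weight N 0 = 0 := by simp [weight]

theorem weight_self (N : ℕ) : weight N N = 0 := by simp [weight]

theorem weight_pos {N j : ℕ} (hj : j ∈ Finset.Icc 1 (N - 1)) : 0 < weight N j := by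
  have hj' := Finset.mem_Icc.1 hj
  have h1 : (0 : ℝ) < j := Nat.cast_pos.2 (by omega)
  have h2 : (j : ℝ) < N := Nat.cast_lt.2 (by omega)
  exact mul_pos h1 (by linarith)

theorem weight_mul_eigvec {N k j : ℕ} (hk : k ∈ Finset.Icc 1 (N - 1)) (hj : j ≤ N) :
    weight N j * eigvec N k j = ((N : ℝ) - 1) * j * hahn N k ((j : ℝ) - 1) := by
  rw [weight, eigvec]
  rcases hj.eq_or_lt with rfl | h
  · rw [hahn_sub_one hk]; simp
  · have : (N : ℝ) - j ≠ 0 := by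
      have : (j : ℝ) < N := Nat.cast_lt.2 h
      linarith
    field_simp

/-- The eigenvalue equation. -/
theorem eigvec_eigen {N k j : ℕ} (hk : k ∈ Finset.Icc 1 (N - 1)) (hj : j ∈ Finset.Icc 1 (N - 1)) :
    2 * (weight N j * eigvec N k j) - weight N (j - 1) * eigvec N k (j - 1)
      - weight N (j + 1) * eigvec N k (j + 1) = (k : ℝ) * (k + 1) * eigvec N k j := by
  have hk' := Finset.mem_Icc.1 hk
  have hj' := Finset.mem_Icc.1 hj
  rw [weight_mul_eigvec hk (by omega), weight_mul_eigvec hk (by omega),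
    weight_mul_eigvec hk (by omega), eigvec]
  have hd := hahn_difference (N := N) (k := k) (by omega) ((j : ℝ) - 1)
  have hne : (N : ℝ) - j ≠ 0 := by
    have : (j : ℝ) < N := Nat.cast_lt.2 (by omega)
    linarith
  rw [Nat.cast_sub hj'.1]
  push_cast
  rw [show (j : ℝ) - 1 + 1 = j by ring] at hd
  rw [show (j : ℝ) + 1 - 1 = j by ring]
  field_simp
  linear_combination (-((N : ℝ) - 1)) * hd

theorem eigvec_one {N k : ℕ} (hN : 2 ≤ N) : eigvec N k 1 = 1 := by
  have : (N : ℝ) - 1 ≠ 0 := by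
    have : (2 : ℝ) ≤ N := by exact_mod_cast hN
    linarith
  simp [eigvec, hahn_zero, this]

/-- For `1 ≤ k ≤ N - 1`, the entries of the eigenvectors are polynomials in `j` of degree less than
`k`. -/
theorem exists_polynomial_eigvec {N k : ℕ} (hk : k ∈ Finset.Icc 1 (N - 1)) :
    ∃ p : Polynomial ℝ, p.degree < k ∧ ∀ j ∈ Finset.Icc 1 (N - 1), p.eval (j : ℝ) = eigvec N k j := by
  open Polynomial in
  set q : ℝ[X] := ∑ i ∈ Finset.range (k + 1),
    C (hahnCoeff N k i) * (ascPochhammer ℝ i).comp (1 - X) with hq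
  have hqe : ∀ x, q.eval x = hahn N k (x - 1) := by
    intro x
    rw [hahn_eq, hq, eval_finsetSum]
    refine Finset.sum_congr rfl fun i _ => ?_
    simp
  have hqd : q.natDegree ≤ k := by
    refine natDegree_sum_le_of_forall_le _ _ fun i hi => ?_
    refine (natDegree_C_mul_le _ _).trans (natDegree_comp_le.trans ?_)
    rw [ascPochhammer_natDegree]
    have h1 : (1 - X : ℝ[X]).natDegree ≤ 1 := by
      refine (natDegree_sub_le _ _).trans ?_
      simp
    calc i * (1 - X : ℝ[X]).natDegree ≤ i * 1 := Nat.mul_le_mul_left _ h1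
      _ ≤ k := by have := Finset.mem_range.1 hi; omega
  -- Dividing by the factor `X - N` accounts for the denominator `N - j` of the eigenvector and
  -- lowers the degree from at most `k` to less than `k`.
  have hroot : q.IsRoot (N : ℝ) := by rw [IsRoot, hqe, hahn_sub_one hk]
  obtain ⟨p, hp⟩ := dvd_iff_isRoot.2 hroot
  refine ⟨C (-((N : ℝ) - 1)) * p, ?_, fun j hj => ?_⟩
  · have hk' := Finset.mem_Icc.1 hk
    rcases eq_or_ne p 0 with h | h
    · simp [h, bot_lt_iff_ne_bot]
    · have h2 : q.natDegree = p.natDegree + 1 := by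
        rw [hp, natDegree_mul (X_sub_C_ne_zero _) h, natDegree_X_sub_C, add_comm]
      have h3 : -((N : ℝ) - 1) ≠ 0 := by
        have : (2 : ℝ) ≤ N := by exact_mod_cast (by omega : 2 ≤ N)
        linarith
      rw [degree_C_mul h3, degree_eq_natDegree h]
      exact_mod_cast (by omega : p.natDegree < k)
  · have h1 := hqe j
    have hj' := Finset.mem_Icc.1 hj
    have hne : (N : ℝ) - j ≠ 0 := by
      have : (j : ℝ) < N := Nat.cast_lt.2 (by omega)
      linarith
    rw [hp, eval_mul] at h1
    simp only [eval_sub, eval_X, eval_C] at h1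
    rw [eigvec, ← h1, eval_mul, eval_C]
    field_simp
    ring

/-! ### The basis of eigenvectors -/

/-- The eigenvector `v_k`, extended by zero. -/
noncomputable def modeVec (N k : ℕ) : ℕ → ℝ := restrictIdx N (eigvec N k)

/-- The operator of the linearised gauge field equations on sequences supported on
`1, …, N - 1`. -/
noncomputable def modeOp (N : ℕ) : (Idx N → ℝ) →ₗ[ℝ] (Idx N → ℝ) where
  toFun u i := 2 * (weight N i * u i) -
    (if h : (i : ℕ) - 1 ∈ Finset.Icc 1 (N - 1) then weight N (i - 1) * u ⟨_, h⟩ else 0) -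
    (if h : (i : ℕ) + 1 ∈ Finset.Icc 1 (N - 1) then weight N (i + 1) * u ⟨_, h⟩ else 0)
  map_add' u v := by
    ext i
    simp only [Pi.add_apply]
    split_ifs <;> ring
  map_smul' c u := by
    ext i
    simp only [Pi.smul_apply, smul_eq_mul, RingHom.id_apply]
    split_ifs <;> ring

theorem weight_mul_modeVec {N k j : ℕ} (hj : j ≤ N) :
    weight N j * modeVec N k j = weight N j * eigvec N k j := by
  by_cases h : j ∈ Finset.Icc 1 (N - 1)
  · rw [modeVec, restrictIdx_of_mem h]
  · have : j = 0 ∨ j = N := by rw [Finset.mem_Icc] at h; omega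
    rcases this with rfl | rfl <;> simp [weight_zero, weight_self]

theorem modeVec_eigen {N k j : ℕ} (hk : k ∈ Finset.Icc 1 (N - 1)) (hj : j ∈ Finset.Icc 1 (N - 1)) :
    2 * (weight N j * modeVec N k j) - weight N (j - 1) * modeVec N k (j - 1)
      - weight N (j + 1) * modeVec N k (j + 1) = (k : ℝ) * (k + 1) * modeVec N k j := by
  have hj' := Finset.mem_Icc.1 hj
  rw [weight_mul_modeVec (by omega), weight_mul_modeVec (by omega), weight_mul_modeVec (by omega),
    eigvec_eigen hk hj, modeVec, restrictIdx_of_mem hj]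

theorem modeOp_modeVec {N : ℕ} (k : Idx N) :
    modeOp N (fun i => modeVec N k i) = ((k : ℝ) * (k + 1)) • fun i : Idx N => modeVec N k i := by
  ext i
  have h := modeVec_eigen k.2 i.2
  have hi := Finset.mem_Icc.1 i.2
  have hmul : ∀ j ≤ N, (if _h : j ∈ Finset.Icc 1 (N - 1) then weight N j * modeVec N k j else 0) =
      weight N j * modeVec N k j := by
    intro j hj
    split_ifs with h1
    · rfl
    · simp [modeVec, restrictIdx, h1]
  change 2 * (weight N i * modeVec N k i) - (if h : (i : ℕ) - 1 ∈ Finset.Icc 1 (N - 1) then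
    weight N (i - 1) * modeVec N k (i - 1) else 0) - (if h : (i : ℕ) + 1 ∈ Finset.Icc 1 (N - 1) then
    weight N (i + 1) * modeVec N k (i + 1) else 0) = _
  rw [hmul _ (by omega), hmul _ (by omega), h]
  rfl

/-- The eigenvalues `k (k + 1)` are distinct, and each vector is non-zero because its first entry is
`1`. -/
theorem linearIndependent_modeVec (N : ℕ) :
    LinearIndependent ℝ (fun (k : Idx N) (i : Idx N) => modeVec N k i) := by
  refine Module.End.eigenvectors_linearIndependent' (modeOp N) (fun k : Idx N => (k : ℝ) * (k + 1))
    (fun a b h => ?_) _ fun k => ?_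
  · simp only at h
    have ha : (0 : ℝ) ≤ (a : ℕ) := Nat.cast_nonneg _
    have hb : (0 : ℝ) ≤ (b : ℕ) := Nat.cast_nonneg _
    have : ((a : ℕ) : ℝ) = (b : ℕ) := by nlinarith
    exact Subtype.ext (by exact_mod_cast this)
  · refine Module.End.hasEigenvector_iff.2 ⟨Module.End.mem_eigenspace_iff.2 (modeOp_modeVec k), ?_⟩
    intro h
    have hk := Finset.mem_Icc.1 k.2
    have h1 : (1 : ℕ) ∈ Finset.Icc 1 (N - 1) := Finset.mem_Icc.2 ⟨le_rfl, by omega⟩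
    have := congrFun h ⟨1, h1⟩
    simp only [modeVec, restrictIdx_of_mem h1, eigvec_one (by omega : 2 ≤ N)] at this
    exact one_ne_zero this

noncomputable def modeBasis (N : ℕ) : Module.Basis (Idx N) ℝ (Idx N → ℝ) :=
  basisOfLinearIndependentOfCardEqFinrank' _ (linearIndependent_modeVec N) (by simp)

theorem modeBasis_apply {N : ℕ} (k : Idx N) : modeBasis N k = fun i : Idx N => modeVec N k i := by
  simp [modeBasis]

/-- The coefficient of `v_k` in the expansion of a sequence. -/
noncomputable def modeCoord (N : ℕ) (u : ℕ → ℝ) (k : ℕ) : ℝ :=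
  if h : k ∈ Finset.Icc 1 (N - 1) then (modeBasis N).repr (fun i : Idx N => u i) ⟨k, h⟩ else 0

theorem sum_Icc_eq_sum_idx {M : Type*} [AddCommMonoid M] (N : ℕ) (f : ℕ → M) :
    ∑ k ∈ Finset.Icc 1 (N - 1), f k = ∑ k : Idx N, f k :=
  (Finset.sum_coe_sort (Finset.Icc 1 (N - 1)) f).symm

theorem sum_modeCoord (N : ℕ) (u : ℕ → ℝ) {j : ℕ} (hj : j ∈ Finset.Icc 1 (N - 1)) :
    ∑ k ∈ Finset.Icc 1 (N - 1), modeCoord N u k * modeVec N k j = u j := by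
  have h := congrFun ((modeBasis N).sum_repr (fun i : Idx N => u i)) ⟨j, hj⟩
  rw [sum_Icc_eq_sum_idx, ← h, Finset.sum_apply]
  refine Finset.sum_congr rfl fun k _ => ?_
  rw [modeCoord, dif_pos k.2, modeBasis_apply]
  rfl

theorem modeCoord_sum (N : ℕ) (b : ℕ → ℝ) {k : ℕ} (hk : k ∈ Finset.Icc 1 (N - 1)) :
    modeCoord N (fun j => ∑ k ∈ Finset.Icc 1 (N - 1), b k * modeVec N k j) k = b k := by
  rw [modeCoord, dif_pos hk]
  have h : (fun i : Idx N => ∑ k ∈ Finset.Icc 1 (N - 1), b k * modeVec N k i) =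
      ∑ k : Idx N, b k • modeBasis N k := by
    ext i
    rw [sum_Icc_eq_sum_idx, Finset.sum_apply]
    exact Finset.sum_congr rfl fun k _ => by rw [modeBasis_apply]; rfl
  rw [h, Module.Basis.repr_sum_self]

theorem modeCoord_congr {N : ℕ} {u u' : ℕ → ℝ} (h : ∀ j ∈ Finset.Icc 1 (N - 1), u j = u' j) :
    modeCoord N u = modeCoord N u' := by
  have : (fun i : Idx N => u i) = fun i : Idx N => u' i := funext fun i => h i i.2
  ext k; rw [modeCoord, modeCoord, this]

/-- The entries of the matrix of `modeCoord`. -/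
noncomputable def modeDual (N k j : ℕ) : ℝ := modeCoord N (fun i => if i = j then 1 else 0) k

theorem modeCoord_eq_sum (N : ℕ) (u : ℕ → ℝ) (k : ℕ) :
    modeCoord N u k = ∑ j ∈ Finset.Icc 1 (N - 1), modeDual N k j * u j := by
  by_cases hk : k ∈ Finset.Icc 1 (N - 1)
  · have h : (fun i : Idx N => u i) = ∑ j : Idx N, u j • fun i : Idx N => if (i : ℕ) = j then (1 : ℝ)
        else 0 := by
      ext i
      rw [Finset.sum_apply, Finset.sum_eq_single i]
      · simp
      · intro j _ hj
        have : (i : ℕ) ≠ j := fun h => hj (Subtype.ext h.symm)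
        rw [Pi.smul_apply, if_neg this, smul_zero]
      · simp
    rw [modeCoord, dif_pos hk, h, map_sum, Finsupp.finsetSum_apply, sum_Icc_eq_sum_idx]
    refine Finset.sum_congr rfl fun j _ => ?_
    rw [map_smul, modeDual, modeCoord, dif_pos hk, Finsupp.smul_apply, smul_eq_mul, mul_comm]
  · simp [modeDual, modeCoord, hk]

/-- A polynomial of degree less than `d` is a combination of `v_1, …, v_d`. -/
theorem modeCoord_eq_zero_of_degree_lt {N : ℕ} {p : Polynomial ℝ} {d k : ℕ} (hp : p.degree < d)
    (hk : d < k) : modeCoord N (fun j => p.eval (j : ℝ)) k = 0 := by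
  by_cases hkI : k ∈ Finset.Icc 1 (N - 1)
  swap
  · simp [modeCoord, hkI]
  have hk' := Finset.mem_Icc.1 hkI
  set ev : Polynomial ℝ →ₗ[ℝ] (Idx N → ℝ) := LinearMap.pi fun i => Polynomial.leval ((i : ℕ) : ℝ)
    with hev
  set W := (Polynomial.degreeLT ℝ d).map ev with hW
  let v : Finset.Icc 1 d → (Idx N → ℝ) := fun k i => modeVec N k i
  have hmem : ∀ i : Finset.Icc 1 d, (i : ℕ) ∈ Finset.Icc 1 (N - 1) := fun i => by
    have := Finset.mem_Icc.1 i.2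
    exact Finset.mem_Icc.2 ⟨this.1, by omega⟩
  have hli : LinearIndependent ℝ v := by
    exact (linearIndependent_modeVec N).comp (fun i : Finset.Icc 1 d => (⟨i, hmem i⟩ : Idx N))
      fun a b h => Subtype.ext (by simpa using h)
  have hle : Submodule.span ℝ (Set.range v) ≤ W := by
    rw [Submodule.span_le]
    rintro _ ⟨i, rfl⟩
    obtain ⟨q, hq, hqe⟩ := exists_polynomial_eigvec (hmem i)
    have hi := Finset.mem_Icc.1 i.2
    refine ⟨q, Polynomial.mem_degreeLT.2 (hq.trans_le (by exact_mod_cast hi.2)), ?_⟩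
    ext j
    simp only [hev, LinearMap.pi_apply, Polynomial.leval_apply, v, modeVec]
    rw [restrictIdx_of_mem j.2, hqe j j.2]
  have hfin : Module.Finite ℝ (Polynomial.degreeLT ℝ d) :=
    Module.Finite.equiv (Polynomial.degreeLTEquiv ℝ d).symm
  -- Dimension count: the `d` independent vectors lie in the image of the `d`-dimensional space of
  -- polynomials of degree less than `d`, hence span it.
  have hrank : Module.finrank ℝ W ≤ Module.finrank ℝ (Submodule.span ℝ (Set.range v)) := by
    rw [finrank_span_eq_card hli]
    refine (Submodule.finrank_map_le _ _).trans ?_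
    rw [(Polynomial.degreeLTEquiv ℝ d).finrank_eq]
    simp
  have heq := Submodule.eq_of_le_of_finrank_le hle hrank
  have hpW : ev p ∈ Submodule.span ℝ (Set.range v) := by
    rw [heq]
    exact ⟨p, Polynomial.mem_degreeLT.2 hp, rfl⟩
  have hker : Submodule.span ℝ (Set.range v) ≤
      LinearMap.ker ((modeBasis N).coord ⟨k, hkI⟩) := by
    rw [Submodule.span_le]
    rintro _ ⟨i, rfl⟩
    have hi := Finset.mem_Icc.1 i.2
    have : v i = modeBasis N ⟨i, hmem i⟩ := by rw [modeBasis_apply]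
    simp only [SetLike.mem_coe, LinearMap.mem_ker, Module.Basis.coord_apply]
    rw [this, Module.Basis.repr_self, Finsupp.single_apply, if_neg]
    intro h
    have : (i : ℕ) = k := congrArg Subtype.val h
    omega
  have := hker hpW
  rw [LinearMap.mem_ker, Module.Basis.coord_apply] at this
  rw [modeCoord, dif_pos hkI]
  exact this

/-- The structure constants of the pointwise product in the basis of eigenvectors. -/
noncomputable def modeStruct (N a b c : ℕ) : ℝ :=
  modeCoord N (fun j => modeVec N a j * modeVec N b j) c

/-- The factors are polynomials in `j` of degrees at most `a - 1` and `b - 1`. Their product has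
degree less than `a + b - 1` and involves only the modes `1, …, a + b - 1`. This triangularity is
what keeps nonlinear terms regular at the origin. -/
theorem modeStruct_eq_zero {N a b c : ℕ} (ha : a ∈ Finset.Icc 1 (N - 1))
    (hb : b ∈ Finset.Icc 1 (N - 1)) (hc : a + b - 1 < c) : modeStruct N a b c = 0 := by
  obtain ⟨p, hp, hpe⟩ := exists_polynomial_eigvec ha
  obtain ⟨q, hq, hqe⟩ := exists_polynomial_eigvec hb
  have ha' := Finset.mem_Icc.1 ha
  have hb' := Finset.mem_Icc.1 hb
  have h : (p * q).degree < ((a + b - 1 : ℕ) : WithBot ℕ) := by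
    rcases eq_or_ne p 0 with h | h
    · simp [h, bot_lt_iff_ne_bot]
    rcases eq_or_ne q 0 with h' | h'
    · simp [h', bot_lt_iff_ne_bot]
    rw [Polynomial.degree_eq_natDegree h] at hp
    rw [Polynomial.degree_eq_natDegree h'] at hq
    rw [Polynomial.degree_eq_natDegree (mul_ne_zero h h'), Polynomial.natDegree_mul h h']
    have hp' : p.natDegree < a := by exact_mod_cast hp
    have hq' : q.natDegree < b := by exact_mod_cast hq
    exact_mod_cast (by omega : p.natDegree + q.natDegree < a + b - 1)
  rw [modeStruct, ← modeCoord_eq_zero_of_degree_lt (N := N) h hc]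
  refine congrFun (modeCoord_congr fun j hj => ?_) c
  rw [Polynomial.eval_mul, hpe j hj, hqe j hj, modeVec, modeVec, restrictIdx_of_mem hj,
    restrictIdx_of_mem hj]

/-! ### Expansions in the eigenvectors, graded by powers of `x` -/

/-- The sequence `∑ x^(k-1) b_k v_k`. -/
noncomputable def modeSum (N : ℕ) (x : ℝ) : (ℕ → ℝ) →ₗ[ℝ] (ℕ → ℝ) where
  toFun b j := ∑ k ∈ Finset.Icc 1 (N - 1), x ^ (k - 1) * b k * modeVec N k j
  map_add' b b' := by
    ext j
    simp only [Pi.add_apply, ← Finset.sum_add_distrib]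
    exact Finset.sum_congr rfl fun _ _ => by ring
  map_smul' c b := by
    ext j
    simp only [Pi.smul_apply, smul_eq_mul, RingHom.id_apply, Finset.mul_sum]
    exact Finset.sum_congr rfl fun _ _ => by ring

theorem modeSum_apply (N : ℕ) (x : ℝ) (b : ℕ → ℝ) (j : ℕ) :
    modeSum N x b j = ∑ k ∈ Finset.Icc 1 (N - 1), x ^ (k - 1) * b k * modeVec N k j := rfl

/-- Multiplication of the `k`-th coefficient by `k`. -/
def modeIdx : (ℕ → ℝ) →ₗ[ℝ] (ℕ → ℝ) where
  toFun b k := k * b k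
  map_add' b b' := by ext k; simp only [Pi.add_apply]; ring
  map_smul' c b := by ext k; simp only [Pi.smul_apply, smul_eq_mul, RingHom.id_apply]; ring

/-- Multiplication of the `k`-th coefficient by the eigenvalue `k (k + 1)`. -/
def modeEig : (ℕ → ℝ) →ₗ[ℝ] (ℕ → ℝ) where
  toFun b k := k * (k + 1) * b k
  map_add' b b' := by ext k; simp only [Pi.add_apply]; ring
  map_smul' c b := by ext k; simp only [Pi.smul_apply, smul_eq_mul, RingHom.id_apply]; ring

theorem modeIdx_apply (b : ℕ → ℝ) (k : ℕ) : modeIdx b k = k * b k := rfl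

theorem modeEig_apply (b : ℕ → ℝ) (k : ℕ) : modeEig b k = k * (k + 1) * b k := rfl

theorem modeIdx_modeIdx (b : ℕ → ℝ) : modeIdx (modeIdx b) = modeEig b - modeIdx b := by
  ext k; simp only [modeIdx_apply, modeEig_apply, Pi.sub_apply]; ring

/-- The product which `modeSum N x` carries to the pointwise product. -/
noncomputable def modeMul (N : ℕ) (x : ℝ) (b b' : ℕ → ℝ) (c : ℕ) : ℝ :=
  ∑ k ∈ Finset.Icc 1 (N - 1), ∑ l ∈ Finset.Icc 1 (N - 1),
    modeStruct N k l c * x ^ (k + l - 1 - c) * (b k * b' l)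

theorem modeVec_of_notMem {N k j : ℕ} (hj : j ∉ Finset.Icc 1 (N - 1)) : modeVec N k j = 0 :=
  if_neg hj

theorem modeSum_of_notMem {N : ℕ} (x : ℝ) (b : ℕ → ℝ) {j : ℕ} (hj : j ∉ Finset.Icc 1 (N - 1)) :
    modeSum N x b j = 0 := by
  rw [modeSum_apply]
  exact Finset.sum_eq_zero fun k _ => by rw [modeVec_of_notMem hj, mul_zero]

/-- The mode `k` carries the weight `x^(k-1)`, and the product of the modes `k` and `l` reaches only
modes `c ≤ k + l - 1`. The coefficients of a product are therefore polynomial in `x`, with no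
negative powers. -/
theorem modeSum_modeMul (N : ℕ) (x : ℝ) (b b' : ℕ → ℝ) (j : ℕ) :
    modeSum N x (modeMul N x b b') j = modeSum N x b j * modeSum N x b' j := by
  by_cases hj : j ∈ Finset.Icc 1 (N - 1)
  swap
  · simp [modeSum_of_notMem, hj]
  have h1 : ∀ c ∈ Finset.Icc 1 (N - 1), x ^ (c - 1) * modeMul N x b b' c * modeVec N c j =
      ∑ k ∈ Finset.Icc 1 (N - 1), ∑ l ∈ Finset.Icc 1 (N - 1),
        (x ^ (k - 1) * b k) * (x ^ (l - 1) * b' l) * (modeStruct N k l c * modeVec N c j) := by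
    intro c hc
    rw [modeMul, Finset.mul_sum, Finset.sum_mul]
    refine Finset.sum_congr rfl fun k hk => ?_
    rw [Finset.mul_sum, Finset.sum_mul]
    refine Finset.sum_congr rfl fun l hl => ?_
    by_cases h : k + l - 1 < c
    -- Here the natural subtraction in the exponent is truncated to zero, but the structure constant
    -- vanishes; in the other case the subtraction is exact.
    · rw [modeStruct_eq_zero hk hl h]; ring
    · have hc' := Finset.mem_Icc.1 hc
      have hk' := Finset.mem_Icc.1 hk
      have hl' := Finset.mem_Icc.1 hl
      have e : x ^ (k - 1) * x ^ (l - 1) = x ^ (c - 1) * x ^ (k + l - 1 - c) := by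
        rw [← pow_add, ← pow_add]; congr 1; omega
      linear_combination (-(b k * b' l * modeStruct N k l c * modeVec N c j)) * e
  rw [modeSum_apply, Finset.sum_congr rfl h1, Finset.sum_comm, modeSum_apply, modeSum_apply,
    Finset.sum_mul_sum]
  refine Finset.sum_congr rfl fun k _ => ?_
  rw [Finset.sum_comm]
  refine Finset.sum_congr rfl fun l _ => ?_
  rw [← Finset.mul_sum]
  have := sum_modeCoord N (fun j => modeVec N k j * modeVec N l j) hj
  simp only [modeStruct]
  rw [this]
  ring

theorem modeSum_modeEig {N : ℕ} (x : ℝ) (b : ℕ → ℝ) {j : ℕ} (hj : j ∈ Finset.Icc 1 (N - 1)) :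
    modeSum N x (modeEig b) j = 2 * (weight N j * modeSum N x b j)
      - weight N (j - 1) * modeSum N x b (j - 1) - weight N (j + 1) * modeSum N x b (j + 1) := by
  simp only [modeSum_apply, Finset.mul_sum, ← Finset.sum_sub_distrib]
  refine Finset.sum_congr rfl fun k hk => ?_
  rw [modeEig_apply]
  linear_combination (-(x ^ (k - 1) * b k)) * modeVec_eigen hk hj

theorem modeSum_congr {N : ℕ} (x : ℝ) {b b' : ℕ → ℝ} (h : ∀ k ∈ Finset.Icc 1 (N - 1), b k = b' k) :
    modeSum N x b = modeSum N x b' := by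
  ext j
  rw [modeSum_apply, modeSum_apply]
  exact Finset.sum_congr rfl fun k hk => by rw [h k hk]

/-- The eigenvectors are independent and the weights `x^(k-1)` are non-zero. This is how equations
for components are turned into equations for modes. -/
theorem eq_zero_of_modeSum_eq_zero {N : ℕ} {x : ℝ} (hx : x ≠ 0) {b : ℕ → ℝ}
    (h : ∀ j ∈ Finset.Icc 1 (N - 1), modeSum N x b j = 0) {k : ℕ} (hk : k ∈ Finset.Icc 1 (N - 1)) :
    b k = 0 := by
  have h1 := modeCoord_sum N (fun k => x ^ (k - 1) * b k) hk
  simp only [modeSum_apply] at h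
  rw [congrFun (modeCoord_congr (u' := fun _ => 0) h) k, modeCoord_eq_sum] at h1
  simp only [mul_zero, Finset.sum_const_zero] at h1
  exact (mul_eq_zero.1 h1.symm).resolve_left (pow_ne_zero _ hx)

theorem hasDerivAt_pow_mul_modeSum {N : ℕ} {b : ℕ → ℝ → ℝ} {B : ℕ → ℝ} {x : ℝ} (e j : ℕ)
    (h : ∀ k ∈ Finset.Icc 1 (N - 1), HasDerivAt (b k) (B k) x) :
    HasDerivAt (fun x => x ^ (e + 1) * modeSum N x (fun k => b k x) j)
      (x ^ e * modeSum N x (modeIdx (fun k => b k x) + (e : ℝ) • (fun k => b k x) + x • B) j) x := by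
  have h1 : ∀ k ∈ Finset.Icc 1 (N - 1), HasDerivAt (fun x => x ^ (k + e) * b k x * modeVec N k j)
      (x ^ e * (x ^ (k - 1) * (modeIdx (fun k => b k x) + (e : ℝ) • (fun k => b k x) + x • B) k *
        modeVec N k j)) x := by
    intro k hk
    have hk' := Finset.mem_Icc.1 hk
    refine (((hasDerivAt_pow (k + e) x).mul (h k hk)).mul_const _).congr_deriv ?_
    obtain ⟨i, rfl⟩ : ∃ i, k = i + 1 := ⟨k - 1, by omega⟩
    simp only [modeIdx_apply, Pi.add_apply, Pi.smul_apply, smul_eq_mul, Nat.add_sub_cancel]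
    rw [show i + 1 + e - 1 = i + e by omega]
    push_cast
    ring
  have h2 := HasDerivAt.fun_sum h1
  rw [← Finset.mul_sum] at h2
  refine h2.congr_of_eventuallyEq (Eventually.of_forall fun y => ?_)
  simp only [modeSum_apply, Finset.mul_sum]
  refine Finset.sum_congr rfl fun k hk => ?_
  have hk' := Finset.mem_Icc.1 hk
  rw [show k + e = (e + 1) + (k - 1) by omega, pow_add]
  ring

section Smoothness

variable {V : Type*} [NormedAddCommGroup V] [NormedSpace ℝ V] {N : ℕ} {x : V → ℝ}
  {b b' : V → ℕ → ℝ} {s : Set V}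

theorem contDiffOn_modeSum (hx : ContDiffOn ℝ (⊤ : ℕ∞) x s)
    (hb : ∀ k, ContDiffOn ℝ (⊤ : ℕ∞) (fun z => b z k) s) (j : ℕ) :
    ContDiffOn ℝ (⊤ : ℕ∞) (fun z => modeSum N (x z) (b z) j) s := by
  simp only [modeSum_apply]
  exact ContDiffOn.sum fun k _ => ((hx.pow _).mul (hb k)).mul contDiffOn_const

theorem contDiffOn_modeMul (hx : ContDiffOn ℝ (⊤ : ℕ∞) x s)
    (hb : ∀ k, ContDiffOn ℝ (⊤ : ℕ∞) (fun z => b z k) s)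
    (hb' : ∀ k, ContDiffOn ℝ (⊤ : ℕ∞) (fun z => b' z k) s) (k : ℕ) :
    ContDiffOn ℝ (⊤ : ℕ∞) (fun z => modeMul N (x z) (b z) (b' z) k) s :=
  ContDiffOn.sum fun k _ => ContDiffOn.sum fun l _ =>
    (contDiffOn_const.mul (hx.pow _)).mul ((hb k).mul (hb' l))

theorem contDiffOn_modeIdx (hb : ∀ k, ContDiffOn ℝ (⊤ : ℕ∞) (fun z => b z k) s) (k : ℕ) :
    ContDiffOn ℝ (⊤ : ℕ∞) (fun z => modeIdx (b z) k) s := contDiffOn_const.mul (hb k)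

theorem contDiffOn_modeEig (hb : ∀ k, ContDiffOn ℝ (⊤ : ℕ∞) (fun z => b z k) s) (k : ℕ) :
    ContDiffOn ℝ (⊤ : ℕ∞) (fun z => modeEig (b z) k) s := contDiffOn_const.mul (hb k)

end Smoothness

/-! ### Regularised variables at the origin -/

/-- The variables in which the equations become regular-singular at the origin:
`ω_j = √(j (N - j)) (1 + ∑ b_k v_k^j x^(k+1))`, `𝓔_j = ∑ θ_k v_k^j x^k`, `m = x³ a`, and the
derivatives `B`, `Θ` of `b`, `θ`. -/
structure OriginState where
  x : ℝ
  b : ℕ → ℝ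
  θ : ℕ → ℝ
  S : ℝ
  B : ℕ → ℝ
  Θ : ℕ → ℝ
  a : ℝ

namespace OriginState

noncomputable section

variable (N : ℕ) (ℓ : ℝ) (z : OriginState)

/-- `(ν - 1) / (-x)`. -/
def d : ℝ := 2 - z.x + 2 * z.x * z.a * (1 - z.x) ^ 3 - z.x / ℓ ^ 2

def nu : ℝ := 1 - z.x * z.d ℓ

/-- The mode coefficients of the derivative of `ω`: `(x^(k+1) b_k)' = x^k ((k + 1) b_k + x B_k)`. -/
def bt : ℕ → ℝ := z.b + modeIdx z.b + z.x • z.B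

/-- The mode coefficients of the derivative of `𝓔`: `(x^k θ_k)' = x^(k-1) (k θ_k + x Θ_k)`. -/
def tt : ℕ → ℝ := modeIdx z.θ + z.x • z.Θ

def w (j : ℕ) : ℝ := √(weight N j) * (1 + z.x ^ 2 * modeSum N z.x z.b j)

def dw (j : ℕ) : ℝ := √(weight N j) * (z.x * modeSum N z.x z.bt j)

def E (j : ℕ) : ℝ := z.x * modeSum N z.x z.θ j

def dE (j : ℕ) : ℝ := modeSum N z.x z.tt j

/-- `ζ / x²`. -/
def zetaHat : ℝ := zetaSum N (z.w N) (modeSum N z.x z.θ)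

/-- `∑ γ_j² y_j²` for the sequence `y` with coefficients `c`. -/
def sqHat (c : ℕ → ℝ) : ℝ := sumSq N (fun j => √(weight N j) * modeSum N z.x c j)

/-- The logarithmic derivative of `S`, divided by `x`. -/
def sigmaHat : ℝ :=
  (1 - z.x) ^ 3 * (z.zetaHat N / (2 * z.nu ℓ ^ 2 * z.S ^ 2) + 2 * z.sqHat N z.bt)

/-- The pressure divided by `x²`. -/
def pressureHat : ℝ := 1 / 4 * ∑ j ∈ Finset.Icc 1 N,
  (weight N j * (2 * modeSum N z.x z.b j + z.x ^ 2 * modeSum N z.x z.b j ^ 2) -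
    weight N (j - 1) * (2 * modeSum N z.x z.b (j - 1) + z.x ^ 2 * modeSum N z.x z.b (j - 1) ^ 2)) ^ 2

/-- The part of `m' / x²` which is regular in `x` and does not involve `B`, `Θ`, `a`. -/
def massH : ℝ := etaSum N (modeSum N z.x (modeIdx z.θ)) / (4 * z.S ^ 2) +
  z.zetaHat N / (4 * z.S ^ 2) + z.sqHat N (z.b + modeIdx z.b) + z.pressureHat N

/-- The remainder of `m' / x²` after `massH`, divided by `x`. Quadratic forms are split at `B = Θ =
0`, and `ν` and `1 / ν` are expanded as `1 - x d` and `1 + x d / ν`. -/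
def massG : ℝ :=
  (etaSum N (modeSum N z.x (modeIdx z.θ + z.Θ)) - etaSum N (modeSum N z.x (modeIdx z.θ)) +
      (z.x - 1) * etaSum N (modeSum N z.x z.Θ)) / (4 * z.S ^ 2) +
    z.d ℓ / z.nu ℓ * (z.zetaHat N / (4 * z.S ^ 2)) +
    z.nu ℓ * (z.sqHat N (z.b + modeIdx z.b + z.B) - z.sqHat N (z.b + modeIdx z.b) +
      (z.x - 1) * z.sqHat N z.B) - z.d ℓ * z.sqHat N (z.b + modeIdx z.b)

/-- `m' / x²`. -/
def massHat : ℝ := z.massH N + z.x * z.massG N ℓ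

/-- The quotient `(ν' + 2) / x`, when `m'` is replaced by `x² massHat`. -/
def rho0 : ℝ := 2 - 2 * z.massHat N ℓ * (1 - z.x) ^ 3 + 6 * z.x * z.a * (1 - z.x) ^ 2 +
  2 * z.a * (1 - z.x) ^ 3 + 2 / ℓ ^ 2

/-- Defined so that `(-2 + x rho0) / ν = -2 + x rho`, the expansion of `ν' / ν` at the origin. -/
def rho : ℝ := (z.rho0 N ℓ - 2 * z.d ℓ) / z.nu ℓ

/-- The second-order remainder in `1 / ν = 1 + 2 x + x² tau`, valid for `ν ≠ 0`. -/
def tau : ℝ := -1 + 2 * z.a * (1 - z.x) ^ 3 - 1 / ℓ ^ 2 + z.d ℓ ^ 2 / z.nu ℓ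

/-- The forcing in `x b_k'' + 2 (k + 1) b_k' = bH + x bG`. The two summands arise from the leading
parts `-2` of `ν' / ν` and `2 x` of `1 / ν - 1`; neither involves `B`, `Θ` or `a`. -/
def bH : ℕ → ℝ := (2 : ℝ) • (z.b + modeIdx z.b) + (2 : ℝ) • modeEig z.b

def bG : ℕ → ℝ := (-(z.sigmaHat N ℓ + z.rho N ℓ)) • z.bt + (2 : ℝ) • z.B + z.tau ℓ • modeEig z.b +
  (1 / z.nu ℓ) • ((1 / 2 : ℝ) • modeEig (modeMul N z.x z.b z.b) + modeMul N z.x z.b (modeEig z.b) +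
    (z.x ^ 2 / 2) • modeMul N z.x z.b (modeEig (modeMul N z.x z.b z.b))) -
  (1 / (4 * z.nu ℓ ^ 2 * z.S ^ 2)) • (modeMul N z.x z.θ z.θ +
    z.x ^ 2 • modeMul N z.x z.b (modeMul N z.x z.θ z.θ))

/-- The forcing in `x θ_k'' + 2 (k + 1) θ_k' = tH + x tG`, from the term `2 x` in the expansion of
`1 / ν`. -/
def tH : ℕ → ℝ := (2 : ℝ) • modeEig z.θ

def tG : ℕ → ℝ := z.sigmaHat N ℓ • z.tt + z.tau ℓ • modeEig z.θ + (1 / z.nu ℓ) •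
  modeEig ((2 : ℝ) • modeMul N z.x z.b z.θ + z.x ^ 2 • modeMul N z.x z.b (modeMul N z.x z.b z.θ))

end

variable {N : ℕ} {ℓ : ℝ} {z : OriginState}

theorem nuOf_eq (hx : z.x ≠ 0) : nuOf 1 ℓ (z.x ^ 3 * z.a) z.x = z.nu ℓ := by
  rw [nuOf, nu, d]; field_simp; ring

theorem weight_nonneg {N j : ℕ} (hj : j ≤ N) : 0 ≤ weight N j := by
  have : (j : ℝ) ≤ N := Nat.cast_le.2 hj
  exact mul_nonneg (Nat.cast_nonneg _) (by linarith)

theorem w_sq {j : ℕ} (hj : j ≤ N) :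
    z.w N j ^ 2 = weight N j * (1 + z.x ^ 2 * modeSum N z.x z.b j) ^ 2 := by
  rw [w, mul_pow, Real.sq_sqrt (weight_nonneg hj)]

theorem zetaSum_eq : zetaSum N (z.w N) (z.E N) = z.x ^ 2 * z.zetaHat N :=
  zetaSum_mul N z.x (z.w N) (modeSum N z.x z.θ)

theorem sumSq_eq : sumSq N (z.dw N) = z.x ^ 2 * z.sqHat N z.bt := by
  rw [sqHat, ← sumSq_mul]
  exact sumSq_congr fun j _ => by rw [dw]; ring

theorem sigmaOf_eq (hx : z.x ≠ 0) :
    sigmaOf N z.x (z.nu ℓ) z.S (z.w N) (z.dw N) (z.E N) = z.x * z.sigmaHat N ℓ := by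
  rw [sigmaOf, zetaSum_eq, sumSq_eq, sigmaHat]
  rcases eq_or_ne (z.nu ℓ) 0 with h | h
  · rw [h]; simp; field_simp
  rcases eq_or_ne z.S 0 with h' | h'
  · rw [h']; simp; field_simp
  field_simp

/-- The vacuum values `ω_j² = j (N - j)` cancel the constant terms, because `N + 1 - 2 j` is the
difference of consecutive weights. What remains is quadratic in the deviation of order `x²`. -/
theorem pressure_eq (hx : z.x ≠ 0) : pressure N 1 z.x (z.w N) = z.x ^ 2 * z.pressureHat N := by
  rw [pressure, pressureHat, ← mul_assoc, Finset.mul_sum, Finset.mul_sum]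
  refine Finset.sum_congr rfl fun j hj => ?_
  have hj' := Finset.mem_Icc.1 hj
  rw [w_sq (by omega), w_sq (by omega)]
  have e : (1 : ℝ) * ((N : ℝ) + 1 - 2 * j) = weight N j - weight N (j - 1) := by
    rw [weight, weight, Nat.cast_sub hj'.1]; push_cast; ring
  rw [e]
  field_simp
  ring

/-- Polarisation of a quadratic form, written with its values only; the right side shows that the
`v`-dependence carries a factor `x`. -/
theorem etaSum_add_mul (N : ℕ) (x : ℝ) (u v : ℕ → ℝ) :
    etaSum N (u + x • v) = etaSum N u + x * (etaSum N (u + v) - etaSum N u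
      + (x - 1) * etaSum N v) := by
  have h : ∀ y j, alphaOf N (u + y • v) j = alphaOf N u j + y * alphaOf N v j := by
    intro y j
    have := alphaOf_add_mul N 1 y u v j
    rw [one_mul] at this
    rw [← this]
    congr 1
    ext i; simp
  have h1 : ∀ j, alphaOf N (u + v) j = alphaOf N u j + alphaOf N v j := by
    intro j
    have := h 1 j
    rwa [one_smul, one_mul] at this
  simp only [etaSum, h, h1, Finset.mul_sum, ← Finset.sum_add_distrib, ← Finset.sum_sub_distrib]
  exact Finset.sum_congr rfl fun j _ => by ring

theorem sqHat_add_smul (u v : ℕ → ℝ) (x : ℝ) :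
    z.sqHat N (u + x • v) = z.sqHat N u + x * (z.sqHat N (u + v) - z.sqHat N u
      + (x - 1) * z.sqHat N v) := by
  simp only [sqHat, sumSq, map_add, map_smul, Pi.add_apply, Pi.smul_apply, smul_eq_mul,
    Finset.mul_sum, ← Finset.sum_add_distrib, ← Finset.sum_sub_distrib]
  exact Finset.sum_congr rfl fun j _ => by ring

theorem massOf_eq (hx : z.x ≠ 0) (hν : z.nu ℓ ≠ 0) (hS : z.S ≠ 0) :
    massOf N 1 z.x (z.nu ℓ) z.S (z.w N) (z.dw N) (z.E N) (z.dE N) = z.x ^ 2 * z.massHat N ℓ := by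
  have hdE : z.dE N = modeSum N z.x (modeIdx z.θ) + z.x • modeSum N z.x z.Θ := by
    ext j; simp [dE, tt]
  rw [massOf, zetaSum_eq, sumSq_eq, pressure_eq hx, hdE, etaSum_add_mul, bt, sqHat_add_smul,
    massHat, massH, massG, map_add]
  generalize etaSum N (modeSum N z.x (modeIdx z.θ)) = e1
  generalize etaSum N (modeSum N z.x (modeIdx z.θ) + modeSum N z.x z.Θ) = e2
  generalize etaSum N (modeSum N z.x z.Θ) = e3
  generalize z.sqHat N (z.b + modeIdx z.b + z.B) = e4
  generalize z.sqHat N (z.b + modeIdx z.b) = e5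
  have hd : z.d ℓ = (1 - z.nu ℓ) / z.x := by rw [nu]; field_simp; ring
  rw [hd]
  field_simp
  ring

/-- The weights satisfy `γ_j - (γ_{j+1} + γ_{j-1}) / 2 = 1`, so `W_j` vanishes at the vacuum. Its
deviation is a discrete second difference, given by the eigenvalue operator. -/
theorem wCoef_eq {j : ℕ} (hj : j ∈ Finset.Icc 1 (N - 1)) :
    wCoef 1 (z.w N) j = -(z.x ^ 2 / 2) * (2 * modeSum N z.x (modeEig z.b) j +
      z.x ^ 2 * modeSum N z.x (modeEig (modeMul N z.x z.b z.b)) j) := by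
  have hj' := Finset.mem_Icc.1 hj
  rw [wCoef, w_sq (by omega), w_sq (by omega), w_sq (by omega), modeSum_modeEig _ _ hj,
    modeSum_modeEig _ _ hj, modeSum_modeMul, modeSum_modeMul, modeSum_modeMul]
  have e : weight N j - (weight N (j + 1) + weight N (j - 1)) / 2 = 1 := by
    rw [weight, weight, weight, Nat.cast_sub hj'.1]; push_cast; ring
  linear_combination -e

theorem elecForce_eq {j : ℕ} (hj : j ∈ Finset.Icc 1 (N - 1)) :
    elecForce (z.w N) (z.E N) j = z.x * modeSum N z.x (modeEig (z.θ +
      z.x ^ 2 • ((2 : ℝ) • modeMul N z.x z.b z.θ +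
        z.x ^ 2 • modeMul N z.x z.b (modeMul N z.x z.b z.θ)))) j := by
  have hj' := Finset.mem_Icc.1 hj
  rw [elecForce, w_sq (by omega), w_sq (by omega), w_sq (by omega), modeSum_modeEig _ _ hj]
  simp only [map_add, map_smul, Pi.add_apply, Pi.smul_apply, smul_eq_mul, modeSum_modeMul, E]
  ring

/-- The residual of the magnetic equation in the regularised variables. -/
theorem flux_residual (hx : z.x ≠ 0) (hν : z.nu ℓ ≠ 0) (hS : z.S ≠ 0) (B₂ : ℕ → ℝ) {j : ℕ}
    (hj : j ∈ Finset.Icc 1 (N - 1)) :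
    (-2 + z.x * z.rho0 N ℓ) * z.dw N j + z.nu ℓ * (√(weight N j) * modeSum N z.x
        (modeIdx z.bt + z.x • (z.B + modeIdx z.B + z.B + z.x • B₂)) j) -
      (-(z.x * z.sigmaHat N ℓ) * (z.nu ℓ * z.dw N j)
        - z.w N j * z.E N j ^ 2 / (4 * z.nu ℓ * z.S ^ 2)
        - wCoef 1 (z.w N) j * z.w N j / z.x ^ 2) =
    √(weight N j) * z.nu ℓ * z.x * modeSum N z.x (z.x • B₂ + (2 : ℝ) • (z.B + modeIdx z.B) - z.bH -
      z.x • z.bG N ℓ) j := by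
  rw [wCoef_eq hj, bH, bG, rho, tau, bt]
  simp only [map_add, map_smul, map_sub, Pi.add_apply, Pi.smul_apply, Pi.sub_apply, smul_eq_mul,
    modeSum_modeMul, modeIdx_modeIdx, E, dw, w, bt]
  -- Eliminating `d`, `a` and `ℓ` in favour of `ν` makes the claim a rational identity in
  -- independent quantities.
  have hd : z.d ℓ = (1 - z.nu ℓ) / z.x := by rw [nu]; field_simp; ring
  have hd1 : -1 + 2 * z.a * (1 - z.x) ^ 3 - 1 / ℓ ^ 2 = ((1 - z.nu ℓ) / z.x - 2) / z.x := by
    rw [← hd, d]; field_simp; ring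
  rw [hd1, hd]
  generalize z.rho0 N ℓ = r0
  generalize z.sigmaHat N ℓ = s0
  generalize z.nu ℓ = n at *
  field_simp
  ring

/-- The residual of the electric equation in the regularised variables. -/
theorem elec_residual (hx : z.x ≠ 0) (hν : z.nu ℓ ≠ 0) (Θ₂ : ℕ → ℝ) {j : ℕ}
    (hj : j ∈ Finset.Icc 1 (N - 1)) :
    modeSum N z.x (modeIdx z.tt - z.tt + z.x • (modeIdx z.Θ + z.Θ + z.x • Θ₂)) j / z.x -
      ((z.x * z.sigmaHat N ℓ - 2 / z.x) * z.dE N j +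
        elecForce (z.w N) (z.E N) j / (z.nu ℓ * z.x ^ 2)) =
    modeSum N z.x (z.x • Θ₂ + (2 : ℝ) • (z.Θ + modeIdx z.Θ) - z.tH - z.x • z.tG N ℓ) j := by
  rw [elecForce_eq hj, tH, tG, tau, dE, tt]
  simp only [map_add, map_smul, map_sub, Pi.add_apply, Pi.smul_apply, Pi.sub_apply, smul_eq_mul,
    modeIdx_modeIdx]
  have hd : z.d ℓ = (1 - z.nu ℓ) / z.x := by rw [nu]; field_simp; ring
  have hd1 : -1 + 2 * z.a * (1 - z.x) ^ 3 - 1 / ℓ ^ 2 = ((1 - z.nu ℓ) / z.x - 2) / z.x := by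
    rw [← hd, d]; field_simp; ring
  rw [hd1, hd]
  generalize z.sigmaHat N ℓ = s0
  generalize z.nu ℓ = n at *
  field_simp
  ring

end OriginState

/-! ### Smoothness and derivatives of the expressions at the origin. -/

namespace OriginState

section Smoothness

variable {V : Type*} [NormedAddCommGroup V] [NormedSpace ℝ V]

structure IsSmoothOn (z : V → OriginState) (s : Set V) : Prop where
  x : ContDiffOn ℝ (⊤ : ℕ∞) (fun v => (z v).x) s
  b : ∀ k, ContDiffOn ℝ (⊤ : ℕ∞) (fun v => (z v).b k) s
  θ : ∀ k, ContDiffOn ℝ (⊤ : ℕ∞) (fun v => (z v).θ k) s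
  S : ContDiffOn ℝ (⊤ : ℕ∞) (fun v => (z v).S) s
  B : ∀ k, ContDiffOn ℝ (⊤ : ℕ∞) (fun v => (z v).B k) s
  Θ : ∀ k, ContDiffOn ℝ (⊤ : ℕ∞) (fun v => (z v).Θ k) s
  a : ContDiffOn ℝ (⊤ : ℕ∞) (fun v => (z v).a) s

variable {N : ℕ} {ℓ : ℝ} {z : V → OriginState} {s : Set V}

theorem contDiffOn_sqHat (hz : IsSmoothOn z s) {c : V → ℕ → ℝ}
    (hc : ∀ k, ContDiffOn ℝ (⊤ : ℕ∞) (fun v => c v k) s) :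
    ContDiffOn ℝ (⊤ : ℕ∞) (fun v => (z v).sqHat N (c v)) s :=
  contDiffOn_sumSq fun j _ => contDiffOn_const.mul (contDiffOn_modeSum hz.x hc j)

namespace IsSmoothOn

theorem d (hz : IsSmoothOn z s) : ContDiffOn ℝ (⊤ : ℕ∞) (fun v => (z v).d ℓ) s :=
  ((contDiffOn_const.sub hz.x).add (((contDiffOn_const.mul hz.x).mul hz.a).mul
    ((contDiffOn_const.sub hz.x).pow 3))).sub (hz.x.div_const _)

theorem nu (hz : IsSmoothOn z s) : ContDiffOn ℝ (⊤ : ℕ∞) (fun v => (z v).nu ℓ) s :=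
  contDiffOn_const.sub (hz.x.mul hz.d)

theorem bt (hz : IsSmoothOn z s) (k : ℕ) : ContDiffOn ℝ (⊤ : ℕ∞) (fun v => (z v).bt k) s :=
  ((hz.b k).add (contDiffOn_modeIdx hz.b k)).add (hz.x.mul (hz.B k))

theorem tt (hz : IsSmoothOn z s) (k : ℕ) : ContDiffOn ℝ (⊤ : ℕ∞) (fun v => (z v).tt k) s :=
  (contDiffOn_modeIdx hz.θ k).add (hz.x.mul (hz.Θ k))

theorem w (hz : IsSmoothOn z s) (j : ℕ) : ContDiffOn ℝ (⊤ : ℕ∞) (fun v => (z v).w N j) s :=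
  contDiffOn_const.mul (contDiffOn_const.add ((hz.x.pow 2).mul (contDiffOn_modeSum hz.x hz.b j)))

theorem dw (hz : IsSmoothOn z s) (j : ℕ) : ContDiffOn ℝ (⊤ : ℕ∞) (fun v => (z v).dw N j) s :=
  contDiffOn_const.mul (hz.x.mul (contDiffOn_modeSum hz.x hz.bt j))

theorem E (hz : IsSmoothOn z s) (j : ℕ) : ContDiffOn ℝ (⊤ : ℕ∞) (fun v => (z v).E N j) s :=
  hz.x.mul (contDiffOn_modeSum hz.x hz.θ j)

theorem dE (hz : IsSmoothOn z s) (j : ℕ) : ContDiffOn ℝ (⊤ : ℕ∞) (fun v => (z v).dE N j) s :=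
  contDiffOn_modeSum hz.x hz.tt j

theorem zetaHat (hz : IsSmoothOn z s) : ContDiffOn ℝ (⊤ : ℕ∞) (fun v => (z v).zetaHat N) s :=
  contDiffOn_zetaSum (fun j _ => hz.w j) fun j _ => contDiffOn_modeSum hz.x hz.θ j

theorem sigmaHat (hz : IsSmoothOn z s) (hν : ∀ v ∈ s, (z v).nu ℓ ≠ 0) (hS : ∀ v ∈ s, (z v).S ≠ 0) :
    ContDiffOn ℝ (⊤ : ℕ∞) (fun v => (z v).sigmaHat N ℓ) s := by
  refine ((contDiffOn_const.sub hz.x).pow 3).mul ((hz.zetaHat.div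
    ((contDiffOn_const.mul (hz.nu.pow 2)).mul (hz.S.pow 2)) fun v hv => ?_).add
    (contDiffOn_const.mul (contDiffOn_sqHat hz hz.bt)))
  have := hν v hv
  have := hS v hv
  positivity

theorem pressureHat (hz : IsSmoothOn z s) :
    ContDiffOn ℝ (⊤ : ℕ∞) (fun v => (z v).pressureHat N) s := by
  have h : ∀ j, ContDiffOn ℝ (⊤ : ℕ∞) (fun v => weight N j * (2 * modeSum N (z v).x (z v).b j +
      (z v).x ^ 2 * modeSum N (z v).x (z v).b j ^ 2)) s := fun j =>
    contDiffOn_const.mul ((contDiffOn_const.mul (contDiffOn_modeSum hz.x hz.b j)).add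
      ((hz.x.pow 2).mul ((contDiffOn_modeSum hz.x hz.b j).pow 2)))
  exact contDiffOn_const.mul (ContDiffOn.sum fun j _ => ((h j).sub (h (j - 1))).pow 2)

theorem etaSum (hz : IsSmoothOn z s) {c : V → ℕ → ℝ}
    (hc : ∀ k, ContDiffOn ℝ (⊤ : ℕ∞) (fun v => c v k) s) :
    ContDiffOn ℝ (⊤ : ℕ∞) (fun v => etaSum N (modeSum N (z v).x (c v))) s :=
  contDiffOn_etaSum fun j _ => contDiffOn_modeSum hz.x hc j

theorem massH (hz : IsSmoothOn z s) (hS : ∀ v ∈ s, (z v).S ≠ 0) :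
    ContDiffOn ℝ (⊤ : ℕ∞) (fun v => (z v).massH N) s := by
  have h4 : ∀ v ∈ s, 4 * (z v).S ^ 2 ≠ 0 := fun v hv => by
    have := hS v hv
    positivity
  have h5 : ContDiffOn ℝ (⊤ : ℕ∞) (fun v => 4 * (z v).S ^ 2) s := contDiffOn_const.mul (hz.S.pow 2)
  exact ((((hz.etaSum (contDiffOn_modeIdx hz.θ)).div h5 h4).add (hz.zetaHat.div h5 h4)).add
    (contDiffOn_sqHat hz fun k => (hz.b k).add (contDiffOn_modeIdx hz.b k))).add hz.pressureHat

theorem massG (hz : IsSmoothOn z s) (hν : ∀ v ∈ s, (z v).nu ℓ ≠ 0) (hS : ∀ v ∈ s, (z v).S ≠ 0) :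
    ContDiffOn ℝ (⊤ : ℕ∞) (fun v => (z v).massG N ℓ) s := by
  have h4 : ∀ v ∈ s, 4 * (z v).S ^ 2 ≠ 0 := fun v hv => by
    have := hS v hv
    positivity
  have h5 : ContDiffOn ℝ (⊤ : ℕ∞) (fun v => 4 * (z v).S ^ 2) s := contDiffOn_const.mul (hz.S.pow 2)
  have hi := contDiffOn_modeIdx hz.b
  have ht := contDiffOn_modeIdx hz.θ
  have h0 : ContDiffOn ℝ (⊤ : ℕ∞) (fun v => (z v).sqHat N ((z v).b + modeIdx (z v).b)) s :=
    contDiffOn_sqHat hz fun k => (hz.b k).add (hi k)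
  have hx1 : ContDiffOn ℝ (⊤ : ℕ∞) (fun v => (z v).x - 1) s := hz.x.sub contDiffOn_const
  refine ContDiffOn.sub (ContDiffOn.add (ContDiffOn.add (ContDiffOn.div ?_ h5 h4)
    ((hz.d.div hz.nu hν).mul (hz.zetaHat.div h5 h4))) (hz.nu.mul ?_)) (hz.d.mul h0)
  · exact ((hz.etaSum fun k => (ht k).add (hz.Θ k)).sub (hz.etaSum ht)).add
      (hx1.mul (hz.etaSum hz.Θ))
  · exact ((contDiffOn_sqHat hz fun k => ((hz.b k).add (hi k)).add (hz.B k)).sub h0).add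
      (hx1.mul (contDiffOn_sqHat hz hz.B))

theorem rho (hz : IsSmoothOn z s) (hν : ∀ v ∈ s, (z v).nu ℓ ≠ 0) (hS : ∀ v ∈ s, (z v).S ≠ 0) :
    ContDiffOn ℝ (⊤ : ℕ∞) (fun v => (z v).rho N ℓ) s := by
  have hM : ContDiffOn ℝ (⊤ : ℕ∞) (fun v => (z v).massHat N ℓ) s :=
    (hz.massH hS).add (hz.x.mul (hz.massG hν hS))
  have h0 : ContDiffOn ℝ (⊤ : ℕ∞) (fun v => (z v).rho0 N ℓ) s := by
    have hx := hz.x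
    have ha := hz.a
    unfold rho0
    fun_prop
  exact (h0.sub (contDiffOn_const.mul hz.d)).div hz.nu hν

theorem tau (hz : IsSmoothOn z s) (hν : ∀ v ∈ s, (z v).nu ℓ ≠ 0) :
    ContDiffOn ℝ (⊤ : ℕ∞) (fun v => (z v).tau ℓ) s :=
  ((contDiffOn_const.add ((contDiffOn_const.mul hz.a).mul
    ((contDiffOn_const.sub hz.x).pow 3))).sub contDiffOn_const).add ((hz.d.pow 2).div hz.nu hν)

theorem bH (hz : IsSmoothOn z s) (k : ℕ) : ContDiffOn ℝ (⊤ : ℕ∞) (fun v => (z v).bH k) s :=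
  (contDiffOn_const.mul ((hz.b k).add (contDiffOn_modeIdx hz.b k))).add
    (contDiffOn_const.mul (contDiffOn_modeEig hz.b k))

theorem tH (hz : IsSmoothOn z s) (k : ℕ) : ContDiffOn ℝ (⊤ : ℕ∞) (fun v => (z v).tH k) s :=
  contDiffOn_const.mul (contDiffOn_modeEig hz.θ k)

theorem bG (hz : IsSmoothOn z s) (hν : ∀ v ∈ s, (z v).nu ℓ ≠ 0) (hS : ∀ v ∈ s, (z v).S ≠ 0)
    (k : ℕ) : ContDiffOn ℝ (⊤ : ℕ∞) (fun v => (z v).bG N ℓ k) s := by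
  have h1 := contDiffOn_modeMul (N := N) hz.x hz.b hz.b
  have h2 := contDiffOn_modeMul (N := N) hz.x hz.b (contDiffOn_modeEig hz.b)
  have h3 := contDiffOn_modeMul (N := N) hz.x hz.b (contDiffOn_modeEig h1)
  have h4 := contDiffOn_modeMul (N := N) hz.x hz.θ hz.θ
  have h5 := contDiffOn_modeMul (N := N) hz.x hz.b h4
  refine ContDiffOn.sub (ContDiffOn.add (ContDiffOn.add (ContDiffOn.add
    (((hz.sigmaHat hν hS).add (hz.rho hν hS)).neg.mul (hz.bt k)) (contDiffOn_const.mul (hz.B k)))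
    ((hz.tau hν).mul (contDiffOn_modeEig hz.b k))) ((contDiffOn_const.div hz.nu hν).mul
    (((contDiffOn_const.mul (contDiffOn_modeEig h1 k)).add (h2 k)).add
      (((hz.x.pow 2).div_const 2).mul (h3 k))))) ((contDiffOn_const.div
      ((contDiffOn_const.mul (hz.nu.pow 2)).mul (hz.S.pow 2)) fun v hv => ?_).mul
      ((h4 k).add ((hz.x.pow 2).mul (h5 k))))
  have := hν v hv
  have := hS v hv
  positivity

theorem tG (hz : IsSmoothOn z s) (hν : ∀ v ∈ s, (z v).nu ℓ ≠ 0) (hS : ∀ v ∈ s, (z v).S ≠ 0)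
    (k : ℕ) : ContDiffOn ℝ (⊤ : ℕ∞) (fun v => (z v).tG N ℓ k) s := by
  have h1 := contDiffOn_modeMul (N := N) hz.x hz.b hz.θ
  have h2 := contDiffOn_modeMul (N := N) hz.x hz.b h1
  exact (((hz.sigmaHat hν hS).mul (hz.tt k)).add ((hz.tau hν).mul (contDiffOn_modeEig hz.θ k))).add
    ((contDiffOn_const.div hz.nu hν).mul (contDiffOn_modeEig (fun k =>
      (contDiffOn_const.mul (h1 k)).add ((hz.x.pow 2).mul (h2 k))) k))

end IsSmoothOn

end Smoothness

section Derivatives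

variable {N : ℕ} {ℓ x : ℝ} {z : ℝ → OriginState}

theorem hasDerivAt_w (hzx : ∀ y, (z y).x = y)
    (hb : ∀ k ∈ Finset.Icc 1 (N - 1), HasDerivAt (fun y => (z y).b k) ((z x).B k) x) (j : ℕ) :
    HasDerivAt (fun y => (z y).w N j) ((z x).dw N j) x := by
  have h := ((hasDerivAt_pow_mul_modeSum 1 j hb).const_add 1).const_mul √(weight N j)
  simp only [w, dw, hzx]
  refine h.congr_deriv ?_
  rw [pow_one, show (z x).bt = modeIdx (fun k => (z x).b k) + ((1 : ℕ) : ℝ) • (fun k => (z x).b k)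
    + x • (z x).B by rw [bt, hzx]; ext; simp; ring]

theorem hasDerivAt_E (hzx : ∀ y, (z y).x = y)
    (hθ : ∀ k ∈ Finset.Icc 1 (N - 1), HasDerivAt (fun y => (z y).θ k) ((z x).Θ k) x) (j : ℕ) :
    HasDerivAt (fun y => (z y).E N j) ((z x).dE N j) x := by
  have h := hasDerivAt_pow_mul_modeSum 0 j hθ
  simp only [zero_add, pow_one, pow_zero, one_mul] at h
  simp only [E, dE, hzx]
  refine h.congr_deriv ?_
  rw [show (z x).tt = modeIdx (fun k => (z x).θ k) + ((0 : ℕ) : ℝ) • (fun k => (z x).θ k)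
    + x • (z x).Θ by rw [tt, hzx]; ext; simp]

theorem hasDerivAt_dw (hzx : ∀ y, (z y).x = y)
    (hb : ∀ k ∈ Finset.Icc 1 (N - 1), HasDerivAt (fun y => (z y).b k) ((z x).B k) x) {B₂ : ℕ → ℝ}
    (hB : ∀ k ∈ Finset.Icc 1 (N - 1), HasDerivAt (fun y => (z y).B k) (B₂ k) x) (j : ℕ) :
    HasDerivAt (fun y => (z y).dw N j) (√(weight N j) * modeSum N x (modeIdx (z x).bt +
      x • ((z x).B + modeIdx (z x).B + (z x).B + x • B₂)) j) x := by
  have h0 : ∀ k ∈ Finset.Icc 1 (N - 1), HasDerivAt (fun y => (z y).bt k)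
      (((z x).B + modeIdx (z x).B + (z x).B + x • B₂) k) x := by
    intro k hk
    simp only [bt, hzx, Pi.add_apply, Pi.smul_apply, smul_eq_mul, modeIdx_apply]
    refine (((hb k hk).add ((hb k hk).const_mul _)).add
      ((hasDerivAt_id x).mul (hB k hk))).congr_deriv ?_
    simp only [id]; ring
  have h := (hasDerivAt_pow_mul_modeSum 0 j h0).const_mul √(weight N j)
  simp only [zero_add, pow_one, pow_zero, one_mul, Nat.cast_zero, zero_smul, add_zero] at h
  simp only [dw, hzx]
  exact h

theorem hasDerivAt_dE (hzx : ∀ y, (z y).x = y) (hx : x ≠ 0)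
    (hθ : ∀ k ∈ Finset.Icc 1 (N - 1), HasDerivAt (fun y => (z y).θ k) ((z x).Θ k) x) {Θ₂ : ℕ → ℝ}
    (hΘ : ∀ k ∈ Finset.Icc 1 (N - 1), HasDerivAt (fun y => (z y).Θ k) (Θ₂ k) x) (j : ℕ) :
    HasDerivAt (fun y => (z y).dE N j) (modeSum N x (modeIdx (z x).tt - (z x).tt +
      x • (modeIdx (z x).Θ + (z x).Θ + x • Θ₂)) j / x) x := by
  have h0 : ∀ k ∈ Finset.Icc 1 (N - 1), HasDerivAt (fun y => (z y).tt k)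
      ((modeIdx (z x).Θ + (z x).Θ + x • Θ₂) k) x := by
    intro k hk
    simp only [tt, hzx, Pi.add_apply, Pi.smul_apply, smul_eq_mul, modeIdx_apply]
    refine (((hθ k hk).const_mul _).add ((hasDerivAt_id x).mul (hΘ k hk))).congr_deriv ?_
    simp only [id]; ring
  have h := hasDerivAt_pow_mul_modeSum 0 j h0
  simp only [zero_add, pow_one, pow_zero, one_mul, Nat.cast_zero, zero_smul, add_zero] at h
  simp only [dE, hzx]
  refine (HasDerivAt.of_id_mul hx h).congr_deriv ?_
  simp only [map_add, map_sub, Pi.add_apply, Pi.sub_apply]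
  ring

theorem hasDerivAt_nu {X : CompactFields} {M a : ℝ} (hx : x ≠ 0) (hm : HasDerivAt X.m (x ^ 2 * M) x)
    (ha : X.m x = x ^ 3 * a) : HasDerivAt (fun y => X.nu 1 ℓ y) (-2 + x * (2 - 2 * M * (1 - x) ^ 3 +
      6 * x * a * (1 - x) ^ 2 + 2 * a * (1 - x) ^ 3 + 2 / ℓ ^ 2)) x := by
  have hid := hasDerivAt_id x
  have h1 := hid.const_sub 1
  refine ((((h1.pow 2).const_mul 1).sub (((hm.const_mul 2).mul (h1.pow 3)).div hid hx)).add
    ((hid.pow 2).div_const (ℓ ^ 2))).congr_deriv ?_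
  simp only [id, ha, Pi.mul_apply, Pi.pow_apply]
  field_simp
  ring

end Derivatives

end OriginState

/-! ### The regular-singular system at the origin. -/

noncomputable section OriginSystem

variable (N : ℕ) (ℓ : ℝ)

def originState {N : ℕ} (z : Phase N) : OriginState :=
  ⟨z.1, blockA z.2.1, blockB z.2.1, blockC z.2.1, blockA z.2.2, blockB z.2.2, blockC z.2.2⟩

/-- The zeros are placeholders: `bH`, `tH` and `massH` do not involve `B`, `Θ` or `a`, as the
forcing `h(t, p)` requires. -/
def originBase {N : ℕ} (z : ℝ × (BlockIdx N → ℝ)) : OriginState :=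
  ⟨z.1, blockA z.2, blockB z.2, blockC z.2, 0, 0, 0⟩

def originF (z : Phase N) : BlockIdx N → ℝ :=
  blocks N (originState z).B (originState z).Θ
    ((originState z).S * ((originState z).x * (originState z).sigmaHat N ℓ))

def originH (z : ℝ × (BlockIdx N → ℝ)) : BlockIdx N → ℝ :=
  blocks N (originBase z).bH (originBase z).tH ((originBase z).massH N)

def originG (z : Phase N) : BlockIdx N → ℝ :=
  blocks N ((originState z).bG N ℓ) ((originState z).tG N ℓ) ((originState z).massG N ℓ)

/-- The mode exponents come from `(x^(k+1) b)'' - k (k + 1) x^(k-1) b = x^(k+1) (b'' + 2 (k + 1) b'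
/ x)` and its electric analogue; the `3` comes from `(x³ a)' = x² (3 a + x a')`. -/
def originLam (N : ℕ) : BlockIdx N → ℕ :=
  Sum.elim (fun k => 2 * ((k : ℕ) + 1)) (Sum.elim (fun k => 2 * ((k : ℕ) + 1)) fun _ => 3)

def originDomain : Set (Phase N) :=
  {z | 0 < (originState z).S} ∩ {z | 0 < (originState z).nu ℓ}

end OriginSystem

section

variable {N : ℕ} {ℓ : ℝ}

theorem isSmoothOn_originState_comp {V : Type*} [NormedAddCommGroup V] [NormedSpace ℝ V]
    {s : Set V} {x : V → ℝ} {p q : V → BlockIdx N → ℝ} (hx : ContDiffOn ℝ (⊤ : ℕ∞) x s)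
    (hp : ContDiffOn ℝ (⊤ : ℕ∞) p s) (hq : ContDiffOn ℝ (⊤ : ℕ∞) q s) :
    OriginState.IsSmoothOn (fun v => originState (x v, p v, q v)) s :=
  ⟨hx, contDiffOn_blockA hp, contDiffOn_blockB hp, contDiffOn_blockC hp, contDiffOn_blockA hq,
    contDiffOn_blockB hq, contDiffOn_blockC hq⟩

theorem isSmoothOn_originState (s : Set (Phase N)) :
    OriginState.IsSmoothOn (originState : Phase N → OriginState) s := by
  obtain ⟨h1, h2, h3⟩ := contDiffOn_blocks_coord s
  exact isSmoothOn_originState_comp h1 h2 h3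

theorem isOpen_originDomain : IsOpen (originDomain N ℓ) := by
  have h := isSmoothOn_originState (univ : Set (Phase N))
  refine (isOpen_lt continuous_const ?_).inter (isOpen_lt continuous_const ?_)
  · exact continuousOn_univ.1 h.S.continuousOn
  · exact continuousOn_univ.1 h.nu.continuousOn

theorem contDiffOn_origin :
    ContDiffOn ℝ (⊤ : ℕ∞) (originF N ℓ) (originDomain N ℓ) ∧
    ContDiffOn ℝ (⊤ : ℕ∞) (originG N ℓ) (originDomain N ℓ) := by
  have h := isSmoothOn_originState (originDomain N ℓ)
  have hS : ∀ z ∈ originDomain N ℓ, (originState z).S ≠ 0 := fun z hz =>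
    (show 0 < (originState z).S from hz.1).ne'
  have hν : ∀ z ∈ originDomain N ℓ, (originState z).nu ℓ ≠ 0 := fun z hz =>
    (show 0 < (originState z).nu ℓ from hz.2).ne'
  exact ⟨contDiffOn_blocks (fun j _ => h.B j) (fun j _ => h.Θ j)
    (h.S.mul (h.x.mul (h.sigmaHat hν hS))), contDiffOn_blocks (fun j _ => h.bG hν hS j)
    (fun j _ => h.tG hν hS j) (h.massG hν hS)⟩

theorem contDiffOn_originH :
    ContDiffOn ℝ (⊤ : ℕ∞) (originH N) {z | 0 < (originBase z).S} := by
  have h2 : ContDiffOn ℝ (⊤ : ℕ∞) (fun z : ℝ × (BlockIdx N → ℝ) => z.2)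
    {z | 0 < (originBase z).S} := contDiffOn_snd
  have h : OriginState.IsSmoothOn (originBase : ℝ × (BlockIdx N → ℝ) → OriginState)
      {z | 0 < (originBase z).S} :=
    ⟨contDiffOn_fst, contDiffOn_blockA h2, contDiffOn_blockB h2, contDiffOn_blockC h2,
      fun _ => contDiffOn_const, fun _ => contDiffOn_const, contDiffOn_const⟩
  have hS : ∀ z ∈ {z : ℝ × (BlockIdx N → ℝ) | 0 < (originBase z).S}, (originBase z).S ≠ 0 :=
    fun z hz => (show 0 < (originBase z).S from hz).ne'
  exact contDiffOn_blocks (fun j _ => h.bH j) (fun j _ => h.tH j) (h.massH hS)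

theorem isOpen_originBase : IsOpen {z : ℝ × (BlockIdx N → ℝ) | 0 < (originBase z).S} := by
  have := continuous_blockC (N := N)
  exact isOpen_lt continuous_const (this.comp continuous_snd)

/-- The compactified fields built from a solution of the regularised system at the origin. -/
noncomputable def originFields (N : ℕ) (P Q : ℝ → BlockIdx N → ℝ) : CompactFields where
  m x := x ^ 3 * (originState (x, P x, Q x)).a
  S x := (originState (x, P x, Q x)).S
  w j x := (originState (x, P x, Q x)).w N j
  dw j x := (originState (x, P x, Q x)).dw N j
  E j x := (originState (x, P x, Q x)).E N j
  dE j x := (originState (x, P x, Q x)).dE N j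

theorem OriginState.w_zero (z : OriginState) : z.w N 0 = 0 := by simp [w, weight_zero]

theorem OriginState.w_last (z : OriginState) : z.w N N = 0 := by simp [w, weight_self]

theorem originFields_nu {P Q : ℝ → BlockIdx N → ℝ} {x : ℝ} (hx : x ≠ 0) :
    (originFields N P Q).nu 1 ℓ x = (originState (x, P x, Q x)).nu ℓ :=
  OriginState.nuOf_eq (z := originState (x, P x, Q x)) hx

variable {P Q : ℝ → BlockIdx N → ℝ}

/-- The residuals of the original equations are multiples of mode sums of the residuals of the
regularised ones, so solving the latter solves the former. -/
theorem originFields_isCompactSolution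
    (hP : ContDiffOn ℝ (⊤ : ℕ∞) P (Icc 0 1)) (hQ : ContDiffOn ℝ (⊤ : ℕ∞) Q (Icc 0 1))
    (hU : ∀ t ∈ Icc (0 : ℝ) 1, (t, P t, Q t) ∈ originDomain N ℓ)
    (hp : ∀ t ∈ Ioo (0 : ℝ) 1, ∀ i, HasDerivAt (fun s => P s i) (originF N ℓ (t, P t, Q t) i) t)
    (hq : ∀ t ∈ Ioo (0 : ℝ) 1, ∀ i, HasDerivAt (fun s => Q s i)
      ((originH N (t, P t) i - (originLam N i : ℝ) * Q t i) / t +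
        originG N ℓ (t, P t, Q t) i) t) :
    IsCompactSolution N 1 ℓ 0 (originFields N P Q) := by
  set Y := originFields N P Q with hY
  set z : ℝ → OriginState := fun x => originState (x, P x, Q x) with hz
  have hs : OriginState.IsSmoothOn z (Ico 0 1) := isSmoothOn_originState_comp contDiffOn_id
    (hP.mono Ico_subset_Icc_self) (hQ.mono Ico_subset_Icc_self)
  have hzx : ∀ y, (z y).x = y := fun y => rfl
  refine ⟨(contDiffOn_id.pow 3).mul hs.a, hs.S, fun j _ => hs.w j, fun j _ => hs.dw j,
    fun j _ => hs.E j, fun j _ => hs.dE j, fun x => (z x).w_zero, fun x => (z x).w_last,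
    fun x hx => (hU x (Ico_subset_Icc_self hx)).1, fun x hx => ?_, fun x hx => ?_⟩
  · rw [originFields_nu hx.1.ne']
    exact (hU x (Ioo_subset_Icc_self hx)).2
  have hx0 : x ≠ 0 := hx.1.ne'
  have hν : 0 < (z x).nu ℓ := (hU x (Ioo_subset_Icc_self hx)).2
  have hS : 0 < (z x).S := (hU x (Ioo_subset_Icc_self hx)).1
  have eν : Y.nu 1 ℓ x = (z x).nu ℓ := originFields_nu hx0
  have eσ : Y.sigma N 1 ℓ x = x * (z x).sigmaHat N ℓ := by
    rw [CompactFields.sigma, eν]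
    exact OriginState.sigmaOf_eq (z := z x) hx0
  obtain ⟨p1, p2, p3⟩ := forall_blockIdx.1 (hp x hx)
  obtain ⟨q1, q2, q3⟩ := forall_blockIdx.1 (hq x hx)
  have hb : ∀ k ∈ Finset.Icc 1 (N - 1), HasDerivAt (fun y => (z y).b k) ((z x).B k) x := by
    intro k hk
    simp only [hz, originState, blockA_of_mem _ hk]
    refine (p1 k hk).congr_deriv ?_
    simp [originF, blocks, originState, blockA_of_mem _ hk]
  have hθ : ∀ k ∈ Finset.Icc 1 (N - 1), HasDerivAt (fun y => (z y).θ k) ((z x).Θ k) x := by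
    intro k hk
    simp only [hz, originState, blockB_of_mem _ hk]
    refine (p2 k hk).congr_deriv ?_
    simp [originF, blocks, originState, blockB_of_mem _ hk]
  set B₂ : ℕ → ℝ := fun k => ((z x).bH k - 2 * ((k : ℝ) + 1) * (z x).B k) / x + (z x).bG N ℓ k
    with hB₂
  set Θ₂ : ℕ → ℝ := fun k => ((z x).tH k - 2 * ((k : ℝ) + 1) * (z x).Θ k) / x + (z x).tG N ℓ k
    with hΘ₂
  have hB : ∀ k ∈ Finset.Icc 1 (N - 1), HasDerivAt (fun y => (z y).B k) (B₂ k) x := by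
    intro k hk
    have e : (fun y => (z y).B k) = fun y => Q y (Sum.inl ⟨k, hk⟩) :=
      funext fun y => blockA_of_mem _ hk
    rw [e]
    refine (q1 k hk).congr_deriv ?_
    rw [hB₂, ← congrFun e x]
    simp only [originH, originG, originLam, blocks, Sum.elim_inl]
    push_cast
    rfl
  have hΘ : ∀ k ∈ Finset.Icc 1 (N - 1), HasDerivAt (fun y => (z y).Θ k) (Θ₂ k) x := by
    intro k hk
    have e : (fun y => (z y).Θ k) = fun y => Q y (Sum.inr (Sum.inl ⟨k, hk⟩)) :=
      funext fun y => blockB_of_mem _ hk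
    rw [e]
    refine (q2 k hk).congr_deriv ?_
    rw [hΘ₂, ← congrFun e x]
    simp only [originH, originG, originLam, blocks, Sum.elim_inl, Sum.elim_inr]
    push_cast
    rfl
  have ha : HasDerivAt (fun y => (z y).a) (((z x).massH N - 3 * (z x).a) / x + (z x).massG N ℓ)
      x := by
    refine q3.congr_deriv ?_
    simp only [originH, originG, originLam, blocks, Sum.elim_inr]
    push_cast
    rfl
  have hm : HasDerivAt Y.m (x ^ 2 * (z x).massHat N ℓ) x := by
    refine ((hasDerivAt_pow 3 x).mul ha).congr_deriv ?_
    rw [OriginState.massHat, hzx]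
    push_cast
    field_simp
    ring
  refine ⟨fun j hj => OriginState.hasDerivAt_w hzx hb j, fun j hj =>
    OriginState.hasDerivAt_E hzx hθ j, ?_, ?_, fun j hj => ?_, fun j hj => ?_⟩
  · refine hm.congr_deriv ?_
    rw [eν]
    exact (OriginState.massOf_eq (z := z x) hx0 hν.ne' hS.ne').symm
  · rw [eσ]
    exact p3
  · rw [eσ, eν]
    refine (OriginState.hasDerivAt_dE hzx hx0 hθ hΘ j).congr_deriv (sub_eq_zero.1 ?_)
    refine (OriginState.elec_residual (z := z x) hx0 hν.ne' Θ₂ hj).trans ?_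
    -- Every coefficient of the residual vanishes, since `Θ₂` is the second derivative prescribed by
    -- the regularised system.
    rw [modeSum_congr (b' := 0) (z x).x fun k _ => ?_, map_zero]
    · rfl
    · simp only [hΘ₂, hzx, Pi.add_apply, Pi.sub_apply, Pi.smul_apply, smul_eq_mul, modeIdx_apply,
        Pi.zero_apply]
      field_simp
      ring
  · rw [eσ, eν]
    have hev : (fun y => Y.nu 1 ℓ y * Y.dw j y) = (fun y => Y.nu 1 ℓ y) * fun y => (z y).dw N j :=
      rfl
    rw [hev]
    refine ((OriginState.hasDerivAt_nu hx0 hm rfl).mul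
      (OriginState.hasDerivAt_dw hzx hb hB j)).congr_deriv (sub_eq_zero.1 ?_)
    rw [eν]
    refine (OriginState.flux_residual (z := z x) hx0 hν.ne' hS.ne' B₂ hj).trans ?_
    rw [modeSum_congr (b' := 0) (z x).x fun k _ => ?_, map_zero, Pi.zero_apply, mul_zero]
    simp only [hB₂, hzx, Pi.add_apply, Pi.sub_apply, Pi.smul_apply, smul_eq_mul, modeIdx_apply,
      Pi.zero_apply]
    field_simp
    ring

end

/-! ### Solitons from the regularised system. -/

section

variable {N : ℕ} {ℓ : ℝ}

theorem tendsto_div_one_add_zero :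
    Tendsto (fun r : ℝ => r / (1 + r)) (𝓝[>] 0) (𝓝[Icc 0 1] 0) := by
  refine tendsto_nhdsWithin_iff.2 ⟨?_, ?_⟩
  · have h : ContinuousAt (fun r : ℝ => r / (1 + r)) 0 :=
      (hasDerivAt_div_one_add le_rfl).continuousAt
    have h2 := h.tendsto
    simp only [zero_div] at h2
    exact h2.mono_left nhdsWithin_le_nhds
  · filter_upwards [self_mem_nhdsWithin] with r (hr : 0 < r)
    exact ⟨by positivity, by rw [div_le_one (by linarith)]; linarith⟩

/-- A solution of the regularised system at the origin is a soliton. -/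
theorem originFields_isSoliton (hN : 1 ≤ N) (hℓ : 0 < ℓ) {P Q : ℝ → BlockIdx N → ℝ}
    (hP : ContDiffOn ℝ (⊤ : ℕ∞) P (Icc 0 1)) (hQ : ContDiffOn ℝ (⊤ : ℕ∞) Q (Icc 0 1))
    (hU : ∀ t ∈ Icc (0 : ℝ) 1, (t, P t, Q t) ∈ originDomain N ℓ)
    (hp : ∀ t ∈ Ioo (0 : ℝ) 1, ∀ i, HasDerivAt (fun s => P s i) (originF N ℓ (t, P t, Q t) i) t)
    (hq : ∀ t ∈ Ioo (0 : ℝ) 1, ∀ i, HasDerivAt (fun s => Q s i)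
      ((originH N (t, P t) i - (originLam N i : ℝ) * Q t i) / t +
        originG N ℓ (t, P t, Q t) i) t) :
    IsSoliton N ℓ ((originFields N P Q).S 1) ((originFields N P Q).toFields N) := by
  have hY := originFields_isCompactSolution hP hQ hU hp hq
  set Y := originFields N P Q with hYdef
  have e0 : (0 : ℝ) / (1 + 0) = 0 := by norm_num
  have hs : OriginState.IsSmoothOn (fun x => originState (x, P x, Q x)) (Icc 0 1) :=
    isSmoothOn_originState_comp contDiffOn_id hP hQ
  have hglob : IsGlobalSolution N 1 ℓ 0 (Y.S 1) (Y.toFields N) := by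
    refine IsCompactSolution.isGlobalSolution hN hℓ le_rfl (by rwa [e0]) ?_ ?_ ?_ ?_ ?_ ?_
    · rw [e0]; exact (contDiffOn_id.pow 3).mul hs.a
    · rw [e0]; exact hs.S
    · rw [e0]; exact fun j _ => hs.w j
    · rw [e0]; exact fun j _ => hs.dw j
    · rw [e0]; exact fun j _ => hs.E j
    · exact (hU 1 ⟨zero_le_one, le_rfl⟩).1
  refine ⟨hglob, ?_, fun j hj => ?_, fun j hj => ?_⟩
  · have h1 : Tendsto (fun r : ℝ => (originState (r / (1 + r), P (r / (1 + r)),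
        Q (r / (1 + r)))).a) (𝓝[>] 0) (𝓝 (originState (0, P 0, Q 0)).a) :=
      (hs.a.continuousOn 0 ⟨le_rfl, zero_le_one⟩).tendsto.comp tendsto_div_one_add_zero
    have h2 : (fun r : ℝ => (r / (1 + r)) ^ 3) =O[𝓝[>] 0] fun r => r ^ 3 := by
      refine IsBigO.pow (IsBigO.of_bound 1 ?_) 3
      filter_upwards [self_mem_nhdsWithin] with r (hr : 0 < r)
      rw [one_mul, Real.norm_of_nonneg (by positivity), Real.norm_of_nonneg hr.le]
      exact div_le_self hr.le (by linarith)
    have h3 := h2.mul (h1.isBigO_one ℝ)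
    simp only [mul_one] at h3
    exact h3
  · change (originState (0 / (1 + 0), _, _)).w N j = _
    simp [OriginState.w, originState, weight]
  · have h : (Y.toFields N).elec j 0 = Y.E j (0 / (1 + 0)) :=
      alphaOf_sub_alphaOf_succ (E := fun i => Y.E i (0 / (1 + 0))) hj
    rw [h, e0]
    change (originState (0, _, _)).E N j = 0
    simp [OriginState.E, originState]

/-- The expansions hold without remainder. Rewriting powers of `x` in terms of `r` puts powers of `1
+ r` into the coefficients, and these tend to `1`, so the data in `x` and in `r` agree. -/
theorem originFields_hasOriginData {P Q : ℝ → BlockIdx N → ℝ}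
    (hP : ContinuousOn P (Icc 0 1)) {β θ : ℕ → ℝ}
    (hβ : ∀ k ∈ Finset.Icc 1 (N - 1), blockA (P 0) k = β k)
    (hθ : ∀ k ∈ Finset.Icc 1 (N - 1), blockB (P 0) k = θ k) :
    HasOriginData N ((originFields N P Q).toFields N) β θ := by
  have hP0 : ∀ i, Tendsto (fun r : ℝ => P (r / (1 + r)) i) (𝓝[>] 0) (𝓝 (P 0 i)) := fun i =>
    ((continuousOn_pi.1 hP i) 0 ⟨le_rfl, zero_le_one⟩).tendsto.comp tendsto_div_one_add_zero
  have hpow : ∀ n : ℕ, Tendsto (fun r : ℝ => (1 + r) ^ n) (𝓝[>] 0) (𝓝 1) := by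
    intro n
    have : Continuous fun r : ℝ => (1 + r) ^ n := by fun_prop
    have h := this.tendsto 0
    simp only [add_zero, one_pow] at h
    exact h.mono_left nhdsWithin_le_nhds
  refine ⟨fun k r => blockA (P (r / (1 + r))) k / (1 + r) ^ (k + 1),
    fun k r => blockB (P (r / (1 + r))) k / (1 + r) ^ k, fun k hk => ?_, fun k hk => ?_,
    fun j hj => ⟨?_, ?_⟩⟩
  · rw [← hβ k hk]
    simp only [blockA_of_mem _ hk]
    have h := (hP0 (Sum.inl ⟨k, hk⟩)).div (hpow (k + 1)) one_ne_zero
    rw [div_one] at h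
    exact h
  · rw [← hθ k hk]
    simp only [blockB_of_mem _ hk]
    have h := (hP0 (Sum.inr (Sum.inl ⟨k, hk⟩))).div (hpow k) one_ne_zero
    rw [div_one] at h
    exact h
  · refine (isBigO_zero _ _).congr' ?_ EventuallyEq.rfl
    filter_upwards [self_mem_nhdsWithin] with r (hr : 0 < r)
    have h1 : 1 + r ≠ 0 := by positivity
    change (0 : ℝ) = √(weight N j) * (1 + (r / (1 + r)) ^ 2 * modeSum N (r / (1 + r))
      (blockA (P (r / (1 + r)))) j) - √(weight N j) * _
    rw [modeSum_apply, Finset.mul_sum, eq_comm, sub_eq_zero]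
    congr 2
    refine Finset.sum_congr rfl fun k hk => ?_
    have hk' := Finset.mem_Icc.1 hk
    obtain ⟨i, rfl⟩ : ∃ i, k = i + 1 := ⟨k - 1, by omega⟩
    rw [modeVec, restrictIdx_of_mem hj, Nat.add_sub_cancel]
    generalize blockA (P (r / (1 + r))) (i + 1) = b
    simp only [div_pow]
    field_simp
    ring
  · refine (isBigO_zero _ _).congr' ?_ EventuallyEq.rfl
    filter_upwards [self_mem_nhdsWithin] with r (hr : 0 < r)
    have h1 : 1 + r ≠ 0 := by positivity
    have h : ((originFields N P Q).toFields N).elec j r = (originFields N P Q).E j (r / (1 + r)) :=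
      alphaOf_sub_alphaOf_succ (E := fun i => (originFields N P Q).E i (r / (1 + r))) hj
    rw [h]
    change (0 : ℝ) = (r / (1 + r)) * modeSum N (r / (1 + r)) (blockB (P (r / (1 + r)))) j - _
    rw [modeSum_apply, Finset.mul_sum, eq_comm, sub_eq_zero]
    refine Finset.sum_congr rfl fun k hk => ?_
    have hk' := Finset.mem_Icc.1 hk
    obtain ⟨i, rfl⟩ : ∃ i, k = i + 1 := ⟨k - 1, by omega⟩
    rw [modeVec, restrictIdx_of_mem hj, Nat.add_sub_cancel]
    generalize blockB (P (r / (1 + r))) (i + 1) = b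
    simp only [div_pow]
    field_simp
    ring

/-! ### Regularised variables of a given soliton -/

/-- Projection to the mode `k` is a fixed linear combination of components. It isolates `βbar k` up
to an error `O(r^(N+e))`, which is `o(r^(k+e))` because `k ≤ N - 1`. -/
theorem tendsto_modeCoord_div {f βbar : ℕ → ℝ → ℝ} {β : ℕ → ℝ} (e : ℕ)
    (hβ : ∀ k ∈ Finset.Icc 1 (N - 1), Tendsto (βbar k) (𝓝[>] 0) (𝓝 (β k)))
    (hf : ∀ j ∈ Finset.Icc 1 (N - 1), (fun r => f j r - ∑ k ∈ Finset.Icc 1 (N - 1),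
      βbar k r * eigvec N k j * r ^ (k + e)) =O[𝓝[>] 0] fun r => r ^ (N + e)) {k : ℕ}
    (hk : k ∈ Finset.Icc 1 (N - 1)) :
    Tendsto (fun r => modeCoord N (f · r) k / r ^ (k + e)) (𝓝[>] 0) (𝓝 (β k)) := by
  have hk' := Finset.mem_Icc.1 hk
  have h1 : (fun r => ∑ j ∈ Finset.Icc 1 (N - 1), modeDual N k j * (f j r -
      ∑ k ∈ Finset.Icc 1 (N - 1), βbar k r * eigvec N k j * r ^ (k + e))) =O[𝓝[>] 0]
      fun r => r ^ (N + e) := IsBigO.fun_sum fun j hj => (hf j hj).const_mul_left _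
  have h2 : (fun r : ℝ => r ^ (N + e)) =o[𝓝[>] 0] fun r => r ^ (k + e) :=
    (isLittleO_pow_pow (by omega : k + e < N + e)).mono nhdsWithin_le_nhds
  have h3 := (hβ k hk).add (h1.trans_isLittleO h2).tendsto_div_nhds_zero
  rw [add_zero] at h3
  refine h3.congr' ?_
  filter_upwards [self_mem_nhdsWithin] with r (hr : 0 < r)
  have h4 := modeCoord_sum N (fun k => βbar k r * r ^ (k + e)) hk
  rw [modeCoord_eq_sum] at h4
  rw [modeCoord_eq_sum]
  simp only [mul_sub, Finset.sum_sub_distrib]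
  have h5 : ∑ j ∈ Finset.Icc 1 (N - 1), modeDual N k j * ∑ k ∈ Finset.Icc 1 (N - 1),
      βbar k r * eigvec N k j * r ^ (k + e) = βbar k r * r ^ (k + e) := by
    rw [← h4]
    refine Finset.sum_congr rfl fun j hj => ?_
    congr 1
    refine Finset.sum_congr rfl fun k _ => ?_
    rw [modeVec, restrictIdx_of_mem hj]; ring
  rw [h5]
  field_simp
  ring

theorem tendsto_div_one_sub_zero :
    Tendsto (fun x : ℝ => x / (1 - x)) (𝓝[>] 0) (𝓝[>] 0) := by
  refine tendsto_nhdsWithin_iff.2 ⟨?_, ?_⟩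
  · have h := (hasDerivAt_div_one_sub zero_lt_one).continuousAt.tendsto
    simp only [zero_div] at h
    exact h.mono_left nhdsWithin_le_nhds
  · filter_upwards [Ioo_mem_nhdsGT (zero_lt_one (α := ℝ))] with x hx
    exact div_pos hx.1 (by linarith [hx.2])

theorem tendsto_comp_div_one_sub {g : ℝ → ℝ} {n : ℕ} {l : ℝ}
    (h : Tendsto (fun r => g r / r ^ n) (𝓝[>] 0) (𝓝 l)) :
    Tendsto (fun x => g (x / (1 - x)) / x ^ n) (𝓝[>] 0) (𝓝 l) := by
  have h1 : Tendsto (fun x : ℝ => (1 / (1 - x)) ^ n) (𝓝[>] 0) (𝓝 1) := by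
    have : ContinuousAt (fun x : ℝ => (1 / (1 - x)) ^ n) 0 := by
      have : (1 : ℝ) - 0 ≠ 0 := by norm_num
      fun_prop (disch := assumption)
    have h2 := this.tendsto
    simp only [sub_zero, div_one, one_pow] at h2
    exact h2.mono_left nhdsWithin_le_nhds
  have h2 := (h.comp tendsto_div_one_sub_zero).mul h1
  rw [mul_one] at h2
  refine h2.congr' ?_
  filter_upwards [Ioo_mem_nhdsGT (zero_lt_one (α := ℝ))] with x hx
  have hx0 : x ≠ 0 := hx.1.ne'
  have hx1 : 1 - x ≠ 0 := (sub_pos.2 hx.2).ne'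
  simp only [Function.comp]
  generalize g (x / (1 - x)) = y
  rw [div_pow, div_pow, one_pow]
  field_simp

/-- Division by a power of a smooth function of the corresponding order. -/
theorem exists_eq_pow_mul_of_tendsto {c : ℝ → ℝ} {n : ℕ} {l : ℝ}
    (hc : ContDiffOn ℝ (⊤ : ℕ∞) c (Ico 0 1))
    (hl : Tendsto (fun x => c x / x ^ n) (𝓝[>] 0) (𝓝 l)) :
    ∃ b : ℝ → ℝ, ContDiffOn ℝ (⊤ : ℕ∞) b (Ico 0 1) ∧ b 0 = l ∧
      ∀ x ∈ Ico (0 : ℝ) 1, c x = x ^ n * b x := by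
  have hO : c =O[𝓝[>] 0] fun x => x ^ n := by
    refine isBigO_of_div_tendsto_nhds ?_ l hl
    filter_upwards [self_mem_nhdsWithin] with x (hx : 0 < x) h
    exact absurd h (pow_pos hx n).ne'
  obtain ⟨b, hb, hbc⟩ := exists_eq_pow_mul_of_isBigO zero_lt_one n hc hO
  refine ⟨b, hb, ?_, hbc⟩
  have h1 : Tendsto b (𝓝[>] 0) (𝓝 (b 0)) := by
    have := (hb.continuousOn 0 ⟨le_rfl, zero_lt_one⟩).tendsto
    refine this.mono_left ?_
    rw [← nhdsWithin_Ioo_eq_nhdsGT (zero_lt_one (α := ℝ))]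
    exact nhdsWithin_mono _ Ioo_subset_Ico_self
  refine tendsto_nhds_unique (h1.congr' ?_) hl
  filter_upwards [Ioo_mem_nhdsGT (zero_lt_one (α := ℝ))] with x hx
  rw [hbc x ⟨hx.1.le, hx.2⟩, mul_div_cancel_left₀ _ (pow_pos hx.1 n).ne']

theorem tendsto_of_eq_pow_mul {b c : ℝ → ℝ} {n : ℕ} {cL : ℝ}
    (h : ∀ x ∈ Ico (0 : ℝ) 1, c x = x ^ n * b x) (hc : Tendsto c (𝓝[<] 1) (𝓝 cL)) :
    Tendsto b (𝓝[<] 1) (𝓝 cL) := by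
  have hid : Tendsto (fun x : ℝ => x ^ n) (𝓝[<] 1) (𝓝 1) := by
    have : Continuous fun x : ℝ => x ^ n := by fun_prop
    have h := this.tendsto 1
    rw [one_pow] at h
    exact h.mono_left nhdsWithin_le_nhds
  have h1 := hc.div hid one_ne_zero
  rw [div_one] at h1
  refine h1.congr' ?_
  filter_upwards [Ioo_mem_nhdsLT (zero_lt_one (α := ℝ))] with x hx
  rw [Pi.div_apply, h x ⟨hx.1.le, hx.2⟩, mul_div_cancel_left₀ _ (pow_pos hx.1 n).ne']

theorem tendsto_derivWithin_of_eq_pow_mul {b c c' : ℝ → ℝ} {n : ℕ} {cL cL' : ℝ}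
    (hb : ContDiffOn ℝ (⊤ : ℕ∞) b (Ico 0 1))
    (h : ∀ x ∈ Ico (0 : ℝ) 1, c x = x ^ n * b x) (hc : Tendsto c (𝓝[<] 1) (𝓝 cL))
    (hd : ∀ x ∈ Ioo (0 : ℝ) 1, HasDerivAt c (c' x) x) (hc' : Tendsto c' (𝓝[<] 1) (𝓝 cL')) :
    ∃ l, Tendsto (derivWithin b (Ico 0 1)) (𝓝[<] 1) (𝓝 l) := by
  have hid : Tendsto (fun x : ℝ => x) (𝓝[<] 1) (𝓝 1) := tendsto_id.mono_left nhdsWithin_le_nhds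
  have hb1 := tendsto_of_eq_pow_mul h hc
  have h1 := (hc'.sub ((tendsto_const_nhds (x := (n : ℝ))).mul ((hid.pow (n - 1)).mul hb1))).div
    (hid.pow n) (by simp)
  refine ⟨_, h1.congr' ?_⟩
  filter_upwards [Ioo_mem_nhdsLT (zero_lt_one (α := ℝ))] with x hx
  have hbx : HasDerivAt b (derivWithin b (Ico 0 1) x) x :=
    ((hb.differentiableOn (by simp)) x (Ioo_subset_Ico_self hx)).hasDerivWithinAt.hasDerivAt
      (Ico_mem_nhds hx.1 hx.2)
  have h2 : HasDerivAt c ((n : ℝ) * x ^ (n - 1) * b x + x ^ n * derivWithin b (Ico 0 1) x) x := by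
    refine ((hasDerivAt_pow n x).mul hbx).congr_of_eventuallyEq ?_
    filter_upwards [Ioo_mem_nhds hx.1 hx.2] with y hy using h y (Ioo_subset_Ico_self hy)
  have hne : x ^ n ≠ 0 := (pow_pos hx.1 n).ne'
  rw [Pi.div_apply, (hd x hx).unique h2]
  field_simp
  ring

end

section

variable {N : ℕ} {k ℓ : ℝ}

/-- Fields rebuilt from regularised variables agree with those of the soliton only locally and for
indices `1, …, N - 1`. That suffices, because `ω_0` and `ω_N` vanish in both, so all other entries
drop out. -/
theorem CompactEquationsAt.congr {X Y : CompactFields} {x : ℝ} (h : CompactEquationsAt N k ℓ X x)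
    {s : Set ℝ} (hs : s ∈ 𝓝 x) (hm : EqOn Y.m X.m s) (hS : EqOn Y.S X.S s)
    (hw : ∀ j ∈ Finset.Icc 1 (N - 1), EqOn (Y.w j) (X.w j) s)
    (hdw : ∀ j ∈ Finset.Icc 1 (N - 1), EqOn (Y.dw j) (X.dw j) s)
    (hE : ∀ j ∈ Finset.Icc 1 (N - 1), EqOn (Y.E j) (X.E j) s)
    (hdE : ∀ j ∈ Finset.Icc 1 (N - 1), EqOn (Y.dE j) (X.dE j) s)
    (hX0 : X.w 0 x = 0) (hXN : X.w N x = 0) (hY0 : Y.w 0 x = 0) (hYN : Y.w N x = 0) :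
    CompactEquationsAt N k ℓ Y x := by
  have hx : x ∈ s := mem_of_mem_nhds hs
  have ev : ∀ {f g : ℝ → ℝ}, EqOn f g s → f =ᶠ[𝓝 x] g := fun h => h.eventuallyEq_of_mem hs
  have hν : ∀ y ∈ s, Y.nu k ℓ y = X.nu k ℓ y := fun y hy => by
    rw [CompactFields.nu, CompactFields.nu, hm hy]
  have rw' : ∀ {f g : ℕ → ℝ → ℝ}, (∀ j ∈ Finset.Icc 1 (N - 1), EqOn (f j) (g j) s) →
      restrictIdx N (f · x) = restrictIdx N (g · x) := by
    intro f g hfg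
    ext j
    by_cases hj : j ∈ Finset.Icc 1 (N - 1)
    · rw [restrictIdx_of_mem hj, restrictIdx_of_mem hj, hfg j hj hx]
    · rw [restrictIdx, restrictIdx, if_neg hj, if_neg hj]
  have e1 := rw' hw
  have e2 := rw' hdw
  have e3 := rw' hE
  have e4 := rw' hdE
  have hζ : zetaSum N (Y.w · x) (Y.E · x) = zetaSum N (X.w · x) (X.E · x) := by
    rw [← zetaSum_restrictIdx, e1, e3, zetaSum_restrictIdx]
  have hG : sumSq N (Y.dw · x) = sumSq N (X.dw · x) := by
    rw [← sumSq_restrictIdx, e2, sumSq_restrictIdx]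
  have hη : etaSum N (Y.dE · x) = etaSum N (X.dE · x) := by
    rw [← etaSum_restrictIdx, e4, etaSum_restrictIdx]
  have hP : pressure N k x (Y.w · x) = pressure N k x (X.w · x) := by
    rw [← pressure_restrictIdx (w := (Y.w · x)) hY0 hYN, e1,
      pressure_restrictIdx (w := (X.w · x)) hX0 hXN]
  have hW : ∀ j ∈ Finset.Icc 1 (N - 1), wCoef k (Y.w · x) j = wCoef k (X.w · x) j := fun j hj => by
    rw [← wCoef_restrictIdx (w := (Y.w · x)) hY0 hYN k hj, e1,
      wCoef_restrictIdx (w := (X.w · x)) hX0 hXN k hj]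
  have hF : ∀ j ∈ Finset.Icc 1 (N - 1), elecForce (Y.w · x) (Y.E · x) j =
      elecForce (X.w · x) (X.E · x) j := fun j hj => by
    rw [← elecForce_restrictIdx (w := (Y.w · x)) hY0 hYN hj, e1, e3,
      elecForce_restrictIdx (w := (X.w · x)) hX0 hXN hj]
  have hσ : Y.sigma N k ℓ x = X.sigma N k ℓ x := by
    rw [CompactFields.sigma, CompactFields.sigma, sigmaOf, sigmaOf, hζ, hG, hν x hx, hS hx]
  refine ⟨fun j hj => ?_, fun j hj => ?_, ?_, ?_, fun j hj => ?_, fun j hj => ?_⟩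
  · rw [hdw j hj hx]
    exact (h.w j hj).congr_of_eventuallyEq (ev (hw j hj))
  · rw [hdE j hj hx]
    exact (h.E j hj).congr_of_eventuallyEq (ev (hE j hj))
  · refine (h.m.congr_of_eventuallyEq (ev hm)).congr_deriv ?_
    rw [massOf, massOf, hζ, hG, hη, hP, hν x hx, hS hx]
  · rw [hσ, hS hx]
    exact h.S.congr_of_eventuallyEq (ev hS)
  · rw [hσ, hF j hj, hν x hx, hdE j hj hx]
    exact (h.dE j hj).congr_of_eventuallyEq (ev (hdE j hj))
  · rw [hσ, hW j hj, hν x hx, hdw j hj hx, hw j hj hx, hE j hj hx, hS hx]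
    refine (h.flux j hj).congr_of_eventuallyEq ?_
    filter_upwards [hs] with y hy
    rw [hν y hy, hdw j hj hy]

/-- The regularised system at the origin follows from the compactified equations. -/
theorem CompactEquationsAt.hasDerivAt_origin {P Q : ℝ → BlockIdx N → ℝ} {x : ℝ} (hx : 0 < x)
    (h : CompactEquationsAt N 1 ℓ (originFields N P Q) x)
    (hU : (x, P x, Q x) ∈ originDomain N ℓ)
    (hb : ∀ k ∈ Finset.Icc 1 (N - 1), HasDerivAt (fun y => blockA (P y) k) (blockA (Q x) k) x)
    (hθ : ∀ k ∈ Finset.Icc 1 (N - 1), HasDerivAt (fun y => blockB (P y) k) (blockB (Q x) k) x)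
    (hB : ∀ k ∈ Finset.Icc 1 (N - 1), DifferentiableAt ℝ (fun y => blockA (Q y) k) x)
    (hΘ : ∀ k ∈ Finset.Icc 1 (N - 1), DifferentiableAt ℝ (fun y => blockB (Q y) k) x)
    (ha : DifferentiableAt ℝ (fun y => blockC (Q y)) x) :
    (∀ i, HasDerivAt (fun s => P s i) (originF N ℓ (x, P x, Q x) i) x) ∧
    ∀ i, HasDerivAt (fun s => Q s i) ((originH N (x, P x) i - (originLam N i : ℝ) * Q x i) / x +
      originG N ℓ (x, P x, Q x) i) x := by
  set Y := originFields N P Q with hY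
  set z : ℝ → OriginState := fun y => originState (y, P y, Q y) with hz
  have hzx : ∀ y, (z y).x = y := fun y => rfl
  have hx0 : x ≠ 0 := hx.ne'
  have hν : 0 < (z x).nu ℓ := hU.2
  have hS : 0 < (z x).S := hU.1
  have eν : Y.nu 1 ℓ x = (z x).nu ℓ := originFields_nu hx0
  have eσ : Y.sigma N 1 ℓ x = x * (z x).sigmaHat N ℓ := by
    rw [CompactFields.sigma, eν]
    exact OriginState.sigmaOf_eq (z := z x) hx0
  set B₂ : ℕ → ℝ := fun k => deriv (fun y => blockA (Q y) k) x
  set Θ₂ : ℕ → ℝ := fun k => deriv (fun y => blockB (Q y) k) x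
  have hB' : ∀ k ∈ Finset.Icc 1 (N - 1), HasDerivAt (fun y => (z y).B k) (B₂ k) x :=
    fun k hk => (hB k hk).hasDerivAt
  have hΘ' : ∀ k ∈ Finset.Icc 1 (N - 1), HasDerivAt (fun y => (z y).Θ k) (Θ₂ k) x :=
    fun k hk => (hΘ k hk).hasDerivAt
  have hb' : ∀ k ∈ Finset.Icc 1 (N - 1), HasDerivAt (fun y => (z y).b k) ((z x).B k) x := hb
  have hθ' : ∀ k ∈ Finset.Icc 1 (N - 1), HasDerivAt (fun y => (z y).θ k) ((z x).Θ k) x := hθ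
  have hm : HasDerivAt Y.m (x ^ 2 * (z x).massHat N ℓ) x := by
    refine h.m.congr_deriv ?_
    rw [eν]
    exact OriginState.massOf_eq (z := z x) hx0 hν.ne' hS.ne'
  have eB : ∀ k ∈ Finset.Icc 1 (N - 1), B₂ k =
      ((z x).bH k - 2 * ((k : ℝ) + 1) * (z x).B k) / x + (z x).bG N ℓ k := by
    intro k hk
    -- The residual identities are used backwards: the components of the equation hold, and
    -- independence of the eigenvectors gives it mode by mode.
    have h1 := eq_zero_of_modeSum_eq_zero (N := N) hx0 (fun j hj => ?_) hk (b := x • B₂ +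
      (2 : ℝ) • ((z x).B + modeIdx (z x).B) - (z x).bH - x • (z x).bG N ℓ)
    · simp only [Pi.add_apply, Pi.sub_apply, Pi.smul_apply, smul_eq_mul, modeIdx_apply] at h1
      field_simp
      linarith
    · have h2 := (((OriginState.hasDerivAt_nu hx0 hm rfl).mul
        (OriginState.hasDerivAt_dw hzx hb' hB' j)).unique (h.flux j hj))
      rw [eσ, eν] at h2
      have h3 := (OriginState.flux_residual (z := z x) hx0 hν.ne' hS.ne' B₂ hj).symm.trans
        (sub_eq_zero.2 h2)
      refine (mul_eq_zero.1 h3).resolve_left ?_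
      have := Real.sqrt_pos.2 (weight_pos hj)
      exact mul_ne_zero (mul_ne_zero this.ne' hν.ne') hx0
  have eΘ : ∀ k ∈ Finset.Icc 1 (N - 1), Θ₂ k =
      ((z x).tH k - 2 * ((k : ℝ) + 1) * (z x).Θ k) / x + (z x).tG N ℓ k := by
    intro k hk
    have h1 := eq_zero_of_modeSum_eq_zero (N := N) hx0 (fun j hj => ?_) hk (b := x • Θ₂ +
      (2 : ℝ) • ((z x).Θ + modeIdx (z x).Θ) - (z x).tH - x • (z x).tG N ℓ)
    · simp only [Pi.add_apply, Pi.sub_apply, Pi.smul_apply, smul_eq_mul, modeIdx_apply] at h1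
      field_simp
      linarith
    · have h2 := (OriginState.hasDerivAt_dE hzx hx0 hθ' hΘ' j).unique (h.dE j hj)
      rw [eσ, eν] at h2
      exact (OriginState.elec_residual (z := z x) hx0 hν.ne' Θ₂ hj).symm.trans (sub_eq_zero.2 h2)
  have ea : deriv (fun y => blockC (Q y)) x =
      ((z x).massH N - 3 * (z x).a) / x + (z x).massG N ℓ := by
    have h1 := ((hasDerivAt_pow 3 x).mul ha.hasDerivAt).unique hm
    rw [OriginState.massHat, hzx] at h1
    have e : (z x).a = blockC (Q x) := rfl
    rw [e]
    push_cast at h1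
    have hx2 : x ^ 2 ≠ 0 := pow_ne_zero 2 hx0
    have h2 : x * deriv (fun y => blockC (Q y)) x =
        (z x).massH N + x * (z x).massG N ℓ - 3 * blockC (Q x) := by
      apply mul_left_cancel₀ hx2
      linear_combination h1
    field_simp
    linarith
  refine ⟨forall_blockIdx.2 ⟨fun k hk => ?_, fun k hk => ?_, ?_⟩,
    forall_blockIdx.2 ⟨fun k hk => ?_, fun k hk => ?_, ?_⟩⟩
  · have := hb k hk
    simp only [blockA_of_mem _ hk] at this
    refine this.congr_deriv ?_
    simp [originF, blocks, originState, blockA_of_mem _ hk]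
  · have := hθ k hk
    simp only [blockB_of_mem _ hk] at this
    refine this.congr_deriv ?_
    simp [originF, blocks, originState, blockB_of_mem _ hk]
  · have := h.S
    rw [eσ] at this
    exact this
  · have e : (fun y => (z y).B k) = fun y => Q y (Sum.inl ⟨k, hk⟩) :=
      funext fun y => blockA_of_mem _ hk
    rw [← e]
    refine (hB' k hk).congr_deriv ?_
    rw [eB k hk, congrFun e x]
    simp only [originH, originG, originLam, blocks, Sum.elim_inl]
    push_cast
    rfl
  · have e : (fun y => (z y).Θ k) = fun y => Q y (Sum.inr (Sum.inl ⟨k, hk⟩)) :=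
      funext fun y => blockB_of_mem _ hk
    rw [← e]
    refine (hΘ' k hk).congr_deriv ?_
    rw [eΘ k hk, congrFun e x]
    simp only [originH, originG, originLam, blocks, Sum.elim_inl, Sum.elim_inr]
    push_cast
    rfl
  · refine ha.hasDerivAt.congr_deriv ?_
    rw [ea]
    simp only [originH, originG, originLam, blocks, Sum.elim_inr]
    push_cast
    rfl

/-- The mode coefficients of a family of smooth functions, with powers of `x` split off. -/
theorem exists_mode_expansion {f f' : ℕ → ℝ → ℝ} {L L' β : ℕ → ℝ} (e : ℕ)
    (hf : ∀ j ∈ Finset.Icc 1 (N - 1), ContDiffOn ℝ (⊤ : ℕ∞) (f j) (Ico 0 1))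
    (hL : ∀ j ∈ Finset.Icc 1 (N - 1), Tendsto (f j) (𝓝[<] 1) (𝓝 (L j)))
    (hd : ∀ j ∈ Finset.Icc 1 (N - 1), ∀ x ∈ Ioo (0 : ℝ) 1, HasDerivAt (f j) (f' j x) x)
    (hL' : ∀ j ∈ Finset.Icc 1 (N - 1), Tendsto (f' j) (𝓝[<] 1) (𝓝 (L' j)))
    (h0 : ∀ k ∈ Finset.Icc 1 (N - 1),
      Tendsto (fun x => modeCoord N (f · x) k / x ^ (k + e)) (𝓝[>] 0) (𝓝 (β k))) :
    ∃ (b : ℕ → ℝ → ℝ) (l l' : ℕ → ℝ), (∀ k ∈ Finset.Icc 1 (N - 1),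
      ContDiffOn ℝ (⊤ : ℕ∞) (b k) (Ico 0 1) ∧ b k 0 = β k ∧ Tendsto (b k) (𝓝[<] 1) (𝓝 (l k)) ∧
        Tendsto (derivWithin (b k) (Ico 0 1)) (𝓝[<] 1) (𝓝 (l' k))) ∧
      ∀ j ∈ Finset.Icc 1 (N - 1), ∀ x ∈ Ico (0 : ℝ) 1,
        f j x = x ^ (e + 1) * modeSum N x (b · x) j := by
  have key : ∀ k, ∃ (b : ℝ → ℝ) (l l' : ℝ), k ∈ Finset.Icc 1 (N - 1) →
      (ContDiffOn ℝ (⊤ : ℕ∞) b (Ico 0 1) ∧ b 0 = β k ∧ Tendsto b (𝓝[<] 1) (𝓝 l) ∧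
        Tendsto (derivWithin b (Ico 0 1)) (𝓝[<] 1) (𝓝 l')) ∧
      ∀ x ∈ Ico (0 : ℝ) 1, modeCoord N (f · x) k = x ^ (k + e) * b x := by
    intro k
    by_cases hk : k ∈ Finset.Icc 1 (N - 1)
    swap
    · exact ⟨0, 0, 0, fun h => absurd h hk⟩
    have e1 : (fun x => modeCoord N (f · x) k) =
        fun x => ∑ j ∈ Finset.Icc 1 (N - 1), modeDual N k j * f j x :=
      funext fun x => modeCoord_eq_sum N _ k
    have h1 : ContDiffOn ℝ (⊤ : ℕ∞) (fun x => modeCoord N (f · x) k) (Ico 0 1) := by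
      rw [e1]
      exact ContDiffOn.sum fun j hj => contDiffOn_const.mul (hf j hj)
    have h2 : Tendsto (fun x => modeCoord N (f · x) k) (𝓝[<] 1)
        (𝓝 (∑ j ∈ Finset.Icc 1 (N - 1), modeDual N k j * L j)) := by
      rw [e1]
      exact tendsto_finsetSum _ fun j hj => (hL j hj).const_mul _
    have h3 : ∀ x ∈ Ioo (0 : ℝ) 1, HasDerivAt (fun x => modeCoord N (f · x) k)
        (∑ j ∈ Finset.Icc 1 (N - 1), modeDual N k j * f' j x) x := by
      intro x hx
      rw [e1]
      exact HasDerivAt.fun_sum fun j hj => (hd j hj x hx).const_mul _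
    obtain ⟨b, hb, hb0, hbc⟩ := exists_eq_pow_mul_of_tendsto h1 (h0 k hk)
    obtain ⟨l', hl'⟩ := tendsto_derivWithin_of_eq_pow_mul hb hbc h2 h3
      (tendsto_finsetSum _ fun j hj => (hL' j hj).const_mul (modeDual N k j))
    exact ⟨b, _, l', fun _ => ⟨⟨hb, hb0, tendsto_of_eq_pow_mul hbc h2, hl'⟩, hbc⟩⟩
  choose b l l' h using key
  refine ⟨b, l, l', fun k hk => (h k hk).1, fun j hj x hx => ?_⟩
  rw [← sum_modeCoord N (f · x) hj, modeSum_apply, Finset.mul_sum]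
  refine Finset.sum_congr rfl fun k hk => ?_
  have hk' := Finset.mem_Icc.1 hk
  obtain ⟨i, rfl⟩ : ∃ i, k = i + 1 := ⟨k - 1, by omega⟩
  rw [(h _ hk).2 x hx, Nat.add_sub_cancel]
  ring

end

/-! ### The given soliton in regularised variables, and nearby solitons. -/

section

variable {N : ℕ} {ℓ Sinf : ℝ} {F : Fields} {β θ : ℕ → ℝ}

/-- Dividing `ω_j` by its value at the origin and subtracting `1` gives both families the same form,
with the shift `1` for the magnetic and `0` for the electric modes. -/
theorem HasOriginData.tendsto_modeCoord (hd : HasOriginData N F β θ) {k : ℕ}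
    (hk : k ∈ Finset.Icc 1 (N - 1)) :
    Tendsto (fun r => modeCoord N (fun j => F.ω j r / √(weight N j) - 1) k / r ^ (k + 1)) (𝓝[>] 0)
      (𝓝 (β k)) ∧
    Tendsto (fun r => modeCoord N (fun j => F.elec j r) k / r ^ (k + 0)) (𝓝[>] 0) (𝓝 (θ k)) := by
  obtain ⟨βbar, θbar, hβ, hθ, h⟩ := hd
  constructor
  · refine tendsto_modeCoord_div (f := fun j r => F.ω j r / √(weight N j) - 1) 1 hβ
      (fun j hj => ?_) hk
    have hne : √(weight N j) ≠ 0 := (Real.sqrt_pos.2 (weight_pos hj)).ne'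
    refine ((h j hj).1.const_mul_left (1 / √(weight N j))).congr_left fun r => ?_
    change 1 / √(weight N j) * (F.ω j r - √(weight N j) * _) = _
    field_simp
    ring
  · exact tendsto_modeCoord_div (f := F.elec) 0 hθ (fun j hj => (h j hj).2) hk

/-- A soliton solves the regularised system at the origin. -/
theorem IsSoliton.exists_origin_solution (hN : 1 ≤ N) (hℓ : 0 < ℓ) (hF : IsSoliton N ℓ Sinf F)
    (hd : HasOriginData N F β θ) :
    ∃ (p q : ℝ → BlockIdx N → ℝ) (pT qT : BlockIdx N → ℝ),
      p 0 = blocks N β θ (F.S 0) ∧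
      ContinuousOn p (Ico 0 1) ∧ Tendsto p (𝓝[<] 1) (𝓝 pT) ∧
      ContinuousOn q (Ico 0 1) ∧ Tendsto q (𝓝[<] 1) (𝓝 qT) ∧
      (∀ t ∈ Ico (0 : ℝ) 1, (t, p t, q t) ∈ originDomain N ℓ) ∧ (1, pT, qT) ∈ originDomain N ℓ ∧
      (∀ t ∈ Ioo (0 : ℝ) 1,
        (∀ i, HasDerivAt (fun s => p s i) (originF N ℓ (t, p t, q t) i) t) ∧
        ∀ i, HasDerivAt (fun s => q s i) ((originH N (t, p t) i - (originLam N i : ℝ) * q t i) / t +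
          originG N ℓ (t, p t, q t) i) t) ∧
      ∀ j ∈ Finset.Icc 1 (N - 1), ∀ t ∈ Ico (0 : ℝ) 1,
        (originState (t, p t, q t)).w N j = (F.toCompact 0).w j t ∧
        (originState (t, p t, q t)).dw N j = (F.toCompact 0).dw j t := by
  have e0 : (0 : ℝ) / (1 + 0) = 0 := by norm_num
  have hG := hF.toIsGlobalSolution
  have hXs := hG.toCompact hN le_rfl
  obtain ⟨mL, wL, dwL, EL, dEL, hL⟩ := hG.hasLimits hN hℓ le_rfl
  rw [e0] at hXs hL
  set X := F.toCompact 0 with hX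
  have hud : UniqueDiffOn ℝ (Ico (0 : ℝ) 1) := uniqueDiffOn_Ico _ _
  have hX00 : (0 : ℝ) / (1 - 0) = 0 := by norm_num
  have h1 : ∀ k ∈ Finset.Icc 1 (N - 1), Tendsto (fun x => modeCoord N
      (fun j => X.w j x / √(weight N j) - 1) k / x ^ (k + 1)) (𝓝[>] 0) (𝓝 (β k)) := fun k hk =>
    tendsto_comp_div_one_sub (g := fun r => modeCoord N (fun j => F.ω j r / √(weight N j) - 1) k)
      (hd.tendsto_modeCoord hk).1
  have h2 : ∀ k ∈ Finset.Icc 1 (N - 1), Tendsto (fun x => modeCoord N (X.E · x) k / x ^ (k + 0))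
      (𝓝[>] 0) (𝓝 (θ k)) := fun k hk =>
    tendsto_comp_div_one_sub (g := fun r => modeCoord N (fun j => F.elec j r) k)
      (hd.tendsto_modeCoord hk).2
  obtain ⟨b, bL, bL', hb, hbw⟩ := exists_mode_expansion (N := N) (β := β) 1
    (f := fun j x => X.w j x / √(weight N j) - 1) (f' := fun j x => X.dw j x / √(weight N j))
    (fun j hj => ((hXs.smooth_w j hj).div_const _).sub contDiffOn_const)
    (fun j hj => ((hL.w j hj).div_const _).sub_const 1)
    (fun j hj x hx => (((hXs.equations x hx).w j hj).div_const _).sub_const 1)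
    (fun j hj => (hL.dw j hj).div_const _)
    h1
  obtain ⟨c, cL, cL', hc, hcE⟩ := exists_mode_expansion (N := N) (β := θ) 0 hXs.smooth_E hL.E
    (fun j hj x hx => (hXs.equations x hx).E j hj) hL.dE
    h2
  have hmO : X.m =O[𝓝[>] 0] fun x => x ^ 3 := by
    have h1 := hF.m_origin.comp_tendsto tendsto_div_one_sub_zero
    refine h1.trans (IsBigO.pow (IsBigO.of_bound 2 ?_) 3)
    filter_upwards [Ioo_mem_nhdsGT (show (0 : ℝ) < 1 / 2 by norm_num)] with x hx
    have h2 : 0 < 1 - x := by linarith [hx.2]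
    rw [Real.norm_of_nonneg (div_nonneg hx.1.le h2.le), Real.norm_of_nonneg hx.1.le,
      div_le_iff₀ h2]
    nlinarith [hx.1, hx.2]
  obtain ⟨a, ha, hma⟩ := exists_eq_pow_mul_of_isBigO zero_lt_one 3 hXs.smooth_m hmO
  have haL := tendsto_of_eq_pow_mul hma hL.m
  set p : ℝ → BlockIdx N → ℝ := fun t => blocks N (b · t) (c · t) (X.S t) with hp
  set q : ℝ → BlockIdx N → ℝ := fun t => blocks N (fun k => derivWithin (b k) (Ico 0 1) t)
    (fun k => derivWithin (c k) (Ico 0 1) t) (a t) with hq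
  have hb' : ∀ k ∈ Finset.Icc 1 (N - 1), ContDiffOn ℝ (⊤ : ℕ∞) (derivWithin (b k) (Ico 0 1))
      (Ico 0 1) := fun k hk => (hb k hk).1.derivWithin hud (by simp)
  have hc' : ∀ k ∈ Finset.Icc 1 (N - 1), ContDiffOn ℝ (⊤ : ℕ∞) (derivWithin (c k) (Ico 0 1))
      (Ico 0 1) := fun k hk => (hc k hk).1.derivWithin hud (by simp)
  have hps : ContDiffOn ℝ (⊤ : ℕ∞) p (Ico 0 1) :=
    contDiffOn_blocks (fun k hk => (hb k hk).1) (fun k hk => (hc k hk).1) hXs.smooth_S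
  have hqs : ContDiffOn ℝ (⊤ : ℕ∞) q (Ico 0 1) := contDiffOn_blocks hb' hc' ha
  have hzs : OriginState.IsSmoothOn (fun x => originState (x, p x, q x)) (Ico 0 1) :=
    isSmoothOn_originState_comp contDiffOn_id hps hqs
  have hzw : ∀ j ∈ Finset.Icc 1 (N - 1), ∀ x ∈ Ico (0 : ℝ) 1,
      (originState (x, p x, q x)).w N j = X.w j x := by
    intro j hj x hx
    have hne : √(weight N j) ≠ 0 := (Real.sqrt_pos.2 (weight_pos hj)).ne'
    have h1 := hbw j hj x hx
    change √(weight N j) * (1 + x ^ 2 * modeSum N x (blockA (p x)) j) = _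
    rw [hp, blockA_blocks, modeSum_congr x fun k hk => restrictIdx_of_mem hk, ← h1]
    field_simp
    ring
  have hzE : ∀ j ∈ Finset.Icc 1 (N - 1), ∀ x ∈ Ico (0 : ℝ) 1,
      (originState (x, p x, q x)).E N j = X.E j x := by
    intro j hj x hx
    have h1 := hcE j hj x hx
    change x * modeSum N x (blockB (p x)) j = _
    rw [hp, blockB_blocks, modeSum_congr x fun k hk => restrictIdx_of_mem hk, h1]
    ring
  have hbd : ∀ x ∈ Ioo (0 : ℝ) 1, ∀ k ∈ Finset.Icc 1 (N - 1),
      HasDerivAt (fun y => blockA (p y) k) (blockA (q x) k) x := by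
    intro x hx k hk
    simp only [hp, hq, blockA_blocks, restrictIdx_of_mem hk]
    exact (((hb k hk).1.differentiableOn (by simp)) x
      (Ioo_subset_Ico_self hx)).hasDerivWithinAt.hasDerivAt (Ico_mem_nhds hx.1 hx.2)
  have hcd : ∀ x ∈ Ioo (0 : ℝ) 1, ∀ k ∈ Finset.Icc 1 (N - 1),
      HasDerivAt (fun y => blockB (p y) k) (blockB (q x) k) x := by
    intro x hx k hk
    simp only [hp, hq, blockB_blocks, restrictIdx_of_mem hk]
    exact (((hc k hk).1.differentiableOn (by simp)) x
      (Ioo_subset_Ico_self hx)).hasDerivWithinAt.hasDerivAt (Ico_mem_nhds hx.1 hx.2)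
  have hdw : ∀ j ∈ Finset.Icc 1 (N - 1), EqOn (fun x => (originState (x, p x, q x)).dw N j)
      (X.dw j) (Ioo 0 1) := by
    intro j hj x hx
    refine HasDerivAt.unique (OriginState.hasDerivAt_w (z := fun x => originState (x, p x, q x))
      (fun _ => rfl) (hbd x hx) j) (((hXs.equations x hx).w j hj).congr_of_eventuallyEq ?_)
    filter_upwards [Ico_mem_nhds hx.1 hx.2] with y hy using hzw j hj y hy
  have hdE : ∀ j ∈ Finset.Icc 1 (N - 1), EqOn (fun x => (originState (x, p x, q x)).dE N j)
      (X.dE j) (Ioo 0 1) := by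
    intro j hj x hx
    refine HasDerivAt.unique (OriginState.hasDerivAt_E (z := fun x => originState (x, p x, q x))
      (fun _ => rfl) (hcd x hx) j) (((hXs.equations x hx).E j hj).congr_of_eventuallyEq ?_)
    filter_upwards [Ico_mem_nhds hx.1 hx.2] with y hy using hzE j hj y hy
  have hU : ∀ t ∈ Ico (0 : ℝ) 1, (t, p t, q t) ∈ originDomain N ℓ := by
    intro t ht
    refine ⟨hXs.S_pos t ht, ?_⟩
    -- At the origin the regularised `ν` equals `1` by its formula, although the original expression
    -- divides by zero there.
    rcases ht.1.eq_or_lt with rfl | h0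
    · simp [OriginState.nu, originState]
    · have h1 := hXs.nu_pos t ⟨h0, ht.2⟩
      rw [CompactFields.nu, hma t ht] at h1
      have h2 := OriginState.nuOf_eq (ℓ := ℓ) (z := originState (t, p t, q t)) h0.ne'
      exact lt_of_lt_of_eq h1 h2
  refine ⟨p, q, blocks N bL cL Sinf, blocks N bL' cL' mL, ?_, hps.continuousOn,
    tendsto_blocks (fun k hk => (hb k hk).2.2.1) (fun k hk => (hc k hk).2.2.1) hL.S,
    hqs.continuousOn,
    tendsto_blocks (fun k hk => (hb k hk).2.2.2) (fun k hk => (hc k hk).2.2.2) haL, hU, ?_,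
    fun x hx => ?_, fun j hj t ht => ⟨hzw j hj t ht, ?_⟩⟩
  · funext i
    revert i
    refine forall_blockIdx.2 ⟨fun k hk => (hb k hk).2.1, fun k hk => (hc k hk).2.1, ?_⟩
    change F.S (0 / (1 - 0)) = F.S 0
    rw [hX00]
  · refine ⟨hG.Sinf_pos, ?_⟩
    have : 0 < 1 / ℓ ^ 2 := by positivity
    change 0 < 1 - 1 * (2 - 1 + 2 * 1 * mL * (1 - 1) ^ 3 - 1 / ℓ ^ 2)
    linarith
  · have hxI := Ioo_subset_Ico_self hx
    have hn := Ico_mem_nhds hx.1 hx.2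
    refine CompactEquationsAt.hasDerivAt_origin hx.1 (CompactEquationsAt.congr
      (hXs.equations x hx) (Ioo_mem_nhds hx.1 hx.2) (fun y hy => (hma y (Ioo_subset_Ico_self hy)).symm)
      (fun y hy => rfl) (fun j hj y hy => hzw j hj y (Ioo_subset_Ico_self hy)) hdw
      (fun j hj y hy => hzE j hj y (Ioo_subset_Ico_self hy)) hdE (hXs.w_zero x) (hXs.w_last x)
      (OriginState.w_zero _) (OriginState.w_last _)) (hU x hxI) (hbd x hx) (hcd x hx)
      (fun k hk => ?_) (fun k hk => ?_) ?_
    · exact ((contDiffOn_blockA hqs k).differentiableOn (by simp) x hxI).differentiableAt hn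
    · exact ((contDiffOn_blockB hqs k).differentiableOn (by simp) x hxI).differentiableAt hn
    · exact ((contDiffOn_blockC hqs).differentiableOn (by simp) x hxI).differentiableAt hn
  -- The derivatives were identified on the open interval through uniqueness of derivatives;
  -- continuity extends the equality to `x = 0`.
  · refine (hdw j hj).of_subset_closure (hzs.dw j).continuousOn (hXs.smooth_dw j hj).continuousOn
      Ioo_subset_Ico_self ?_ ht
    rw [closure_Ioo (zero_ne_one)]
    exact Ico_subset_Icc_self

/-- Solitons with data near the data of a given soliton. -/
theorem IsSoliton.exists_near (hN : 1 ≤ N) (hℓ : 0 < ℓ) (hF : IsSoliton N ℓ Sinf F)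
    (hd : HasOriginData N F β θ) :
    ∃ δ : ℝ, 0 < δ ∧ ∀ β' θ' : ℕ → ℝ,
      (∀ k ∈ Finset.Icc 1 (N - 1), |β' k - β k| < δ ∧ |θ' k - θ k| < δ) →
      ∃ (H : Fields) (c : ℝ), IsSoliton N ℓ c H ∧ H.S 0 = F.S 0 ∧ HasOriginData N H β' θ' ∧
        ∀ j ∈ Finset.Icc 1 (N - 1), ¬ Tendsto (F.ω j) atTop (𝓝 0) →
          nodes 0 (H.ω j) = nodes 0 (F.ω j) := by
  have e0 : (0 : ℝ) / (1 + 0) = 0 := by norm_num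
  obtain ⟨p, q, pT, qT, hp0, hpc, hpT, hqc, hqT, hU, hUT, hder, hw⟩ :=
    hF.exists_origin_solution hN hℓ hd
  obtain ⟨ε₀, hε₀, hnodes⟩ := hF.toIsGlobalSolution.exists_nodes_eq hN hℓ le_rfl
    -- The condition at the start is vacuous here, as `ω_j(0) = √(j (N - j))` is positive.
    fun j hj h0 => by
      have := Real.sqrt_pos.2 (weight_pos hj)
      rw [hF.ω_origin j hj] at h0
      exact absurd h0 this.ne'
  rw [e0] at hnodes
  have hs := isSmoothOn_originState (originDomain N ℓ)
  have ho : ∀ i : Idx N ⊕ Idx N, ContinuousOn (fun z : Phase N => Sum.elim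
      (fun i : Idx N => (originState z).w N i) (fun i : Idx N => (originState z).dw N i) i)
      (originDomain N ℓ) := by
    rintro (i | i)
    · exact (hs.w i).continuousOn
    · exact (hs.dw i).continuousOn
  have hlam : ∀ i, originLam N i ≠ 0 := by
    rintro (i | i | i) <;> simp [originLam]
  obtain ⟨δ, hδ, hex⟩ := exists_regular_singular_solution_near_of_continuousOn one_pos
    hlam isOpen_originDomain isOpen_originBase
    (fun z hz => hz.1) contDiffOn_origin.1 contDiffOn_origin.2 contDiffOn_originH ho hpc hpT
    hqc hqT hU hUT (fun t ht => (hder t ht).1) (fun t ht => (hder t ht).2) hε₀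
  refine ⟨δ, hδ, fun β' θ' hβθ => ?_⟩
  obtain ⟨P, Q, hP, hQ, hP0, hPU, hPd, hQd, hclose⟩ := hex (blocks N β' θ' (F.S 0)) (by
    rw [hp0]
    refine forall_blockIdx.2 ⟨fun k hk => (hβθ k hk).1, fun k hk => (hβθ k hk).2, ?_⟩
    simp [blocks, hδ])
  have hsol := originFields_isCompactSolution hP hQ hPU hPd hQd
  refine ⟨(originFields N P Q).toFields N, _, originFields_isSoliton hN hℓ hP hQ hPU hPd hQd, ?_,
    originFields_hasOriginData hP.continuousOn (fun k hk => ?_) (fun k hk => ?_),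
    hnodes _ (fun j hj x hx => (hsol.equations x hx).w j hj) fun j hj x hx => ?_⟩
  · change blockC (P (0 / (1 + 0))) = _
    rw [e0, hP0]; rfl
  · rw [hP0, blockA_blocks, restrictIdx_of_mem hk]
  · rw [hP0, blockB_blocks, restrictIdx_of_mem hk]
  · have h1 := hclose x hx (Sum.inl ⟨j, hj⟩)
    have h2 := hclose x hx (Sum.inr ⟨j, hj⟩)
    simp only [Sum.elim_inl, Sum.elim_inr, (hw j hj x hx).1, (hw j hj x hx).2] at h1 h2
    exact ⟨h1, h2⟩

end

end EYM
-- Assembly: both cases, normalised by rescaling time.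
theorem mainTheorem2 (N : ℕ) (hN : 2 ≤ N) (ℓ : ℝ) (hℓ : 0 < ℓ) :
    -- topological black holes
    (∀ k : ℝ, (k = 1 ∨ k = 0 ∨ k = -1) → ∀ rh : ℝ, 0 < rh →
      ∀ (F : EYM.Fields) (w e : ℕ → ℝ),
        EYM.IsBlackHole N k ℓ rh 1 F → EYM.HasHorizonData N rh F w e →
        ∃ δ : ℝ, 0 < δ ∧ ∀ w' e' : ℕ → ℝ,
          (∀ j ∈ Finset.Icc 1 (N - 1), |w' j - w j| < δ ∧ |e' j - e j| < δ) →
          ∃ (H : EYM.Fields) (c : ℝ),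
            EYM.IsBlackHole N k ℓ rh c H ∧
            EYM.IsBlackHole N k ℓ rh 1 (H.timeRescale c⁻¹) ∧
            H.S rh = F.S rh ∧
            EYM.HasHorizonData N rh H w' e' ∧
            ∀ j ∈ Finset.Icc 1 (N - 1), ¬ Tendsto (F.ω j) atTop (𝓝 0) →
              EYM.nodes rh (H.ω j) = EYM.nodes rh (F.ω j)) ∧
    -- spherical solitons
    (∀ (F : EYM.Fields) (β θ : ℕ → ℝ),
      EYM.IsSoliton N ℓ 1 F → EYM.HasOriginData N F β θ →
      ∃ δ : ℝ, 0 < δ ∧ ∀ β' θ' : ℕ → ℝ,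
        (∀ k ∈ Finset.Icc 1 (N - 1), |β' k - β k| < δ ∧ |θ' k - θ k| < δ) →
        ∃ (H : EYM.Fields) (c : ℝ),
          EYM.IsSoliton N ℓ c H ∧
          EYM.IsSoliton N ℓ 1 (H.timeRescale c⁻¹) ∧
          H.S 0 = F.S 0 ∧
          EYM.HasOriginData N H β' θ' ∧
          ∀ j ∈ Finset.Icc 1 (N - 1), ¬ Tendsto (F.ω j) atTop (𝓝 0) →
            EYM.nodes 0 (H.ω j) = EYM.nodes 0 (F.ω j)) := by
  have hN1 : 1 ≤ N := by omega
  refine ⟨fun k _ rh hrh F w e hF hd => ?_, fun F β θ hF hd => ?_⟩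
  · obtain ⟨δ, hδ, h⟩ := hF.exists_near hN1 hℓ hrh hd
    refine ⟨δ, hδ, fun w' e' hwe => ?_⟩
    obtain ⟨H, c, hH, hS, hHd, hn⟩ := h w' e' hwe
    exact ⟨H, c, hH, hH.normalise, hS, hHd, hn⟩
  · obtain ⟨δ, hδ, h⟩ := hF.exists_near hN1 hℓ hd
    refine ⟨δ, hδ, fun β' θ' hβθ => ?_⟩
    obtain ⟨H, c, hH, hS, hHd, hn⟩ := h β' θ' hβθ
    exact ⟨H, c, hH, hH.normalise, hS, hHd, hn⟩
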